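/- Let $k\ge 1$ and $n>2k$ be integers, $2^\sharp:=\frac{2n}{n-2k}$, and let $(N,g_\infty)$ be a smooth (second countable, Hausdorff) $n$-dimensional Riemannian manifold without boundary. For a metric $h$, write $\Delta_h=-\mathrm{div}_h\nabla$, $(\Delta_h^{k/2}u)^2:=|\nabla\Delta_h^{(k-1)/2}u|_h^2$ for odd $k$, and let $dv_h$ be the Riemannian measure. For $\Omega\subset N$ open, $H^2_{k,0}(\Omega)$ is the completion of $C^\infty_c(\Omega)$ for the norm $\|u\|_{H^2_k(\Omega)}:=\big(\sum_{l=0}^k\int_\Omega|\nabla^l u|^2_{g_\infty}\,dv_{g_\infty}\big)^{1/2}$, the background metric being $g_\infty$. Balls $B_x(r)$ are for the distance of $g_\infty$. Let $(g_i)_{i\in\mathbb N}$ be smooth metrics on $N$ with $g_i\to g_\infty$ in $C^p_{loc}(N)$ for all $p$. For $0\le l\le k-1$ let $A^i_l$ and $A_l$ be smooth covariant tensor fields of rank $2l$ with $A(X,Y)=A(Y,X)$ for all $l$-tensors $X,Y$, such that $A^i_l\to A_l$ in $C^p_{loc}(N)$ for all $p$, and let $$P_i=\Delta_{g_i}^k+\sum_{l=0}^{k-1}(-1)^l\nabla^{l}\big(A^i_l\,\nabla^{l}\,\cdot\big).$$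 Let $\Omega\subset N$ be open and, for $u\in H^2_{k,0}(\Omega)$, let $$J_i(u)=\frac12\int_\Omega uP_iu\,dv_{g_i}-\frac1{2^\sharp}\int_\Omega|u|^{2^\sharp}dv_{g_i},$$ where $\int_\Omega uP_iu\,dv_{g_i}$ is understood in the weak sense $$\int_\Omega uP_iu\,dv_{g_i}:=\int_\Omega\Big((\Delta_{g_i}^{k/2}u)^2+\sum_{l=0}^{k-1}A^i_l(\nabla^l u,\nabla^l u)\Big)dv_{g_i},$$ covariant derivatives and contractions being those of $g_i$. Assume that, for every $i$, both integrals converge for all $u\in H^2_{k,0}(\Omega)$ and that $J_i$ is $C^1$ on $H^2_{k,0}(\Omega)$. Let $u_i,u_\infty\in H^2_{k,0}(\Omega)$ with $u_i\rightharpoonup u_\infty$ weakly in $H^2_{k,0}(\Omega)$, and assume that for some compact $K\subset N$ $$\lim_{i\to+\infty}\ \sup_{\varphi\in H^2_{k,0}(\Omega)\setminus\{0\},\ \mathrm{Supp}\,\varphi\subset K}\frac{\langle DJ_i(u_i),\varphi\rangle}{\|\varphi\|_{H^2_k(\Omega)}}=0 .$$ Assume that there are $K_\infty>0$ and $C\ge0$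 such that, for all $u\in C^\infty_c(N)$, $$\Big(\int_N|u|^{2^\sharp}dv_{g_\infty}\Big)^{2/2^\sharp}\le K_\infty\int_N(\Delta_{g_\infty}^{k/2}u)^2\,dv_{g_\infty}+C\sum_{l=0}^{k-1}\int_N|\nabla^l u|^2_{g_\infty}\,dv_{g_\infty}.$$ Let $x_0\in\Omega$ and $\delta>0$ be such that $B_{x_0}(2\delta)\subset K$ and $$\int_{B_{x_0}(2\delta)\cap\Omega}|u_i|^{2^\sharp}dv_{g_i}\le\Big(\frac1{2K_\infty}\Big)^{\frac{2^\sharp}{2^\sharp-2}}\qquad\text{for all } i\in\mathbb N .$$ Then $u_i\to u_\infty$ strongly in $H^2_k(B_{x_0}(\delta)\cap\Omega)$, that is, $$\sum_{l=0}^k\int_{B_{x_0}(\delta)\cap\Omega}|\nabla^l(u_i-u_\infty)|_{g_\infty}^2\,dv_{g_\infty}\longrightarrow 0 .$$ (In particular this holds when $(N,g_\infty)$ has positive injectivity radius $i_{g_\infty}(N)$, $\Omega$ is a smooth domain and $0<\delta<i_{g_\infty}(N)/2$; these conditions are not needed.) -/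

import Mathlib

open scoped Manifold ContDiff ENNReal Topology
open MeasureTheory Filter Set

namespace SmallEnergy

/-- The model space `ℝⁿ`. -/
abbrev E (n : ℕ) : Type := EuclideanSpace ℝ (Fin n)

section

variable {n : ℕ} {N : Type*} [TopologicalSpace N] [ChartedSpace (E n) N]

/-! ### A measurable choice of a chart at every point -/

theorem exists_chartSeq (n : ℕ) (N : Type*) [TopologicalSpace N] [ChartedSpace (E n) N]
    [SecondCountableTopology N] [Nonempty N] :
    ∃ p : ℕ → N, ∀ x : N, ∃ j : ℕ, x ∈ (chartAt (E n) (p j)).source := by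
  obtain ⟨s, hs, hcov⟩ := TopologicalSpace.countable_cover_nhds
    (fun x : N => chart_source_mem_nhds (E n) x)
  have hne : s.Nonempty := by
    by_contra h
    rw [Set.not_nonempty_iff_eq_empty] at h
    obtain ⟨x⟩ := (inferInstance : Nonempty N)
    have : x ∈ ⋃ x ∈ s, (chartAt (E n) x).source := by rw [hcov]; trivial
    simp [h] at this
  obtain ⟨p, hp⟩ := hs.exists_eq_range hne
  refine ⟨p, fun x => ?_⟩
  have hx : x ∈ ⋃ x ∈ s, (chartAt (E n) x).source := by rw [hcov]; trivial
  simp only [hp, Set.mem_iUnion, Set.mem_range] at hx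
  obtain ⟨_, ⟨j, rfl⟩, h⟩ := hx
  exact ⟨j, h⟩

variable (n) in
/-- Centres of countably many charts whose domains cover `N`. -/
noncomputable def chartSeq [SecondCountableTopology N] [Nonempty N] : ℕ → N :=
  Classical.choose (exists_chartSeq n N)

theorem chartSeq_spec [SecondCountableTopology N] [Nonempty N] (x : N) :
    ∃ j : ℕ, x ∈ (chartAt (E n) (chartSeq n j : N)).source :=
  Classical.choose_spec (exists_chartSeq n N) x

open Classical in
variable (n) in
/-- The index of the first of these charts whose domain contains `x`. -/
noncomputable def chartIdx [SecondCountableTopology N] [Nonempty N] (x : N) : ℕ :=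
  Nat.find (chartSeq_spec (n := n) x)

variable (n) in
/-- The centre of the chart used at the point `x`. -/
noncomputable def ctr [SecondCountableTopology N] [Nonempty N] (x : N) : N :=
  chartSeq n (chartIdx n x)

/-! ### Coordinate expressions -/

/-- The coordinate vector field `∂_i` of the chart centred at `p`, at the point `x`. -/
noncomputable def coordVec (p : N) (i : Fin n) (x : N) : TangentSpace (𝓡 n) x :=
  (mfderiv (𝓡 n) 𝓘(ℝ, E n) (extChartAt (𝓡 n) p) x).inverse (EuclideanSpace.single i (1 : ℝ))

variable (n) in
/-- Covariant tensor fields of rank `2 l`, as forms `A x (X, Y)` with `X`, `Y` two families of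
`l` vectors. -/
abbrev TensorField (N : Type*) [TopologicalSpace N] [ChartedSpace (E n) N] (l : ℕ) : Type _ :=
  (x : N) → MultilinearMap ℝ (fun _ : Fin l ⊕ Fin l => TangentSpace (𝓡 n) x) ℝ

/-- Components `A_{i₁ … i_l j₁ … j_l}` of `A` in the chart centred at `p`. -/
noncomputable def tensorCoord {l : ℕ} (A : TensorField n N l) (p : N) (I J : Fin l → Fin n)
    (y : E n) : ℝ :=
  let x := (extChartAt (𝓡 n) p).symm y
  A x (Sum.elim (fun s => coordVec p (I s) x) (fun s => coordVec p (J s) x))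

/-- The tensor field is smooth. -/
def TensorField.IsSmooth {l : ℕ} (A : TensorField n N l) : Prop :=
  ∀ (p : N) (I J : Fin l → Fin n),
    ContDiffOn ℝ ∞ (tensorCoord A p I J) (extChartAt (𝓡 n) p).target

/-- `A(X, Y) = A(Y, X)`. -/
def TensorField.IsSymm {l : ℕ} (A : TensorField n N l) : Prop :=
  ∀ (x : N) (X Y : Fin l → TangentSpace (𝓡 n) x), A x (Sum.elim X Y) = A x (Sum.elim Y X)

/-- `a i → b` in `C^p_loc` for all `p`, for functions on an open set `U` of `ℝⁿ`: all derivatives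
converge uniformly on compact subsets of `U`. -/
def TendstoSmoothLoc (a : ℕ → E n → ℝ) (b : E n → ℝ) (U : Set (E n)) : Prop :=
  ∀ L : Set (E n), L ⊆ U → IsCompact L → ∀ m : ℕ,
    TendstoUniformlyOn (fun i => iteratedFDeriv ℝ m (a i)) (iteratedFDeriv ℝ m b) atTop L

/-- Convergence of tensor fields in `C^p_loc` for all `p`. -/
def TensorTendsto {l : ℕ} (A : ℕ → TensorField n N l) (A' : TensorField n N l) : Prop :=
  ∀ (p : N) (I J : Fin l → Fin n), TendstoSmoothLoc (fun i => tensorCoord (A i) p I J)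
    (tensorCoord A' p I J) (extChartAt (𝓡 n) p).target

end

section

variable {n : ℕ} {N : Type*} [TopologicalSpace N] [ChartedSpace (E n) N] [IsManifold (𝓡 n) ∞ N]

variable (n N) in
/-- Smooth Riemannian metrics on `N`. -/
abbrev RMetric : Type _ :=
  Bundle.ContMDiffRiemannianMetric (𝓡 n) ∞ (E n) (fun x : N => TangentSpace (𝓡 n) x)

/-- The matrix `(g_{ij})` in the chart centred at `p`. -/
noncomputable def gram (g : RMetric n N) (p : N) (y : E n) : Matrix (Fin n) (Fin n) ℝ :=
  Matrix.of fun i j =>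
    let x := (extChartAt (𝓡 n) p).symm y
    g.inner x (coordVec p i x) (coordVec p j x)

/-- Convergence of metrics in `C^p_loc` for all `p`. -/
def MetricTendsto (g : ℕ → RMetric n N) (g' : RMetric n N) : Prop :=
  ∀ (p : N) (i j : Fin n), TendstoSmoothLoc (fun m y => gram (g m) p y i j)
    (fun y => gram g' p y i j) (extChartAt (𝓡 n) p).target

open scoped Bundle in
/-- The open ball of radius `r` for the Riemannian distance of `g`. -/
noncomputable def gBall (g : RMetric n N) (x : N) (r : ℝ) : Set N :=
  letI : Bundle.RiemannianBundle (fun x : N => TangentSpace (𝓡 n) x) := ⟨g.toRiemannianMetric⟩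
  {y | Manifold.riemannianEDist (𝓡 n) x y < ENNReal.ofReal r}

/-- Christoffel symbols `Γ^m_{ij}` in the chart centred at `p`. -/
noncomputable def christoffel (g : RMetric n N) (p : N) (m i j : Fin n) (y : E n) : ℝ :=
  let d (a b c : Fin n) : ℝ :=
    fderiv ℝ (fun z => gram g p z b c) y (EuclideanSpace.single a (1 : ℝ))
  (1 / 2) * ∑ r, (gram g p y)⁻¹ m r * (d i j r + d j i r - d r i j)

/-- Components `∇_{i₁} ⋯ ∇_{i_l} f` of the `l`-th covariant derivative of `f` (Levi-Civita
connection of `g`) in the chart centred at `p`. -/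
noncomputable def covCoord (g : RMetric n N) (p : N) (f : N → ℝ) :
    (l : ℕ) → (Fin l → Fin n) → E n → ℝ
  | 0, _ => fun y => f ((extChartAt (𝓡 n) p).symm y)
  | l + 1, I => fun y =>
      fderiv ℝ (covCoord g p f l (Fin.tail I)) y (EuclideanSpace.single (I 0) (1 : ℝ))
        - ∑ s : Fin l, ∑ m : Fin n, christoffel g p m (I 0) (I s.succ) y *
            covCoord g p f l (Function.update (Fin.tail I) s m) y

variable [SecondCountableTopology N] [Nonempty N]

open scoped MatrixOrder Matrix.Norms.L2Operator in
/-- The symmetric matrix `(g_{ij})^{-1/2}` at `x`, in the chart used at `x`. -/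
noncomputable def frameMat (g : RMetric n N) (x : N) : Matrix (Fin n) (Fin n) ℝ :=
  CFC.sqrt (gram g (ctr n x) (extChartAt (𝓡 n) (ctr n x) x))⁻¹

/-- The `g`-orthonormal frame `e_a = ∑ i, (g^{-1/2})_{i a} ∂_i` at `x`. -/
noncomputable def frame (g : RMetric n N) (x : N) (a : Fin n) : TangentSpace (𝓡 n) x :=
  ∑ i, frameMat g x i a • coordVec (ctr n x) i x

/-- The components `∇^l f (e_{a₁}, …, e_{a_l})` at `x` of the covariant derivative of a smooth
function in the `g`-orthonormal frame. In particular `|∇^l f|²_g = ∑ a, (cov g f l a x)²`. -/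
noncomputable def cov (g : RMetric n N) (f : N → ℝ) (l : ℕ) (a : Fin l → Fin n) (x : N) : ℝ :=
  ∑ I : Fin l → Fin n, (∏ s, frameMat g x (I s) (a s)) *
    covCoord g (ctr n x) f l I (extChartAt (𝓡 n) (ctr n x) x)

/-- The Laplace-Beltrami operator `Δ_g = - div_g ∇`, i.e. minus the trace of `∇²`. -/
noncomputable def lap (g : RMetric n N) (f : N → ℝ) (x : N) : ℝ :=
  - ∑ a : Fin n, cov g f 2 ![a, a] x

/-- `(Δ_g^{k/2} f)²` at `x`, which is `|∇ Δ_g^{(k-1)/2} f|²` for odd `k`. -/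
noncomputable def lapHalfSq (g : RMetric n N) (k : ℕ) (f : N → ℝ) (x : N) : ℝ :=
  if Even k then ((lap g)^[k / 2] f x) ^ 2
  else ∑ a : Fin 1 → Fin n, (cov g ((lap g)^[k / 2] f) 1 a x) ^ 2

/-- `A(∇^l f, ∇^l f)` at `x`, where all contractions are with `g`. -/
noncomputable def tensorQuad (g : RMetric n N) {l : ℕ} (A : TensorField n N l) (f : N → ℝ) (x : N) :
    ℝ :=
  ∑ a : Fin l → Fin n, ∑ b : Fin l → Fin n,
    A x (Sum.elim (fun s => frame g x (a s)) (fun s => frame g x (b s))) *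
      (cov g f l a x * cov g f l b x)

/-- The density `(Δ_g^{k/2} f)² + ∑_{l < k} A_l(∇^l f, ∇^l f)` of the quadratic form of the operator
`P = Δ_g^k + ∑_{l < k} (-1)^l ∇^l (A_l ∇^l ·)`. -/
noncomputable def quadDensity (g : RMetric n N) (k : ℕ) (A : (l : ℕ) → TensorField n N l)
    (f : N → ℝ) (x : N) : ℝ :=
  lapHalfSq g k f x + ∑ l ∈ Finset.range k, tensorQuad g (A l) f x

variable [MeasurableSpace N]

/-- The Riemannian measure `dv_g`. In a chart it is `√(det g_{ij}) dy`; the parts of `N` on which the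
`j`-th chart is the one in use are disjoint and cover `N`. -/
noncomputable def vol (g : RMetric n N) : Measure N :=
  Measure.sum fun j : ℕ =>
    (((volume.withDensity fun y => ENNReal.ofReal (Real.sqrt (gram g (chartSeq n j) y).det)).restrict
      (extChartAt (𝓡 n) (chartSeq n j : N)).target).map
        (extChartAt (𝓡 n) (chartSeq n j : N)).symm).restrict {x : N | chartIdx n x = j}

/-! ### Sobolev spaces -/

/-- Index set of the components of `(f, ∇ f, …, ∇^k f)`. -/
abbrev JetIdx (n k : ℕ) : Type := (l : Fin (k + 1)) × (Fin l → Fin n)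

/-- The components of `(f, ∇ f, …, ∇^k f)` at `x` in the `g`-orthonormal frame. The square of the
norm of this vector is `∑_{l ≤ k} |∇^l f|²_g`. -/
noncomputable def jet (g : RMetric n N) (k : ℕ) (f : N → ℝ) (x : N) :
    EuclideanSpace ℝ (JetIdx n k) :=
  WithLp.toLp 2 fun c => cov g f c.1 c.2 x

/-- `f ∈ C^∞_c(Ω)`. -/
def IsTest (n : ℕ) {N : Type*} [TopologicalSpace N] [ChartedSpace (E n) N]
    (Ω : Set N) (f : N → ℝ) : Prop :=
  ContMDiff (𝓡 n) 𝓘(ℝ, ℝ) ∞ f ∧ HasCompactSupport f ∧ tsupport f ⊆ Ω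

/-- The space `H²_{k,0}(Ω)`, the completion of `C^∞_c(Ω)` for the norm
`(∑_{l ≤ k} ‖∇^l f‖²_{L²(Ω, g)})^{1/2}`: it is the closure of `{(f, ∇ f, …, ∇^k f)}` in `L²`.
An element `u` is thus the class of `x ↦ (u(x), ∇ u(x), …, ∇^k u(x))`. -/
noncomputable def Hk0 (g : RMetric n N) (k : ℕ) (Ω : Set N) :
    Submodule ℝ (Lp (EuclideanSpace ℝ (JetIdx n k)) 2 ((vol g).restrict Ω)) :=
  (Submodule.span ℝ {F : Lp (EuclideanSpace ℝ (JetIdx n k)) 2 ((vol g).restrict Ω) |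
    ∃ f : N → ℝ, IsTest n Ω f ∧ (F : N → EuclideanSpace ℝ (JetIdx n k)) =ᵐ[(vol g).restrict Ω] jet g k f}).topologicalClosure

variable {g : RMetric n N} {k : ℕ} {Ω : Set N}

/-- The vector `(u(x), ∇ u(x), …, ∇^k u(x))`. -/
noncomputable def Hk0.jetAt (u : Hk0 g k Ω) (x : N) : EuclideanSpace ℝ (JetIdx n k) :=
  (u : Lp (EuclideanSpace ℝ (JetIdx n k)) 2 ((vol g).restrict Ω)) x

/-- The value `u(x)`. -/
noncomputable def Hk0.val (u : Hk0 g k Ω) (x : N) : ℝ :=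
  Hk0.jetAt u x ⟨0, Fin.elim0⟩

open Classical in
/-- A smooth function with the same derivatives of order at most `k` at `x` as `u` (it exists for
almost every `x`). A differential operator of order at most `k`, possibly with respect to another
metric, is applied to `u` at `x` by applying it to this function. -/
noncomputable def Hk0.rep (u : Hk0 g k Ω) (x : N) : N → ℝ :=
  if h : ∃ f : N → ℝ, ContMDiff (𝓡 n) 𝓘(ℝ, ℝ) ∞ f ∧ jet g k f x = Hk0.jetAt u x
  then Classical.choose h else 0

/-- The critical exponent `2^♯ = 2 n / (n - 2 k)`. -/
noncomputable def crit (n k : ℕ) : ℝ := 2 * n / (n - 2 * k)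

/-- `∫ u P u dv_h` has the density `quadP`, for the metric `h`, in the weak sense. -/
noncomputable def quadP (h : RMetric n N) (A : (l : ℕ) → TensorField n N l) (u : Hk0 g k Ω) (x : N) :
    ℝ :=
  quadDensity h k A (Hk0.rep u x) x

/-- `J(u) = ½ ∫_Ω u P u dv_h - (1 / 2^♯) ∫_Ω |u|^{2^♯} dv_h` on `H²_{k,0}(Ω)`; here `h` is the metric
of the functional and `g` is the background metric of the Sobolev space. -/
noncomputable def J (h : RMetric n N) (A : (l : ℕ) → TensorField n N l) (u : Hk0 g k Ω) : ℝ :=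
  (1 / 2) * ∫ x in Ω, quadP h A u x ∂(vol h)
    - (1 / crit n k) * ∫ x in Ω, |Hk0.val u x| ^ crit n k ∂(vol h)

/-- `J` is a well-defined (both integrals converge) functional of class `C¹` on `H²_{k,0}(Ω)`. -/
def IsC1Functional (h : RMetric n N) (A : (l : ℕ) → TensorField n N l)
    (g : RMetric n N) (k : ℕ) (Ω : Set N) : Prop :=
  (∀ u : Hk0 g k Ω, IntegrableOn (quadP h A u) Ω (vol h) ∧
    IntegrableOn (fun x => |Hk0.val u x| ^ crit n k) Ω (vol h)) ∧
  ContDiff ℝ 1 (fun u : Hk0 g k Ω => J h A u)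

/-- `Supp φ ⊆ K` for a closed set `K`. -/
def Hk0.SuppIn (φ : Hk0 g k Ω) (K : Set N) : Prop :=
  ∀ᵐ x ∂((vol g).restrict Ω), x ∉ K → Hk0.val φ x = 0

/-- `‖f‖²_{H²_{k-1}} = ∑_{l < k} ∫_N |∇^l f|²_g dv_g` for smooth `f`. -/
noncomputable def lowerNormSq (g : RMetric n N) (k : ℕ) (f : N → ℝ) : ℝ :=
  ∑ l ∈ Finset.range k, ∫ x, ∑ a : Fin l → Fin n, (cov g f l a x) ^ 2 ∂(vol g)

/-- The Sobolev inequality with constants `K` and `C`. -/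
def SobolevIneq (g : RMetric n N) (k : ℕ) (K C : ℝ) : Prop :=
  ∀ f : N → ℝ, IsTest n univ f →
    (∫ x, |f x| ^ crit n k ∂(vol g)) ^ (2 / crit n k) ≤
      K * ∫ x, lapHalfSq g k f x ∂(vol g) + C * lowerNormSq g k f

end

end SmallEnergy

/-! The statement is local. The closure of the ball of radius δ lies in the ball of radius 2δ, hence
in `K`, so it is compact. It therefore suffices to find, around each point of the larger ball, a
neighbourhood on which the convergence is strong (`exists_nhds_tendsto`), and there everything is
transported to a chart.

Write q for the critical exponent. Replace u_i by a test function f_i so close to it that the norm,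
the derivative of J_i and the local energy bound change by at most 1/(i+1), and u_∞ by test
functions h_i converging to it in norm. With a cut-off χ put F = χ f_i, h = χ h_i and W = F - h,
which is bounded and weakly null in H^k. With a smaller cut-off η, test DJ_i(f_i) against η² W and
put v = η W. By Rellich's theorem the norms of W of order below k tend to zero. Hence the quadratic
part equals Q = ∫ (Δ^{k/2} v)² up to o(1): the coefficients of the i-th form converge locally
uniformly, commutators with η and the terms A_l are of lower order, and pairing the norm convergent
h with the weakly null W gives nothing in the limit. The nonlinear part is ∫ |F|^{q-2} F η² W = ∫
|F|^{q-2} v² + o(1). Hölder's inequality, the energy bound and the Sobolev inequality give ∫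
|F|^{q-2} v² ≤ (∫_{supp η} |F|^q)^{(q-2)/q} ‖v‖_q² ≤ (1/(2 K_∞)) K_∞ Q + o(1). Thus Q ≤ Q/2 + o(1),
so Q → 0, and the elliptic estimate for Δ^{k/2} yields v → 0 in H^k. This is
`local_strong_convergence`. Since the energy of F itself enters Hölder's inequality, neither the
equation satisfied by the weak limit nor a splitting of L^q norms is needed.

Four groups of lemmas carry this. Covariant derivatives and volumes are defined through one chart
selected at each point; `IsPullback.covE_eq` (from the transformation law of the Christoffel
symbols) and `dens_trans` allow them to be computed in any chart. In a fixed chart, operators are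
handled by their effect on jets, through `IsDiffOp`, `DiffOpTendsto` and `BilTendsto`. The analytic
input is `rellich`, by Fourier transform, and `elliptic_lapHalf`, by integration by parts and
commutation with derivatives. Finally, `IsC1Functional.fderiv_cls` computes DJ at a test function
from the symmetric difference J(f + tφ) - J(f - tφ), in which everything outside the support of φ
cancels.

Throughout, `jetNorm m` and `sobSq m` count derivatives of order less than `m`: `sobSq (k + 1)` is
the squared H^k norm and `sobSq k` the squared H^{k-1} norm. -/

namespace SmallEnergy

/-! ### Sizes of jets -/

section JetNorm

variable {n : ℕ}

/-- The size of the derivatives of order less than `m` of `f` at `y`. -/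
noncomputable def jetNorm (m : ℕ) (f : E n → ℝ) (y : E n) : ℝ :=
  ∑ j ∈ Finset.range m, ‖iteratedFDeriv ℝ j f y‖

/-- The partial derivative `∂_a f`. -/
noncomputable def pd (a : Fin n) (f : E n → ℝ) (y : E n) : ℝ :=
  fderiv ℝ f y (EuclideanSpace.single a (1 : ℝ))

theorem natCast_le_smooth (m : ℕ) : (m : WithTop ℕ∞) ≤ ((⊤ : ℕ∞) : WithTop ℕ∞) := by
  exact_mod_cast (le_top : (m : ℕ∞) ≤ ⊤)

theorem contDiffAt_nat {f : E n → ℝ} {U : Set (E n)} (hf : ContDiffOn ℝ ∞ f U) (hU : IsOpen U)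
    {y : E n} (hy : y ∈ U) (m : ℕ) : ContDiffAt ℝ m f y :=
  ((hf.contDiffAt (hU.mem_nhds hy)).of_le (natCast_le_smooth m))

theorem jetNorm_nonneg (m : ℕ) (f : E n → ℝ) (y : E n) : 0 ≤ jetNorm m f y :=
  Finset.sum_nonneg fun _ _ => norm_nonneg _

@[simp] theorem jetNorm_zero_left (f : E n → ℝ) (y : E n) : jetNorm 0 f y = 0 := by
  simp [jetNorm]

theorem jetNorm_mono {m m' : ℕ} (h : m ≤ m') (f : E n → ℝ) (y : E n) :
    jetNorm m f y ≤ jetNorm m' f y :=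
  Finset.sum_le_sum_of_subset_of_nonneg (Finset.range_mono h) fun _ _ _ => norm_nonneg _

theorem jetNorm_congr {f g : E n → ℝ} {y : E n} (h : f =ᶠ[𝓝 y] g) (m : ℕ) :
    jetNorm m f y = jetNorm m g y :=
  Finset.sum_congr rfl fun j _ => by rw [(h.iteratedFDeriv ℝ j).self_of_nhds]

theorem jetNorm_congr_on {U : Set (E n)} (hU : IsOpen U) {f g : E n → ℝ} (h : EqOn f g U)
    {y : E n} (hy : y ∈ U) (m : ℕ) : jetNorm m f y = jetNorm m g y :=
  jetNorm_congr (h.eventuallyEq_of_mem (hU.mem_nhds hy)) m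

@[simp] theorem jetNorm_zero (m : ℕ) (y : E n) : jetNorm m (fun _ => (0 : ℝ)) y = 0 := by
  unfold jetNorm
  refine Finset.sum_eq_zero fun j _ => ?_
  have := congrFun (iteratedFDeriv_fun_zero (𝕜 := ℝ) (E := E n) (F := ℝ) (n := j)) y
  simp [this]

theorem jetNorm_one (f : E n → ℝ) (y : E n) : jetNorm 1 f y = |f y| := by
  simp [jetNorm]

variable {U : Set (E n)} {f g : E n → ℝ} {y : E n}

theorem jetNorm_add_le (hU : IsOpen U) (hf : ContDiffOn ℝ ∞ f U) (hg : ContDiffOn ℝ ∞ g U)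
    (hy : y ∈ U) (m : ℕ) :
    jetNorm m (fun z => f z + g z) y ≤ jetNorm m f y + jetNorm m g y := by
  unfold jetNorm
  rw [← Finset.sum_add_distrib]
  refine Finset.sum_le_sum fun j _ => ?_
  have := iteratedFDeriv_add_apply (contDiffAt_nat hf hU hy j) (contDiffAt_nat hg hU hy j)
  change ‖iteratedFDeriv ℝ j (f + g) y‖ ≤ _
  rw [this]
  exact norm_add_le _ _

theorem jetNorm_const_mul (hU : IsOpen U) (hf : ContDiffOn ℝ ∞ f U) (hy : y ∈ U) (m : ℕ)
    (c : ℝ) : jetNorm m (fun z => c * f z) y = |c| * jetNorm m f y := by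
  unfold jetNorm
  rw [Finset.mul_sum]
  refine Finset.sum_congr rfl fun j _ => ?_
  have := iteratedFDeriv_const_smul_apply (a := c) (contDiffAt_nat hf hU hy j)
  change ‖iteratedFDeriv ℝ j (c • f) y‖ = _
  rw [this, norm_smul, Real.norm_eq_abs]

theorem jetNorm_neg (hU : IsOpen U) (hf : ContDiffOn ℝ ∞ f U) (hy : y ∈ U) (m : ℕ) :
    jetNorm m (fun z => - f z) y = jetNorm m f y := by
  have := jetNorm_const_mul hU hf hy m (-1)
  simpa using this

theorem jetNorm_sub_le (hU : IsOpen U) (hf : ContDiffOn ℝ ∞ f U) (hg : ContDiffOn ℝ ∞ g U)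
    (hy : y ∈ U) (m : ℕ) :
    jetNorm m (fun z => f z - g z) y ≤ jetNorm m f y + jetNorm m g y := by
  have := jetNorm_add_le hU hf hg.neg hy m
  rw [jetNorm_neg hU hg hy] at this
  simpa [sub_eq_add_neg] using this

/-- Leibniz' rule with a crude constant: a factor `m` for the orders `j < m` on the left, `2 ^ m`
for the binomial coefficients and `m` for the at most `m` terms of each expansion. -/
theorem jetNorm_mul_le (hU : IsOpen U) (hf : ContDiffOn ℝ ∞ f U) (hg : ContDiffOn ℝ ∞ g U)
    (hy : y ∈ U) (m : ℕ) :
    jetNorm m (fun z => f z * g z) y ≤ (m * 2 ^ m * m) * (jetNorm m f y * jetNorm m g y) := by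
  have key : ∀ j ∈ Finset.range m, ‖iteratedFDeriv ℝ j (fun z => f z * g z) y‖ ≤
      (2 ^ m * m) * (jetNorm m f y * jetNorm m g y) := by
    intro j hj
    have hj' := Finset.mem_range.1 hj
    have h := norm_iteratedFDerivWithin_mul_le hf hg hU.uniqueDiffOn hy (natCast_le_smooth j)
    rw [iteratedFDerivWithin_of_isOpen j hU hy] at h
    refine h.trans ?_
    have : ∀ i ∈ Finset.range (j + 1), (j.choose i : ℝ) * ‖iteratedFDerivWithin ℝ i f U y‖ *
        ‖iteratedFDerivWithin ℝ (j - i) g U y‖ ≤ 2 ^ m * (jetNorm m f y * jetNorm m g y) := by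
      intro i hi
      have hi' := Finset.mem_range.1 hi
      rw [iteratedFDerivWithin_of_isOpen i hU hy, iteratedFDerivWithin_of_isOpen (j - i) hU hy,
        mul_assoc]
      have h1 : (j.choose i : ℝ) ≤ 2 ^ m := by
        have : j.choose i ≤ 2 ^ m :=
          (Nat.choose_le_two_pow j i).trans (Nat.pow_le_pow_right (by norm_num) hj'.le)
        exact_mod_cast this
      have h2 : ‖iteratedFDeriv ℝ i f y‖ ≤ jetNorm m f y :=
        Finset.single_le_sum (f := fun j => ‖iteratedFDeriv ℝ j f y‖) (fun _ _ => norm_nonneg _)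
          (Finset.mem_range.2 (by lia))
      have h3 : ‖iteratedFDeriv ℝ (j - i) g y‖ ≤ jetNorm m g y :=
        Finset.single_le_sum (f := fun j => ‖iteratedFDeriv ℝ j g y‖) (fun _ _ => norm_nonneg _)
          (Finset.mem_range.2 (by lia))
      have := jetNorm_nonneg m f y
      gcongr
    refine (Finset.sum_le_sum this).trans ?_
    rw [Finset.sum_const, Finset.card_range, nsmul_eq_mul]
    have h0 := mul_nonneg (jetNorm_nonneg m f y) (jetNorm_nonneg m g y)
    have h1 : ((j + 1 : ℕ) : ℝ) ≤ m := by exact_mod_cast hj'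
    calc ((j + 1 : ℕ) : ℝ) * (2 ^ m * (jetNorm m f y * jetNorm m g y))
        ≤ m * (2 ^ m * (jetNorm m f y * jetNorm m g y)) := by gcongr
      _ = _ := by ring
  refine (Finset.sum_le_sum key).trans (le_of_eq ?_)
  rw [Finset.sum_const, Finset.card_range, nsmul_eq_mul]
  ring

theorem contDiffOn_pd (hU : IsOpen U) (hf : ContDiffOn ℝ ∞ f U) (a : Fin n) :
    ContDiffOn ℝ ∞ (pd a f) U :=
  (hf.fderiv_of_isOpen hU (by simp)).clm_apply contDiffOn_const

theorem jetNorm_pd_le (hU : IsOpen U) (hf : ContDiffOn ℝ ∞ f U) (hy : y ∈ U) (m : ℕ)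
    (a : Fin n) : jetNorm m (pd a f) y ≤ jetNorm (m + 1) f y := by
  have : jetNorm (m + 1) f y = ∑ j ∈ Finset.range m, ‖iteratedFDeriv ℝ (j + 1) f y‖ + |f y| := by
    simp [jetNorm, Finset.sum_range_succ']
  rw [this]
  refine le_trans (Finset.sum_le_sum fun j _ => ?_) (le_add_of_nonneg_right (abs_nonneg _))
  have h := norm_iteratedFDeriv_clm_apply_const (c := EuclideanSpace.single a (1 : ℝ))
    ((hf.fderiv_of_isOpen hU (m := ∞) (by simp)).contDiffAt (hU.mem_nhds hy)) (natCast_le_smooth j)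
  rw [norm_iteratedFDeriv_fderiv, PiLp.norm_single, norm_one, one_mul] at h
  exact h

theorem pd_add (hf : DifferentiableAt ℝ f y) (hg : DifferentiableAt ℝ g y) (a : Fin n) :
    pd a (fun z => f z + g z) y = pd a f y + pd a g y := by
  simp [pd, fderiv_fun_add hf hg]

theorem pd_sub (hf : DifferentiableAt ℝ f y) (hg : DifferentiableAt ℝ g y) (a : Fin n) :
    pd a (fun z => f z - g z) y = pd a f y - pd a g y := by
  simp [pd, fderiv_fun_sub hf hg]

theorem pd_const_mul (hf : DifferentiableAt ℝ f y) (c : ℝ) (a : Fin n) :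
    pd a (fun z => c * f z) y = c * pd a f y := by
  simp [pd, fderiv_const_mul hf]

theorem pd_mul (hf : DifferentiableAt ℝ f y) (hg : DifferentiableAt ℝ g y) (a : Fin n) :
    pd a (fun z => f z * g z) y = f y * pd a g y + pd a f y * g y := by
  simp [pd, fderiv_fun_mul hf hg]; ring

theorem pd_sum {ι : Type*} (s : Finset ι) {F : ι → E n → ℝ}
    (hF : ∀ i ∈ s, DifferentiableAt ℝ (F i) y) (a : Fin n) :
    pd a (fun z => ∑ i ∈ s, F i z) y = ∑ i ∈ s, pd a (F i) y := by
  simp [pd, fderiv_fun_sum hF]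

theorem pd_congr (h : f =ᶠ[𝓝 y] g) (a : Fin n) : pd a f y = pd a g y := by
  simp [pd, h.fderiv_eq]

theorem pd_congr_on (hU : IsOpen U) (h : EqOn f g U) (hy : y ∈ U) (a : Fin n) :
    pd a f y = pd a g y :=
  pd_congr (h.eventuallyEq_of_mem (hU.mem_nhds hy)) a

theorem differentiableAt_of_smooth (hU : IsOpen U) (hf : ContDiffOn ℝ ∞ f U) (hy : y ∈ U) :
    DifferentiableAt ℝ f y :=
  (hf.contDiffAt (hU.mem_nhds hy)).differentiableAt (by simp)

theorem continuousOn_jetNorm (hU : IsOpen U) (hf : ContDiffOn ℝ ∞ f U) (m : ℕ) :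
    ContinuousOn (jetNorm m f) U := by
  unfold jetNorm
  refine continuousOn_finsetSum _ fun j _ => ?_
  have h := hf.continuousOn_iteratedFDerivWithin (natCast_le_smooth j) hU.uniqueDiffOn
  exact (h.congr fun y hy => (iteratedFDerivWithin_of_isOpen j hU hy).symm).norm

theorem exists_jetNorm_le (hU : IsOpen U) (hf : ContDiffOn ℝ ∞ f U) {L : Set (E n)} (hLU : L ⊆ U)
    (hL : IsCompact L) (m : ℕ) : ∃ C : ℝ, 0 ≤ C ∧ ∀ y ∈ L, jetNorm m f y ≤ C := by
  obtain ⟨C, hC⟩ := hL.exists_bound_of_continuousOn ((continuousOn_jetNorm hU hf m).mono hLU)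
  refine ⟨max C 0, le_max_right _ _, fun y hy => ?_⟩
  exact ((le_abs_self _).trans (hC y hy)).trans (le_max_left _ _)

/-- Iterated partial derivatives. -/
noncomputable def pdI : (l : ℕ) → (Fin l → Fin n) → (E n → ℝ) → E n → ℝ
  | 0, _, f => f
  | l + 1, I, f => pd (I 0) (pdI l (Fin.tail I) f)

theorem contDiffOn_pdI (hU : IsOpen U) (hf : ContDiffOn ℝ ∞ f U) :
    ∀ (l : ℕ) (I : Fin l → Fin n), ContDiffOn ℝ ∞ (pdI l I f) U
  | 0, _ => hf
  | l + 1, I => contDiffOn_pd hU (contDiffOn_pdI hU hf l (Fin.tail I)) (I 0)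

/-- The outermost derivative in `pdI` belongs to the first index, which is the leftmost argument of
the iterated Fréchet derivative; the induction peels arguments off from the left. -/
theorem pdI_eq (hU : IsOpen U) (hf : ContDiffOn ℝ ∞ f U) :
    ∀ (l : ℕ) (I : Fin l → Fin n) (y : E n), y ∈ U →
      pdI l I f y = iteratedFDeriv ℝ l f y (fun s => EuclideanSpace.single (I s) (1 : ℝ))
  | 0, _, y, _ => by simp [pdI]
  | l + 1, I, y, hy => by
      rw [iteratedFDeriv_succ_apply_left]
      have h1 : pdI l (Fin.tail I) f =ᶠ[𝓝 y] fun z => iteratedFDeriv ℝ l f z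
          (fun s => EuclideanSpace.single (Fin.tail I s) (1 : ℝ)) := by
        filter_upwards [hU.mem_nhds hy] with z hz using pdI_eq hU hf l (Fin.tail I) z hz
      have hd : DifferentiableAt ℝ (iteratedFDeriv ℝ l f) y :=
        ((hf.contDiffAt (hU.mem_nhds hy)).iteratedFDeriv_right (m := 1) (by
          exact_mod_cast natCast_le_smooth (1 + l))).differentiableAt (by simp)
      have h2 := (ContinuousMultilinearMap.apply ℝ (fun _ : Fin l => E n) ℝ
        (fun s => EuclideanSpace.single (Fin.tail I s) (1 : ℝ))).hasFDerivAt.comp y hd.hasFDerivAt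
      change pd (I 0) (pdI l (Fin.tail I) f) y = _
      rw [pd_congr h1, pd]
      erw [h2.fderiv]
      rfl

theorem abs_pdI_le (hU : IsOpen U) (hf : ContDiffOn ℝ ∞ f U) (hy : y ∈ U) (l m : ℕ) (hlm : l < m)
    (I : Fin l → Fin n) : |pdI l I f y| ≤ jetNorm m f y := by
  rw [pdI_eq hU hf l I y hy, ← Real.norm_eq_abs]
  refine (ContinuousMultilinearMap.le_opNorm _ _).trans ?_
  simp only [PiLp.norm_single, norm_one, Finset.prod_const_one, mul_one]
  exact Finset.single_le_sum (f := fun j => ‖iteratedFDeriv ℝ j f y‖) (fun _ _ => norm_nonneg _)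
    (Finset.mem_range.2 hlm)

/-- Expand every argument in the standard basis and bound each coordinate by the norm of its vector.
-/
theorem norm_multilinear_le {l : ℕ} (M : ContinuousMultilinearMap ℝ (fun _ : Fin l => E n) ℝ) :
    ‖M‖ ≤ ∑ I : Fin l → Fin n, |M (fun s => EuclideanSpace.single (I s) (1 : ℝ))| := by
  refine ContinuousMultilinearMap.opNorm_le_bound (Finset.sum_nonneg fun _ _ => abs_nonneg _)
    fun v => ?_
  have hv : v = fun s => ∑ a : Fin n, v s a • EuclideanSpace.single a (1 : ℝ) := by
    funext s
    ext b
    simp [Finset.sum_apply, Pi.single_apply]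
  have h1 : M v = ∑ I : Fin l → Fin n, (∏ s, v s (I s)) *
      M (fun s => EuclideanSpace.single (I s) (1 : ℝ)) := by
    conv_lhs => rw [hv]
    change M.toMultilinearMap _ = _
    rw [MultilinearMap.map_sum]
    refine Finset.sum_congr rfl fun I _ => ?_
    rw [MultilinearMap.map_smul_univ]
    rfl
  rw [h1, Finset.sum_mul]
  refine (norm_sum_le _ _).trans (Finset.sum_le_sum fun I _ => ?_)
  rw [norm_mul, Real.norm_eq_abs, Real.norm_eq_abs, mul_comm, Finset.abs_prod]
  refine mul_le_mul_of_nonneg_left ?_ (abs_nonneg _)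
  refine Finset.prod_le_prod (fun _ _ => abs_nonneg _) fun s _ => ?_
  exact PiLp.norm_apply_le (v s) (I s)

theorem jetNorm_le_sum_pdI (hU : IsOpen U) (hf : ContDiffOn ℝ ∞ f U) (hy : y ∈ U) (m : ℕ) :
    jetNorm m f y ≤ ∑ l ∈ Finset.range m, ∑ I : Fin l → Fin n, |pdI l I f y| := by
  refine Finset.sum_le_sum fun l _ => (norm_multilinear_le _).trans (le_of_eq ?_)
  exact Finset.sum_congr rfl fun I _ => by rw [pdI_eq hU hf l I y hy]

/-- The rightmost argument of the Fréchet derivative is the derivative taken first, so peeling from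
the right needs no symmetry of higher derivatives. -/
theorem pdI_pd_comm (hU : IsOpen U) (hf : ContDiffOn ℝ ∞ f U) (hy : y ∈ U) (l : ℕ)
    (I : Fin (l + 1) → Fin n) :
    pdI (l + 1) I f y = pdI l (Fin.init I) (pd (I (Fin.last l)) f) y := by
  rw [pdI_eq hU hf _ I y hy, pdI_eq hU (contDiffOn_pd hU hf _) _ _ y hy,
    iteratedFDeriv_succ_apply_right]
  have h := (hf.fderiv_of_isOpen hU (m := ∞) (by simp)).contDiffAt (hU.mem_nhds hy)
  have := ContinuousLinearMap.iteratedFDeriv_comp_left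
    (ContinuousLinearMap.apply ℝ ℝ (EuclideanSpace.single (I (Fin.last l)) (1 : ℝ))) h
    (natCast_le_smooth l)
  change _ = iteratedFDeriv ℝ l (⇑(ContinuousLinearMap.apply ℝ ℝ
    (EuclideanSpace.single (I (Fin.last l)) (1 : ℝ))) ∘ fderiv ℝ f) y _
  rw [this]
  rfl

/-- Raises estimates by one order by applying them to the partial derivatives. The constant counts
the multi-indices. -/
theorem exists_jetNorm_succ_le (n m : ℕ) : ∃ C : ℝ, 0 ≤ C ∧ ∀ {U : Set (E n)} {f : E n → ℝ} {y : E n},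
    IsOpen U → ContDiffOn ℝ ∞ f U → y ∈ U →
      jetNorm (m + 1) f y ≤ |f y| + C * ∑ a : Fin n, jetNorm m (pd a f) y := by
  refine ⟨∑ l ∈ Finset.range m, ∑ I : Fin (l + 1) → Fin n, 1, by positivity,
    fun {U f y} hU hf hy => ?_⟩
  refine (jetNorm_le_sum_pdI hU hf hy (m + 1)).trans ?_
  rw [Finset.sum_range_succ']
  have h0 : ∑ I : Fin 0 → Fin n, |pdI 0 I f y| = |f y| := by simp [pdI]
  rw [h0, add_comm]
  refine add_le_add le_rfl ?_
  rw [Finset.sum_mul]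
  refine Finset.sum_le_sum fun l hl => ?_
  rw [Finset.sum_mul]
  refine Finset.sum_le_sum fun I _ => ?_
  rw [one_mul, pdI_pd_comm hU hf hy]
  refine (abs_pdI_le hU (contDiffOn_pd hU hf _) hy l m (Finset.mem_range.1 hl) _).trans ?_
  exact Finset.single_le_sum (f := fun a => jetNorm m (pd a f) y)
    (fun _ _ => jetNorm_nonneg _ _ _) (Finset.mem_univ _)

end JetNorm

end SmallEnergy

namespace SmallEnergy

/-! ### Locally smooth convergence of coefficients and its algebra. -/

section SmoothConvergence

variable {n : ℕ}

/-- Smooth functions on `U` converging with all derivatives, locally uniformly. -/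
structure SmoothTendsto (U : Set (E n)) (a : ℕ → E n → ℝ) (b : E n → ℝ) : Prop where
  smooth : ∀ i, ContDiffOn ℝ ∞ (a i) U
  lim : ContDiffOn ℝ ∞ b U
  conv : ∀ m : ℕ, ∀ L ⊆ U, IsCompact L → ∀ ε : ℝ, 0 < ε → ∀ᶠ i in atTop, ∀ y ∈ L,
    jetNorm m (fun z => a i z - b z) y ≤ ε

variable {U : Set (E n)} {a a' : ℕ → E n → ℝ} {b b' : E n → ℝ}

theorem SmoothTendsto.of_tendstoSmoothLoc (hU : IsOpen U) (ha : ∀ i, ContDiffOn ℝ ∞ (a i) U)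
    (hb : ContDiffOn ℝ ∞ b U) (h : TendstoSmoothLoc a b U) : SmoothTendsto U a b := by
  refine ⟨ha, hb, fun m L hLU hL ε hε => ?_⟩
  -- The `m` orders share `ε`; the denominator `m + 1` stays positive for `m = 0`.
  have h1 : ∀ j ∈ Finset.range m, ∀ᶠ i in atTop, ∀ y ∈ L,
      ‖iteratedFDeriv ℝ j (fun z => a i z - b z) y‖ ≤ ε / (m + 1) := by
    intro j _
    have := Metric.tendstoUniformlyOn_iff.1 (h L hLU hL j) (ε / (m + 1)) (by positivity)
    filter_upwards [this] with i hi y hy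
    have h2 := iteratedFDeriv_sub_apply (contDiffAt_nat (ha i) hU (hLU hy) j)
      (contDiffAt_nat hb hU (hLU hy) j)
    change ‖iteratedFDeriv ℝ j (a i - b) y‖ ≤ _
    rw [h2, ← dist_eq_norm, dist_comm]
    exact (hi y hy).le
  filter_upwards [(Finset.eventually_all _).2 h1] with i hi y hy
  refine (Finset.sum_le_sum fun j hj => hi j hj y hy).trans ?_
  rw [Finset.sum_const, Finset.card_range, nsmul_eq_mul, mul_div_assoc', div_le_iff₀ (by positivity)]
  nlinarith

theorem SmoothTendsto.const (hb : ContDiffOn ℝ ∞ b U) : SmoothTendsto U (fun _ => b) b :=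
  ⟨fun _ => hb, hb, fun m L _ _ ε hε => Eventually.of_forall fun i y _ => by simp [hε.le]⟩

theorem SmoothTendsto.add (hU : IsOpen U) (h : SmoothTendsto U a b) (h' : SmoothTendsto U a' b') :
    SmoothTendsto U (fun i z => a i z + a' i z) (fun z => b z + b' z) := by
  refine ⟨fun i => (h.smooth i).add (h'.smooth i), h.lim.add h'.lim, fun m L hLU hL ε hε => ?_⟩
  filter_upwards [h.conv m L hLU hL (ε / 2) (by positivity),
    h'.conv m L hLU hL (ε / 2) (by positivity)] with i hi hi' y hy
  have e : (fun z => a i z + a' i z - (b z + b' z)) =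
    fun z => (a i z - b z) + (a' i z - b' z) := by funext z; ring
  rw [e]
  refine (jetNorm_add_le hU ((h.smooth i).sub h.lim) ((h'.smooth i).sub h'.lim) (hLU hy) m).trans ?_
  linarith [hi y hy, hi' y hy]

theorem SmoothTendsto.mul (hU : IsOpen U) (h : SmoothTendsto U a b) (h' : SmoothTendsto U a' b') :
    SmoothTendsto U (fun i z => a i z * a' i z) (fun z => b z * b' z) := by
  refine ⟨fun i => (h.smooth i).mul (h'.smooth i), h.lim.mul h'.lim, fun m L hLU hL ε hε => ?_⟩
  obtain ⟨C, hC0, hC⟩ := exists_jetNorm_le hU h.lim hLU hL m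
  obtain ⟨C', hC0', hC'⟩ := exists_jetNorm_le hU h'.lim hLU hL m
  set D : ℝ := m * 2 ^ m * m with hD
  have hD0 : 0 ≤ D := by positivity
  set t : ℝ := min 1 (ε / (D * (1 + C + C') + 1)) with ht
  have ht0 : 0 < t := by positivity
  filter_upwards [h.conv m L hLU hL t ht0, h'.conv m L hLU hL t ht0] with i hi hi' y hy
  -- Expanding around the limits leaves one product of two small factors, where `t ≤ 1` is used, and
  -- two products of a small factor with a bounded one.
  have e : (fun z => a i z * a' i z - b z * b' z) =
    fun z => ((a i z - b z) * (a' i z - b' z) + b z * (a' i z - b' z)) + (a i z - b z) * b' z := by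
    funext z; ring
  have s1 := (h.smooth i).sub h.lim
  have s2 := (h'.smooth i).sub h'.lim
  rw [e]
  have hy' := hLU hy
  have i1 := jetNorm_mul_le hU s1 s2 hy' m
  have i2 := jetNorm_mul_le hU h.lim s2 hy' m
  have i3 := jetNorm_mul_le hU s1 h'.lim hy' m
  have j1 := jetNorm_add_le hU (s1.mul s2) (h.lim.mul s2) hy' m
  have j2 := jetNorm_add_le hU ((s1.mul s2).add (h.lim.mul s2)) (s1.mul h'.lim) hy' m
  have n1 := jetNorm_nonneg m (fun z => a i z - b z) y
  have n2 := jetNorm_nonneg m (fun z => a' i z - b' z) y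
  have n3 := jetNorm_nonneg m b y
  have n4 := jetNorm_nonneg m b' y
  have k1 := hi y hy
  have k2 := hi' y hy
  have k3 := hC y hy
  have k4 := hC' y hy
  have t1 : t ≤ 1 := min_le_left _ _
  have t2 : t * (D * (1 + C + C') + 1) ≤ ε := by
    have : t ≤ ε / (D * (1 + C + C') + 1) := min_le_right _ _
    rwa [le_div_iff₀ (by positivity)] at this
  have l1 : jetNorm m (fun z => a i z - b z) y * jetNorm m (fun z => a' i z - b' z) y ≤ t * 1 :=
    mul_le_mul k1 (k2.trans t1) n2 ht0.le
  have l2 : jetNorm m b y * jetNorm m (fun z => a' i z - b' z) y ≤ C * t :=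
    mul_le_mul k3 k2 n2 hC0
  have l3 : jetNorm m (fun z => a i z - b z) y * jetNorm m b' y ≤ t * C' :=
    mul_le_mul k1 k4 n4 ht0.le
  have m1 := mul_le_mul_of_nonneg_left l1 hD0
  have m2 := mul_le_mul_of_nonneg_left l2 hD0
  have m3 := mul_le_mul_of_nonneg_left l3 hD0
  calc _ ≤ D * (t * 1) + D * (C * t) + D * (t * C') := by
        refine j2.trans ?_
        refine add_le_add (j1.trans (add_le_add (i1.trans m1) (i2.trans m2))) (i3.trans m3)
    _ = t * (D * (1 + C + C')) := by ring
    _ ≤ t * (D * (1 + C + C') + 1) := by nlinarith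
    _ ≤ ε := t2

theorem SmoothTendsto.const_mul (hU : IsOpen U) (c : ℝ) (h : SmoothTendsto U a b) :
    SmoothTendsto U (fun i z => c * a i z) (fun z => c * b z) :=
  (SmoothTendsto.const (contDiffOn_const (c := c))).mul hU h

theorem SmoothTendsto.neg (hU : IsOpen U) (h : SmoothTendsto U a b) :
    SmoothTendsto U (fun i z => - a i z) (fun z => - b z) := by
  simpa using h.const_mul hU (-1)

theorem SmoothTendsto.sub (hU : IsOpen U) (h : SmoothTendsto U a b) (h' : SmoothTendsto U a' b') :
    SmoothTendsto U (fun i z => a i z - a' i z) (fun z => b z - b' z) := by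
  simpa [sub_eq_add_neg] using h.add hU (h'.neg hU)

theorem SmoothTendsto.sum (hU : IsOpen U) {ι : Type*} (s : Finset ι) {a : ι → ℕ → E n → ℝ}
    {b : ι → E n → ℝ} (h : ∀ j ∈ s, SmoothTendsto U (a j) (b j)) :
    SmoothTendsto U (fun i z => ∑ j ∈ s, a j i z) (fun z => ∑ j ∈ s, b j z) := by
  classical
  induction s using Finset.induction_on with
  | empty => simpa using SmoothTendsto.const (U := U) (contDiffOn_const (c := (0 : ℝ)))
  | insert j s hj ih =>
    simp only [Finset.sum_insert hj]
    exact (h j (Finset.mem_insert_self _ _)).add hU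
      (ih fun j' hj' => h j' (Finset.mem_insert_of_mem hj'))

theorem SmoothTendsto.prod (hU : IsOpen U) {ι : Type*} (s : Finset ι) {a : ι → ℕ → E n → ℝ}
    {b : ι → E n → ℝ} (h : ∀ j ∈ s, SmoothTendsto U (a j) (b j)) :
    SmoothTendsto U (fun i z => ∏ j ∈ s, a j i z) (fun z => ∏ j ∈ s, b j z) := by
  classical
  induction s using Finset.induction_on with
  | empty => simpa using SmoothTendsto.const (U := U) (contDiffOn_const (c := (1 : ℝ)))
  | insert j s hj ih =>
    simp only [Finset.prod_insert hj]
    exact (h j (Finset.mem_insert_self _ _)).mul hU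
      (ih fun j' hj' => h j' (Finset.mem_insert_of_mem hj'))

theorem SmoothTendsto.pd (hU : IsOpen U) (h : SmoothTendsto U a b) (c : Fin n) :
    SmoothTendsto U (fun i => pd c (a i)) (pd c b) := by
  refine ⟨fun i => contDiffOn_pd hU (h.smooth i) c, contDiffOn_pd hU h.lim c,
    fun m L hLU hL ε hε => ?_⟩
  filter_upwards [h.conv (m + 1) L hLU hL ε hε] with i hi y hy
  have e : EqOn (fun z => SmallEnergy.pd c (a i) z - SmallEnergy.pd c b z)
      (SmallEnergy.pd c fun z => a i z - b z) U := fun z hz =>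
    (pd_sub (differentiableAt_of_smooth hU (h.smooth i) hz)
      (differentiableAt_of_smooth hU h.lim hz) c).symm
  rw [jetNorm_congr_on hU e (hLU hy)]
  exact (jetNorm_pd_le hU ((h.smooth i).sub h.lim) (hLU hy) m c).trans (hi y hy)

/-- With r = 1/b, e = a_i - b and s = 1/a_i - 1/b one has s = -r e (r + s). The size of s is
therefore at most q t (C + |s|), and the term in s is absorbed once q t ≤ 1/2. No formula for the
higher derivatives of an inverse is needed. -/
theorem SmoothTendsto.inv (hU : IsOpen U) (h : SmoothTendsto U a b) (h0 : ∀ i, ∀ z ∈ U, a i z ≠ 0)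
    (h0' : ∀ z ∈ U, b z ≠ 0) : SmoothTendsto U (fun i z => (a i z)⁻¹) (fun z => (b z)⁻¹) := by
  have sm : ∀ i, ContDiffOn ℝ ∞ (fun z => (a i z)⁻¹) U := fun i => (h.smooth i).inv (h0 i)
  have sl : ContDiffOn ℝ ∞ (fun z => (b z)⁻¹) U := h.lim.inv h0'
  refine ⟨sm, sl, fun m L hLU hL ε hε => ?_⟩
  obtain ⟨C, hC0, hC⟩ := exists_jetNorm_le hU sl hLU hL m
  set D : ℝ := m * 2 ^ m * m with hD
  have hD0 : 0 ≤ D := by positivity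
  set q : ℝ := D * (D * C) with hq
  have hq0 : 0 ≤ q := by positivity
  set t : ℝ := min (1 / (2 * q + 1)) (ε / (2 * q * C + 1)) with ht
  have ht0 : 0 < t := by positivity
  filter_upwards [h.conv m L hLU hL t ht0] with i hi y hy
  have hy' := hLU hy
  set r : E n → ℝ := fun z => (b z)⁻¹ with hr
  set e : E n → ℝ := fun z => a i z - b z with he
  set s : E n → ℝ := fun z => (a i z)⁻¹ - (b z)⁻¹ with hs
  have se : ContDiffOn ℝ ∞ e U := (h.smooth i).sub h.lim
  have ss : ContDiffOn ℝ ∞ s U := (sm i).sub sl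
  have eq1 : EqOn s (fun z => - (r z * (e z * (r z + s z)))) U := by
    intro z hz
    have n1 := h0 i z hz
    have n2 := h0' z hz
    simp only [hr, he, hs]
    field_simp
    ring
  have i0 : jetNorm m s y = jetNorm m (fun z => r z * (e z * (r z + s z))) y := by
    rw [jetNorm_congr_on hU eq1 hy', jetNorm_neg hU (sl.mul (se.mul (sl.add ss))) hy']
  have i1 := jetNorm_mul_le hU sl (se.mul (sl.add ss)) hy' m
  have i2 := jetNorm_mul_le hU se (sl.add ss) hy' m
  have i3 := jetNorm_add_le hU sl ss hy' m
  have nr := jetNorm_nonneg m r y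
  have ns := jetNorm_nonneg m s y
  have ne := jetNorm_nonneg m e y
  have k1 : jetNorm m e y ≤ t := hi y hy
  have k2 : jetNorm m r y ≤ C := hC y hy
  have main : jetNorm m s y ≤ q * t * (C + jetNorm m s y) := by
    calc jetNorm m s y ≤ D * (jetNorm m r y * (D * (jetNorm m e y * (jetNorm m r y + jetNorm m s y)))) := by
          rw [i0] at ns ⊢
          refine i1.trans ?_
          rw [← i0]
          refine mul_le_mul_of_nonneg_left (mul_le_mul_of_nonneg_left (i2.trans ?_) nr) hD0
          exact mul_le_mul_of_nonneg_left (mul_le_mul_of_nonneg_left i3 ne) hD0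
      _ ≤ D * (C * (D * (t * (C + jetNorm m s y)))) := by gcongr
      _ = _ := by rw [hq]; ring
  have t1 : q * t ≤ 1 / 2 := by
    have : t ≤ 1 / (2 * q + 1) := min_le_left _ _
    rw [le_div_iff₀ (by positivity)] at this
    nlinarith
  have t2 : t * (2 * q * C + 1) ≤ ε := by
    have : t ≤ ε / (2 * q * C + 1) := min_le_right _ _
    rwa [le_div_iff₀ (by positivity)] at this
  nlinarith

theorem SmoothTendsto.exists_bound (hU : IsOpen U) (h : SmoothTendsto U a b) {L : Set (E n)}
    (hLU : L ⊆ U) (hL : IsCompact L) : ∃ C : ℝ, 0 ≤ C ∧ ∀ᶠ i in atTop, ∀ y ∈ L, |a i y| ≤ C := by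
  obtain ⟨C, hC0, hC⟩ := exists_jetNorm_le hU h.lim hLU hL 1
  refine ⟨C + 1, by positivity, ?_⟩
  filter_upwards [h.conv 1 L hLU hL 1 one_pos] with i hi y hy
  have h1 := hi y hy
  have h2 := hC y hy
  rw [jetNorm_one] at h1 h2
  calc |a i y| = |(a i y - b y) + b y| := by ring_nf
    _ ≤ _ := abs_add_le _ _
    _ ≤ C + 1 := by linarith

end SmoothConvergence

/-! ### Differential operators described by their action on jets. -/

section DiffOp

variable {n : ℕ}

/-- Linear differential operators of order at most `r` with smooth coefficients on `U`, described by
their effect on jets. -/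
structure IsDiffOp (U : Set (E n)) (r : ℕ) (P : (E n → ℝ) → E n → ℝ) : Prop where
  smooth : ∀ f, ContDiffOn ℝ ∞ f U → ContDiffOn ℝ ∞ (P f) U
  lin : ∀ f g, ContDiffOn ℝ ∞ f U → ContDiffOn ℝ ∞ g U → ∀ c : ℝ, ∀ y ∈ U,
    P (fun z => f z + c * g z) y = P f y + c * P g y
  bound : ∀ m : ℕ, ∀ L ⊆ U, IsCompact L → ∃ C : ℝ, 0 ≤ C ∧ ∀ f, ContDiffOn ℝ ∞ f U → ∀ y ∈ L,
    jetNorm m (P f) y ≤ C * jetNorm (m + r) f y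
  -- The commutator with a multiplication loses one order. The gain is written as `m + 1` on the
  -- left, not as `r - 1` on the right, so that it also makes sense for `r = 0`, where at `m = 0` it
  -- says that the commutator vanishes.
  comm : ∀ χ, ContDiffOn ℝ ∞ χ U → ∀ m : ℕ, ∀ L ⊆ U, IsCompact L → ∃ C : ℝ, 0 ≤ C ∧
    ∀ f, ContDiffOn ℝ ∞ f U → ∀ y ∈ L,
      jetNorm (m + 1) (fun z => P (fun x => χ x * f x) z - χ z * P f z) y ≤ C * jetNorm (m + r) f y

variable {U : Set (E n)} {r s : ℕ} {P Q : (E n → ℝ) → E n → ℝ}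

theorem IsDiffOp.sub (h : IsDiffOp U r P) {f g : E n → ℝ} (hf : ContDiffOn ℝ ∞ f U)
    (hg : ContDiffOn ℝ ∞ g U) {y : E n} (hy : y ∈ U) :
    P (fun z => f z - g z) y = P f y - P g y := by
  have := h.lin f g hf hg (-1) y hy
  simpa [sub_eq_add_neg] using this

/-- The jet bound on the compact set `{y}`, without further differentiation, shows that an operator
of order `r` sees only the derivatives of order at most `r` at `y`. All later locality statements
rest on this. -/
theorem IsDiffOp.eq_of_jetNorm_sub_eq_zero (h : IsDiffOp U r P) {f g : E n → ℝ}
    (hf : ContDiffOn ℝ ∞ f U) (hg : ContDiffOn ℝ ∞ g U) {y : E n} (hy : y ∈ U)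
    (h0 : jetNorm (r + 1) (fun z => f z - g z) y = 0) : P f y = P g y := by
  obtain ⟨C, _, hC⟩ := h.bound 1 {y} (by simpa using hy) isCompact_singleton
  have h1 := hC _ (hf.sub hg) y rfl
  rw [add_comm 1 r, h0, mul_zero, jetNorm_one, h.sub hf hg hy] at h1
  exact sub_eq_zero.1 (abs_nonpos_iff.1 h1)

theorem IsDiffOp.congr_on (h : IsDiffOp U r P) (hU : IsOpen U) {f g : E n → ℝ}
    (hf : ContDiffOn ℝ ∞ f U) (hfg : EqOn f g U) {y : E n} (hy : y ∈ U) : P f y = P g y := by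
  refine h.eq_of_jetNorm_sub_eq_zero hf (hf.congr hfg.symm) hy ?_
  rw [jetNorm_congr_on hU (g := fun _ => (0 : ℝ)) (fun z hz => by simp [hfg hz]) hy]
  simp

theorem IsDiffOp.mono (h : IsDiffOp U r P) (hrs : r ≤ s) : IsDiffOp U s P := by
  refine ⟨h.smooth, h.lin, fun m L hLU hL => ?_, fun χ hχ m L hLU hL => ?_⟩
  · obtain ⟨C, hC0, hC⟩ := h.bound m L hLU hL
    exact ⟨C, hC0, fun f hf y hy => (hC f hf y hy).trans
      (mul_le_mul_of_nonneg_left (jetNorm_mono (by lia) _ _) hC0)⟩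
  · obtain ⟨C, hC0, hC⟩ := h.comm χ hχ m L hLU hL
    exact ⟨C, hC0, fun f hf y hy => (hC f hf y hy).trans
      (mul_le_mul_of_nonneg_left (jetNorm_mono (by lia) _ _) hC0)⟩

theorem IsDiffOp.id : IsDiffOp U 0 (fun f => f) := by
  refine ⟨fun f hf => hf, fun f g _ _ c y _ => rfl, fun m L _ _ => ⟨1, zero_le_one, by simp⟩,
    fun χ _ m L _ _ => ⟨0, le_rfl, fun f _ y _ => by simp⟩⟩

theorem IsDiffOp.mulLeft (hU : IsOpen U) {c : E n → ℝ} (hc : ContDiffOn ℝ ∞ c U) :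
    IsDiffOp U 0 (fun f z => c z * f z) := by
  refine ⟨fun f hf => hc.mul hf, fun f g _ _ t y _ => by ring, fun m L hLU hL => ?_,
    fun χ _ m L _ _ => ⟨0, le_rfl, fun f _ y _ => ?_⟩⟩
  · obtain ⟨C, hC0, hC⟩ := exists_jetNorm_le hU hc hLU hL m
    refine ⟨m * 2 ^ m * m * C, by positivity, fun f hf y hy => ?_⟩
    refine (jetNorm_mul_le hU hc hf (hLU hy) m).trans ?_
    rw [mul_assoc ((m : ℝ) * 2 ^ m * m), add_zero]
    exact mul_le_mul_of_nonneg_left (mul_le_mul_of_nonneg_right (hC y hy)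
      (jetNorm_nonneg m f y)) (by positivity)
  · have : (fun z => c z * (χ z * f z) - χ z * (c z * f z)) = fun _ => 0 := by funext z; ring
    rw [this]
    simp

theorem IsDiffOp.add (hU : IsOpen U) (h : IsDiffOp U r P) (h' : IsDiffOp U r Q) :
    IsDiffOp U r (fun f z => P f z + Q f z) := by
  refine ⟨fun f hf => (h.smooth f hf).add (h'.smooth f hf), fun f g hf hg c y hy => ?_,
    fun m L hLU hL => ?_, fun χ hχ m L hLU hL => ?_⟩
  · rw [h.lin f g hf hg c y hy, h'.lin f g hf hg c y hy]; ring
  · obtain ⟨C, hC0, hC⟩ := h.bound m L hLU hL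
    obtain ⟨C', hC0', hC'⟩ := h'.bound m L hLU hL
    refine ⟨C + C', by positivity, fun f hf y hy => ?_⟩
    refine (jetNorm_add_le hU (h.smooth f hf) (h'.smooth f hf) (hLU hy) m).trans ?_
    linarith [hC f hf y hy, hC' f hf y hy]
  · obtain ⟨C, hC0, hC⟩ := h.comm χ hχ m L hLU hL
    obtain ⟨C', hC0', hC'⟩ := h'.comm χ hχ m L hLU hL
    refine ⟨C + C', by positivity, fun f hf y hy => ?_⟩
    have e : (fun z => (P (fun x => χ x * f x) z + Q (fun x => χ x * f x) z) -
        χ z * (P f z + Q f z)) = fun z => (P (fun x => χ x * f x) z - χ z * P f z) +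
        (Q (fun x => χ x * f x) z - χ z * Q f z) := by funext z; ring
    rw [e]
    refine (jetNorm_add_le hU ((h.smooth _ (hχ.mul hf)).sub (hχ.mul (h.smooth f hf)))
      ((h'.smooth _ (hχ.mul hf)).sub (hχ.mul (h'.smooth f hf))) (hLU hy) _).trans ?_
    linarith [hC f hf y hy, hC' f hf y hy]

theorem IsDiffOp.zero : IsDiffOp U r (fun _ _ => (0 : ℝ)) :=
  ⟨fun _ _ => contDiffOn_const, fun _ _ _ _ _ _ _ => by simp,
    fun m L _ _ => ⟨0, le_rfl, fun f _ y _ => by simp⟩,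
    fun χ _ m L _ _ => ⟨0, le_rfl, fun f _ y _ => by simp⟩⟩

theorem IsDiffOp.sum (hU : IsOpen U) {ι : Type*} (t : Finset ι)
    {P : ι → (E n → ℝ) → E n → ℝ} (h : ∀ j ∈ t, IsDiffOp U r (P j)) :
    IsDiffOp U r (fun f z => ∑ j ∈ t, P j f z) := by
  classical
  induction t using Finset.induction_on with
  | empty => simpa using IsDiffOp.zero
  | insert j t hj ih =>
    simp only [Finset.sum_insert hj]
    exact (h j (Finset.mem_insert_self _ _)).add hU
      (ih fun j' hj' => h j' (Finset.mem_insert_of_mem hj'))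

theorem IsDiffOp.comp (hU : IsOpen U) (h : IsDiffOp U r P) (h' : IsDiffOp U s Q) :
    IsDiffOp U (r + s) (fun f => P (Q f)) := by
  refine ⟨fun f hf => h.smooth _ (h'.smooth f hf), fun f g hf hg c y hy => ?_,
    fun m L hLU hL => ?_, fun χ hχ m L hLU hL => ?_⟩
  · have hc : ContDiffOn ℝ ∞ (fun z => f z + c * g z) U := hf.add (contDiffOn_const.mul hg)
    rw [← h.lin _ _ (h'.smooth f hf) (h'.smooth g hg) c y hy]
    exact h.congr_on hU (h'.smooth _ hc) (fun z hz => h'.lin f g hf hg c z hz) hy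
  · obtain ⟨C, hC0, hC⟩ := h.bound m L hLU hL
    obtain ⟨C', hC0', hC'⟩ := h'.bound (m + r) L hLU hL
    refine ⟨C * C', by positivity, fun f hf y hy => ?_⟩
    refine (hC _ (h'.smooth f hf) y hy).trans ?_
    rw [mul_assoc, ← add_assoc]
    exact mul_le_mul_of_nonneg_left (hC' f hf y hy) hC0
  · obtain ⟨C1, hC10, hC1⟩ := h.bound (m + 1) L hLU hL
    obtain ⟨C2, hC20, hC2⟩ := h'.comm χ hχ (m + r) L hLU hL
    obtain ⟨C3, hC30, hC3⟩ := h.comm χ hχ m L hLU hL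
    obtain ⟨C4, hC40, hC4⟩ := h'.bound (m + r) L hLU hL
    refine ⟨C1 * C2 + C3 * C4, by positivity, fun f hf y hy => ?_⟩
    have hQ := h'.smooth f hf
    have hQχ := h'.smooth _ (hχ.mul hf)
    -- [PQ, χ] = P [Q, χ] + [P, χ] Q, and either summand has lost one order.
    have e : EqOn (fun z => P (Q fun x => χ x * f x) z - χ z * P (Q f) z)
        (fun z => P (fun x => Q (fun x => χ x * f x) x - χ x * Q f x) z +
          (P (fun x => χ x * Q f x) z - χ z * P (Q f) z)) U := by
      intro z hz
      simp only [h.sub hQχ (hχ.mul hQ) hz]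
      ring
    rw [jetNorm_congr_on hU e (hLU hy)]
    have sD := hQχ.sub (hχ.mul hQ)
    refine (jetNorm_add_le hU (h.smooth _ sD) ((h.smooth _ (hχ.mul hQ)).sub
      (hχ.mul (h.smooth _ hQ))) (hLU hy) _).trans ?_
    have i1 := hC1 _ sD y hy
    have i2 := hC2 f hf y hy
    have i3 := hC3 _ hQ y hy
    have i4 := hC4 f hf y hy
    rw [show m + 1 + r = m + r + 1 by ring] at i1
    rw [add_mul, ← add_assoc m r s, mul_assoc, mul_assoc]
    exact add_le_add (i1.trans (mul_le_mul_of_nonneg_left i2 hC10))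
      (i3.trans (mul_le_mul_of_nonneg_left i4 hC30))

theorem IsDiffOp.pd (hU : IsOpen U) (a : Fin n) : IsDiffOp U 1 (pd a) := by
  refine ⟨fun f hf => contDiffOn_pd hU hf a, fun f g hf hg c y hy => ?_,
    fun m L hLU hL => ⟨1, zero_le_one, fun f hf y hy => by
      rw [one_mul]; exact jetNorm_pd_le hU hf (hLU hy) m a⟩, fun χ hχ m L hLU hL => ?_⟩
  · rw [pd_add (differentiableAt_of_smooth hU hf hy)
      ((differentiableAt_of_smooth hU hg hy).const_mul c),
      pd_const_mul (differentiableAt_of_smooth hU hg hy)]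
  -- The commutator of ∂_a with χ is multiplication by ∂_a χ, of order zero.
  · obtain ⟨C, hC0, hC⟩ := (IsDiffOp.mulLeft hU (contDiffOn_pd hU hχ a)).bound (m + 1) L hLU hL
    refine ⟨C, hC0, fun f hf y hy => ?_⟩
    rw [jetNorm_congr_on hU (g := fun z => SmallEnergy.pd a χ z * f z) (fun z hz => ?_) (hLU hy)]
    · exact hC f hf y hy
    · simp only [pd_mul (differentiableAt_of_smooth hU hχ hz) (differentiableAt_of_smooth hU hf hz)]
      ring

theorem IsDiffOp.mul_op (hU : IsOpen U) {c : E n → ℝ} (hc : ContDiffOn ℝ ∞ c U)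
    (h : IsDiffOp U r P) : IsDiffOp U r (fun f z => c z * P f z) := by
  have := (IsDiffOp.mulLeft hU hc).comp hU h
  rwa [zero_add] at this

theorem IsDiffOp.neg (hU : IsOpen U) (h : IsDiffOp U r P) : IsDiffOp U r (fun f z => - P f z) := by
  simpa using h.mul_op hU (contDiffOn_const (c := (-1 : ℝ)))

theorem IsDiffOp.sub_op (hU : IsOpen U) (h : IsDiffOp U r P) (h' : IsDiffOp U r Q) :
    IsDiffOp U r (fun f z => P f z - Q f z) := by
  simpa [sub_eq_add_neg] using h.add hU (h'.neg hU)

/-- Sequences of differential operators whose coefficients converge. -/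
structure DiffOpTendsto (U : Set (E n)) (r : ℕ) (P : ℕ → (E n → ℝ) → E n → ℝ)
    (Q : (E n → ℝ) → E n → ℝ) : Prop where
  op : ∀ i, IsDiffOp U r (P i)
  lim : IsDiffOp U r Q
  conv : ∀ m : ℕ, ∀ L ⊆ U, IsCompact L → ∀ ε : ℝ, 0 < ε → ∀ᶠ i in atTop,
    ∀ f, ContDiffOn ℝ ∞ f U → ∀ y ∈ L,
      jetNorm m (fun z => P i f z - Q f z) y ≤ ε * jetNorm (m + r) f y

theorem DiffOpTendsto.const (h : IsDiffOp U r P) : DiffOpTendsto U r (fun _ => P) P :=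
  ⟨fun _ => h, h, fun m L _ _ ε hε => Eventually.of_forall fun i f _ y _ => by
    simp only [sub_self, jetNorm_zero]
    exact mul_nonneg hε.le (jetNorm_nonneg _ _ _)⟩

variable {P P' : ℕ → (E n → ℝ) → E n → ℝ} {Q Q' : (E n → ℝ) → E n → ℝ}

theorem DiffOpTendsto.mono (h : DiffOpTendsto U r P Q) (hrs : r ≤ s) : DiffOpTendsto U s P Q := by
  refine ⟨fun i => (h.op i).mono hrs, h.lim.mono hrs, fun m L hLU hL ε hε => ?_⟩
  filter_upwards [h.conv m L hLU hL ε hε] with i hi f hf y hy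
  exact (hi f hf y hy).trans (mul_le_mul_of_nonneg_left (jetNorm_mono (by lia) _ _) hε.le)

theorem DiffOpTendsto.add (hU : IsOpen U) (h : DiffOpTendsto U r P Q)
    (h' : DiffOpTendsto U r P' Q') :
    DiffOpTendsto U r (fun i f z => P i f z + P' i f z) (fun f z => Q f z + Q' f z) := by
  refine ⟨fun i => (h.op i).add hU (h'.op i), h.lim.add hU h'.lim, fun m L hLU hL ε hε => ?_⟩
  filter_upwards [h.conv m L hLU hL (ε / 2) (by positivity),
    h'.conv m L hLU hL (ε / 2) (by positivity)] with i hi hi' f hf y hy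
  have e : (fun z => P i f z + P' i f z - (Q f z + Q' f z)) =
      fun z => (P i f z - Q f z) + (P' i f z - Q' f z) := by funext z; ring
  rw [e]
  refine (jetNorm_add_le hU (((h.op i).smooth f hf).sub (h.lim.smooth f hf))
    (((h'.op i).smooth f hf).sub (h'.lim.smooth f hf)) (hLU hy) m).trans ?_
  linarith [hi f hf y hy, hi' f hf y hy]

theorem DiffOpTendsto.sum (hU : IsOpen U) {ι : Type*} (t : Finset ι)
    {P : ι → ℕ → (E n → ℝ) → E n → ℝ} {Q : ι → (E n → ℝ) → E n → ℝ}
    (h : ∀ j ∈ t, DiffOpTendsto U r (P j) (Q j)) :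
    DiffOpTendsto U r (fun i f z => ∑ j ∈ t, P j i f z) (fun f z => ∑ j ∈ t, Q j f z) := by
  classical
  induction t using Finset.induction_on with
  | empty => simpa using DiffOpTendsto.const (IsDiffOp.zero (U := U) (r := r))
  | insert j t hj ih =>
    simp only [Finset.sum_insert hj]
    exact (h j (Finset.mem_insert_self _ _)).add hU
      (ih fun j' hj' => h j' (Finset.mem_insert_of_mem hj'))

theorem DiffOpTendsto.mulLeft (hU : IsOpen U) {a : ℕ → E n → ℝ} {b : E n → ℝ}
    (h : SmoothTendsto U a b) :
    DiffOpTendsto U 0 (fun i f z => a i z * f z) (fun f z => b z * f z) := by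
  refine ⟨fun i => IsDiffOp.mulLeft hU (h.smooth i), IsDiffOp.mulLeft hU h.lim,
    fun m L hLU hL ε hε => ?_⟩
  set D : ℝ := m * 2 ^ m * m with hD
  have hD0 : 0 ≤ D := by positivity
  filter_upwards [h.conv m L hLU hL (ε / (D + 1)) (by positivity)] with i hi f hf y hy
  have e : (fun z => a i z * f z - b z * f z) = fun z => (a i z - b z) * f z := by funext z; ring
  rw [e]
  refine (jetNorm_mul_le hU ((h.smooth i).sub h.lim) hf (hLU hy) m).trans ?_
  have h1 := hi y hy
  have h2 := jetNorm_nonneg m f y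
  have h3 : D * (ε / (D + 1)) ≤ ε := by
    rw [mul_div_assoc', div_le_iff₀ (by positivity)]
    nlinarith
  calc _ ≤ D * (ε / (D + 1) * jetNorm m f y) := by gcongr
    _ = D * (ε / (D + 1)) * jetNorm m f y := by ring
    _ ≤ ε * jetNorm m f y := by gcongr

theorem DiffOpTendsto.exists_bound (hU : IsOpen U) (h : DiffOpTendsto U r P Q) (m : ℕ)
    {L : Set (E n)} (hLU : L ⊆ U) (hL : IsCompact L) : ∃ C : ℝ, 0 ≤ C ∧ ∀ᶠ i in atTop,
      ∀ f, ContDiffOn ℝ ∞ f U → ∀ y ∈ L, jetNorm m (P i f) y ≤ C * jetNorm (m + r) f y := by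
  obtain ⟨C, hC0, hC⟩ := h.lim.bound m L hLU hL
  refine ⟨C + 1, by positivity, ?_⟩
  filter_upwards [h.conv m L hLU hL 1 one_pos] with i hi f hf y hy
  have e : P i f = fun z => (P i f z - Q f z) + Q f z := by funext z; ring
  rw [e]
  refine (jetNorm_add_le hU (((h.op i).smooth f hf).sub (h.lim.smooth f hf))
    (h.lim.smooth f hf) (hLU hy) m).trans ?_
  linarith [hi f hf y hy, hC f hf y hy]

theorem DiffOpTendsto.comp (hU : IsOpen U) (h : DiffOpTendsto U r P Q)
    (h' : DiffOpTendsto U s P' Q') :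
    DiffOpTendsto U (r + s) (fun i f => P i (P' i f)) (fun f => Q (Q' f)) := by
  refine ⟨fun i => (h.op i).comp hU (h'.op i), h.lim.comp hU h'.lim, fun m L hLU hL ε hε => ?_⟩
  obtain ⟨C, hC0, hC⟩ := h.exists_bound hU m hLU hL
  obtain ⟨C', hC0', hC'⟩ := h'.lim.bound (m + r) L hLU hL
  filter_upwards [hC, h'.conv (m + r) L hLU hL (ε / (2 * (C + 1))) (by positivity),
    h.conv m L hLU hL (ε / (2 * (C' + 1))) (by positivity)] with i hCi hi' hi f hf y hy
  have s1 := (h'.op i).smooth f hf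
  have s2 := h'.lim.smooth f hf
  -- P_i P'_i - Q Q' = P_i (P'_i - Q') + (P_i - Q) Q'; the first summand needs a bound on P_i
  -- uniform in i.
  have e : EqOn (fun z => P i (P' i f) z - Q (Q' f) z)
      (fun z => P i (fun x => P' i f x - Q' f x) z + (P i (Q' f) z - Q (Q' f) z)) U := by
    intro z hz
    simp only [(h.op i).sub s1 s2 hz]
    ring
  rw [jetNorm_congr_on hU e (hLU hy)]
  refine (jetNorm_add_le hU ((h.op i).smooth _ (s1.sub s2))
    (((h.op i).smooth _ s2).sub (h.lim.smooth _ s2)) (hLU hy) m).trans ?_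
  have i1 := hCi _ (s1.sub s2) y hy
  have i2 := hi' f hf y hy
  have i3 := hi _ s2 y hy
  have i4 := hC' f hf y hy
  rw [← add_assoc m r s]
  set J := jetNorm (m + r + s) f y with hJ
  have hJ0 : 0 ≤ J := jetNorm_nonneg _ _ _
  have k1 : C * (ε / (2 * (C + 1)) * J) ≤ ε / 2 * J := by
    have : C * (ε / (2 * (C + 1))) ≤ ε / 2 := by
      rw [mul_div_assoc', div_le_div_iff₀ (by positivity) (by positivity)]
      nlinarith
    calc _ = C * (ε / (2 * (C + 1))) * J := by ring
      _ ≤ _ := by gcongr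
  have k2 : ε / (2 * (C' + 1)) * (C' * J) ≤ ε / 2 * J := by
    have : ε / (2 * (C' + 1)) * C' ≤ ε / 2 := by
      rw [div_mul_eq_mul_div, div_le_div_iff₀ (by positivity) (by positivity)]
      nlinarith
    calc _ = ε / (2 * (C' + 1)) * C' * J := by ring
      _ ≤ _ := by gcongr
  have l1 := mul_le_mul_of_nonneg_left i2 hC0
  have l2 := mul_le_mul_of_nonneg_left i4 (show 0 ≤ ε / (2 * (C' + 1)) by positivity)
  calc _ ≤ ε / 2 * J + ε / 2 * J :=
        add_le_add (i1.trans (l1.trans k1)) (i3.trans (l2.trans k2))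
    _ = ε * J := by ring

theorem DiffOpTendsto.mul_op (hU : IsOpen U) {a : ℕ → E n → ℝ} {b : E n → ℝ}
    (ha : SmoothTendsto U a b) (h : DiffOpTendsto U r P Q) :
    DiffOpTendsto U r (fun i f z => a i z * P i f z) (fun f z => b z * Q f z) := by
  have := (DiffOpTendsto.mulLeft hU ha).comp hU h
  rwa [zero_add] at this

theorem DiffOpTendsto.iterate (hU : IsOpen U) (h : DiffOpTendsto U r P Q) (m : ℕ) :
    DiffOpTendsto U (r * m) (fun i => (P i)^[m]) (Q^[m]) := by
  induction m with
  | zero => exact DiffOpTendsto.const IsDiffOp.id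
  | succ m ih =>
    have := h.comp hU ih
    simp only [Function.iterate_succ']
    rw [mul_add, mul_one, add_comm]
    exact this

end DiffOp

end SmallEnergy

namespace SmallEnergy

/-! ### Evaluation of tensors given by their components. -/

section TensorEvaluation

variable {n l : ℕ}

/-- The value of the tensor with components `C` on the vectors `v`. -/
noncomputable def tev (C : (Fin l → Fin n) → ℝ) (v : Fin l → Fin n → ℝ) : ℝ :=
  ∑ J : Fin l → Fin n, (∏ s, v s (J s)) * C J

theorem prod_update_eq (v : Fin l → Fin n → ℝ) (s : Fin l) (x : Fin n → ℝ) (J : Fin l → Fin n) :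
    ∏ t, (Function.update v s x) t (J t) = x (J s) * ∏ t ∈ Finset.univ.erase s, v t (J t) := by
  rw [← Finset.mul_prod_erase _ _ (Finset.mem_univ s)]
  congr 1
  · simp
  · refine Finset.prod_congr rfl fun t ht => ?_
    rw [Function.update_of_ne (Finset.ne_of_mem_erase ht)]

theorem tev_update (C : (Fin l → Fin n) → ℝ) (v : Fin l → Fin n → ℝ) (s : Fin l) (x : Fin n → ℝ) :
    tev C (Function.update v s x) =
      ∑ J : Fin l → Fin n, x (J s) * ((∏ t ∈ Finset.univ.erase s, v t (J t)) * C J) := by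
  unfold tev
  exact Finset.sum_congr rfl fun J _ => by rw [prod_update_eq, mul_assoc]

theorem tev_update_sub (C : (Fin l → Fin n) → ℝ) (v : Fin l → Fin n → ℝ) (s : Fin l)
    (x x' : Fin n → ℝ) : tev C (Function.update v s (fun a => x a - x' a)) =
      tev C (Function.update v s x) - tev C (Function.update v s x') := by
  simp only [tev_update, sub_mul, Finset.sum_sub_distrib]

theorem tev_update_sum (C : (Fin l → Fin n) → ℝ) (v : Fin l → Fin n → ℝ) (s : Fin l)
    (c : Fin n → ℝ) (x : Fin n → Fin n → ℝ) :
    tev C (Function.update v s (fun a => ∑ m, c m * x m a)) =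
      ∑ m, c m * tev C (Function.update v s (x m)) := by
  simp only [tev_update, Finset.sum_mul, Finset.mul_sum]
  rw [Finset.sum_comm]
  simp only [mul_assoc]

/-- A contraction in slot `s` can be carried by the vector in that slot instead of by the tensor.
Christoffel corrections thereby become evaluations on a modified vector. -/
theorem sum_update_tev (C : (Fin l → Fin n) → ℝ) (v : Fin l → Fin n → ℝ) (s : Fin l)
    (γ : Fin n → Fin n → ℝ) :
    ∑ J : Fin l → Fin n, (∏ t, v t (J t)) * ∑ m, γ m (J s) * C (Function.update J s m) =
      tev C (Function.update v s (fun m => ∑ c, γ m c * v s c)) := by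
  simp only [tev_update, Finset.mul_sum, Finset.sum_mul]
  rw [← Fintype.sum_prod_type', ← Fintype.sum_prod_type']
  -- The involution that exchanges the summed index `m` with the entry `J s`.
  let e : ((Fin l → Fin n) × Fin n) ≃ ((Fin l → Fin n) × Fin n) :=
    { toFun := fun q => (Function.update q.1 s q.2, q.1 s)
      invFun := fun q => (Function.update q.1 s q.2, q.1 s)
      left_inv := fun q => by simp
      right_inv := fun q => by simp }
  refine Fintype.sum_equiv e _ _ fun q => ?_
  obtain ⟨J, m⟩ := q
  simp only [e, Equiv.coe_fn_mk, Function.update_self]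
  have h : ∏ t ∈ Finset.univ.erase s, v t (Function.update J s m t) =
      ∏ t ∈ Finset.univ.erase s, v t (J t) := Finset.prod_congr rfl fun t ht => by
    rw [Function.update_of_ne (Finset.ne_of_mem_erase ht)]
  rw [h, ← Finset.mul_prod_erase _ _ (Finset.mem_univ s)]
  ring

theorem pd_prod {ι : Type*} [DecidableEq ι] (t : Finset ι) {F : ι → E n → ℝ} {y : E n}
    (hF : ∀ i ∈ t, DifferentiableAt ℝ (F i) y) (a : Fin n) :
    pd a (fun z => ∏ i ∈ t, F i z) y = ∑ i ∈ t, (∏ j ∈ t.erase i, F j y) * pd a (F i) y := by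
  have := HasFDerivAt.finset_prod (u := t) (g := F) (x := y)
    (g' := fun i => fderiv ℝ (F i) y) fun i hi => (hF i hi).hasFDerivAt
  unfold pd
  rw [this.fderiv]
  simp

theorem pd_tev {C : (Fin l → Fin n) → E n → ℝ} {v : Fin l → Fin n → E n → ℝ} {y : E n}
    (hC : ∀ J, DifferentiableAt ℝ (C J) y) (hv : ∀ s a, DifferentiableAt ℝ (v s a) y) (i : Fin n) :
    pd i (fun z => tev (fun J => C J z) (fun s a => v s a z)) y =
      tev (fun J => pd i (C J) y) (fun s a => v s a y) +
        ∑ s, tev (fun J => C J y) (Function.update (fun s a => v s a y) s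
          (fun a => pd i (v s a) y)) := by
  have hp : ∀ J : Fin l → Fin n, DifferentiableAt ℝ (fun z => ∏ s, v s (J s) z) y := fun J =>
    (HasFDerivAt.finset_prod fun s _ => (hv s (J s)).hasFDerivAt).differentiableAt
  change pd i (fun z => ∑ J : Fin l → Fin n, (∏ s, v s (J s) z) * C J z) y = _
  unfold tev
  rw [pd_sum _ fun J _ => (hp J).fun_mul (hC J), Finset.sum_comm, ← Finset.sum_add_distrib]
  refine Finset.sum_congr rfl fun J _ => ?_
  rw [pd_mul (hp J) (hC J), pd_prod _ fun s _ => hv s (J s), Finset.sum_mul]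
  congr 1
  refine Finset.sum_congr rfl fun s _ => ?_
  rw [prod_update_eq]
  ring

theorem tev_succ (C : (Fin (l + 1) → Fin n) → ℝ) (v : Fin (l + 1) → Fin n → ℝ) :
    tev C v = ∑ b, v 0 b * tev (fun J => C (Fin.cons b J)) (Fin.tail v) := by
  unfold tev
  simp only [Finset.mul_sum]
  rw [← Fintype.sum_prod_type']
  refine (Fintype.sum_equiv (Fin.consEquiv fun _ => Fin n) _ _ fun q => ?_).symm
  simp only [Fin.consEquiv, Equiv.coe_fn_mk]
  rw [Fin.prod_univ_succ]
  simp [Fin.tail, mul_assoc]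

end TensorEvaluation

/-! ### Riemannian geometry in coordinates and its transformation laws. -/

section EuclideanGeometry

variable {n : ℕ}

/-- Christoffel symbols of the metric with matrix `G`. -/
noncomputable def chris (G : E n → Matrix (Fin n) (Fin n) ℝ) (m i j : Fin n) (y : E n) : ℝ :=
  (1 / 2) * ∑ r, (G y)⁻¹ m r *
    (pd i (fun z => G z j r) y + pd j (fun z => G z i r) y - pd r (fun z => G z i j) y)

/-- Components of the iterated covariant derivatives for the metric with matrix `G`. -/
noncomputable def covE (G : E n → Matrix (Fin n) (Fin n) ℝ) (F : E n → ℝ) :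
    (l : ℕ) → (Fin l → Fin n) → E n → ℝ
  | 0, _ => F
  | l + 1, I => fun y =>
      pd (I 0) (covE G F l (Fin.tail I)) y
        - ∑ s : Fin l, ∑ m : Fin n, chris G m (I 0) (I s.succ) y *
            covE G F l (Function.update (Fin.tail I) s m) y

theorem covE_succ (G : E n → Matrix (Fin n) (Fin n) ℝ) (F : E n → ℝ) (l : ℕ)
    (I : Fin (l + 1) → Fin n) (y : E n) : covE G F (l + 1) I y =
      pd (I 0) (covE G F l (Fin.tail I)) y - ∑ s : Fin l, ∑ m : Fin n,
        chris G m (I 0) (I s.succ) y * covE G F l (Function.update (Fin.tail I) s m) y := rfl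

/-- The Laplacian of the metric with matrix `G`. -/
noncomputable def lapE (G : E n → Matrix (Fin n) (Fin n) ℝ) (F : E n → ℝ) (y : E n) : ℝ :=
  - ∑ i, ∑ j, (G y)⁻¹ i j * covE G F 2 ![i, j] y

/-- A smooth family of positive definite matrices. -/
structure IsMetric (U : Set (E n)) (G : E n → Matrix (Fin n) (Fin n) ℝ) : Prop where
  smooth : ∀ i j, ContDiffOn ℝ ∞ (fun y => G y i j) U
  posDef : ∀ y ∈ U, (G y).PosDef

variable {U V W : Set (E n)} {G H : E n → Matrix (Fin n) (Fin n) ℝ}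

theorem IsMetric.symm (h : IsMetric U G) {y : E n} (hy : y ∈ U) (i j : Fin n) :
    G y i j = G y j i := by
  have := congrFun (congrFun (h.posDef y hy).isHermitian i) j
  simpa [Matrix.conjTranspose_apply] using this.symm

theorem IsMetric.det_pos (h : IsMetric U G) {y : E n} (hy : y ∈ U) : 0 < (G y).det :=
  (h.posDef y hy).det_pos

theorem IsMetric.isUnit_det (h : IsMetric U G) {y : E n} (hy : y ∈ U) : IsUnit (G y).det :=
  (h.det_pos hy).ne'.isUnit

/-- Lowering the upper index cancels the inverse matrix and leaves the symbols of the first kind,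
which are linear in the derivatives of the metric. -/
theorem sum_mul_chris (h : IsMetric U G) {y : E n} (hy : y ∈ U) (i j r : Fin n) :
    ∑ m, G y r m * chris G m i j y =
      (1 / 2) * (pd i (fun z => G z j r) y + pd j (fun z => G z i r) y
        - pd r (fun z => G z i j) y) := by
  have e := Matrix.mul_nonsing_inv _ (h.isUnit_det hy)
  set d : Fin n → ℝ := fun r => pd i (fun z => G z j r) y + pd j (fun z => G z i r) y
        - pd r (fun z => G z i j) y with hd
  have h1 : ∀ m, chris G m i j y = (1 / 2) * ((G y)⁻¹.mulVec d) m := fun m => rfl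
  have h2 : (G y).mulVec ((G y)⁻¹.mulVec d) = d := by
    rw [Matrix.mulVec_mulVec, e, Matrix.one_mulVec]
  simp only [h1]
  calc _ = (1 / 2) * ∑ m, G y r m * ((G y)⁻¹.mulVec d) m := by
        rw [Finset.mul_sum]; exact Finset.sum_congr rfl fun m _ => by ring
    _ = (1 / 2) * ((G y).mulVec ((G y)⁻¹.mulVec d)) r := rfl
    _ = _ := by rw [h2]

/-- The Jacobian matrix `∂_i φ^a`. -/
noncomputable def jac (φ : E n → E n) (a i : Fin n) (y : E n) : ℝ := pd i (fun z => φ z a) y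

/-- `φ` is a smooth map from `V` to `W` that pulls the metric `H` back to the metric `G`. -/
structure IsPullback (V W : Set (E n)) (φ : E n → E n) (G H : E n → Matrix (Fin n) (Fin n) ℝ) :
    Prop where
  openV : IsOpen V
  openW : IsOpen W
  smooth : ContDiffOn ℝ ∞ φ V
  maps : MapsTo φ V W
  metricG : IsMetric V G
  metricH : IsMetric W H
  eq : ∀ y ∈ V, ∀ i j, G y i j = ∑ a, ∑ b, jac φ a i y * jac φ b j y * H (φ y) a b

variable {φ : E n → E n}

theorem contDiffOn_coord (hφ : ContDiffOn ℝ ∞ φ V) (a : Fin n) :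
    ContDiffOn ℝ ∞ (fun z => φ z a) V :=
  (contDiffOn_euclidean.1 hφ) a

theorem contDiffOn_jac (hV : IsOpen V) (hφ : ContDiffOn ℝ ∞ φ V) (a i : Fin n) :
    ContDiffOn ℝ ∞ (jac φ a i) V := contDiffOn_pd hV (contDiffOn_coord hφ a) i

theorem pd_pd_comm (hV : IsOpen V) {f : E n → ℝ} (hf : ContDiffOn ℝ ∞ f V) {y : E n} (hy : y ∈ V)
    (i j : Fin n) : pd i (pd j f) y = pd j (pd i f) y := by
  have hsym : IsSymmSndFDerivAt ℝ f y :=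
    (hf.contDiffAt (hV.mem_nhds hy)).isSymmSndFDerivAt
      (by simpa using natCast_le_smooth 2)
  have hd : DifferentiableAt ℝ (fderiv ℝ f) y :=
    ((hf.fderiv_of_isOpen hV (m := ∞) (by simp)).contDiffAt (hV.mem_nhds hy)).differentiableAt
      (by simp)
  have key : ∀ i j : Fin n, pd i (pd j f) y =
      fderiv ℝ (fderiv ℝ f) y (EuclideanSpace.single i 1) (EuclideanSpace.single j 1) := by
    intro i j
    change fderiv ℝ (fun z => fderiv ℝ f z (EuclideanSpace.single j 1)) y _ = _
    rw [fderiv_clm_apply hd (differentiableAt_const _)]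
    simp
  rw [key, key, hsym.eq]

theorem pd_comp (hV : IsOpen V) (hW : IsOpen W) (hφ : ContDiffOn ℝ ∞ φ V) (hm : MapsTo φ V W)
    {h : E n → ℝ} (hh : ContDiffOn ℝ ∞ h W) {y : E n} (hy : y ∈ V) (i : Fin n) :
    pd i (fun z => h (φ z)) y = ∑ c, jac φ c i y * pd c h (φ y) := by
  have d1 : DifferentiableAt ℝ φ y := (hφ.contDiffAt (hV.mem_nhds hy)).differentiableAt (by simp)
  have d2 := differentiableAt_of_smooth hW hh (hm hy)
  have e1 : pd i (fun z => h (φ z)) y =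
      fderiv ℝ h (φ y) (fderiv ℝ φ y (EuclideanSpace.single i 1)) := by
    unfold pd
    rw [show (fun z => h (φ z)) = h ∘ φ from rfl, fderiv_comp y d2 d1]
    rfl
  have e2 : ∀ c, jac φ c i y = (fderiv ℝ φ y (EuclideanSpace.single i 1)) c := by
    intro c
    have := ((EuclideanSpace.proj (𝕜 := ℝ) c).hasFDerivAt (x := φ y)).comp y d1.hasFDerivAt
    unfold jac pd
    erw [this.fderiv]
    rfl
  set w := fderiv ℝ φ y (EuclideanSpace.single i 1) with hw
  have e3 : w = ∑ c, w c • EuclideanSpace.single c (1 : ℝ) := by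
    ext b
    simp [Pi.single_apply]
  rw [e1, e3, map_sum]
  refine Finset.sum_congr rfl fun c _ => ?_
  rw [map_smul, e2, smul_eq_mul, pd]

/-- The product rule applied to the pull-back formula. Symmetry of `H` brings the two terms with a
second derivative of φ to the same shape, so that they can cancel in the Christoffel combination. -/
theorem IsPullback.pd_metric (h : IsPullback V W φ G H) {y : E n} (hy : y ∈ V) (k i j : Fin n) :
    pd k (fun z => G z i j) y =
      (∑ a, ∑ b, pd k (jac φ a i) y * jac φ b j y * H (φ y) a b)
      + (∑ a, ∑ b, pd k (jac φ a j) y * jac φ b i y * H (φ y) a b)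
      + ∑ a, ∑ b, ∑ c, jac φ a i y * jac φ b j y * jac φ c k y * pd c (fun z => H z a b) (φ y) := by
  have dj : ∀ a i, DifferentiableAt ℝ (jac φ a i) y := fun a i =>
    differentiableAt_of_smooth h.openV (contDiffOn_jac h.openV h.smooth a i) hy
  have dH : ∀ a b, DifferentiableAt ℝ (fun z => H (φ z) a b) y := fun a b =>
    differentiableAt_of_smooth h.openV ((h.metricH.smooth a b).comp h.smooth h.maps) hy
  rw [pd_congr_on h.openV (g := fun z => ∑ a, ∑ b, jac φ a i z * jac φ b j z * H (φ z) a b)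
    (fun z hz => h.eq z hz i j) hy]
  rw [pd_sum _ fun a _ => DifferentiableAt.fun_sum fun b _ => ((dj a i).fun_mul (dj b j)).fun_mul (dH a b)]
  have e2 : (∑ a, ∑ b, pd k (jac φ a j) y * jac φ b i y * H (φ y) a b) =
      ∑ a, ∑ b, pd k (jac φ b j) y * jac φ a i y * H (φ y) a b := by
    rw [Finset.sum_comm]
    refine Finset.sum_congr rfl fun a _ => Finset.sum_congr rfl fun b _ => ?_
    rw [h.metricH.symm (h.maps hy)]
  rw [e2, ← Finset.sum_add_distrib, ← Finset.sum_add_distrib]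
  refine Finset.sum_congr rfl fun a _ => ?_
  rw [pd_sum _ fun b _ => ((dj a i).fun_mul (dj b j)).fun_mul (dH a b), ← Finset.sum_add_distrib,
    ← Finset.sum_add_distrib]
  refine Finset.sum_congr rfl fun b _ => ?_
  rw [pd_mul (f := fun z => jac φ a i z * jac φ b j z) ((dj a i).mul (dj b j)) (dH a b),
    pd_mul (dj a i) (dj b j),
    pd_comp h.openV h.openW h.smooth h.maps (h.metricH.smooth a b) hy, Finset.mul_sum]
  have : (∑ c, jac φ a i y * jac φ b j y * (jac φ c k y * pd c (fun y => H y a b) (φ y))) =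
    ∑ c, jac φ a i y * jac φ b j y * jac φ c k y * pd c (fun z => H z a b) (φ y) :=
    Finset.sum_congr rfl fun c _ => by ring
  rw [this]
  ring

theorem sum_rotate {α : Type*} [Fintype α] (F : α → α → α → ℝ) :
    ∑ a, ∑ b, ∑ c, F a b c = ∑ b, ∑ c, ∑ a, F a b c := by
  rw [Finset.sum_comm]
  exact Finset.sum_congr rfl fun b _ => Finset.sum_comm

/-- The transformation law of the Christoffel symbols. -/
theorem IsPullback.pd_jac (h : IsPullback V W φ G H) {y : E n} (hy : y ∈ V) (a i j : Fin n) :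
    pd i (jac φ a j) y = ∑ m, chris G m i j y * jac φ a m y
      - ∑ b, jac φ b i y * ∑ c, chris H a b c (φ y) * jac φ c j y := by
  set T : Matrix (Fin n) (Fin n) ℝ := Matrix.of fun a i => jac φ a i y with hT
  set S : Fin n → ℝ := fun a => pd i (jac φ a j) y with hS
  have hsymm : ∀ a i j, pd i (jac φ a j) y = pd j (jac φ a i) y := fun a i j =>
    pd_pd_comm h.openV (contDiffOn_coord h.smooth a) hy i j
  have hy' := h.maps hy
  have hG : G y = T.transpose * H (φ y) * T := by
    ext i j
    rw [h.eq y hy i j, Matrix.mul_apply]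
    simp only [Matrix.mul_apply, Finset.sum_mul, Matrix.transpose_apply, hT, Matrix.of_apply]
    rw [Finset.sum_comm]
    exact Finset.sum_congr rfl fun a _ => Finset.sum_congr rfl fun b _ => by ring
  -- Since Tᵀ H T = G is invertible, so is the left factor Tᵀ H. It can be cancelled at the end, and
  -- invertibility of φ is not used.
  have hdet : IsUnit (T.transpose * H (φ y)).det := by
    have := h.metricG.isUnit_det hy
    rw [hG, Matrix.det_mul] at this
    exact isUnit_of_mul_isUnit_left this
  -- the vector of first kind symbols
  have key : (T.transpose * H (φ y)).mulVec (fun a => S a +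
        ∑ b, jac φ b i y * ∑ c, chris H a b c (φ y) * jac φ c j y) =
      (T.transpose * H (φ y)).mulVec (T.mulVec fun m => chris G m i j y) := by
    rw [Matrix.mulVec_mulVec, ← hG]
    funext r
    have hr : (G y).mulVec (fun m => chris G m i j y) r = _ := sum_mul_chris h.metricG hy i j r
    rw [hr, h.pd_metric hy, h.pd_metric hy, h.pd_metric hy]
    have lhs : (T.transpose * H (φ y)).mulVec (fun a => S a +
        ∑ b, jac φ b i y * ∑ c, chris H a b c (φ y) * jac φ c j y) r =
        (∑ a, ∑ b, S a * jac φ b r y * H (φ y) a b) +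
          ∑ a, ∑ b, ∑ c, jac φ a i y * jac φ b j y * jac φ c r y *
            ((1 / 2) * (pd a (fun z => H z b c) (φ y) + pd b (fun z => H z a c) (φ y)
        - pd c (fun z => H z a b) (φ y))) := by
      rw [← Matrix.mulVec_mulVec]
      change ∑ c, jac φ c r y * (∑ e, H (φ y) c e * _) = _
      simp only [mul_add, Finset.sum_add_distrib]
      congr 1
      · rw [Finset.sum_comm]
        simp only [Finset.mul_sum]
        refine Finset.sum_congr rfl fun a _ => Finset.sum_congr rfl fun b _ => ?_
        rw [h.metricH.symm hy' b a]
        ring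
      · have e1 : ∀ a b c, (1 / 2) * (pd a (fun z => H z b c) (φ y) + pd b (fun z => H z a c) (φ y)
            - pd c (fun z => H z a b) (φ y)) = ∑ m, H (φ y) c m * chris H m a b (φ y) :=
          fun a b c => (sum_mul_chris h.metricH hy' a b c).symm
        simp only [e1, Finset.mul_sum]
        conv_rhs =>
          enter [2, a]
          rw [sum_rotate]
        rw [sum_rotate (fun a c m => ∑ b, jac φ a i y * jac φ b j y * jac φ c r y *
          (H (φ y) c m * chris H m a b (φ y)))]
        refine Finset.sum_congr rfl fun c _ => Finset.sum_congr rfl fun m _ =>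
          Finset.sum_congr rfl fun a _ => Finset.sum_congr rfl fun b _ => by ring
    rw [lhs]
    -- Renaming summed indices aligns the derivatives of `H` with those in its first kind symbol.
    have b1 : (∑ a, ∑ b, ∑ c, jac φ a j y * jac φ b r y * jac φ c i y *
        pd c (fun z => H z a b) (φ y)) = ∑ a, ∑ b, ∑ c, jac φ a i y * jac φ b j y * jac φ c r y *
          pd a (fun z => H z b c) (φ y) := by
      rw [sum_rotate (fun a b c => jac φ a i y * jac φ b j y * jac φ c r y *
          pd a (fun z => H z b c) (φ y))]
      exact Finset.sum_congr rfl fun c _ => Finset.sum_congr rfl fun m _ =>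
          Finset.sum_congr rfl fun a _ => by ring
    have b2 : (∑ a, ∑ b, ∑ c, jac φ a i y * jac φ b r y * jac φ c j y *
        pd c (fun z => H z a b) (φ y)) = ∑ a, ∑ b, ∑ c, jac φ a i y * jac φ b j y * jac φ c r y *
          pd b (fun z => H z a c) (φ y) := by
      refine Finset.sum_congr rfl fun a _ => ?_
      rw [Finset.sum_comm]
      exact Finset.sum_congr rfl fun b _ => Finset.sum_congr rfl fun c _ => by ring
    have e2 : (∑ a, ∑ b, ∑ c, jac φ a i y * jac φ b j y * jac φ c r y *
            ((1 / 2) * (pd a (fun z => H z b c) (φ y) + pd b (fun z => H z a c) (φ y)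
        - pd c (fun z => H z a b) (φ y)))) =
        (1 / 2) * ((∑ a, ∑ b, ∑ c, jac φ a i y * jac φ b j y * jac φ c r y *
          pd a (fun z => H z b c) (φ y)) + (∑ a, ∑ b, ∑ c, jac φ a i y * jac φ b j y * jac φ c r y *
          pd b (fun z => H z a c) (φ y)) - ∑ a, ∑ b, ∑ c, jac φ a i y * jac φ b j y * jac φ c r y *
          pd c (fun z => H z a b) (φ y)) := by
      simp only [← Finset.sum_add_distrib, ← Finset.sum_sub_distrib, Finset.mul_sum]
      exact Finset.sum_congr rfl fun a _ => Finset.sum_congr rfl fun b _ =>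
          Finset.sum_congr rfl fun c _ => by ring
    -- Second derivatives of φ commute. Of the six terms that contain them, four cancel and the
    -- remaining two are equal.
    have s1 : ∀ i j r, (∑ a, ∑ b, pd i (jac φ a j) y * jac φ b r y * H (φ y) a b) =
        ∑ a, ∑ b, pd j (jac φ a i) y * jac φ b r y * H (φ y) a b := fun i j r =>
      Finset.sum_congr rfl fun a _ => Finset.sum_congr rfl fun b _ => by rw [hsymm]
    rw [b1, b2, e2, s1 j i r, s1 r i j, s1 r j i]
    simp only [hS]
    ring
  have inj := Matrix.mulVec_injective_of_isUnit ((Matrix.isUnit_iff_isUnit_det _).2 hdet) key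
  have := congrFun inj a
  have e : T.mulVec (fun m => chris G m i j y) a = ∑ m, chris G m i j y * jac φ a m y := by
    change ∑ m, jac φ a m y * chris G m i j y = _
    exact Finset.sum_congr rfl fun m _ => mul_comm _ _
  rw [e] at this
  linarith

theorem smoothTendsto_det {ι : Type*} [Fintype ι] [DecidableEq ι] (hU : IsOpen U)
    {A : ℕ → E n → Matrix ι ι ℝ} {B : E n → Matrix ι ι ℝ}
    (h : ∀ i j, SmoothTendsto U (fun m y => A m y i j) (fun y => B y i j)) :
    SmoothTendsto U (fun m y => (A m y).det) (fun y => (B y).det) := by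
  simp only [Matrix.det_apply']
  exact SmoothTendsto.sum hU _ fun σ _ => SmoothTendsto.const_mul hU _
    (SmoothTendsto.prod hU _ fun i _ => h _ _)

/-- Smooth metrics converging with all derivatives, locally uniformly. -/
structure MetricConv (U : Set (E n)) (G : ℕ → E n → Matrix (Fin n) (Fin n) ℝ)
    (H : E n → Matrix (Fin n) (Fin n) ℝ) : Prop where
  metric : ∀ i, IsMetric U (G i)
  lim : IsMetric U H
  conv : ∀ i j, SmoothTendsto U (fun m y => G m y i j) (fun y => H y i j)

theorem MetricConv.const (h : IsMetric U G) : MetricConv U (fun _ => G) G :=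
  ⟨fun _ => h, h, fun i j => SmoothTendsto.const (h.smooth i j)⟩

section

variable {G : ℕ → E n → Matrix (Fin n) (Fin n) ℝ}

/-- Cramer's rule: the entries of the inverse are quotients of determinants, hence arise from the
entries by sums, products and one inversion of a positive function. -/
theorem MetricConv.inv (hU : IsOpen U) (h : MetricConv U G H) (i j : Fin n) :
    SmoothTendsto U (fun m y => (G m y)⁻¹ i j) (fun y => (H y)⁻¹ i j) := by
  have e : ∀ M : Matrix (Fin n) (Fin n) ℝ, M⁻¹ i j = (M.det)⁻¹ * M.adjugate i j := fun M => by
    rw [Matrix.inv_def, Ring.inverse_eq_inv']; rfl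
  simp only [e]
  refine SmoothTendsto.mul hU (SmoothTendsto.inv hU (smoothTendsto_det hU h.conv)
    (fun m z hz => ((h.metric m).det_pos hz).ne') fun z hz => (h.lim.det_pos hz).ne') ?_
  simp only [Matrix.adjugate_apply]
  refine smoothTendsto_det hU fun a b => ?_
  by_cases hab : a = j
  · subst hab
    simp only [Matrix.updateRow_self]
    exact SmoothTendsto.const contDiffOn_const
  · simp only [Matrix.updateRow_ne hab]
    exact h.conv a b

theorem MetricConv.chris (hU : IsOpen U) (h : MetricConv U G H) (m i j : Fin n) :
    SmoothTendsto U (fun q y => chris (G q) m i j y) (fun y => chris H m i j y) :=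
  SmoothTendsto.const_mul hU _ (SmoothTendsto.sum hU _ fun r _ => (h.inv hU m r).mul hU
    ((((h.conv j r).pd hU i).add hU ((h.conv i r).pd hU j)).sub hU ((h.conv i j).pd hU r)))

theorem DiffOpTendsto.sub_op {r : ℕ} {P P' : ℕ → (E n → ℝ) → E n → ℝ}
    {Q Q' : (E n → ℝ) → E n → ℝ} (hU : IsOpen U) (h : DiffOpTendsto U r P Q)
    (h' : DiffOpTendsto U r P' Q') :
    DiffOpTendsto U r (fun i f z => P i f z - P' i f z) (fun f z => Q f z - Q' f z) := by
  have := h.add hU (DiffOpTendsto.mul_op hU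
    (SmoothTendsto.const (contDiffOn_const (c := (-1 : ℝ)))) h')
  simpa [sub_eq_add_neg] using this

theorem MetricConv.covE (hU : IsOpen U) (h : MetricConv U G H) :
    ∀ (l : ℕ) (I : Fin l → Fin n),
      DiffOpTendsto U l (fun q f => covE (G q) f l I) (fun f => covE H f l I)
  | 0, _ => DiffOpTendsto.const IsDiffOp.id
  | l + 1, I => by
      have h1 := (DiffOpTendsto.const (IsDiffOp.pd hU (I 0))).comp hU (h.covE hU l (Fin.tail I))
      rw [add_comm] at h1
      refine h1.sub_op hU (DiffOpTendsto.sum hU _ fun s _ => DiffOpTendsto.sum hU _ fun m _ => ?_)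
      exact ((DiffOpTendsto.mul_op hU (h.chris hU m (I 0) (I s.succ))
        (h.covE hU l (Function.update (Fin.tail I) s m))).mono (Nat.le_succ l))

theorem covE_two (G : E n → Matrix (Fin n) (Fin n) ℝ) (F : E n → ℝ) (i j : Fin n) (y : E n) :
    SmallEnergy.covE G F 2 ![i, j] y =
      pd i (pd j F) y - ∑ m, SmallEnergy.chris G m i j y * pd m F y := by
  have h1 : ∀ (I : Fin 1 → Fin n), SmallEnergy.covE G F 1 I = pd (I 0) F := fun I => by
    funext z; simp [SmallEnergy.covE]
  rw [SmallEnergy.covE]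
  simp [h1, Fin.tail]

theorem MetricConv.lapE (hU : IsOpen U) (h : MetricConv U G H) :
    DiffOpTendsto U 2 (fun q => lapE (G q)) (lapE H) := by
  have h1 : DiffOpTendsto U 2 (fun q f z => ∑ i, ∑ j, (-(G q z)⁻¹ i j) * SmallEnergy.covE (G q) f 2 ![i, j] z)
      (fun f z => ∑ i, ∑ j, (-(H z)⁻¹ i j) * SmallEnergy.covE H f 2 ![i, j] z) :=
    DiffOpTendsto.sum hU _ fun i _ => DiffOpTendsto.sum hU _ fun j _ =>
      DiffOpTendsto.mul_op hU ((h.inv hU i j).neg hU) (h.covE hU 2 _)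
  simp only [neg_mul, Finset.sum_neg_distrib] at h1
  exact h1

end

theorem IsMetric.covE (hU : IsOpen U) (h : IsMetric U G) (l : ℕ) (I : Fin l → Fin n) :
    IsDiffOp U l (fun f => covE G f l I) := ((MetricConv.const h).covE hU l I).lim

theorem IsMetric.lapE (hU : IsOpen U) (h : IsMetric U G) : IsDiffOp U 2 (lapE G) :=
  ((MetricConv.const h).lapE hU).lim

theorem IsMetric.inv_smooth (hU : IsOpen U) (h : IsMetric U G) (i j : Fin n) :
    ContDiffOn ℝ ∞ (fun y => (G y)⁻¹ i j) U := ((MetricConv.const h).inv hU i j).lim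

theorem IsMetric.chris_smooth (hU : IsOpen U) (h : IsMetric U G) (m i j : Fin n) :
    ContDiffOn ℝ ∞ (fun y => chris G m i j y) U := ((MetricConv.const h).chris hU m i j).lim

/-- The leading part of the iterated covariant derivative. -/
theorem IsMetric.covE_eq_pdI_add (hU : IsOpen U) (h : IsMetric U G) :
    ∀ (l : ℕ) (I : Fin (l + 1) → Fin n), ∃ R, IsDiffOp U l R ∧
      ∀ f, ContDiffOn ℝ ∞ f U → ∀ y ∈ U, SmallEnergy.covE G f (l + 1) I y = pdI (l + 1) I f y + R f y
  | 0, I => ⟨_, IsDiffOp.zero, fun f hf y hy => by simp [SmallEnergy.covE, pdI]⟩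
  | l + 1, I => by
      obtain ⟨R, hR, hRe⟩ := h.covE_eq_pdI_add hU l (Fin.tail I)
      have h1 := (IsDiffOp.pd hU (I 0)).comp hU hR
      rw [add_comm] at h1
      refine ⟨_, h1.sub_op hU (IsDiffOp.sum hU Finset.univ fun s _ =>
        IsDiffOp.sum hU Finset.univ fun m _ =>
          (h.covE hU (l + 1) (Function.update (Fin.tail I) s m)).mul_op hU
            (h.chris_smooth hU m (I 0) (I s.succ))), fun f hf y hy => ?_⟩
      rw [covE_succ, pdI, pd_congr_on hU (g := fun z => pdI (l + 1) (Fin.tail I) f z + R f z)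
        (hRe f hf) hy, pd_add (differentiableAt_of_smooth hU (contDiffOn_pdI hU hf _ _) hy)
        (differentiableAt_of_smooth hU (hR.smooth f hf) hy)]
      ring

/-- A covariant derivative of order `l` is the corresponding partial derivative plus an operator of
lower order. The system is triangular and is inverted from the lowest order upwards. -/
theorem IsMetric.jetNorm_le_covE (hU : IsOpen U) (h : IsMetric U G) {L : Set (E n)} (hLU : L ⊆ U)
    (hL : IsCompact L) (m : ℕ) : ∃ C : ℝ, 0 ≤ C ∧ ∀ f, ContDiffOn ℝ ∞ f U → ∀ y ∈ L,
      jetNorm m f y ≤ C * ∑ l ∈ Finset.range m, ∑ I : Fin l → Fin n, |SmallEnergy.covE G f l I y| := by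
  induction m with
  | zero => exact ⟨0, le_rfl, fun f _ y _ => by simp⟩
  | succ m ih =>
    obtain ⟨C, hC0, hC⟩ := ih
    have h1 : ∀ I : Fin m → Fin n, ∃ D : ℝ, 0 ≤ D ∧ ∀ f, ContDiffOn ℝ ∞ f U → ∀ y ∈ L,
        |pdI m I f y| ≤ |SmallEnergy.covE G f m I y| + D * jetNorm m f y := by
      intro I
      cases m with
      | zero => exact ⟨0, le_rfl, fun f _ y _ => by simp [pdI, SmallEnergy.covE]⟩
      | succ m =>
        obtain ⟨R, hR, hRe⟩ := h.covE_eq_pdI_add hU m I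
        obtain ⟨D, hD0, hD⟩ := hR.bound 1 L hLU hL
        refine ⟨D, hD0, fun f hf y hy => ?_⟩
        have h2 := hD f hf y hy
        rw [jetNorm_one, add_comm 1 m] at h2
        have h3 : pdI (m + 1) I f y = SmallEnergy.covE G f (m + 1) I y - R f y := by
          rw [hRe f hf y (hLU hy)]; ring
        rw [h3]
        exact (abs_sub _ _).trans (by linarith)
    choose D hD0 hD using h1
    refine ⟨(1 + ∑ I, D I) * C + 1, by
      have := Finset.sum_nonneg fun I (_ : I ∈ Finset.univ) => hD0 I
      positivity, fun f hf y hy => ?_⟩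
    have hDs := Finset.sum_nonneg fun I (_ : I ∈ Finset.univ) => hD0 I
    set S := ∑ l ∈ Finset.range m, ∑ I : Fin l → Fin n, |SmallEnergy.covE G f l I y| with hS
    have hS0 : 0 ≤ S := Finset.sum_nonneg fun _ _ => Finset.sum_nonneg fun _ _ => abs_nonneg _
    set T := ∑ I : Fin m → Fin n, |SmallEnergy.covE G f m I y| with hT
    have hT0 : 0 ≤ T := Finset.sum_nonneg fun _ _ => abs_nonneg _
    have i1 : jetNorm (m + 1) f y ≤ jetNorm m f y + ∑ I, |pdI m I f y| := by
      unfold jetNorm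
      rw [Finset.sum_range_succ]
      refine add_le_add le_rfl ((norm_multilinear_le _).trans (le_of_eq ?_))
      exact Finset.sum_congr rfl fun I _ => by rw [pdI_eq hU hf m I y (hLU hy)]
    have i2 : ∑ I, |pdI m I f y| ≤ T + (∑ I, D I) * jetNorm m f y := by
      rw [Finset.sum_mul, hT, ← Finset.sum_add_distrib]
      exact Finset.sum_le_sum fun I _ => hD I f hf y hy
    have i3 := hC f hf y hy
    rw [Finset.sum_range_succ]
    calc jetNorm (m + 1) f y ≤ (1 + ∑ I, D I) * jetNorm m f y + T := by linarith
      _ ≤ (1 + ∑ I, D I) * (C * S) + T := by gcongr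
      _ ≤ ((1 + ∑ I, D I) * C + 1) * (S + T) := by
        have : 0 ≤ (1 + ∑ I, D I) * C * T := by positivity
        nlinarith

/-- The iterated covariant derivatives are tensors. -/
theorem IsPullback.covE_eq (h : IsPullback V W φ G H) {F F' : E n → ℝ}
    (hF' : ContDiffOn ℝ ∞ F' W) (hF : ∀ y ∈ V, F y = F' (φ y)) :
    ∀ (l : ℕ) (I : Fin l → Fin n), ∀ y ∈ V, covE G F l I y =
      tev (fun J => covE H F' l J (φ y)) (fun s a => jac φ a (I s) y)
  | 0, I, y, hy => by simp [covE, tev, hF y hy]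
  | l + 1, I, y, hy => by
      have sC : ∀ J, ContDiffOn ℝ ∞ (covE H F' l J) W := fun J =>
        (h.metricH.covE h.openW l J).smooth F' hF'
      have dC : ∀ J, DifferentiableAt ℝ (fun z => covE H F' l J (φ z)) y := fun J =>
        differentiableAt_of_smooth h.openV ((sC J).comp h.smooth h.maps) hy
      have dj : ∀ a i, DifferentiableAt ℝ (jac φ a i) y := fun a i =>
        differentiableAt_of_smooth h.openV (contDiffOn_jac h.openV h.smooth a i) hy
      rw [covE_succ, pd_congr_on h.openV (g := fun z => tev (fun J => covE H F' l J (φ z))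
        (fun s a => jac φ a (Fin.tail I s) z)) (fun z hz => h.covE_eq hF' hF l (Fin.tail I) z hz) hy,
        pd_tev dC (fun s a => dj a _)]
      set v : Fin l → Fin n → ℝ := fun s a => jac φ a (Fin.tail I s) y with hv
      set C : (Fin l → Fin n) → ℝ := fun J => covE H F' l J (φ y) with hC
      have e1 : ∀ s m, covE G F l (Function.update (Fin.tail I) s m) y =
          tev C (Function.update v s (fun a => jac φ a m y)) := by
        intro s m
        rw [h.covE_eq hF' hF l _ y hy]
        congr 1
        funext t a
        by_cases hts : t = s
        · subst hts; simp
        · simp [hv, Function.update_of_ne hts]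
      -- The derivative of the Jacobian splits by the Christoffel law: the first sum is cancelled by
      -- the correction terms of `G`, the second supplies the correction terms of `H`.
      have e2 : ∀ s : Fin l, tev C (Function.update v s
          (fun a => pd (I 0) (jac φ a (Fin.tail I s)) y)) =
          ∑ m, chris G m (I 0) (I s.succ) y * tev C (Function.update v s (fun a => jac φ a m y)) -
          ∑ b, jac φ b (I 0) y * tev C (Function.update v s
            (fun a => ∑ c, chris H a b c (φ y) * v s c)) := by
        intro s
        simp only [h.pd_jac hy]
        rw [tev_update_sub, tev_update_sum, tev_update_sum]
        rfl
      simp only [e1, e2, Finset.sum_sub_distrib]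
      rw [tev_succ]
      have e3 : ∀ b, tev (fun J => covE H F' (l + 1) (Fin.cons b J) (φ y))
          (Fin.tail fun s a => jac φ a (I s) y) =
          tev (fun J => pd b (covE H F' l J) (φ y)) v -
            ∑ s, tev C (Function.update v s (fun a => ∑ c, chris H a b c (φ y) * v s c)) := by
        intro b
        simp only [← sum_update_tev]
        rw [Finset.sum_comm]
        unfold tev
        rw [← Finset.sum_sub_distrib]
        refine Finset.sum_congr rfl fun J _ => ?_
        simp only [covE_succ, Fin.cons_zero, Fin.tail_cons, Fin.cons_succ]
        rw [← Finset.mul_sum, mul_sub]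
        rfl
      simp only [e3, mul_sub, Finset.sum_sub_distrib]
      have e4 : tev (fun J => pd (I 0) (fun z => covE H F' l J (φ z)) y) v =
          ∑ b, jac φ b (I 0) y * tev (fun J => pd b (covE H F' l J) (φ y)) v := by
        simp only [pd_comp h.openV h.openW h.smooth h.maps (sC _) hy]
        unfold tev
        simp only [Finset.mul_sum]
        rw [Finset.sum_comm]
        exact Finset.sum_congr rfl fun b _ => Finset.sum_congr rfl fun J _ => by ring
      have e5 : ∑ s, ∑ b, jac φ b (I 0) y * tev C (Function.update v s
            (fun a => ∑ c, chris H a b c (φ y) * v s c)) =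
          ∑ b, jac φ b (I 0) y * ∑ s, tev C (Function.update v s
            (fun a => ∑ c, chris H a b c (φ y) * v s c)) := by
        rw [Finset.sum_comm]
        simp only [Finset.mul_sum]
      rw [e4, e5]
      ring

end EuclideanGeometry

end SmallEnergy

namespace SmallEnergy

/-! ### Orthonormal frames and norms of tensors. -/

section Frames

variable {n : ℕ} {G F : Matrix (Fin n) (Fin n) ℝ}

/-- The columns of `F` are orthonormal for `G`. -/
def IsFrame (G F : Matrix (Fin n) (Fin n) ℝ) : Prop := F.transpose * G * F = 1

/-- A one-sided inverse of a square matrix is two-sided: S (S G) = 1 turns into S G S = 1. -/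
theorem isFrame_of_sqrt {S : Matrix (Fin n) (Fin n) ℝ} (hG : IsUnit G.det) (hS : S.transpose = S)
    (h : S * S = G⁻¹) : IsFrame G S := by
  have h1 : S * (S * G) = 1 := by
    rw [← Matrix.mul_assoc, h, Matrix.nonsing_inv_mul _ hG]
  have h2 : S * G * S = 1 := by
    have := mul_eq_one_comm.1 h1
    exact this
  rw [IsFrame, hS, h2]

theorem exists_isFrame (hG : G.PosDef) : ∃ F, IsFrame G F := by
  open scoped MatrixOrder Matrix.Norms.L2Operator in
  refine ⟨CFC.sqrt G⁻¹, isFrame_of_sqrt hG.det_pos.ne'.isUnit ?_ ?_⟩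
  · have := (Matrix.nonneg_iff_posSemidef.1 (CFC.sqrt_nonneg G⁻¹)).isHermitian
    ext i j
    simpa [Matrix.conjTranspose_apply] using congrFun (congrFun this i) j
  · exact CFC.sqrt_mul_sqrt_self _ hG.inv.posSemidef.nonneg

theorem IsFrame.isUnit_det (h : IsFrame G F) : IsUnit F.det := by
  have := congrArg Matrix.det h
  rw [Matrix.det_mul, Matrix.det_one] at this
  exact IsUnit.of_mul_eq_one_right _ this

theorem IsFrame.mul_transpose (h : IsFrame G F) : F * F.transpose = G⁻¹ := by
  have h1 : F * (F.transpose * G) = 1 := mul_eq_one_comm.1 h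
  rw [← Matrix.mul_assoc] at h1
  exact (Matrix.inv_eq_left_inv h1).symm

theorem IsFrame.eq_transpose_mul (h : IsFrame G F) : G = (F⁻¹).transpose * F⁻¹ := by
  have hT : IsUnit F.transpose.det := by rw [Matrix.det_transpose]; exact h.isUnit_det
  have h1 : F * F⁻¹ = 1 := Matrix.mul_nonsing_inv _ h.isUnit_det
  have h2 : (F.transpose)⁻¹ * F.transpose = 1 := Matrix.nonsing_inv_mul _ hT
  rw [Matrix.transpose_nonsing_inv]
  calc G = ((F.transpose)⁻¹ * F.transpose) * G * (F * F⁻¹) := by rw [h1, h2]; simp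
    _ = (F.transpose)⁻¹ * (F.transpose * G * F) * F⁻¹ := by simp only [Matrix.mul_assoc]
    _ = _ := by rw [h, Matrix.mul_one]

theorem IsFrame.sum_inv_sq (h : IsFrame G F) : ∑ a, ∑ i, (F⁻¹ a i) ^ 2 = G.trace := by
  have := h.eq_transpose_mul
  conv_rhs => rw [this]
  simp only [Matrix.trace, Matrix.diag, Matrix.mul_apply, Matrix.transpose_apply]
  rw [Finset.sum_comm]
  simp [sq]

theorem IsFrame.sum_sq (h : IsFrame G F) : ∑ i, ∑ a, (F i a) ^ 2 = G⁻¹.trace := by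
  rw [← h.mul_transpose]
  simp only [Matrix.trace, Matrix.diag, Matrix.mul_apply, Matrix.transpose_apply]
  simp [sq]

/-- The crude bound |x| ≤ 1 + x² avoids square roots. -/
theorem abs_le_one_add_of_sum_sq {M : Matrix (Fin n) (Fin n) ℝ} {t : ℝ}
    (h : ∑ i, ∑ a, (M i a) ^ 2 = t) (i a : Fin n) : |M i a| ≤ 1 + t := by
  have h1 : (M i a) ^ 2 ≤ t := by
    rw [← h]
    refine le_trans ?_ (Finset.single_le_sum (f := fun i => ∑ a, (M i a) ^ 2)
      (fun _ _ => Finset.sum_nonneg fun _ _ => sq_nonneg _) (Finset.mem_univ i))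
    exact Finset.single_le_sum (f := fun a => (M i a) ^ 2) (fun _ _ => sq_nonneg _)
      (Finset.mem_univ a)
  have h2 := sq_abs (M i a)
  nlinarith [sq_nonneg (|M i a| - 1), abs_nonneg (M i a)]

theorem abs_tev_le {l : ℕ} (C : (Fin l → Fin n) → ℝ) {v : Fin l → Fin n → ℝ} {t : ℝ}
    (hv : ∀ s a, |v s a| ≤ t) : |tev C v| ≤ t ^ l * ∑ J, |C J| := by
  unfold tev
  refine (Finset.abs_sum_le_sum_abs _ _).trans ?_
  rw [Finset.mul_sum]
  refine Finset.sum_le_sum fun J _ => ?_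
  rw [abs_mul, Finset.abs_prod]
  refine mul_le_mul_of_nonneg_right ?_ (abs_nonneg _)
  calc ∏ s, |v s (J s)| ≤ ∏ _s : Fin l, t :=
        Finset.prod_le_prod (fun _ _ => abs_nonneg _) fun s _ => hv s _
    _ = t ^ l := by simp

theorem tev_tev {l : ℕ} (C : (Fin l → Fin n) → ℝ) (F : Matrix (Fin n) (Fin n) ℝ)
    (v : Fin l → Fin n → ℝ) :
    tev (fun a => tev C (fun s j => F j (a s))) v = tev C (fun s j => ∑ a, F j a * v s a) := by
  unfold tev
  simp only [Finset.mul_sum]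
  rw [Finset.sum_comm]
  refine Finset.sum_congr rfl fun J _ => ?_
  rw [Finset.prod_univ_sum, Fintype.piFinset_univ, Finset.sum_mul]
  refine Finset.sum_congr rfl fun a _ => ?_
  rw [Finset.prod_mul_distrib]
  ring

theorem tev_single {l : ℕ} (C : (Fin l → Fin n) → ℝ) (J : Fin l → Fin n) :
    tev C (fun s j => (1 : Matrix (Fin n) (Fin n) ℝ) j (J s)) = C J := by
  unfold tev
  rw [Finset.sum_eq_single J]
  · simp
  · intro K _ hK
    obtain ⟨s, hs⟩ := Function.ne_iff.1 hK
    rw [Finset.prod_eq_zero (Finset.mem_univ s) (by simp [Matrix.one_apply, hs]), zero_mul]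
  · simp

/-- The components of a tensor in a frame control the tensor. -/
theorem IsFrame.abs_le (h : IsFrame G F) {l : ℕ} (C : (Fin l → Fin n) → ℝ) (J : Fin l → Fin n) :
    |C J| ≤ (1 + G.trace) ^ l * ∑ a : Fin l → Fin n, |tev C (fun s j => F j (a s))| := by
  have e : C J = tev (fun a => tev C (fun s j => F j (a s))) (fun s a => F⁻¹ a (J s)) := by
    rw [tev_tev, ← tev_single C J]
    congr 1
    funext s j
    rw [← Matrix.mul_nonsing_inv _ h.isUnit_det, Matrix.mul_apply]
  rw [e]
  exact abs_tev_le _ fun s a => abs_le_one_add_of_sum_sq h.sum_inv_sq a (J s)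

theorem IsFrame.abs_tev_le (h : IsFrame G F) {l : ℕ} (C : (Fin l → Fin n) → ℝ)
    (a : Fin l → Fin n) :
    |tev C (fun s j => F j (a s))| ≤ (1 + G⁻¹.trace) ^ l * ∑ J, |C J| :=
  SmallEnergy.abs_tev_le _ fun s j => abs_le_one_add_of_sum_sq h.sum_sq j (a s)

theorem IsFrame.quad_eq (hF : IsFrame G F) (p : Fin n → ℝ) :
    ∑ i, ∑ j, G⁻¹ i j * (p i * p j) = ∑ a, (∑ i, F i a * p i) ^ 2 := by
  rw [← hF.mul_transpose]
  have e : ∀ a, (∑ i, F i a * p i) ^ 2 = ∑ i, ∑ j, (F i a * p i) * (F j a * p j) := fun a => by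
    rw [sq]; exact Finset.sum_mul_sum _ _ _ _
  simp only [e, Matrix.mul_apply, Matrix.transpose_apply, Finset.sum_mul]
  rw [← sum_rotate]
  exact Finset.sum_congr rfl fun a _ => Finset.sum_congr rfl fun i _ =>
    Finset.sum_congr rfl fun j _ => by ring

/-- `∑ p² ≤ tr G ⬝ |p|²_G` for covectors. -/
theorem sum_sq_le_of_posDef (hG : G.PosDef) (p : Fin n → ℝ) :
    ∑ i, (p i) ^ 2 ≤ G.trace * ∑ i, ∑ j, G⁻¹ i j * (p i * p j) := by
  obtain ⟨F, hF⟩ := exists_isFrame hG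
  set q : Fin n → ℝ := fun a => ∑ i, F i a * p i with hq
  have h1 : ∑ i, ∑ j, G⁻¹ i j * (p i * p j) = ∑ a, (q a) ^ 2 := hF.quad_eq p
  have h2 : ∀ i, p i = ∑ a, F⁻¹ a i * q a := by
    intro i
    have e := Matrix.mul_nonsing_inv _ hF.isUnit_det
    have : ∑ a, F⁻¹ a i * q a = ∑ j, (F * F⁻¹) j i * p j := by
      simp only [hq, Finset.mul_sum, Matrix.mul_apply, Finset.sum_mul]
      rw [Finset.sum_comm]
      exact Finset.sum_congr rfl fun a _ => Finset.sum_congr rfl fun i _ => by ring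
    rw [this, e]
    simp [Matrix.one_apply]
  rw [h1, ← hF.sum_inv_sq, Finset.sum_comm, Finset.sum_mul]
  refine Finset.sum_le_sum fun i _ => ?_
  conv_lhs => rw [h2 i]
  exact Finset.sum_mul_sq_le_sq_mul_sq _ _ _

/-- `∑ H_{ij}² ≤ (tr G)² |H|²_G` for 2-tensors. -/
theorem sum_sq_le_of_posDef_two (hG : G.PosDef) (M : Fin n → Fin n → ℝ) :
    0 ≤ ∑ i, ∑ j, ∑ m, ∑ l, G⁻¹ i j * G⁻¹ m l * (M i m * M j l) ∧ ∑ i, ∑ j, (M i j) ^ 2 ≤ G.trace ^ 2 *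
      ∑ i, ∑ j, ∑ m, ∑ l, G⁻¹ i j * G⁻¹ m l * (M i m * M j l) := by
  have ht : 0 ≤ G.trace := by
    obtain ⟨F, hF⟩ := exists_isFrame hG
    rw [← hF.sum_inv_sq]
    positivity
  -- contract one index at a time
  obtain ⟨F, hF⟩ := exists_isFrame hG
  set Q : Fin n → Fin n → ℝ := fun a m => ∑ i, F i a * M i m with hQ
  have h1 : ∀ m, ∑ i, (M i m) ^ 2 ≤ G.trace * ∑ a, (Q a m) ^ 2 := by
    intro m
    refine (sum_sq_le_of_posDef hG (fun i => M i m)).trans (le_of_eq ?_)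
    congr 1
    exact hF.quad_eq fun i => M i m
  have h2 : ∀ a, ∑ m, (Q a m) ^ 2 ≤ G.trace * ∑ m, ∑ l, G⁻¹ m l * (Q a m * Q a l) := fun a =>
    sum_sq_le_of_posDef hG (Q a)
  have h3 : ∑ a, ∑ m, ∑ l, G⁻¹ m l * (Q a m * Q a l) =
      ∑ i, ∑ j, ∑ m, ∑ l, G⁻¹ i j * G⁻¹ m l * (M i m * M j l) := by
    have e : ∀ i j, G⁻¹ i j = ∑ a, F i a * F j a := fun i j => by
      rw [← hF.mul_transpose]; rfl
    have e2 : ∀ i j m l, G⁻¹ i j * G⁻¹ m l * (M i m * M j l) =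
        ∑ a, G⁻¹ m l * ((F i a * M i m) * (F j a * M j l)) := fun i j m l => by
      rw [e i j, Finset.sum_mul, Finset.sum_mul]
      exact Finset.sum_congr rfl fun a _ => by ring
    have e3 : ∀ a m l, Q a m * Q a l = ∑ i, ∑ j, F i a * M i m * (F j a * M j l) :=
      fun a m l => Finset.sum_mul_sum _ _ _ _
    simp only [e2, e3, Finset.mul_sum]
    -- move the sums over `a`, `m`, `l`
    calc ∑ a, ∑ m, ∑ l, ∑ i, ∑ j, G⁻¹ m l * (F i a * M i m * (F j a * M j l))
        = ∑ a, ∑ i, ∑ j, ∑ m, ∑ l, G⁻¹ m l * (F i a * M i m * (F j a * M j l)) := by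
          refine Finset.sum_congr rfl fun a _ => ?_
          simp only [← Fintype.sum_prod_type']
          refine Fintype.sum_equiv (((Equiv.prodAssoc _ _ _).symm.trans
            (Equiv.prodComm _ _)).trans (Equiv.prodAssoc _ _ _)) _ _ fun q => rfl
      _ = _ := by
          simp only [← Fintype.sum_prod_type']
          refine Fintype.sum_equiv ((Equiv.prodComm _ _).trans
            ((Equiv.prodAssoc _ _ _).trans (Equiv.prodCongr (Equiv.refl _)
              ((Equiv.prodAssoc _ _ _).trans (Equiv.prodCongr (Equiv.refl _)
                (Equiv.prodAssoc _ _ _)))))) _ _ fun q => rfl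
  refine ⟨?_, ?_⟩
  · rw [← h3]
    refine Finset.sum_nonneg fun a _ => ?_
    rw [hF.quad_eq]
    positivity
  calc ∑ i, ∑ j, (M i j) ^ 2 = ∑ m, ∑ i, (M i m) ^ 2 := Finset.sum_comm
    _ ≤ ∑ m, G.trace * ∑ a, (Q a m) ^ 2 := Finset.sum_le_sum fun m _ => h1 m
    _ = G.trace * ∑ a, ∑ m, (Q a m) ^ 2 := by rw [← Finset.mul_sum, Finset.sum_comm]
    _ ≤ G.trace * ∑ a, G.trace * ∑ m, ∑ l, G⁻¹ m l * (Q a m * Q a l) :=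
        mul_le_mul_of_nonneg_left (Finset.sum_le_sum fun a _ => h2 a) ht
    _ = _ := by rw [← Finset.mul_sum, h3]; ring

end Frames

end SmallEnergy

namespace SmallEnergy

/-! ### Compactly supported functions and elliptic estimates. -/

section CompactSupport

variable {n : ℕ} {U L : Set (E n)} {G : E n → Matrix (Fin n) (Fin n) ℝ} {v : E n → ℝ}

/-- Smooth functions supported in `L`. -/
structure IsBumpOn (L : Set (E n)) (v : E n → ℝ) : Prop where
  smooth : ContDiff ℝ ∞ v
  supp : tsupport v ⊆ L

theorem IsBumpOn.hasCompactSupport (hL : IsCompact L) (h : IsBumpOn L v) : HasCompactSupport v :=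
  hL.of_isClosed_subset (isClosed_tsupport v) h.supp

theorem jetNorm_eq_zero_of_notMem {f : E n → ℝ} {y : E n} (hy : y ∉ tsupport f) (m : ℕ) :
    jetNorm m f y = 0 := by
  rw [jetNorm_congr (g := fun _ => (0 : ℝ)) (notMem_tsupport_iff_eventuallyEq.1 hy)]
  simp

theorem contDiff_of_tsupport {w : E n → ℝ} (hU : IsOpen U) (hw : ContDiffOn ℝ ∞ w U)
    (hs : tsupport w ⊆ U) : ContDiff ℝ ∞ w := by
  rw [contDiff_iff_contDiffAt]
  intro y
  by_cases hy : y ∈ U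
  · exact hw.contDiffAt (hU.mem_nhds hy)
  · have : w =ᶠ[𝓝 y] fun _ => 0 := notMem_tsupport_iff_eventuallyEq.1 fun h => hy (hs h)
    exact contDiffAt_const.congr_of_eventuallyEq this

theorem tsupport_subset_of_eventually_zero {w v : E n → ℝ}
    (h : ∀ y, v =ᶠ[𝓝 y] (fun _ => 0) → w y = 0) : tsupport w ⊆ tsupport v := by
  refine closure_minimal (fun y hy => ?_) (isClosed_tsupport v)
  by_contra hv
  exact hy (h y (notMem_tsupport_iff_eventuallyEq.1 hv))

/-- Operators are controlled only on `U`. A local one still sends bumps to globally smooth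
functions, because its value vanishes wherever the germ of `v` does and the support stays inside `L
⊆ U`. -/
theorem IsBumpOn.of_local (hU : IsOpen U) (hLU : L ⊆ U) (h : IsBumpOn L v) {w : E n → ℝ}
    (hw : ContDiffOn ℝ ∞ w U) (h0 : ∀ y, v =ᶠ[𝓝 y] (fun _ => 0) → w y = 0) : IsBumpOn L w := by
  have hs := (tsupport_subset_of_eventually_zero h0).trans h.supp
  exact ⟨contDiff_of_tsupport hU hw (hs.trans hLU), hs⟩

theorem pd_eq_zero_of_eventually {y : E n} (h : v =ᶠ[𝓝 y] fun _ => 0) (a : Fin n) :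
    pd a v y = 0 := by
  rw [pd_congr h]; simp [pd]

theorem pd_eventually_zero {y : E n} (h : v =ᶠ[𝓝 y] fun _ => 0) (a : Fin n) :
    pd a v =ᶠ[𝓝 y] fun _ => 0 := by
  filter_upwards [h.eventuallyEq_nhds] with z hz using pd_eq_zero_of_eventually hz a

theorem IsBumpOn.pd (h : IsBumpOn L v) (a : Fin n) : IsBumpOn L (pd a v) := by
  refine ⟨?_, ?_⟩
  · have := contDiffOn_pd isOpen_univ h.smooth.contDiffOn a
    exact contDiffOn_univ.1 this
  · exact (tsupport_subset_of_eventually_zero fun y hy => pd_eq_zero_of_eventually hy a).trans h.supp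

theorem IsBumpOn.mul_left (hU : IsOpen U) (hLU : L ⊆ U) (h : IsBumpOn L v) {c : E n → ℝ}
    (hc : ContDiffOn ℝ ∞ c U) : IsBumpOn L (fun y => c y * v y) :=
  h.of_local hU hLU (hc.mul h.smooth.contDiffOn) fun y hy => by simp [hy.self_of_nhds]

theorem lapE_eq_zero_of_eventually {y : E n} (h : v =ᶠ[𝓝 y] fun _ => 0) : lapE G v y = 0 := by
  unfold lapE
  have h1 : ∀ i j, covE G v 2 ![i, j] y = 0 := fun i j => by
    rw [covE_two, pd_eq_zero_of_eventually (pd_eventually_zero h j)]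
    simp [pd_eq_zero_of_eventually h]
  simp [h1]

theorem IsBumpOn.lapE (hU : IsOpen U) (hG : IsMetric U G) (hLU : L ⊆ U) (h : IsBumpOn L v) :
    IsBumpOn L (lapE G v) :=
  h.of_local hU hLU ((hG.lapE hU).smooth v h.smooth.contDiffOn) fun _ hy =>
    lapE_eq_zero_of_eventually hy

theorem IsBumpOn.continuous_jetNorm (h : IsBumpOn L v) (m : ℕ) : Continuous (jetNorm m v) := by
  rw [← continuousOn_univ]
  exact continuousOn_jetNorm isOpen_univ h.smooth.contDiffOn m

theorem IsBumpOn.jetNorm_eq_zero (h : IsBumpOn L v) {y : E n} (hy : y ∉ L) (m : ℕ) :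
    jetNorm m v y = 0 :=
  jetNorm_eq_zero_of_notMem (fun hy' => hy (h.supp hy')) m

theorem IsBumpOn.integrable_jetNorm_sq (hL : IsCompact L) (h : IsBumpOn L v) (m : ℕ) :
    Integrable (fun y => (jetNorm m v y) ^ 2) :=
  ((h.continuous_jetNorm m).pow 2).integrable_of_hasCompactSupport
    (HasCompactSupport.intro hL fun y hy => by simp [h.jetNorm_eq_zero hy])

theorem integral_pd_eq_zero (hL : IsCompact L) (h : IsBumpOn L v) (a : Fin n) :
    ∫ y, pd a v y = 0 := by
  have h1 := (h.pd a).smooth.continuous.integrable_of_hasCompactSupport (μ := volume)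
    ((h.pd a).hasCompactSupport hL)
  have h2 := h.smooth.continuous.integrable_of_hasCompactSupport (μ := volume)
    (h.hasCompactSupport hL)
  have := integral_mul_fderiv_eq_neg_fderiv_mul_of_integrable (μ := volume) (f := fun _ : E n => (1 : ℝ))
    (g := v) (v := EuclideanSpace.single a (1 : ℝ)) (by simp) (by simp only [one_mul]; exact h1)
    (by simpa using h2) (fun x _ => differentiableAt_const _)
    (fun x _ => h.smooth.differentiable (by simp) x)
  simpa [pd] using this

/-- The squared Sobolev norm `∫ (∑_{j < m} |D^j v|)²`. -/
noncomputable def sobSq (m : ℕ) (v : E n → ℝ) : ℝ := ∫ y, (jetNorm m v y) ^ 2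

theorem sobSq_nonneg (m : ℕ) (v : E n → ℝ) : 0 ≤ sobSq m v := integral_nonneg fun _ => sq_nonneg _

theorem sobSq_mono (hL : IsCompact L) (h : IsBumpOn L v) {m m' : ℕ} (hm : m ≤ m') :
    sobSq m v ≤ sobSq m' v :=
  integral_mono (h.integrable_jetNorm_sq hL m) (h.integrable_jetNorm_sq hL m') fun y =>
    pow_le_pow_left₀ (jetNorm_nonneg _ _ _) (jetNorm_mono hm _ _) 2

/-- The square of `Δ^{k/2}`. -/
noncomputable def lapHalfE (G : E n → Matrix (Fin n) (Fin n) ℝ) (k : ℕ) (v : E n → ℝ) (y : E n) : ℝ :=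
  if Even k then ((lapE G)^[k / 2] v y) ^ 2
  else ∑ i, ∑ j, (G y)⁻¹ i j * (pd i ((lapE G)^[k / 2] v) y * pd j ((lapE G)^[k / 2] v) y)

theorem lapHalfE_add_two (k : ℕ) (v : E n → ℝ) (y : E n) :
    lapHalfE G (k + 2) v y = lapHalfE G k (lapE G v) y := by
  unfold lapHalfE
  have h1 : Even (k + 2) ↔ Even k := by simp [Nat.even_add]
  have h2 : (k + 2) / 2 = k / 2 + 1 := by lia
  simp only [h1, h2, Function.iterate_succ_apply]

theorem exists_bound_abs (hU : IsOpen U) {c : E n → ℝ} (hc : ContDiffOn ℝ ∞ c U) (hLU : L ⊆ U)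
    (hL : IsCompact L) : ∃ C : ℝ, 0 ≤ C ∧ ∀ y ∈ L, |c y| ≤ C := by
  obtain ⟨C, hC0, hC⟩ := exists_jetNorm_le hU hc hLU hL 1
  exact ⟨C, hC0, fun y hy => by rw [← jetNorm_one]; exact hC y hy⟩

theorem IsMetric.trace_smooth (h : IsMetric U G) : ContDiffOn ℝ ∞ (fun y => (G y).trace) U :=
  ContDiffOn.sum fun i _ => h.smooth i i

theorem jetNorm_three_le (hU : IsOpen U) {f : E n → ℝ} (hf : ContDiffOn ℝ ∞ f U) {y : E n}
    (hy : y ∈ U) : jetNorm 3 f y ≤ jetNorm 2 f y + ∑ i, ∑ j, |pd i (pd j f) y| := by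
  have h1 : jetNorm 3 f y = jetNorm 2 f y + ‖iteratedFDeriv ℝ 2 f y‖ := by
    simp [jetNorm, Finset.sum_range_succ]
  rw [h1]
  refine add_le_add le_rfl ((norm_multilinear_le _).trans (le_of_eq ?_))
  rw [← Fintype.sum_prod_type']
  refine Fintype.sum_equiv (finTwoArrowEquiv _) _ _ fun I => ?_
  rw [← pdI_eq hU hf 2 I y hy]
  rfl

theorem abs_pd_le (hU : IsOpen U) {f : E n → ℝ} (hf : ContDiffOn ℝ ∞ f U) {y : E n}
    (hy : y ∈ U) (i : Fin n) {m : ℕ} (hm : 2 ≤ m) : |pd i f y| ≤ jetNorm m f y := by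
  have := jetNorm_pd_le hU hf hy 1 i
  rw [jetNorm_one] at this
  exact this.trans (jetNorm_mono hm _ _)

theorem abs_pd_pd_le (hU : IsOpen U) {f : E n → ℝ} (hf : ContDiffOn ℝ ∞ f U) {y : E n}
    (hy : y ∈ U) (i j : Fin n) : |pd i (pd j f) y| ≤ jetNorm 3 f y :=
  (abs_pd_le hU (contDiffOn_pd hU hf j) hy i le_rfl).trans (jetNorm_pd_le hU hf hy 2 j)

/-- The basic second order elliptic estimate. -/
theorem elliptic_two (hU : IsOpen U) (hG : IsMetric U G) (hLU : L ⊆ U) (hL : IsCompact L) :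
    ∃ C : ℝ, 0 ≤ C ∧ ∀ v, IsBumpOn L v →
      sobSq 3 v ≤ C * (sobSq 1 (lapE G v) + sobSq 2 v) := by
  obtain ⟨τ, hτ0, hτ⟩ := exists_bound_abs hU hG.trace_smooth hLU hL
  -- coefficients
  set c : Fin n → Fin n → Fin n → Fin n → E n → ℝ := fun i j m l y => (G y)⁻¹ i j * (G y)⁻¹ m l with hc
  have sc : ∀ i j m l, ContDiffOn ℝ ∞ (c i j m l) U := fun i j m l =>
    (hG.inv_smooth hU i j).mul (hG.inv_smooth hU m l)
  have hB : ∃ B : ℝ, 0 ≤ B ∧ ∀ i j m l a, ∀ y ∈ L, |pd a (c i j m l) y| ≤ B := by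
    choose B hB0 hB using fun q : Fin n × Fin n × Fin n × Fin n × Fin n =>
      exists_bound_abs hU (contDiffOn_pd hU (sc q.1 q.2.1 q.2.2.1 q.2.2.2.1) q.2.2.2.2) hLU hL
    refine ⟨∑ q, B q, Finset.sum_nonneg fun q _ => hB0 q, fun i j m l a y hy => ?_⟩
    exact (hB (i, j, m, l, a) y hy).trans
      (Finset.single_le_sum (f := B) (fun q _ => hB0 q) (Finset.mem_univ _))
  obtain ⟨B, hB0, hB⟩ := hB
  -- The Laplacian is -G^{ij} ∂_i ∂_j up to an operator of order one.
  have hD : ∃ D : ℝ, 0 ≤ D ∧ ∀ f, ContDiffOn ℝ ∞ f U → ∀ y ∈ L,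
      |lapE G f y + ∑ i, ∑ j, (G y)⁻¹ i j * pd i (pd j f) y| ≤ D * jetNorm 2 f y := by
    have op : IsDiffOp U 1 (fun f y => ∑ i, ∑ j, (G y)⁻¹ i j * ∑ m, chris G m i j y * pd m f y) :=
      IsDiffOp.sum hU _ fun i _ => IsDiffOp.sum hU _ fun j _ => IsDiffOp.mul_op hU
        (hG.inv_smooth hU i j) (IsDiffOp.sum hU _ fun m _ => IsDiffOp.mul_op hU
          (hG.chris_smooth hU m i j) (IsDiffOp.pd hU m))
    obtain ⟨D, hD0, hD⟩ := op.bound 1 L hLU hL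
    refine ⟨D, hD0, fun f hf y hy => ?_⟩
    have := hD f hf y hy
    rw [jetNorm_one] at this
    convert this using 2
    unfold lapE
    simp only [covE_two, mul_sub, Finset.sum_sub_distrib]
    ring
  obtain ⟨D, hD0, hD⟩ := hD
  set M : ℝ := ∑ _i : Fin n, ∑ _j : Fin n, ∑ _m : Fin n, ∑ _l : Fin n, (2 * B) with hM
  have hM0 : 0 ≤ M := by positivity
  -- `n ^ 2` comes from Cauchy-Schwarz over the second derivatives, `τ ^ 2` from removing the metric
  -- in two indices, and 2 from (a + b)² ≤ 2a² + 2b².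
  set A : ℝ := 2 * (n : ℝ) ^ 2 * τ ^ 2 with hA
  have hA0 : 0 ≤ A := by positivity
  refine ⟨4 * A + (4 + 4 * A * D ^ 2 + A ^ 2 * M ^ 2), by positivity, fun v hv => ?_⟩
  -- The identity behind the estimate: in ∂_m h1 - ∂_j h2 the third derivatives of `v` cancel. What
  -- remains is |∂²v|²_G minus the square of the trace of ∂²v, plus terms in which a coefficient is
  -- differentiated. The divergence integrates to zero, so the trace controls the full Hessian.
  set h1 : Fin n → Fin n → Fin n → Fin n → E n → ℝ := fun i j m l y =>
    c i j m l y * (pd j (pd l v) y * pd i v y) with hh1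
  set h2 : Fin n → Fin n → Fin n → Fin n → E n → ℝ := fun i j m l y =>
    c i j m l y * (pd m (pd l v) y * pd i v y) with hh2
  have vs := hv.smooth.contDiffOn (s := U)
  have bb : ∀ j l i : Fin n, IsBumpOn L (fun y => pd j (pd l v) y * pd i v y) := fun j l i =>
    ((hv.pd i).mul_left hU hLU (contDiffOn_pd hU (contDiffOn_pd hU vs l) j))
  have b1 : ∀ i j m l, IsBumpOn L (h1 i j m l) := fun i j m l =>
    (bb j l i).mul_left hU hLU (sc i j m l)
  have b2 : ∀ i j m l, IsBumpOn L (h2 i j m l) := fun i j m l =>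
    (bb m l i).mul_left hU hLU (sc i j m l)
  set div : E n → ℝ := fun y => ∑ i, ∑ j, ∑ m, ∑ l, (pd m (h1 i j m l) y - pd j (h2 i j m l) y) with hdiv
  have int_pd : ∀ {w : E n → ℝ}, IsBumpOn L w → ∀ a, Integrable (pd a w) := fun {w} hw a =>
    (hw.pd a).smooth.continuous.integrable_of_hasCompactSupport ((hw.pd a).hasCompactSupport hL)
  have idiv : Integrable div := by
    refine integrable_finsetSum _ fun i _ => integrable_finsetSum _ fun j _ =>
      integrable_finsetSum _ fun m _ => integrable_finsetSum _ fun l _ => ?_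
    exact (int_pd (b1 i j m l) m).sub (int_pd (b2 i j m l) j)
  have zdiv : ∫ y, div y = 0 := by
    have i0 : ∀ i j m l, Integrable (fun y => pd m (h1 i j m l) y - pd j (h2 i j m l) y) :=
      fun i j m l => (int_pd (b1 i j m l) m).sub (int_pd (b2 i j m l) j)
    rw [integral_finsetSum _ fun i _ => integrable_finsetSum _ fun j _ =>
      integrable_finsetSum _ fun m _ => integrable_finsetSum _ fun l _ => i0 i j m l]
    refine Finset.sum_eq_zero fun i _ => ?_
    rw [integral_finsetSum _ fun j _ =>
      integrable_finsetSum _ fun m _ => integrable_finsetSum _ fun l _ => i0 i j m l]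
    refine Finset.sum_eq_zero fun j _ => ?_
    rw [integral_finsetSum _ fun m _ => integrable_finsetSum _ fun l _ => i0 i j m l]
    refine Finset.sum_eq_zero fun m _ => ?_
    rw [integral_finsetSum _ fun l _ => i0 i j m l]
    refine Finset.sum_eq_zero fun l _ => ?_
    rw [integral_sub (int_pd (b1 i j m l) m) (int_pd (b2 i j m l) j),
      integral_pd_eq_zero hL (b1 i j m l), integral_pd_eq_zero hL (b2 i j m l), sub_zero]
  have key : ∀ y, (jetNorm 3 v y) ^ 2 ≤ 4 * A * (jetNorm 1 (lapE G v) y) ^ 2 +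
      (4 + 4 * A * D ^ 2 + A ^ 2 * M ^ 2) * (jetNorm 2 v y) ^ 2 + 2 * A * div y := by
    intro y
    by_cases hy : y ∈ L
    swap
    · have z : div y = 0 := by
        refine Finset.sum_eq_zero fun i _ => Finset.sum_eq_zero fun j _ =>
          Finset.sum_eq_zero fun m _ => Finset.sum_eq_zero fun l _ => ?_
        have e := fun {w : E n → ℝ} (hw : IsBumpOn L w) (a : Fin n) =>
          pd_eq_zero_of_eventually (notMem_tsupport_iff_eventuallyEq.1
            (fun h => hy (hw.supp h))) a
        rw [e (b1 i j m l), e (b2 i j m l), sub_zero]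
      rw [z, hv.jetNorm_eq_zero hy, mul_zero, add_zero, zero_pow two_ne_zero]
      positivity
    have hyU := hLU hy
    have comm : ∀ i j, pd i (pd j v) y = pd j (pd i v) y := fun i j => pd_pd_comm hU vs hyU i j
    set Vm : Fin n → Fin n → ℝ := fun i j => pd j (pd i v) y with hV
    set X := ∑ i, ∑ j, ∑ m, ∑ l, (G y)⁻¹ i j * (G y)⁻¹ m l * (Vm i m * Vm j l) with hX
    set Z := ∑ i, ∑ j, (G y)⁻¹ i j * pd i (pd j v) y with hZ
    set R := ∑ i, ∑ j, ∑ m, ∑ l, (pd m (c i j m l) y * (pd j (pd l v) y * pd i v y) -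
      pd j (c i j m l) y * (pd m (pd l v) y * pd i v y)) with hR
    have eX : X = Z ^ 2 + div y - R := by
      have eZ : Z ^ 2 = ∑ i, ∑ j, ∑ m, ∑ l, (G y)⁻¹ i j * (G y)⁻¹ m l * (Vm i j * Vm m l) := by
        rw [sq, hZ, Finset.sum_mul]
        refine Finset.sum_congr rfl fun i _ => ?_
        rw [Finset.sum_mul]
        refine Finset.sum_congr rfl fun j _ => ?_
        rw [Finset.mul_sum]
        refine Finset.sum_congr rfl fun m _ => ?_
        rw [Finset.mul_sum]
        refine Finset.sum_congr rfl fun l _ => ?_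
        rw [comm i j, comm m l]
        ring
      rw [eZ, hX, hR, hdiv]
      simp only [← Finset.sum_add_distrib, ← Finset.sum_sub_distrib]
      refine Finset.sum_congr rfl fun i _ => Finset.sum_congr rfl fun j _ =>
        Finset.sum_congr rfl fun m _ => Finset.sum_congr rfl fun l _ => ?_
      have dd := fun {w : E n → ℝ} (hw : ContDiffOn ℝ ∞ w U) => differentiableAt_of_smooth hU hw hyU
      have s2 := fun a b => contDiffOn_pd hU (contDiffOn_pd hU vs b) a
      rw [hh1, hh2]
      simp only
      rw [pd_mul (dd (sc i j m l)) (dd ((s2 j l).mul (contDiffOn_pd hU vs i))),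
        pd_mul (dd (sc i j m l)) (dd ((s2 m l).mul (contDiffOn_pd hU vs i))),
        pd_mul (dd (s2 j l)) (dd (contDiffOn_pd hU vs i)),
        pd_mul (dd (s2 m l)) (dd (contDiffOn_pd hU vs i)),
        pd_pd_comm hU (contDiffOn_pd hU vs l) hyU m j]
      simp only [hV, hc, comm l j, comm l m]
      ring
    have n2 := jetNorm_nonneg 2 v y
    have n3 := jetNorm_nonneg 3 v y
    have hRb : |R| ≤ M * (jetNorm 2 v y * jetNorm 3 v y) := by
      rw [hR, hM]
      simp only [Finset.sum_mul]
      refine (Finset.abs_sum_le_sum_abs _ _).trans (Finset.sum_le_sum fun i _ => ?_)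
      refine (Finset.abs_sum_le_sum_abs _ _).trans (Finset.sum_le_sum fun j _ => ?_)
      refine (Finset.abs_sum_le_sum_abs _ _).trans (Finset.sum_le_sum fun m _ => ?_)
      refine (Finset.abs_sum_le_sum_abs _ _).trans (Finset.sum_le_sum fun l _ => ?_)
      have t : ∀ a b, |pd a (pd b v) y * pd i v y| ≤ jetNorm 2 v y * jetNorm 3 v y := by
        intro a b
        rw [abs_mul, mul_comm]
        exact mul_le_mul (abs_pd_le hU vs hyU i le_rfl) (abs_pd_pd_le hU vs hyU a b)
          (abs_nonneg _) n2
      have u : ∀ a b d, |pd d (c i j m l) y * (pd a (pd b v) y * pd i v y)| ≤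
          B * (jetNorm 2 v y * jetNorm 3 v y) := by
        intro a b d
        rw [abs_mul]
        exact mul_le_mul (hB i j m l d y hy) (t a b) (abs_nonneg _) hB0
      refine (abs_sub _ _).trans ?_
      linarith [u j l m, u m l j]
    have hZb : |Z| ≤ |lapE G v y| + D * jetNorm 2 v y := by
      have := hD v vs y hy
      calc |Z| = |(lapE G v y + Z) - lapE G v y| := by ring_nf
        _ ≤ |lapE G v y + Z| + |lapE G v y| := abs_sub _ _
        _ ≤ _ := by linarith
    have hZ2 : Z ^ 2 ≤ 2 * (lapE G v y) ^ 2 + 2 * D ^ 2 * (jetNorm 2 v y) ^ 2 := by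
      have h3 : Z ^ 2 ≤ (|lapE G v y| + D * jetNorm 2 v y) ^ 2 := by
        rw [← sq_abs Z]
        exact pow_le_pow_left₀ (abs_nonneg _) hZb 2
      have := sq_abs (lapE G v y)
      nlinarith [sq_nonneg (|lapE G v y| - D * jetNorm 2 v y)]
    have hVX : ∑ i, ∑ m, (Vm i m) ^ 2 ≤ τ ^ 2 * X := by
      have h3 := sum_sq_le_of_posDef_two (hG.posDef y hyU) Vm
      have h4 : (G y).trace ^ 2 ≤ τ ^ 2 := by
        rw [← sq_abs]; exact pow_le_pow_left₀ (abs_nonneg _) (hτ y hy) 2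
      exact h3.2.trans (mul_le_mul_of_nonneg_right h4 h3.1)
    have hS : (∑ i, ∑ j, |pd i (pd j v) y|) ^ 2 ≤ (n : ℝ) ^ 2 * ∑ i, ∑ m, (Vm i m) ^ 2 := by
      have h3 : ∑ i, ∑ j, |pd i (pd j v) y| = ∑ q : Fin n × Fin n, |Vm q.1 q.2| := by
        rw [Fintype.sum_prod_type]
        exact Finset.sum_congr rfl fun i _ => Finset.sum_congr rfl fun j _ => by rw [comm]
      have h4 : ∑ i, ∑ m, (Vm i m) ^ 2 = ∑ q : Fin n × Fin n, |Vm q.1 q.2| ^ 2 := by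
        rw [Fintype.sum_prod_type]
        exact Finset.sum_congr rfl fun i _ => Finset.sum_congr rfl fun j _ => (sq_abs _).symm
      rw [h3, h4]
      have := sq_sum_le_card_mul_sum_sq (s := (Finset.univ : Finset (Fin n × Fin n)))
        (f := fun q => |Vm q.1 q.2|)
      simpa [sq] using this
    have hN := jetNorm_three_le hU vs hyU
    set S := ∑ i, ∑ j, |pd i (pd j v) y| with hSdef
    have hS0 : 0 ≤ S := by positivity
    have hN2 : (jetNorm 3 v y) ^ 2 ≤ 2 * (jetNorm 2 v y) ^ 2 + 2 * S ^ 2 := by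
      have h3 : (jetNorm 3 v y) ^ 2 ≤ (jetNorm 2 v y + S) ^ 2 := pow_le_pow_left₀ n3 hN 2
      nlinarith [sq_nonneg (jetNorm 2 v y - S)]
    have hS2 : 2 * S ^ 2 ≤ A * (Z ^ 2 + div y - R) := by
      rw [← eX, hA]
      have : (n : ℝ) ^ 2 * ∑ i, ∑ m, (Vm i m) ^ 2 ≤ (n : ℝ) ^ 2 * (τ ^ 2 * X) :=
        mul_le_mul_of_nonneg_left hVX (by positivity)
      linarith
    have hR2 : A * (-R) ≤ A * (M * (jetNorm 2 v y * jetNorm 3 v y)) :=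
      mul_le_mul_of_nonneg_left ((neg_le_abs R).trans hRb) hA0
    have hZ3 := mul_le_mul_of_nonneg_left hZ2 hA0
    rw [jetNorm_one, sq_abs]
    -- Young's inequality absorbs A M |j₂| |j₃| into half of |j₃|², where j₂ and j₃ are the jets of
    -- `v` of order below 2 and 3; doubling the rest gives the stated constants.
    nlinarith [sq_nonneg (A * M * jetNorm 2 v y - jetNorm 3 v y)]
  have hLv := hv.lapE hU hG hLU
  have I1 := (hLv.integrable_jetNorm_sq hL 1).const_mul (4 * A)
  have I2 := (hv.integrable_jetNorm_sq hL 2).const_mul (4 + 4 * A * D ^ 2 + A ^ 2 * M ^ 2)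
  have I3 := idiv.const_mul (2 * A)
  have fin := integral_mono (hv.integrable_jetNorm_sq hL 3) ((I1.add I2).add I3) key
  have e1 := integral_add (I1.add I2) I3
  have e2 := integral_add I1 I2
  simp only [Pi.add_apply] at fin e1 e2
  rw [e1, e2, integral_const_mul, integral_const_mul,
    integral_const_mul, zdiv, mul_zero, add_zero] at fin
  change sobSq 3 v ≤ 4 * A * sobSq 1 (lapE G v) + _ * sobSq 2 v at fin
  have p1 := sobSq_nonneg 1 (lapE G v)
  have p2 := sobSq_nonneg 2 v
  have q2 : 0 ≤ 4 + 4 * A * D ^ 2 + A ^ 2 * M ^ 2 := by positivity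
  nlinarith [mul_nonneg q2 p1, mul_nonneg hA0 p2]

theorem sobSq_le_of_bound (hL : IsCompact L) {P : (E n → ℝ) → E n → ℝ} {m r : ℕ} {C : ℝ}
    (hv : IsBumpOn L v) (hP : IsBumpOn L (P v)) (hb : ∀ y ∈ L, jetNorm m (P v) y ≤ C * jetNorm (m + r) v y) :
    sobSq m (P v) ≤ C ^ 2 * sobSq (m + r) v := by
  unfold sobSq
  rw [← integral_const_mul]
  refine integral_mono (hP.integrable_jetNorm_sq hL m)
    ((hv.integrable_jetNorm_sq hL (m + r)).const_mul _) fun y => ?_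
  by_cases hy : y ∈ L
  · simp only
    rw [← mul_pow]
    exact pow_le_pow_left₀ (jetNorm_nonneg _ _ _) (hb y hy) 2
  · simp only [hP.jetNorm_eq_zero hy, zero_pow two_ne_zero]
    positivity

theorem sobSq_pd_le (hL : IsCompact L) (hv : IsBumpOn L v) (a : Fin n) (m : ℕ) :
    sobSq m (pd a v) ≤ sobSq (m + 1) v := by
  have := sobSq_le_of_bound (C := 1) (m := m) (r := 1) hL hv (hv.pd a) fun y _ => by
    rw [one_mul]
    exact jetNorm_pd_le isOpen_univ hv.smooth.contDiffOn (mem_univ y) m a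
  simpa using this

/-- In the commutator ∂_a falls only on the coefficients of the Laplacian: third derivatives of `f`
cancel and an operator of order two is left. -/
theorem exists_commutator_pd_lapE (hU : IsOpen U) (hG : IsMetric U G) (a : Fin n) :
    ∃ R, IsDiffOp U 2 R ∧ ∀ f, ContDiffOn ℝ ∞ f U → ∀ y ∈ U,
      lapE G (pd a f) y = pd a (lapE G f) y + R f y := by
  -- `lapE = ∑ c pd pd + ∑ d pd`
  set d : Fin n → E n → ℝ := fun m y => ∑ i, ∑ j, (G y)⁻¹ i j * chris G m i j y with hd
  have sd : ∀ m, ContDiffOn ℝ ∞ (d m) U := fun m => ContDiffOn.sum fun i _ => ContDiffOn.sum fun j _ =>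
    (hG.inv_smooth hU i j).mul (hG.chris_smooth hU m i j)
  have e : ∀ f y, lapE G f y = ∑ m, d m y * pd m f y - ∑ i, ∑ j, (G y)⁻¹ i j * pd i (pd j f) y := by
    intro f y
    have e1 : ∑ m, d m y * pd m f y =
        ∑ i, ∑ j, (G y)⁻¹ i j * ∑ m, chris G m i j y * pd m f y := by
      simp only [hd, Finset.sum_mul, Finset.mul_sum]
      rw [sum_rotate]
      exact Finset.sum_congr rfl fun i _ => Finset.sum_congr rfl fun j _ =>
        Finset.sum_congr rfl fun m _ => by ring
    rw [e1]
    unfold lapE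
    simp only [covE_two, mul_sub, Finset.sum_sub_distrib]
    ring
  refine ⟨fun f y => ∑ i, ∑ j, pd a (fun y => (G y)⁻¹ i j) y * pd i (pd j f) y -
    ∑ m, pd a (d m) y * pd m f y, ?_, fun f hf y hy => ?_⟩
  · exact (IsDiffOp.sum hU _ fun i _ => IsDiffOp.sum hU _ fun j _ => IsDiffOp.mul_op hU
      (contDiffOn_pd hU (hG.inv_smooth hU i j) a) ((IsDiffOp.pd hU i).comp hU (IsDiffOp.pd hU j))).sub_op
      hU (IsDiffOp.sum hU _ fun m _ => (IsDiffOp.mul_op hU (contDiffOn_pd hU (sd m) a)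
        (IsDiffOp.pd hU m)).mono (by norm_num))
  · have dd := fun {w : E n → ℝ} (hw : ContDiffOn ℝ ∞ w U) => differentiableAt_of_smooth hU hw hy
    have s1 := fun i => contDiffOn_pd hU hf i
    have s2 := fun i j => contDiffOn_pd hU (s1 j) i
    have e2 : pd a (lapE G f) y = pd a (fun y => ∑ m, d m y * pd m f y -
        ∑ i, ∑ j, (G y)⁻¹ i j * pd i (pd j f) y) y :=
      pd_congr (Eventually.of_forall fun z => e f z) a
    rw [e2, pd_sub (dd (ContDiffOn.sum fun m _ => (sd m).mul (s1 m)))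
      (dd (ContDiffOn.sum fun i _ => ContDiffOn.sum fun j _ => (hG.inv_smooth hU i j).mul (s2 i j))),
      pd_sum _ fun m _ => dd ((sd m).mul (s1 m)),
      pd_sum _ fun i _ => dd (ContDiffOn.sum fun j _ => (hG.inv_smooth hU i j).mul (s2 i j)), e]
    have e3 : ∀ m, pd a (fun z => d m z * pd m f z) y =
        d m y * pd m (pd a f) y + pd a (d m) y * pd m f y := fun m => by
      rw [pd_mul (dd (sd m)) (dd (s1 m)), pd_pd_comm hU hf hy a m]
    have e4 : ∀ i, pd a (fun z => ∑ j, (G z)⁻¹ i j * pd i (pd j f) z) y =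
        ∑ j, ((G y)⁻¹ i j * pd i (pd j (pd a f)) y +
          pd a (fun y => (G y)⁻¹ i j) y * pd i (pd j f) y) := fun i => by
      rw [pd_sum _ fun j _ => dd ((hG.inv_smooth hU i j).mul (s2 i j))]
      refine Finset.sum_congr rfl fun j _ => ?_
      rw [pd_mul (dd (hG.inv_smooth hU i j)) (dd (s2 i j)), pd_pd_comm hU (s1 j) hy a i,
        pd_congr_on hU (g := pd j (pd a f)) (fun z hz => pd_pd_comm hU hf hz a j) hy]
    simp only [e3, e4, Finset.sum_add_distrib]
    ring

theorem sq_add_mul_sum_le {ι : Type*} (s : Finset ι) (x C : ℝ) (w : ι → ℝ) :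
    (x + C * ∑ a ∈ s, w a) ^ 2 ≤ 2 * x ^ 2 + 2 * C ^ 2 * s.card * ∑ a ∈ s, (w a) ^ 2 := by
  have h := sq_sum_le_card_mul_sum_sq (s := s) (f := w)
  have h2 := mul_le_mul_of_nonneg_left h (sq_nonneg C)
  nlinarith [sq_nonneg (x - C * ∑ a ∈ s, w a)]

theorem sobSq_succ_le (hL : IsCompact L) (m : ℕ) : ∃ C : ℝ, 0 ≤ C ∧ ∀ v, IsBumpOn L v →
    sobSq (m + 1) v ≤ C * (sobSq 1 v + ∑ a : Fin n, sobSq m (pd a v)) := by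
  obtain ⟨C, hC0, hC⟩ := exists_jetNorm_succ_le n m
  refine ⟨2 + 2 * C ^ 2 * n, by positivity, fun v hv => ?_⟩
  have i1 := hv.integrable_jetNorm_sq hL 1
  have i2 := fun a => (hv.pd a).integrable_jetNorm_sq hL m
  unfold sobSq
  rw [← integral_finsetSum _ fun a _ => i2 a, ← integral_add i1 (integrable_finsetSum _ fun a _ => i2 a),
    ← integral_const_mul]
  refine integral_mono (hv.integrable_jetNorm_sq hL (m + 1))
    ((i1.add (integrable_finsetSum _ fun a _ => i2 a)).const_mul _) fun y => ?_
  have h1 := hC isOpen_univ hv.smooth.contDiffOn (mem_univ y)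
  have h2 := pow_le_pow_left₀ (jetNorm_nonneg _ _ _) h1 2
  refine h2.trans ((sq_add_mul_sum_le _ _ _ _).trans ?_)
  simp only [jetNorm_one, Finset.card_univ, Fintype.card_fin]
  have h3 : 0 ≤ ∑ a : Fin n, (jetNorm m (pd a v) y) ^ 2 := by positivity
  have h4 : 0 ≤ 2 * C ^ 2 * (n : ℝ) := by positivity
  have h5 := sq_nonneg |v y|
  nlinarith [mul_nonneg h4 h5]

/-- Elliptic regularity for the Laplacian. -/
theorem elliptic_lap (hU : IsOpen U) (hG : IsMetric U G) (hLU : L ⊆ U) (hL : IsCompact L) (m : ℕ) :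
    ∃ C : ℝ, 0 ≤ C ∧ ∀ v, IsBumpOn L v →
      sobSq (m + 3) v ≤ C * (sobSq (m + 1) (lapE G v) + sobSq (m + 2) v) := by
  induction m with
  | zero => simpa using elliptic_two hU hG hLU hL
  | succ m ih =>
    obtain ⟨C, hC0, hC⟩ := ih
    obtain ⟨C1, hC10, hC1⟩ := sobSq_succ_le (n := n) hL (m + 3)
    choose R hR hRe using fun a => exists_commutator_pd_lapE hU hG a
    choose D hD0 hD using fun a => (hR a).bound (m + 1) L hLU hL
    -- The estimate of the previous order is applied to ∂_a v. Exchanging ∂_a with Δ costs an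
    -- operator of order two, which the lower norm on the right absorbs.
    have key : ∀ a : Fin n, ∀ v, IsBumpOn L v → sobSq (m + 3) (pd a v) ≤
        (C * (2 + 2 * D a ^ 2 + 1)) * (sobSq (m + 2) (lapE G v) + sobSq (m + 3) v) := by
      intro a v hv
      have h1 := hC _ (hv.pd a)
      have h2 := sobSq_pd_le hL hv a (m + 2)
      have hLv := hv.lapE hU hG hLU
      have h3 : sobSq (m + 1) (lapE G (pd a v)) ≤
          2 * sobSq (m + 1) (pd a (lapE G v)) + 2 * D a ^ 2 * sobSq (m + 3) v := by
        unfold sobSq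
        have i1 := ((hLv.pd a).integrable_jetNorm_sq hL (m + 1)).const_mul 2
        have i2 := (hv.integrable_jetNorm_sq hL (m + 3)).const_mul (2 * D a ^ 2)
        rw [← integral_const_mul, ← integral_const_mul, ← integral_add i1 i2]
        refine integral_mono (((hv.pd a).lapE hU hG hLU).integrable_jetNorm_sq hL (m + 1))
          (i1.add i2) fun y => ?_
        by_cases hy : y ∈ L
        · have vs := hv.smooth.contDiffOn (s := U)
          have h4 : jetNorm (m + 1) (lapE G (pd a v)) y ≤
              jetNorm (m + 1) (pd a (lapE G v)) y + D a * jetNorm (m + 3) v y := by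
            rw [jetNorm_congr_on hU (g := fun z => pd a (lapE G v) z + R a v z)
              (fun z hz => hRe a v vs z hz) (hLU hy)]
            refine (jetNorm_add_le hU ((hLv.pd a).smooth.contDiffOn) ((hR a).smooth v vs)
              (hLU hy) _).trans ?_
            exact add_le_add le_rfl (hD a v vs y hy)
          have h5 := pow_le_pow_left₀ (jetNorm_nonneg _ _ _) h4 2
          refine h5.trans ?_
          have := sq_nonneg (jetNorm (m + 1) (pd a (lapE G v)) y - D a * jetNorm (m + 3) v y)
          nlinarith
        · have := ((hv.pd a).lapE hU hG hLU).jetNorm_eq_zero hy (m + 1)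
          simp only [this, zero_pow two_ne_zero]
          positivity
      have h4 := sobSq_pd_le hL hLv a (m + 1)
      have p1 := sobSq_nonneg (m + 2) (lapE G v)
      have p2 := sobSq_nonneg (m + 3) v
      have h5 : sobSq (m + 1) (lapE G (pd a v)) + sobSq (m + 2) (pd a v) ≤
          (2 + 2 * D a ^ 2 + 1) * (sobSq (m + 2) (lapE G v) + sobSq (m + 3) v) := by
        have : 0 ≤ D a ^ 2 * sobSq (m + 2) (lapE G v) := by positivity
        nlinarith
      rw [mul_assoc]
      exact h1.trans (mul_le_mul_of_nonneg_left h5 hC0)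
    refine ⟨C1 * (1 + ∑ a, C * (2 + 2 * D a ^ 2 + 1)), by
      have : 0 ≤ ∑ a, C * (2 + 2 * D a ^ 2 + 1) := Finset.sum_nonneg fun a _ => by positivity
      positivity, fun v hv => ?_⟩
    rw [mul_assoc]
    refine (hC1 v hv).trans (mul_le_mul_of_nonneg_left ?_ hC10)
    rw [add_mul, one_mul, Finset.sum_mul]
    refine add_le_add ?_ (Finset.sum_le_sum fun a _ => key a v hv)
    have := sobSq_mono hL hv (show 1 ≤ m + 3 by lia)
    have := sobSq_nonneg (m + 2) (lapE G v)
    have e : m + 1 + 2 = m + 3 := by ring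
    rw [e, show m + 1 + 1 = m + 2 by ring]
    linarith

theorem IsBumpOn.iterate_lapE (hU : IsOpen U) (hG : IsMetric U G) (hLU : L ⊆ U) (h : IsBumpOn L v)
    (m : ℕ) : IsBumpOn L ((SmallEnergy.lapE G)^[m] v) := by
  induction m generalizing v with
  | zero => exact h
  | succ m ih => exact ih (h.lapE hU hG hLU)

theorem IsBumpOn.lapHalfE_bump (hU : IsOpen U) (hG : IsMetric U G) (hLU : L ⊆ U) (h : IsBumpOn L v)
    (k : ℕ) : IsBumpOn L (lapHalfE G k v) := by
  have hw := h.iterate_lapE hU hG hLU (k / 2)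
  refine h.of_local hU hLU ?_ fun y hy => ?_
  · unfold lapHalfE
    split_ifs
    · exact hw.smooth.contDiffOn.pow 2
    · exact ContDiffOn.sum fun i _ => ContDiffOn.sum fun j _ => (hG.inv_smooth hU i j).mul
        ((hw.pd i).smooth.contDiffOn.mul (hw.pd j).smooth.contDiffOn)
  · have h0 : (SmallEnergy.lapE G)^[k / 2] v =ᶠ[𝓝 y] fun _ => 0 := by
      generalize k / 2 = m
      induction m with
      | zero => exact hy
      | succ m ih =>
        rw [Function.iterate_succ_apply']
        filter_upwards [ih.eventuallyEq_nhds] with z hz using lapE_eq_zero_of_eventually hz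
    unfold lapHalfE
    split_ifs
    · simp [h0.self_of_nhds]
    · simp [pd_eq_zero_of_eventually h0]

theorem IsBumpOn.integrable (hL : IsCompact L) (h : IsBumpOn L v) : Integrable v :=
  h.smooth.continuous.integrable_of_hasCompactSupport (h.hasCompactSupport hL)

/-- The elliptic estimate for `Δ^{k/2}`. -/
theorem elliptic_lapHalf (hU : IsOpen U) (hG : IsMetric U G) (hLU : L ⊆ U) (hL : IsCompact L) :
    ∀ k : ℕ, ∃ C : ℝ, 0 ≤ C ∧ ∀ v, IsBumpOn L v →
      sobSq (k + 1) v ≤ C * ((∫ y, lapHalfE G k v y) + sobSq k v)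
  | 0 => ⟨1, zero_le_one, fun v _ => by
      simp [sobSq, jetNorm_one, lapHalfE]⟩
  | 1 => by
      obtain ⟨τ, hτ0, hτ⟩ := exists_bound_abs hU hG.trace_smooth hLU hL
      obtain ⟨C, hC0, hC⟩ := sobSq_succ_le (n := n) hL 1
      refine ⟨C * (τ + 1), by positivity, fun v hv => ?_⟩
      rw [mul_assoc]
      refine (hC v hv).trans (mul_le_mul_of_nonneg_left ?_ hC0)
      have i1 := fun a => (hv.pd a).integrable_jetNorm_sq hL 1
      have i2 := (hv.lapHalfE_bump hU hG hLU 1).integrable hL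
      have h1 : ∀ y, ∑ a, (jetNorm 1 (SmallEnergy.pd a v) y) ^ 2 ≤ τ * lapHalfE G 1 v y ∧
          0 ≤ lapHalfE G 1 v y := by
        intro y
        have e : lapHalfE G 1 v y = ∑ i, ∑ j, (G y)⁻¹ i j * (pd i v y * pd j v y) := by
          simp [lapHalfE]
        by_cases hy : y ∈ L
        · simp only [jetNorm_one, sq_abs]
          have hp := hG.posDef y (hLU hy)
          have h2 := sum_sq_le_of_posDef hp (fun i => SmallEnergy.pd i v y)
          obtain ⟨F, hF⟩ := exists_isFrame hp
          have h3 : 0 ≤ ∑ i, ∑ j, (G y)⁻¹ i j * (pd i v y * pd j v y) := by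
            rw [hF.quad_eq fun i => pd i v y]; positivity
          rw [e]
          exact ⟨h2.trans (mul_le_mul_of_nonneg_right ((le_abs_self _).trans (hτ y hy)) h3), h3⟩
        · have := fun a => (hv.pd a).jetNorm_eq_zero hy 1
          have z : lapHalfE G 1 v y = 0 := image_eq_zero_of_notMem_tsupport
            fun h => hy ((hv.lapHalfE_bump hU hG hLU 1).supp h)
          simp [this, z]
      have h2 : ∑ a, sobSq 1 (SmallEnergy.pd a v) ≤ τ * ∫ y, lapHalfE G 1 v y := by
        unfold sobSq
        rw [← integral_finsetSum _ fun a _ => i1 a, ← integral_const_mul]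
        exact integral_mono (integrable_finsetSum _ fun a _ => i1 a) (i2.const_mul _) fun y => (h1 y).1
      have h3 : 0 ≤ ∫ y, lapHalfE G 1 v y := integral_nonneg fun y => (h1 y).2
      have h4 := sobSq_nonneg 1 v
      nlinarith
  -- Regularity for Δ bounds `v` by Δv two orders below. The induction hypothesis applies to Δv,
  -- whose Δ^{k/2} is Δ^{(k+2)/2} v, and the lower norm of Δv is bounded by the lower norm of `v`.
  | k + 2 => by
      obtain ⟨C, hC0, hC⟩ := elliptic_lapHalf hU hG hLU hL k
      obtain ⟨C1, hC10, hC1⟩ := elliptic_lap hU hG hLU hL k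
      obtain ⟨D, hD0, hD⟩ := (hG.lapE hU).bound k L hLU hL
      refine ⟨C1 * (C * (1 + D ^ 2) + 1), by positivity, fun v hv => ?_⟩
      have hLv := hv.lapE hU hG hLU
      have h1 := hC1 v hv
      have h2 := hC _ hLv
      have h3 : sobSq k (SmallEnergy.lapE G v) ≤ D ^ 2 * sobSq (k + 2) v :=
        sobSq_le_of_bound hL hv hLv fun y hy => hD v hv.smooth.contDiffOn y hy
      rw [show k + 2 + 1 = k + 3 by ring, mul_assoc]
      refine h1.trans (mul_le_mul_of_nonneg_left ?_ hC10)
      have e : ∫ y, lapHalfE G (k + 2) v y = ∫ y, lapHalfE G k (SmallEnergy.lapE G v) y :=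
        integral_congr_ae (Eventually.of_forall fun y => lapHalfE_add_two k v y)
      rw [e]
      have h4 := sobSq_nonneg (k + 2) v
      have h5 : 0 ≤ ∫ y, lapHalfE G k (SmallEnergy.lapE G v) y := by
        refine integral_nonneg fun y => ?_
        by_cases hy : y ∈ L
        · unfold lapHalfE
          split_ifs
          · positivity
          · obtain ⟨F, hF⟩ := exists_isFrame (hG.posDef y (hLU hy))
            simp only
            rw [hF.quad_eq fun i => pd i ((SmallEnergy.lapE G)^[k / 2] (SmallEnergy.lapE G v)) y]
            positivity
        · exact le_of_eq (image_eq_zero_of_notMem_tsupport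
            fun h => hy ((hLv.lapHalfE_bump hU hG hLU k).supp h)).symm
      have h6 : 0 ≤ D ^ 2 * ∫ y, lapHalfE G k (SmallEnergy.lapE G v) y := by positivity
      calc _ ≤ C * ((∫ y, lapHalfE G k (SmallEnergy.lapE G v) y) + D ^ 2 * sobSq (k + 2) v) +
            sobSq (k + 2) v := by
            refine add_le_add (h2.trans (mul_le_mul_of_nonneg_left (by linarith) hC0)) le_rfl
        _ ≤ _ := by
            nlinarith [mul_nonneg hC0 h6, mul_nonneg hC0 h4]

end CompactSupport

end SmallEnergy

namespace SmallEnergy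

/-! ### Rellich's theorem by the Fourier transform. -/

section Rellich

variable {n : ℕ} {L : Set (E n)}

open scoped FourierTransform SchwartzMap LineDeriv

/-- The Schwartz function defined by a smooth function with compact support. -/
noncomputable def toSchwartz (hL : IsCompact L) {v : E n → ℝ} (hv : IsBumpOn L v) : 𝓢(E n, ℂ) :=
  HasCompactSupport.toSchwartzMap (f := fun y => (v y : ℂ))
    ((hv.hasCompactSupport hL).comp_left (g := fun r : ℝ => (r : ℂ)) (by simp))
    (Complex.ofRealCLM.contDiff.comp hv.smooth)

theorem toSchwartz_apply (hL : IsCompact L) {v : E n → ℝ} (hv : IsBumpOn L v) (y : E n) :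
    toSchwartz hL hv y = (v y : ℂ) := rfl

theorem lineDeriv_toSchwartz (hL : IsCompact L) {v : E n → ℝ} (hv : IsBumpOn L v) (a : Fin n) :
    ∂_{(EuclideanSpace.single a (1 : ℝ) : E n)} (toSchwartz hL hv) = toSchwartz hL (hv.pd a) := by
  ext y
  rw [SchwartzMap.lineDerivOp_apply_eq_fderiv, toSchwartz_apply]
  have h := Complex.ofRealCLM.hasFDerivAt.comp y
    ((hv.smooth.differentiable (by simp) y).hasFDerivAt)
  have e : (toSchwartz hL hv : E n → ℂ) = ⇑Complex.ofRealCLM ∘ v := rfl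
  rw [e, h.fderiv]
  rfl

theorem integral_norm_sq_toSchwartz (hL : IsCompact L) {v : E n → ℝ} (hv : IsBumpOn L v) :
    ∫ ξ, ‖𝓕 (toSchwartz hL hv) ξ‖ ^ 2 = sobSq 1 v := by
  rw [SchwartzMap.integral_norm_sq_fourier]
  simp [toSchwartz_apply, sobSq, jetNorm_one]

theorem norm_fourier_pd (hL : IsCompact L) {v : E n → ℝ} (hv : IsBumpOn L v) (a : Fin n) (ξ : E n) :
    ‖𝓕 (toSchwartz hL (hv.pd a)) ξ‖ = 2 * Real.pi * |ξ a| * ‖𝓕 (toSchwartz hL hv) ξ‖ := by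
  rw [← lineDeriv_toSchwartz hL hv a, SchwartzMap.fourier_lineDerivOp_eq]
  have ht : (fun x : E n => inner ℝ x (EuclideanSpace.single a (1 : ℝ))).HasTemperateGrowth :=
    ((innerSL ℝ).flip (EuclideanSpace.single a (1 : ℝ))).hasTemperateGrowth
  rw [SchwartzMap.smul_apply, SchwartzMap.smulLeftCLM_apply_apply ht, norm_smul, norm_smul]
  simp [EuclideanSpace.inner_single_right, abs_of_pos Real.pi_pos, mul_assoc]

/-- The transform is at most the L¹ norm, and |x| ≤ 1 + x² bounds that norm on the support. The
bound does not depend on ξ and serves as the dominating constant. -/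
theorem norm_fourier_le (hL : IsCompact L) {v : E n → ℝ} (hv : IsBumpOn L v) (ξ : E n) :
    ‖𝓕 (toSchwartz hL hv) ξ‖ ≤ volume.real L + sobSq 1 v := by
  refine (SchwartzMap.norm_fourier_apply_le_toLp_one _ _).trans ?_
  rw [SchwartzMap.norm_toLp_one]
  have hLm : MeasurableSet L := hL.measurableSet
  have hi : Integrable (L.indicator fun _ => (1 : ℝ)) (volume : Measure (E n)) :=
    (integrable_indicator_iff hLm).2 (integrableOn_const hL.measure_lt_top.ne)
  have h2 := hv.integrable_jetNorm_sq hL 1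
  have e : volume.real L = ∫ y, L.indicator (fun _ => (1 : ℝ)) y := by
    rw [integral_indicator hLm]; simp [Measure.real]
  rw [e, sobSq, ← integral_add hi h2]
  refine integral_mono ?_ (hi.add h2) fun y => ?_
  · exact (toSchwartz hL hv).integrable.norm
  · simp only [toSchwartz_apply, jetNorm_one, Complex.norm_real, Real.norm_eq_abs]
    by_cases hy : y ∈ L
    · simp only [indicator_of_mem hy]
      nlinarith [sq_nonneg (|v y| - 1), abs_nonneg (v y)]
    · have : v y = 0 := image_eq_zero_of_notMem_tsupport fun h => hy (hv.supp h)
      simp [this, hy]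

/-- Weak convergence is tested against real functions, so the real and imaginary parts are
separated. -/
theorem fourier_eq_re_im (hL : IsCompact L) {v : E n → ℝ} (hv : IsBumpOn L v) (ξ : E n) :
    𝓕 (toSchwartz hL hv) ξ = ((∫ y, v y * Real.cos (-(2 * Real.pi * inner ℝ y ξ)) : ℝ) : ℂ) +
      ((∫ y, v y * Real.sin (-(2 * Real.pi * inner ℝ y ξ)) : ℝ) : ℂ) * Complex.I := by
  have hc : ∀ ψ : E n → ℝ, Continuous ψ → Integrable (fun y => ((v y * ψ y : ℝ) : ℂ)) := fun ψ hψ =>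
    ((hv.smooth.continuous.mul hψ).integrable_of_hasCompactSupport
      ((hv.hasCompactSupport hL).mul_right)).ofReal
  rw [SchwartzMap.fourier_coe, Real.fourier_eq', ← integral_complex_ofReal, ← integral_complex_ofReal,
    ← integral_mul_const, ← integral_add (hc _ (by fun_prop)) ((hc _ (by fun_prop)).mul_const _)]
  refine integral_congr_ae (Eventually.of_forall fun y => ?_)
  simp only [toSchwartz_apply, smul_eq_mul]
  rw [Complex.exp_mul_I]
  push_cast
  ring_nf

/-- Rellich's theorem: weakly convergent bounded sequences in `H¹` with supports in a fixed compact
set converge strongly in `L²`. -/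
theorem rellich (hL : IsCompact L) {w : ℕ → E n → ℝ} (hw : ∀ i, IsBumpOn L (w i)) {C : ℝ}
    (hC : ∀ i, sobSq 2 (w i) ≤ C)
    (hweak : ∀ ψ : E n → ℝ, Continuous ψ → Tendsto (fun i => ∫ y, w i y * ψ y) atTop (𝓝 0)) :
    Tendsto (fun i => sobSq 1 (w i)) atTop (𝓝 0) := by
  have hC0 : 0 ≤ C := (sobSq_nonneg _ _).trans (hC 0)
  set f : ℕ → E n → ℂ := fun i => ⇑(𝓕 (toSchwartz hL (hw i)) : 𝓢(E n, ℂ)) with hf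
  have hpt : ∀ ξ, Tendsto (fun i => ‖f i ξ‖ ^ 2) atTop (𝓝 0) := by
    intro ξ
    have h1 := hweak (fun y => Real.cos (-(2 * Real.pi * inner ℝ y ξ))) (by fun_prop)
    have h2 := hweak (fun y => Real.sin (-(2 * Real.pi * inner ℝ y ξ))) (by fun_prop)
    have h3 : Tendsto (fun i => f i ξ) atTop (𝓝 0) := by
      simp only [hf, fourier_eq_re_im]
      have := (Complex.continuous_ofReal.tendsto 0).comp h1 |>.add
        (((Complex.continuous_ofReal.tendsto 0).comp h2).mul_const Complex.I)
      simpa only [Function.comp_def, Complex.ofReal_zero, zero_mul, add_zero] using this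
    have := (h3.norm).pow 2
    simpa using this
  have hbd : ∀ i ξ, ‖f i ξ‖ ≤ volume.real L + C := fun i ξ =>
    (norm_fourier_le hL (hw i) ξ).trans
      (add_le_add le_rfl ((sobSq_mono hL (hw i) (by norm_num)).trans (hC i)))
  have hint : ∀ i, Integrable (fun ξ => ‖f i ξ‖ ^ 2) := fun i =>
    ((𝓕 (toSchwartz hL (hw i))).memLp 2 volume).integrable_norm_pow (by norm_num)
  -- Low frequencies: pointwise convergence, with a uniform bound on a ball of finite measure.
  have hball : ∀ R : ℝ, Tendsto (fun i => ∫ ξ in Metric.closedBall (0 : E n) R, ‖f i ξ‖ ^ 2) atTop (𝓝 0) := by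
    intro R
    have : Tendsto (fun i => ∫ ξ in Metric.closedBall (0 : E n) R, ‖f i ξ‖ ^ 2) atTop
        (𝓝 (∫ ξ in Metric.closedBall (0 : E n) R, (0 : ℝ))) := by
      refine tendsto_integral_of_dominated_convergence (fun _ => (volume.real L + C) ^ 2)
        (fun i => (hint i).aestronglyMeasurable.restrict) ?_ (fun i => ?_) ?_
      · exact integrableOn_const (isCompact_closedBall _ _).measure_lt_top.ne
      · refine Eventually.of_forall fun ξ => ?_
        rw [Real.norm_of_nonneg (by positivity)]
        exact pow_le_pow_left₀ (norm_nonneg _) (hbd i ξ) 2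
      · exact Eventually.of_forall fun ξ => hpt ξ
    simpa using this
  -- High frequencies: the transform of ∂_a w carries the factor 2π ξ_a, so for |ξ| > R the tail is
  -- at most R⁻² times the energy of the gradient; the factor 4π² ≥ 1 is discarded.
  have hmain : ∀ R : ℝ, 0 < R → ∀ i, sobSq 1 (w i) ≤
      (∫ ξ in Metric.closedBall (0 : E n) R, ‖f i ξ‖ ^ 2) + (R ^ 2)⁻¹ * (n * C) := by
    intro R hR i
    have hg : ∀ a : Fin n, Integrable (fun ξ => ‖𝓕 (toSchwartz hL ((hw i).pd a)) ξ‖ ^ 2) := fun a =>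
      ((𝓕 (toSchwartz hL ((hw i).pd a))).memLp 2 volume).integrable_norm_pow (by norm_num)
    have hB : MeasurableSet (Metric.closedBall (0 : E n) R) := measurableSet_closedBall
    have i1 : Integrable ((Metric.closedBall (0 : E n) R).indicator fun ξ => ‖f i ξ‖ ^ 2) :=
      (hint i).indicator hB
    have i2 : Integrable (fun ξ => (R ^ 2)⁻¹ * ∑ a, ‖𝓕 (toSchwartz hL ((hw i).pd a)) ξ‖ ^ 2) :=
      (integrable_finsetSum _ fun a _ => hg a).const_mul _
    rw [← integral_norm_sq_toSchwartz hL (hw i)]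
    calc ∫ ξ, ‖f i ξ‖ ^ 2 ≤ ∫ ξ, ((Metric.closedBall (0 : E n) R).indicator (fun ξ => ‖f i ξ‖ ^ 2) ξ +
          (R ^ 2)⁻¹ * ∑ a, ‖𝓕 (toSchwartz hL ((hw i).pd a)) ξ‖ ^ 2) := by
          refine integral_mono (hint i) (i1.add i2) fun ξ => ?_
          by_cases hξ : ξ ∈ Metric.closedBall (0 : E n) R
          · simp only [Pi.add_apply, indicator_of_mem hξ]
            have : 0 ≤ (R ^ 2)⁻¹ * ∑ a, ‖𝓕 (toSchwartz hL ((hw i).pd a)) ξ‖ ^ 2 := by positivity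
            linarith
          · simp only [Pi.add_apply, indicator_of_notMem hξ, zero_add]
            rw [Metric.mem_closedBall, dist_zero_right, not_le] at hξ
            have e : ∑ a, (2 * Real.pi * |ξ a| * ‖𝓕 (toSchwartz hL (hw i)) ξ‖) ^ 2 =
                4 * Real.pi ^ 2 * ‖ξ‖ ^ 2 * ‖f i ξ‖ ^ 2 := by
              rw [EuclideanSpace.real_norm_sq_eq, Finset.mul_sum, Finset.sum_mul]
              refine Finset.sum_congr rfl fun a _ => ?_
              rw [mul_pow, mul_pow, mul_pow, sq_abs]
              ring
            rw [Finset.sum_congr rfl fun a _ => congrArg (· ^ 2) (norm_fourier_pd hL (hw i) a ξ), e,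
              inv_mul_eq_div, le_div_iff₀ (by positivity)]
            have h1 : R ^ 2 ≤ ‖ξ‖ ^ 2 := pow_le_pow_left₀ hR.le hξ.le 2
            have h2 : (1 : ℝ) ≤ 4 * Real.pi ^ 2 := by nlinarith [Real.pi_gt_three]
            have h3 : R ^ 2 ≤ 4 * Real.pi ^ 2 * ‖ξ‖ ^ 2 := by nlinarith [sq_nonneg ‖ξ‖]
            rw [mul_comm]
            exact mul_le_mul_of_nonneg_right h3 (sq_nonneg _)
      _ = (∫ ξ in Metric.closedBall (0 : E n) R, ‖f i ξ‖ ^ 2) +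
          (R ^ 2)⁻¹ * ∑ a, sobSq 1 (SmallEnergy.pd a (w i)) := by
          rw [integral_add i1 i2, integral_indicator hB, integral_const_mul,
            integral_finsetSum _ fun a _ => hg a]
          simp only [integral_norm_sq_toSchwartz]
      _ ≤ _ := by
          refine add_le_add le_rfl (mul_le_mul_of_nonneg_left ?_ (by positivity))
          calc _ ≤ ∑ _a : Fin n, C := Finset.sum_le_sum fun a _ =>
                (sobSq_pd_le hL (hw i) a 1).trans (hC i)
            _ = _ := by simp
  rw [Metric.tendsto_atTop]
  intro ε hε
  obtain ⟨R, hR0, hR⟩ : ∃ R : ℝ, 0 < R ∧ (R ^ 2)⁻¹ * (n * C) < ε / 2 := by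
    have h1 : Tendsto (fun R : ℝ => (R ^ 2)⁻¹ * (n * C)) atTop (𝓝 (0 * (n * C))) :=
      ((tendsto_pow_atTop two_ne_zero).inv_tendsto_atTop).mul_const _
    rw [zero_mul] at h1
    obtain ⟨R, h2, h3⟩ := ((h1.eventually (gt_mem_nhds (half_pos hε))).and
      (eventually_gt_atTop 0)).exists
    exact ⟨R, h3, h2⟩
  obtain ⟨N, hN⟩ := (Metric.tendsto_atTop.1 (hball R)) (ε / 2) (half_pos hε)
  refine ⟨N, fun i hi => ?_⟩
  have h1 := hN i hi
  rw [dist_zero_right, Real.norm_eq_abs] at h1 ⊢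
  rw [abs_of_nonneg (sobSq_nonneg _ _)]
  have := hmain R hR0 i
  linarith [le_abs_self (∫ ξ in Metric.closedBall (0 : E n) R, ‖f i ξ‖ ^ 2)]

end Rellich

end SmallEnergy

namespace SmallEnergy

/-! ### Coordinate frames, transition maps and independence of the chart. -/

section Charts

variable {n : ℕ} {N : Type*} [TopologicalSpace N] [ChartedSpace (E n) N]

theorem isOpen_source (p : N) : IsOpen (extChartAt (𝓡 n) p).source := isOpen_extChartAt_source p

theorem isOpen_target (p : N) : IsOpen (extChartAt (𝓡 n) p).target := isOpen_extChartAt_target p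

/-- The derivative of a chart. -/
noncomputable def chartD (p x : N) : TangentSpace (𝓡 n) x →L[ℝ] E n :=
  mfderiv (𝓡 n) 𝓘(ℝ, E n) (extChartAt (𝓡 n) p) x

variable [IsManifold (𝓡 n) ∞ N]

theorem isInvertible_chartD {p x : N} (hx : x ∈ (extChartAt (𝓡 n) p).source) :
    (chartD (n := n) p x).IsInvertible :=
  isInvertible_mfderiv_extChartAt (I := 𝓡 n) hx

theorem chartD_coordVec {p x : N} (hx : x ∈ (extChartAt (𝓡 n) p).source) (i : Fin n) :
    chartD p x (coordVec p i x) = EuclideanSpace.single i (1 : ℝ) :=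
  (isInvertible_chartD hx).self_apply_inverse _

theorem eq_sum_coordVec {p x : N} (hx : x ∈ (extChartAt (𝓡 n) p).source)
    (v : TangentSpace (𝓡 n) x) : v = ∑ i, (chartD p x v) i • coordVec p i x := by
  apply (isInvertible_chartD hx).injective
  rw [map_sum]
  simp only [map_smul, chartD_coordVec hx]
  ext j
  simp [Finset.sum_apply, Pi.single_apply]

/-- The derivative of the chart maps both vectors to the same basis vector. The identification makes
the smoothness of the local frame of the tangent bundle available for the coefficients of the
metric. -/
theorem coordVec_eq {p x : N} (hx : x ∈ (extChartAt (𝓡 n) p).source) (i : Fin n) :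
    coordVec p i x = (trivializationAt (E n) (TangentSpace (𝓡 n)) p).localFrame
      (EuclideanSpace.basisFun (Fin n) ℝ).toBasis i x := by
  have hx' : x ∈ (chartAt (E n) p).source := by rwa [extChartAt_source] at hx
  have hb : x ∈ (trivializationAt (E n) (TangentSpace (𝓡 n)) p).baseSet := by
    simpa using hx'
  rw [Bundle.Trivialization.localFrame_apply_of_mem_baseSet _ _ hb]
  apply (isInvertible_chartD hx).injective
  rw [chartD_coordVec hx]
  have h : (trivializationAt (E n) (TangentSpace (𝓡 n)) p).continuousLinearMapAt ℝ x = chartD p x :=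
    TangentBundle.continuousLinearMapAt_trivializationAt (I := 𝓡 n) hx'
  rw [← h]
  simp only [Bundle.Trivialization.basisAt, Module.Basis.map_apply, OrthonormalBasis.coe_toBasis,
    EuclideanSpace.basisFun_apply]
  rw [Bundle.Trivialization.continuousLinearMapAt_apply,
    Bundle.Trivialization.linearMapAt_def_of_mem _ hb]
  exact (LinearEquiv.apply_symm_apply _ _).symm

theorem contDiffOn_gram (g : RMetric n N) (p : N) (i j : Fin n) :
    ContDiffOn ℝ ∞ (fun y => gram g p y i j) (extChartAt (𝓡 n) p).target := by
  have hc : ∀ i, ContMDiffOn (𝓡 n) ((𝓡 n).prod 𝓘(ℝ, E n)) ∞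
      (fun x => Bundle.TotalSpace.mk' (E n) x (coordVec p i x : TangentSpace (𝓡 n) x))
      (extChartAt (𝓡 n) p).source := by
    intro i
    have h := (trivializationAt (E n) (TangentSpace (𝓡 n)) p).contMDiffOn_localFrame_baseSet
      (I := 𝓡 n) ∞ (EuclideanSpace.basisFun (Fin n) ℝ).toBasis i
    refine (h.mono fun x hx => ?_).congr fun x hx => ?_
    · simpa [extChartAt_source] using hx
    · rw [coordVec_eq hx]
  have hg : ContMDiffOn (𝓡 n) 𝓘(ℝ, ℝ) ∞ (fun x => g.inner x (coordVec p i x) (coordVec p j x))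
      (extChartAt (𝓡 n) p).source := by
    intro x hx
    have : ContMDiffWithinAt (𝓡 n) ((𝓡 n).prod 𝓘(ℝ)) ∞
      (fun m ↦ Bundle.TotalSpace.mk' ℝ (E := Bundle.Trivial N ℝ) m
        (g.inner m (coordVec p i m) (coordVec p j m))) (extChartAt (𝓡 n) p).source x := by
      apply ContMDiffWithinAt.clm_bundle_apply₂ (F₁ := E n) (F₂ := E n)
      · exact g.contMDiff.contMDiffAt.contMDiffWithinAt
      · exact hc i x hx
      · exact hc j x hx
    simp only [Bundle.contMDiffWithinAt_totalSpace] at this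
    exact this.2
  have := hg.comp (contMDiffOn_extChartAt_symm p) (fun y hy => (extChartAt (𝓡 n) p).map_target hy)
  exact contMDiffOn_iff_contDiffOn.1 this

theorem gram_posDef (g : RMetric n N) (p : N) {y : E n} (hy : y ∈ (extChartAt (𝓡 n) p).target) :
    (gram g p y).PosDef := by
  set x := (extChartAt (𝓡 n) p).symm y with hxd
  have hx : x ∈ (extChartAt (𝓡 n) p).source := (extChartAt (𝓡 n) p).map_target hy
  refine Matrix.PosDef.of_dotProduct_mulVec_pos ?_ fun v hv => ?_
  · ext i j
    exact g.symm _ _ _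
  · have e : star v ⬝ᵥ (gram g p y).mulVec v =
        g.inner x (∑ i, v i • coordVec p i x) (∑ j, v j • coordVec p j x) := by
      simp only [map_sum, dotProduct, Matrix.mulVec, gram, map_smul]
      simp only [ContinuousLinearMap.sum_apply, ContinuousLinearMap.smul_apply, smul_eq_mul,
        Finset.mul_sum, star_trivial, Matrix.of_apply]
      rw [Finset.sum_comm]
      refine Finset.sum_congr rfl fun j _ => Finset.sum_congr rfl fun i _ => ?_
      rw [← hxd]
      ring
    rw [e]
    refine g.pos _ _ fun h0 => hv ?_
    have := congrArg (chartD p x) h0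
    rw [map_sum] at this
    simp only [map_smul, chartD_coordVec hx, map_zero] at this
    ext j
    have h2 := congrArg (fun w : E n => w j) this
    simpa [Finset.sum_apply, Pi.single_apply] using h2

theorem isMetric_gram (g : RMetric n N) (p : N) : IsMetric (extChartAt (𝓡 n) p).target (gram g p) :=
  ⟨contDiffOn_gram g p, fun _ hy => gram_posDef g p hy⟩

/-- The change of coordinates from the chart at `q` to the chart at `p`. -/
noncomputable def trans (p q : N) (y : E n) : E n :=
  extChartAt (𝓡 n) p ((extChartAt (𝓡 n) q).symm y)

variable (n) in
/-- The part of the range of the chart at `q` that corresponds to the domain of the chart at `p`. -/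
def overlap (p q : N) : Set (E n) :=
  (extChartAt (𝓡 n) q).target ∩ (extChartAt (𝓡 n) q).symm ⁻¹' (extChartAt (𝓡 n) p).source

theorem isOpen_overlap (p q : N) : IsOpen (overlap n p q) :=
  (continuousOn_extChartAt_symm q).isOpen_inter_preimage (isOpen_target q) (isOpen_source p)

theorem contDiffOn_trans (p q : N) : ContDiffOn ℝ ∞ (trans (n := n) p q) (overlap n p q) := by
  have h : ContMDiffOn 𝓘(ℝ, E n) 𝓘(ℝ, E n) ∞ (trans (n := n) p q) (overlap n p q) :=
    (contMDiffOn_extChartAt (I := 𝓡 n) (x := p) (n := ∞)).comp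
      ((contMDiffOn_extChartAt_symm q).mono inter_subset_left) fun y hy => by
        simpa [extChartAt_source] using hy.2
  exact contMDiffOn_iff_contDiffOn.1 h

theorem mapsTo_trans (p q : N) :
    MapsTo (trans (n := n) p q) (overlap n p q) (extChartAt (𝓡 n) p).target :=
  fun _ hy => (extChartAt (𝓡 n) p).map_source hy.2

theorem mem_overlap {p q x : N} (hp : x ∈ (extChartAt (𝓡 n) p).source)
    (hq : x ∈ (extChartAt (𝓡 n) q).source) : extChartAt (𝓡 n) q x ∈ overlap n p q :=
  ⟨(extChartAt (𝓡 n) q).map_source hq, by rwa [mem_preimage, (extChartAt (𝓡 n) q).left_inv hq]⟩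

/-- Near `x` the chart at `p` is the transition map after the chart at `q`; this is the chain rule.
-/
theorem chartD_coordVec_eq_jac {p q x : N} (hp : x ∈ (extChartAt (𝓡 n) p).source)
    (hq : x ∈ (extChartAt (𝓡 n) q).source) (i a : Fin n) :
    chartD p x (coordVec q i x) a = jac (trans p q) a i (extChartAt (𝓡 n) q x) := by
  have hy := mem_overlap hp hq
  have hd : DifferentiableAt ℝ (trans (n := n) p q) (extChartAt (𝓡 n) q x) :=
    ((contDiffOn_trans p q).contDiffAt ((isOpen_overlap p q).mem_nhds hy)).differentiableAt (by simp)
  have hq' : MDifferentiableAt (𝓡 n) 𝓘(ℝ, E n) (extChartAt (𝓡 n) q) x :=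
    mdifferentiableAt_extChartAt (by rwa [extChartAt_source] at hq)
  have he : (extChartAt (𝓡 n) p : N → E n) =ᶠ[𝓝 x] trans p q ∘ extChartAt (𝓡 n) q := by
    filter_upwards [(isOpen_source q).mem_nhds hq] with z hz
    simp only [trans, Function.comp_apply, (extChartAt (𝓡 n) q).left_inv hz]
  have hD : chartD p x = (fderiv ℝ (trans p q) (extChartAt (𝓡 n) q x)).comp (chartD q x) := by
    have h1 : chartD p x = mfderiv (𝓡 n) 𝓘(ℝ, E n) (trans p q ∘ extChartAt (𝓡 n) q) x :=
      he.mfderiv_eq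
    rw [h1, mfderiv_comp x hd.mdifferentiableAt hq', mfderiv_eq_fderiv]
    rfl
  rw [hD, ContinuousLinearMap.comp_apply, chartD_coordVec hq]
  have := ((EuclideanSpace.proj a : E n →L[ℝ] ℝ).hasFDerivAt.comp _ hd.hasFDerivAt).fderiv
  simp only [jac, pd]
  have e : (fun z => trans p q z a) = (EuclideanSpace.proj a : E n →L[ℝ] ℝ) ∘ trans p q := rfl
  rw [e, this]
  rfl

theorem inner_eq_sum (g : RMetric n N) {p x : N} (hx : x ∈ (extChartAt (𝓡 n) p).source)
    (v w : TangentSpace (𝓡 n) x) : g.inner x v w = ∑ i, ∑ j, (chartD p x v) i * (chartD p x w) j *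
      gram g p (extChartAt (𝓡 n) p x) i j := by
  have e : ∀ i j, gram g p (extChartAt (𝓡 n) p x) i j = g.inner x (coordVec p i x) (coordVec p j x) :=
    fun i j => congrArg (fun z => g.inner z (coordVec p i z) (coordVec p j z))
      ((extChartAt (𝓡 n) p).left_inv hx)
  conv_lhs => rw [eq_sum_coordVec hx v, eq_sum_coordVec hx w]
  simp only [map_sum, map_smul, ContinuousLinearMap.sum_apply, ContinuousLinearMap.smul_apply,
    smul_eq_mul, e, Finset.mul_sum]
  rw [Finset.sum_comm]
  refine Finset.sum_congr rfl fun j _ => Finset.sum_congr rfl fun i _ => ?_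
  ring

theorem isPullback_trans (g : RMetric n N) (p q : N) :
    IsPullback (overlap n p q) (extChartAt (𝓡 n) p).target (trans p q) (gram g q) (gram g p) where
  openV := isOpen_overlap p q
  openW := isOpen_target p
  smooth := contDiffOn_trans p q
  maps := mapsTo_trans p q
  metricG := ⟨fun i j => (contDiffOn_gram g q i j).mono inter_subset_left,
    fun _ hy => gram_posDef g q hy.1⟩
  metricH := isMetric_gram g p
  eq := fun y hy i j => by
    have hq := (extChartAt (𝓡 n) q).map_target hy.1
    have h := inner_eq_sum g hy.2 (coordVec q i ((extChartAt (𝓡 n) q).symm y))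
      (coordVec q j ((extChartAt (𝓡 n) q).symm y))
    simp only [chartD_coordVec_eq_jac hy.2 hq, (extChartAt (𝓡 n) q).right_inv hy.1] at h
    exact h

theorem covCoord_eq (g : RMetric n N) (p : N) (f : N → ℝ) : ∀ (l : ℕ) (I : Fin l → Fin n),
    covCoord g p f l I = covE (gram g p) (f ∘ (extChartAt (𝓡 n) p).symm) l I
  | 0, I => rfl
  | l + 1, I => by
    funext y
    simp only [covCoord, covE, covCoord_eq g p f l]
    rfl

/-- A function that is smooth in every chart. -/
def SmoothFn (f : N → ℝ) : Prop :=
  ∀ p : N, ContDiffOn ℝ ∞ (f ∘ (extChartAt (𝓡 n) p).symm) (extChartAt (𝓡 n) p).target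

theorem _root_.ContMDiff.smoothFn {f : N → ℝ} (hf : ContMDiff (𝓡 n) 𝓘(ℝ, ℝ) ∞ f) :
    SmoothFn (n := n) f := fun p =>
  contMDiffOn_iff_contDiffOn.1 (hf.comp_contMDiffOn (contMDiffOn_extChartAt_symm p))

section

variable [SecondCountableTopology N] [Nonempty N]

theorem mem_source_ctr (x : N) : x ∈ (extChartAt (𝓡 n) (ctr n x)).source := by
  classical
  rw [extChartAt_source]
  exact Nat.find_spec (chartSeq_spec (n := n) x)

/-- The components of the orthonormal frame at `x` in the chart at `p`. -/
noncomputable def frameIn (g : RMetric n N) (p x : N) : Matrix (Fin n) (Fin n) ℝ :=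
  Matrix.of fun i a => chartD p x (frame g x a) i

theorem frameIn_ctr (g : RMetric n N) (x : N) : frameIn g (ctr n x) x = frameMat g x := by
  ext i a
  simp only [frameIn, frame, Matrix.of_apply, map_sum, map_smul, chartD_coordVec (mem_source_ctr x)]
  simp [Finset.sum_apply, Pi.single_apply]

theorem frameIn_eq_sum (g : RMetric n N) {p q x : N} (hp : x ∈ (extChartAt (𝓡 n) p).source)
    (hq : x ∈ (extChartAt (𝓡 n) q).source) (j a : Fin n) :
    frameIn g p x j a = ∑ i, jac (trans p q) j i (extChartAt (𝓡 n) q x) * frameIn g q x i a := by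
  simp only [frameIn, Matrix.of_apply]
  conv_lhs => rw [eq_sum_coordVec hq (frame g x a), map_sum]
  simp only [map_smul]
  rw [WithLp.ofLp_sum, Finset.sum_apply]
  simp only [PiLp.smul_apply, smul_eq_mul, chartD_coordVec_eq_jac hp hq]
  exact Finset.sum_congr rfl fun i _ => mul_comm _ _

/-- Orthonormality is a statement about `g` alone, so it passes from the chart that defines the
frame to any other chart around the point. -/
theorem isFrame_iff (g : RMetric n N) {p x : N} (hx : x ∈ (extChartAt (𝓡 n) p).source) :
    IsFrame (gram g p (extChartAt (𝓡 n) p x)) (frameIn g p x) ↔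
      ∀ a b, g.inner x (frame g x a) (frame g x b) = (1 : Matrix (Fin n) (Fin n) ℝ) a b := by
  rw [IsFrame, ← Matrix.ext_iff]
  refine forall_congr' fun a => forall_congr' fun b => ?_
  rw [inner_eq_sum g hx]
  simp only [Matrix.mul_apply, Matrix.transpose_apply, frameIn, Matrix.of_apply, Finset.sum_mul]
  rw [Finset.sum_comm]
  have : ∀ u v : ℝ, u = v → ∀ c, (u = c ↔ v = c) := fun u v h c => by rw [h]
  refine this _ _ (Finset.sum_congr rfl fun i _ => Finset.sum_congr rfl fun j _ => ?_) _
  ring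

theorem isFrame_frameMat (g : RMetric n N) (x : N) :
    IsFrame (gram g (ctr n x) (extChartAt (𝓡 n) (ctr n x) x)) (frameMat g x) := by
  have hG := gram_posDef g (ctr n x) ((extChartAt (𝓡 n) (ctr n x)).map_source (mem_source_ctr x))
  open scoped MatrixOrder Matrix.Norms.L2Operator in
  refine isFrame_of_sqrt hG.det_pos.ne'.isUnit ?_ ?_
  · have := (Matrix.nonneg_iff_posSemidef.1 (CFC.sqrt_nonneg
      (gram g (ctr n x) (extChartAt (𝓡 n) (ctr n x) x))⁻¹)).isHermitian
    ext i j
    have e := congrFun (congrFun this i) j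
    rw [Matrix.conjTranspose_apply, star_trivial] at e
    exact e
  · exact CFC.sqrt_mul_sqrt_self _ hG.inv.posSemidef.nonneg

theorem isFrame_frameIn (g : RMetric n N) {p x : N} (hx : x ∈ (extChartAt (𝓡 n) p).source) :
    IsFrame (gram g p (extChartAt (𝓡 n) p x)) (frameIn g p x) := by
  rw [isFrame_iff g hx, ← isFrame_iff g (mem_source_ctr x), frameIn_ctr]
  exact isFrame_frameMat g x

/-- The definition uses the chart selected at `x`. The Jacobians in the transformation of the tensor
are absorbed into the components of the frame, so any chart around `x` may be used, in particular
one fixed while `x` varies. -/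
theorem cov_eq (g : RMetric n N) {f : N → ℝ} (hf : SmoothFn (n := n) f) {p x : N}
    (hx : x ∈ (extChartAt (𝓡 n) p).source) (l : ℕ) (a : Fin l → Fin n) :
    cov g f l a x = tev (fun J => covE (gram g p) (f ∘ (extChartAt (𝓡 n) p).symm) l J
      (extChartAt (𝓡 n) p x)) (fun s i => frameIn g p x i (a s)) := by
  have hc := mem_source_ctr (n := n) x
  have hy := mem_overlap hx hc
  have e : trans p (ctr n x) (extChartAt (𝓡 n) (ctr n x) x) = extChartAt (𝓡 n) p x := by
    simp only [trans, (extChartAt (𝓡 n) (ctr n x)).left_inv hc]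
  have hF : ∀ y ∈ overlap n p (ctr n x), (f ∘ (extChartAt (𝓡 n) (ctr n x)).symm) y =
      (f ∘ (extChartAt (𝓡 n) p).symm) (trans p (ctr n x) y) := fun y hy => by
    simp only [Function.comp_apply, trans, (extChartAt (𝓡 n) p).left_inv hy.2]
  simp only [cov, covCoord_eq, (isPullback_trans g p (ctr n x)).covE_eq (hf p) hF l _ _ hy, e]
  refine (tev_tev (fun J => covE (gram g p) (f ∘ (extChartAt (𝓡 n) p).symm) l J
    (extChartAt (𝓡 n) p x)) (Matrix.of fun i j => jac (trans p (ctr n x)) i j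
    (extChartAt (𝓡 n) (ctr n x) x)) (fun s i => frameMat g x i (a s))).trans ?_
  congr 1
  funext s j
  rw [frameIn_eq_sum g hx hc j (a s), frameIn_ctr]
  rfl

/-- The trace over an orthonormal frame is the contraction with G⁻¹, because F Fᵀ = G⁻¹. -/
theorem lap_eq (g : RMetric n N) {f : N → ℝ} (hf : SmoothFn (n := n) f) {p x : N}
    (hx : x ∈ (extChartAt (𝓡 n) p).source) :
    lap g f x = lapE (gram g p) (f ∘ (extChartAt (𝓡 n) p).symm) (extChartAt (𝓡 n) p x) := by
  unfold lap lapE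
  congr 1
  simp only [cov_eq g hf hx]
  set C := fun J => covE (gram g p) (f ∘ (extChartAt (𝓡 n) p).symm) 2 J (extChartAt (𝓡 n) p x)
  have e : ∀ a, tev C (fun s i => frameIn g p x i (![a, a] s)) =
      ∑ i, ∑ j, frameIn g p x i a * frameIn g p x j a * C ![i, j] := by
    intro a
    rw [tev, ← (finTwoArrowEquiv (Fin n)).symm.sum_comp, Fintype.sum_prod_type]
    simp [Fin.prod_univ_two]
  simp only [e]
  rw [sum_rotate fun a i j => frameIn g p x i a * frameIn g p x j a * C ![i, j]]
  refine Finset.sum_congr rfl fun i _ => Finset.sum_congr rfl fun j _ => ?_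
  rw [← Finset.sum_mul, ← (isFrame_frameIn g hx).mul_transpose]
  rfl

theorem lap_comp_symm (g : RMetric n N) {f : N → ℝ} (hf : SmoothFn (n := n) f) (p : N) :
    EqOn (lap g f ∘ (extChartAt (𝓡 n) p).symm) (lapE (gram g p) (f ∘ (extChartAt (𝓡 n) p).symm))
      (extChartAt (𝓡 n) p).target := fun y hy => by
  rw [Function.comp_apply, lap_eq g hf ((extChartAt (𝓡 n) p).map_target hy),
    (extChartAt (𝓡 n) p).right_inv hy]

end

end Charts
end SmallEnergy

namespace SmallEnergy

/-! ### Powers of the Laplacian, tensors and measurability in charts. -/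

section ChartFormulas

variable {n : ℕ} {N : Type*} [TopologicalSpace N] [ChartedSpace (E n) N] [IsManifold (𝓡 n) ∞ N]
  [SecondCountableTopology N] [Nonempty N]

theorem SmoothFn.lap (g : RMetric n N) {f : N → ℝ} (hf : SmoothFn (n := n) f) :
    SmoothFn (n := n) (lap g f) := fun p =>
  (((isMetric_gram g p).lapE (isOpen_target p)).smooth _ (hf p)).congr (lap_comp_symm g hf p)

theorem SmoothFn.iterate_lap (g : RMetric n N) {f : N → ℝ} (hf : SmoothFn (n := n) f) :
    ∀ m, SmoothFn (n := n) ((SmallEnergy.lap g)^[m] f)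
  | 0 => hf
  | m + 1 => by
    rw [Function.iterate_succ_apply']
    exact (hf.iterate_lap g m).lap g

theorem iterate_lap_comp_symm (g : RMetric n N) {f : N → ℝ} (hf : SmoothFn (n := n) f) (p : N) :
    ∀ m, EqOn ((lap g)^[m] f ∘ (extChartAt (𝓡 n) p).symm)
      ((lapE (gram g p))^[m] (f ∘ (extChartAt (𝓡 n) p).symm)) (extChartAt (𝓡 n) p).target
  | 0 => fun _ _ => rfl
  | m + 1 => fun y hy => by
    rw [Function.iterate_succ_apply', Function.iterate_succ_apply',
      lap_comp_symm g (hf.iterate_lap g m) p hy]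
    exact ((isMetric_gram g p).lapE (isOpen_target p)).congr_on (isOpen_target p)
      (hf.iterate_lap g m p) (iterate_lap_comp_symm g hf p m) hy

theorem lapHalfSq_eq (g : RMetric n N) {f : N → ℝ} (hf : SmoothFn (n := n) f) {p x : N}
    (hx : x ∈ (extChartAt (𝓡 n) p).source) (k : ℕ) :
    lapHalfSq g k f x =
      lapHalfE (gram g p) k (f ∘ (extChartAt (𝓡 n) p).symm) (extChartAt (𝓡 n) p x) := by
  have hy := (extChartAt (𝓡 n) p).map_source hx
  unfold lapHalfSq lapHalfE
  split_ifs with h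
  · rw [← iterate_lap_comp_symm g hf p _ hy, Function.comp_apply, (extChartAt (𝓡 n) p).left_inv hx]
  · have e : ∀ i, pd i ((lapE (gram g p))^[k / 2] (f ∘ (extChartAt (𝓡 n) p).symm))
        (extChartAt (𝓡 n) p x) = pd i (((lap g)^[k / 2] f) ∘ (extChartAt (𝓡 n) p).symm)
        (extChartAt (𝓡 n) p x) := fun i =>
      pd_congr_on (isOpen_target p) (iterate_lap_comp_symm g hf p (k / 2)).symm hy i
    simp only [e]
    rw [(isFrame_frameIn g hx).quad_eq, ← (Equiv.funUnique (Fin 1) (Fin n)).symm.sum_comp]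
    refine Finset.sum_congr rfl fun a _ => ?_
    rw [cov_eq g (hf.iterate_lap g _) hx]
    congr 1
    rw [tev, ← (Equiv.funUnique (Fin 1) (Fin n)).symm.sum_comp]
    refine Finset.sum_congr rfl fun i _ => ?_
    simp [covE]

/-- The components of a tensor field in the orthonormal frame, in terms of its components in a
chart. -/
theorem tensor_frame_eq (g : RMetric n N) {l : ℕ} (A : TensorField n N l) {p x : N}
    (hx : x ∈ (extChartAt (𝓡 n) p).source) (a b : Fin l → Fin n) :
    A x (Sum.elim (fun s => frame g x (a s)) (fun s => frame g x (b s))) =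
      ∑ I : Fin l → Fin n, ∑ J : Fin l → Fin n,
        ((∏ s, frameIn g p x (I s) (a s)) * ∏ s, frameIn g p x (J s) (b s)) *
          tensorCoord A p I J (extChartAt (𝓡 n) p x) := by
  have e : ∀ I J, tensorCoord A p I J (extChartAt (𝓡 n) p x) =
      A x (Sum.elim (fun s => coordVec p (I s) x) (fun s => coordVec p (J s) x)) := fun I J =>
    congrArg (fun z => A z (Sum.elim (fun s => coordVec p (I s) z) (fun s => coordVec p (J s) z)))
      ((extChartAt (𝓡 n) p).left_inv hx)
  have h1 : (Sum.elim (fun s => frame g x (a s)) (fun s => frame g x (b s)) :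
      Fin l ⊕ Fin l → TangentSpace (𝓡 n) x) =
      fun t => ∑ i, frameIn g p x i (Sum.elim a b t) • coordVec p i x := by
    funext t
    rcases t with s | s
    · exact eq_sum_coordVec hx _
    · exact eq_sum_coordVec hx _
  rw [h1, MultilinearMap.map_sum, ← (Equiv.sumArrowEquivProdArrow _ _ _).symm.sum_comp,
    Fintype.sum_prod_type]
  refine Finset.sum_congr rfl fun I _ => Finset.sum_congr rfl fun J _ => ?_
  rw [MultilinearMap.map_smul_univ, Fintype.prod_sum_type, e, smul_eq_mul]
  congr 2
  funext t
  rcases t with s | s <;> rfl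

theorem continuousOn_frame_aux (g : RMetric n N) (p : N) :
    ContinuousOn (fun x => (gram g p (extChartAt (𝓡 n) p x))⁻¹) (extChartAt (𝓡 n) p).source := by
  refine continuousOn_pi.2 fun i => continuousOn_pi.2 fun j => ?_
  exact ((isMetric_gram g p).inv_smooth (isOpen_target p) i j).continuousOn.comp
    (continuousOn_extChartAt p) fun x hx => (extChartAt (𝓡 n) p).map_source hx

-- Continuity of the functional calculus for the square root on nonnegative matrices. Continuity is
-- enough, as the frame has only to be measurable.
open scoped MatrixOrder Matrix.Norms.L2Operator in
theorem continuousOn_sqrt_gram_inv (g : RMetric n N) (p : N) (i j : Fin n) :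
    ContinuousOn (fun x => CFC.sqrt (gram g p (extChartAt (𝓡 n) p x))⁻¹ i j)
      (extChartAt (𝓡 n) p).source := by
  have h : ContinuousOn (fun x => CFC.sqrt (gram g p (extChartAt (𝓡 n) p x))⁻¹)
      (extChartAt (𝓡 n) p).source := by
    unfold CFC.sqrt
    refine ContinuousOn.cfcₙ_nnreal_of_mem_nhdsSet (s := univ) _ Filter.univ_mem
      (continuousOn_frame_aux g p) (fun x hx => ?_) NNReal.continuous_sqrt.continuousOn (by simp)
    exact (gram_posDef g p ((extChartAt (𝓡 n) p).map_source hx)).inv.posSemidef.nonneg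
  exact (continuousOn_pi.1 (continuousOn_pi.1 h i)) j

section

variable [MeasurableSpace N] [BorelSpace N]

variable (n N) in
theorem measurableSet_chartIdx (j : ℕ) : MeasurableSet {x : N | chartIdx n x = j} := by
  classical
  have : {x : N | chartIdx n x = j} = (chartAt (E n) (chartSeq n j : N)).source \
      ⋃ i ∈ Finset.range j, (chartAt (E n) (chartSeq n i : N)).source := by
    ext x
    simp only [mem_setOf_eq, chartIdx, mem_diff, mem_iUnion, not_exists, Finset.mem_range]
    rw [Nat.find_eq_iff]
  rw [this]
  exact (chartAt (E n) (chartSeq n j : N)).open_source.measurableSet.diff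
    (Finset.measurableSet_biUnion _ fun i _ => (chartAt (E n) _).open_source.measurableSet)

/-- The selected chart jumps, but only between countably many Borel pieces, and on each piece `F`
restricts a function that is continuous on the domain of one chart. -/
theorem measurable_of_chartIdx {F : N → ℝ} (Fj : ℕ → N → ℝ)
    (hc : ∀ j, ContinuousOn (Fj j) (extChartAt (𝓡 n) (chartSeq n j : N)).source)
    (h : ∀ x, F x = Fj (chartIdx n x) x) : Measurable F := by
  intro B hB
  have e : F ⁻¹' B = ⋃ j, {x : N | chartIdx n x = j} ∩
      ((extChartAt (𝓡 n) (chartSeq n j : N)).source.indicator (Fj j)) ⁻¹' B := by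
    ext x
    simp only [mem_preimage, mem_iUnion, mem_inter_iff, mem_setOf_eq]
    have hx : x ∈ (extChartAt (𝓡 n) (chartSeq n (chartIdx n x) : N)).source := mem_source_ctr x
    constructor
    · intro hxB
      exact ⟨chartIdx n x, rfl, by rwa [indicator_of_mem hx, ← h]⟩
    · rintro ⟨j, rfl, hj⟩
      rwa [indicator_of_mem hx, ← h] at hj
  rw [e]
  refine MeasurableSet.iUnion fun j => (measurableSet_chartIdx n N j).inter ?_
  have : Measurable ((extChartAt (𝓡 n) (chartSeq n j : N)).source.indicator (Fj j)) := by
    classical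
    rw [← piecewise_eq_indicator]
    exact (hc j).measurable_piecewise continuousOn_const (isOpen_source _).measurableSet
  exact this hB

theorem measurable_cov (g : RMetric n N) {f : N → ℝ} (hf : SmoothFn (n := n) f) (l : ℕ)
    (a : Fin l → Fin n) : Measurable (cov g f l a) := by
  open scoped MatrixOrder Matrix.Norms.L2Operator in
  refine measurable_of_chartIdx (n := n) (fun j x => ∑ I : Fin l → Fin n,
    (∏ s, CFC.sqrt (gram g (chartSeq n j) (extChartAt (𝓡 n) (chartSeq n j) x))⁻¹ (I s) (a s)) *
    covCoord g (chartSeq n j) f l I (extChartAt (𝓡 n) (chartSeq n j) x)) (fun j => ?_) fun x => rfl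
  refine continuousOn_finsetSum _ fun I _ => ContinuousOn.mul ?_ ?_
  · exact continuousOn_finsetProd _ fun s _ => continuousOn_sqrt_gram_inv g _ _ _
  · rw [covCoord_eq]
    exact ((((isMetric_gram g _).covE (isOpen_target _) l I).smooth _ (hf _)).continuousOn).comp
      (continuousOn_extChartAt _) fun x hx => (extChartAt (𝓡 n) _).map_source hx

theorem measurable_jet (g : RMetric n N) {f : N → ℝ} (hf : SmoothFn (n := n) f) (k : ℕ) :
    Measurable (jet g k f) := by
  have : Measurable fun x => (fun c : JetIdx n k => cov g f c.1 c.2 x) :=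
    measurable_pi_lambda _ fun c => measurable_cov g hf _ _
  exact (WithLp.measurable_toLp 2 _).comp this

end

/-- The polarisation of `tensorQuad`. -/
noncomputable def tensorBil (g : RMetric n N) {l : ℕ} (A : TensorField n N l) (f φ : N → ℝ) (x : N) :
    ℝ :=
  ∑ a : Fin l → Fin n, ∑ b : Fin l → Fin n,
    A x (Sum.elim (fun s => frame g x (a s)) (fun s => frame g x (b s))) *
      (cov g f l a x * cov g φ l b x)

end ChartFormulas
end SmallEnergy

namespace SmallEnergy

/-! ### The Riemannian measure in charts. -/

section Volume

variable {n : ℕ} {N : Type*} [TopologicalSpace N] [ChartedSpace (E n) N] [IsManifold (𝓡 n) ∞ N]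
  [MeasurableSpace N] [BorelSpace N]

/-- The density of the Riemannian measure in a chart. -/
noncomputable def dens (G : E n → Matrix (Fin n) (Fin n) ℝ) (y : E n) : ℝ := Real.sqrt (G y).det

theorem IsMetric.dens_pos {U : Set (E n)} {G : E n → Matrix (Fin n) (Fin n) ℝ} (h : IsMetric U G)
    {y : E n} (hy : y ∈ U) : 0 < dens G y := Real.sqrt_pos.2 (h.det_pos hy)

theorem IsMetric.continuousOn_dens {U : Set (E n)} {G : E n → Matrix (Fin n) (Fin n) ℝ}
    (h : IsMetric U G) : ContinuousOn (dens G) U := by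
  refine ContinuousOn.sqrt ?_
  refine (continuous_id.matrix_det).comp_continuousOn ?_
  exact continuousOn_pi.2 fun i => continuousOn_pi.2 fun j => (h.smooth i j).continuousOn

/-- The Riemannian measure of the domain of the chart at `p`. -/
noncomputable def chartMeas (g : RMetric n N) (p : N) : Measure N :=
  ((volume.withDensity fun y => ENNReal.ofReal (dens (gram g p) y)).restrict
    (extChartAt (𝓡 n) p).target).map (extChartAt (𝓡 n) p).symm

theorem aemeasurable_symm (p : N) (μ : Measure (E n)) :
    AEMeasurable (extChartAt (𝓡 n) p).symm (μ.restrict (extChartAt (𝓡 n) p).target) :=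
  (continuousOn_extChartAt_symm p).aemeasurable (isOpen_target p).measurableSet

theorem measurableSet_target_inter (p : N) {S : Set N} (hS : MeasurableSet S) :
    MeasurableSet ((extChartAt (𝓡 n) p).target ∩ (extChartAt (𝓡 n) p).symm ⁻¹' S) := by
  have h := (continuousOn_iff_continuous_restrict.1 (continuousOn_extChartAt_symm (I := 𝓡 n) p)).measurable
  have h2 := (isOpen_target (n := n) p).measurableSet.subtype_image (h hS)
  convert h2 using 1
  ext y
  simp [and_comm]

theorem chartMeas_apply (g : RMetric n N) (p : N) {S : Set N} (hS : MeasurableSet S) :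
    chartMeas g p S = ∫⁻ y in (extChartAt (𝓡 n) p).target ∩ (extChartAt (𝓡 n) p).symm ⁻¹' S,
      ENNReal.ofReal (dens (gram g p) y) := by
  have hm := measurableSet_target_inter (n := n) p hS
  rw [chartMeas, Measure.map_apply_of_aemeasurable (aemeasurable_symm p _) hS,
    Measure.restrict_apply' (isOpen_target p).measurableSet, inter_comm, withDensity_apply _ hm]

theorem det_fderiv_trans (p q : N) {y : E n} (hy : y ∈ overlap n p q) :
    (fderiv ℝ (trans (n := n) p q) y).det = (Matrix.of fun a i => jac (trans (n := n) p q) a i y).det := by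
  have hd : DifferentiableAt ℝ (trans (n := n) p q) y :=
    ((contDiffOn_trans p q).contDiffAt ((isOpen_overlap p q).mem_nhds hy)).differentiableAt (by simp)
  rw [ContinuousLinearMap.det, ← LinearMap.det_toMatrix (EuclideanSpace.basisFun (Fin n) ℝ).toBasis]
  congr 1
  ext a i
  rw [LinearMap.toMatrix_apply]
  have h := ((EuclideanSpace.proj a : E n →L[ℝ] ℝ).hasFDerivAt.comp _ hd.hasFDerivAt).fderiv
  have e : (fun z => trans p q z a) = (EuclideanSpace.proj a : E n →L[ℝ] ℝ) ∘ trans p q := rfl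
  simp only [Matrix.of_apply, jac, pd, e, h]
  simp

/-- Taking determinants in G = Tᵀ H T gives det G = (det T)² det H. -/
theorem dens_trans (g : RMetric n N) (p q : N) {y : E n} (hy : y ∈ overlap n p q) :
    dens (gram g q) y = |(fderiv ℝ (trans (n := n) p q) y).det| * dens (gram g p) (trans p q y) := by
  set T : Matrix (Fin n) (Fin n) ℝ := Matrix.of fun a i => jac (trans (n := n) p q) a i y with hT
  have h : gram g q y = T.transpose * gram g p (trans p q y) * T := by
    ext i j
    rw [(isPullback_trans g p q).eq y hy i j]
    simp only [Matrix.mul_apply, Matrix.transpose_apply, hT, Matrix.of_apply, Finset.sum_mul]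
    rw [Finset.sum_comm]
    refine Finset.sum_congr rfl fun a _ => Finset.sum_congr rfl fun b _ => ?_
    ring
  rw [det_fderiv_trans p q hy, dens, dens, h, Matrix.det_mul, Matrix.det_mul, Matrix.det_transpose,
    mul_right_comm, ← sq, Real.sqrt_mul (sq_nonneg _), Real.sqrt_sq_eq_abs]

/-- The change of variables formula for the transition map, whose Jacobian determinant is exactly
the quotient of the two densities. -/
theorem chartMeas_eq (g : RMetric n N) {p q : N} {S : Set N} (hS : MeasurableSet S)
    (hp : S ⊆ (extChartAt (𝓡 n) p).source) (hq : S ⊆ (extChartAt (𝓡 n) q).source) :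
    chartMeas g p S = chartMeas g q S := by
  rw [chartMeas_apply g p hS, chartMeas_apply g q hS]
  set s := (extChartAt (𝓡 n) q).target ∩ (extChartAt (𝓡 n) q).symm ⁻¹' S with hs
  have hsub : s ⊆ overlap n p q := fun y hy => ⟨hy.1, hp hy.2⟩
  have himg : (extChartAt (𝓡 n) p).target ∩ (extChartAt (𝓡 n) p).symm ⁻¹' S = trans p q '' s := by
    ext z
    constructor
    · rintro ⟨hz, hzS⟩
      refine ⟨extChartAt (𝓡 n) q ((extChartAt (𝓡 n) p).symm z),
        ⟨(extChartAt (𝓡 n) q).map_source (hq hzS), ?_⟩, ?_⟩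
      · rw [mem_preimage, (extChartAt (𝓡 n) q).left_inv (hq hzS)]
        exact hzS
      · rw [trans, (extChartAt (𝓡 n) q).left_inv (hq hzS), (extChartAt (𝓡 n) p).right_inv hz]
    · rintro ⟨y, hy, rfl⟩
      refine ⟨mapsTo_trans p q (hsub hy), ?_⟩
      rw [mem_preimage, trans, (extChartAt (𝓡 n) p).left_inv (hp hy.2)]
      exact hy.2
  have hinj : InjOn (trans (n := n) p q) s := by
    intro y hy z hz hyz
    have := (extChartAt (𝓡 n) p).injOn (hp hy.2) (hp hz.2) hyz
    exact (extChartAt (𝓡 n) q).symm.injOn hy.1 hz.1 this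
  have hm : MeasurableSet s := measurableSet_target_inter q hS
  rw [himg, lintegral_image_eq_lintegral_abs_det_fderiv_mul volume hm (fun y hy =>
    (((contDiffOn_trans p q).contDiffAt ((isOpen_overlap p q).mem_nhds
      (hsub hy))).differentiableAt (by simp)).hasFDerivAt.hasFDerivWithinAt) hinj]
  refine setLIntegral_congr_fun hm fun y hy => ?_
  rw [dens_trans g p q (hsub hy), ENNReal.ofReal_mul (abs_nonneg _)]

variable [SecondCountableTopology N] [Nonempty N]

/-- Cut `S` along the pieces used to define the measure; each piece can be measured in the chart at
`p` instead, and the pieces reassemble to `S`. -/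
theorem vol_apply (g : RMetric n N) {p : N} {S : Set N} (hS : MeasurableSet S)
    (hp : S ⊆ (extChartAt (𝓡 n) p).source) : vol g S = chartMeas g p S := by
  have hm : ∀ j, MeasurableSet (S ∩ {x : N | chartIdx n x = j}) := fun j =>
    hS.inter (measurableSet_chartIdx n N j)
  have h1 : ∀ j : ℕ, (chartMeas g (chartSeq n j)).restrict {x : N | chartIdx n x = j} S =
      chartMeas g p (S ∩ {x : N | chartIdx n x = j}) := fun j => by
    rw [Measure.restrict_apply hS]
    refine chartMeas_eq g (hm j) ?_ (inter_subset_left.trans hp)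
    rintro x ⟨-, rfl⟩
    exact mem_source_ctr x
  calc vol g S = ∑' j, (chartMeas g (chartSeq n j)).restrict {x : N | chartIdx n x = j} S :=
        Measure.sum_apply _ hS
    _ = ∑' j, chartMeas g p (S ∩ {x : N | chartIdx n x = j}) := tsum_congr h1
    _ = chartMeas g p (⋃ j, S ∩ {x : N | chartIdx n x = j}) := by
        refine (measure_iUnion ?_ hm).symm
        intro i j hij
        rw [Function.onFun, disjoint_left]
        rintro x ⟨-, rfl⟩ ⟨-, h⟩
        exact hij h
    _ = _ := by
        congr 1
        ext x
        simp

theorem vol_restrict_source (g : RMetric n N) (p : N) :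
    (vol g).restrict (extChartAt (𝓡 n) p).source = chartMeas g p := by
  have ho := (isOpen_source (n := n) p).measurableSet
  ext S hS
  rw [Measure.restrict_apply hS, vol_apply g (hS.inter ho) inter_subset_right,
    chartMeas_apply g p (hS.inter ho), chartMeas_apply g p hS]
  congr 2
  ext y
  simp only [mem_inter_iff, mem_preimage]
  exact ⟨fun h => ⟨h.1, h.2.1⟩, fun h => ⟨h.1, h.2, (extChartAt (𝓡 n) p).map_target h.1⟩⟩

theorem aemeasurable_dens (g : RMetric n N) (p : N) :
    AEMeasurable (fun y => ENNReal.ofReal (dens (gram g p) y))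
      (volume.restrict (extChartAt (𝓡 n) p).target) :=
  ((isMetric_gram g p).continuousOn_dens.aemeasurable (isOpen_target p).measurableSet).ennreal_ofReal

theorem setIntegral_source (g : RMetric n N) (p : N) {F : N → ℝ}
    (hF : AEStronglyMeasurable F (vol g)) :
    ∫ x in (extChartAt (𝓡 n) p).source, F x ∂(vol g) =
      ∫ y in (extChartAt (𝓡 n) p).target, dens (gram g p) y * F ((extChartAt (𝓡 n) p).symm y) := by
  have h := hF.mono_measure (Measure.restrict_le_self (s := (extChartAt (𝓡 n) p).source))
  rw [vol_restrict_source] at h ⊢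
  rw [chartMeas, integral_map (aemeasurable_symm p _) h,
    restrict_withDensity (isOpen_target p).measurableSet,
    integral_withDensity_eq_integral_toReal_smul₀ (aemeasurable_dens g p) (by simp)]
  refine setIntegral_congr_fun (isOpen_target p).measurableSet fun y hy => ?_
  simp only [smul_eq_mul, ENNReal.toReal_ofReal ((isMetric_gram g p).dens_pos hy).le]

/-- Both measures have positive densities in charts. The comparison is needed because Sobolev
classes are defined up to null sets of the background metric, while the functionals integrate
against the others. -/
theorem absolutelyContinuous_vol (g g' : RMetric n N) : vol g ≪ vol g' := by
  refine Measure.AbsolutelyContinuous.mk fun S hS h0 => ?_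
  have hm : ∀ j, MeasurableSet (S ∩ {x : N | chartIdx n x = j}) := fun j =>
    hS.inter (measurableSet_chartIdx n N j)
  have hsrc : ∀ j, S ∩ {x : N | chartIdx n x = j} ⊆ (extChartAt (𝓡 n) (chartSeq n j : N)).source := by
    rintro j x ⟨-, rfl⟩
    exact mem_source_ctr x
  have e : S = ⋃ j, S ∩ {x : N | chartIdx n x = j} := by ext x; simp
  rw [e]
  refine measure_iUnion_null fun j => ?_
  have h1 : vol g' (S ∩ {x : N | chartIdx n x = j}) = 0 := measure_mono_null inter_subset_left h0
  rw [vol_apply _ (hm j) (hsrc j), chartMeas_apply _ _ (hm j)] at h1 ⊢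
  have hmm := measurableSet_target_inter (n := n) (chartSeq n j : N) (hm j)
  rw [lintegral_eq_zero_iff' ((aemeasurable_dens g' _).mono_set inter_subset_left),
    Filter.EventuallyEq, ae_restrict_iff' hmm] at h1
  refine setLIntegral_measure_zero _ _ (measure_mono_null (fun y hy => ?_) h1)
  simp only [mem_compl_iff, mem_setOf_eq, Pi.zero_apply, ENNReal.ofReal_eq_zero, not_forall, not_le]
  exact ⟨hy, (isMetric_gram g' _).dens_pos hy.1⟩

end Volume
end SmallEnergy

namespace SmallEnergy

/-! ### Bilinear differential forms with converging coefficients. -/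

section BilinearForms

variable {n : ℕ} {U L : Set (E n)}

/-- Bilinear differential forms `∑ c_{ab} (T_a u) (T_b v)`. -/
def bil {m : ℕ} (c : Fin m → Fin m → E n → ℝ) (T : Fin m → (E n → ℝ) → E n → ℝ) (u v : E n → ℝ)
    (y : E n) : ℝ := ∑ a, ∑ b, c a b y * (T a u y * T b v y)

/-- Converging sequences of symmetric bilinear differential forms of order `k`. -/
structure BilTendsto (U : Set (E n)) (k : ℕ) {m : ℕ} (c : ℕ → Fin m → Fin m → E n → ℝ)
    (c' : Fin m → Fin m → E n → ℝ) (T : ℕ → Fin m → (E n → ℝ) → E n → ℝ)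
    (T' : Fin m → (E n → ℝ) → E n → ℝ) : Prop where
  coeff : ∀ a b, SmoothTendsto U (fun i => c i a b) (c' a b)
  op : ∀ a, DiffOpTendsto U k (fun i => T i a) (T' a)
  symm : ∀ i a b, ∀ y ∈ U, c i a b y = c i b a y
  symm' : ∀ a b, ∀ y ∈ U, c' a b y = c' b a y

variable {G : ℕ → E n → Matrix (Fin n) (Fin n) ℝ} {H : E n → Matrix (Fin n) (Fin n) ℝ}

/-- Removes the case distinction on the parity of `k`. For even `k` a single operator Δ^{k/2} with
coefficient 1 suffices; for odd `k` one takes the `n` operators ∂_a Δ^{(k-1)/2} with coefficients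
G^{ab}. -/
theorem exists_bil_lapHalfE (hU : IsOpen U) (h : MetricConv U G H) (k : ℕ) :
    ∃ (m : ℕ) (c : ℕ → Fin m → Fin m → E n → ℝ) (c' : Fin m → Fin m → E n → ℝ)
      (T : ℕ → Fin m → (E n → ℝ) → E n → ℝ) (T' : Fin m → (E n → ℝ) → E n → ℝ),
      BilTendsto U k c c' T T' ∧ (∀ i v y, lapHalfE (G i) k v y = bil (c i) (T i) v v y) ∧
        ∀ v y, lapHalfE H k v y = bil c' T' v v y := by
  have hit := (h.lapE hU).iterate hU (k / 2)
  by_cases hk : Even k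
  · refine ⟨1, fun _ _ _ _ => 1, fun _ _ _ => 1, fun i _ => (lapE (G i))^[k / 2],
      fun _ => (lapE H)^[k / 2], ⟨fun _ _ => SmoothTendsto.const contDiffOn_const,
      fun _ => hit.mono (by lia), fun _ _ _ _ _ => rfl, fun _ _ _ _ => rfl⟩, fun i v y => ?_,
      fun v y => ?_⟩ <;> simp [bil, lapHalfE, hk, sq]
  · refine ⟨n, fun i a b y => (G i y)⁻¹ a b, fun a b y => (H y)⁻¹ a b,
      fun i a v => pd a ((lapE (G i))^[k / 2] v), fun a v => pd a ((lapE H)^[k / 2] v),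
      ⟨fun a b => h.inv hU a b, fun a => ((DiffOpTendsto.const (IsDiffOp.pd hU a)).comp hU hit).mono ?_,
        fun i a b y hy => ?_, fun a b y hy => ?_⟩, fun i v y => ?_, fun v y => ?_⟩
    · rw [Nat.not_even_iff] at hk
      lia
    · have := congrFun (congrFun ((h.metric i).posDef y hy).inv.isHermitian b) a
      rw [Matrix.conjTranspose_apply, star_trivial] at this
      exact this
    · have := congrFun (congrFun (h.lim.posDef y hy).inv.isHermitian b) a
      rw [Matrix.conjTranspose_apply, star_trivial] at this
      exact this
    · simp [bil, lapHalfE, hk]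
    · simp [bil, lapHalfE, hk]

variable {k m : ℕ} {c : ℕ → Fin m → Fin m → E n → ℝ} {c' : Fin m → Fin m → E n → ℝ}
  {T : ℕ → Fin m → (E n → ℝ) → E n → ℝ} {T' : Fin m → (E n → ℝ) → E n → ℝ}

theorem bil_add_mul_left {d : Fin m → Fin m → E n → ℝ} {S : Fin m → (E n → ℝ) → E n → ℝ}
    (hS : ∀ a, IsDiffOp U k (S a)) {u u' : E n → ℝ} (hu : ContDiffOn ℝ ∞ u U)
    (hu' : ContDiffOn ℝ ∞ u' U) (t : ℝ) (v : E n → ℝ) {y : E n} (hy : y ∈ U) :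
    bil d S (fun z => u z + t * u' z) v y = bil d S u v y + t * bil d S u' v y := by
  simp only [bil, Finset.mul_sum, ← Finset.sum_add_distrib]
  refine Finset.sum_congr rfl fun a _ => Finset.sum_congr rfl fun b _ => ?_
  rw [(hS a).lin u u' hu hu' t y hy]
  ring

theorem bil_comm {d : Fin m → Fin m → E n → ℝ} {S : Fin m → (E n → ℝ) → E n → ℝ} {y : E n}
    (hd : ∀ a b, d a b y = d b a y) (u v : E n → ℝ) : bil d S u v y = bil d S v u y := by
  simp only [bil]
  rw [Finset.sum_comm]
  refine Finset.sum_congr rfl fun a _ => Finset.sum_congr rfl fun b _ => ?_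
  rw [hd b a]
  ring

theorem bil_congr_left (hU : IsOpen U) {d : Fin m → Fin m → E n → ℝ} {S : Fin m → (E n → ℝ) → E n → ℝ}
    (hS : ∀ a, IsDiffOp U k (S a)) {u u' : E n → ℝ} (hu : ContDiffOn ℝ ∞ u U)
    (hu' : ContDiffOn ℝ ∞ u' U) {y : E n} (hy : y ∈ U) (h : u =ᶠ[𝓝 y] u') (v : E n → ℝ) :
    bil d S u v y = bil d S u' v y := by
  have e : ∀ a, S a u y = S a u' y := fun a => by
    refine (hS a).eq_of_jetNorm_sub_eq_zero hu hu' hy ?_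
    rw [jetNorm_congr (g := fun _ => (0 : ℝ)) (by filter_upwards [h] with z hz; simp [hz])]
    simp
  simp only [bil, e]

theorem BilTendsto.bound (hU : IsOpen U) (h : BilTendsto U k c c' T T') (hLU : L ⊆ U)
    (hL : IsCompact L) : ∃ C : ℝ, 0 ≤ C ∧ ∀ u v, ContDiffOn ℝ ∞ u U → ContDiffOn ℝ ∞ v U → ∀ y ∈ L,
      |bil c' T' u v y| ≤ C * (jetNorm (k + 1) u y * jetNorm (k + 1) v y) := by
  have h1 := fun a b => exists_bound_abs hU (h.coeff a b).lim hLU hL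
  have h2 := fun a => (h.op a).lim.bound 1 L hLU hL
  choose C hC0 hC using h1
  choose D hD0 hD using h2
  refine ⟨∑ a, ∑ b, C a b * (D a * D b), Finset.sum_nonneg fun a _ => Finset.sum_nonneg fun b _ =>
    mul_nonneg (hC0 a b) (mul_nonneg (hD0 a) (hD0 b)), fun u v hu hv y hy => ?_⟩
  unfold bil
  refine (Finset.abs_sum_le_sum_abs _ _).trans ?_
  rw [Finset.sum_mul]
  refine Finset.sum_le_sum fun a _ => (Finset.abs_sum_le_sum_abs _ _).trans ?_
  rw [Finset.sum_mul]
  refine Finset.sum_le_sum fun b _ => ?_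
  have e1 := hD a u hu y hy
  have e2 := hD b v hv y hy
  rw [jetNorm_one, add_comm 1 k] at e1 e2
  rw [abs_mul, abs_mul]
  calc _ ≤ C a b * ((D a * jetNorm (k + 1) u y) * (D b * jetNorm (k + 1) v y)) := by
        refine mul_le_mul (hC a b y hy) ?_ (by positivity) (hC0 a b)
        exact mul_le_mul e1 e2 (abs_nonneg _) (mul_nonneg (hD0 a) (jetNorm_nonneg _ _ _))
    _ = _ := by ring

/-- Telescoping, one factor at a time; `δ ≤ 1` keeps x and y below (C + 1) X and (C + 1) Y. -/
theorem abs_mul_mul_sub_le {c c' x x' y y' δ C X Y : ℝ} (hδ : δ ≤ 1) (hδ0 : 0 ≤ δ) (hC : 0 ≤ C)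
    (hX : 0 ≤ X) (hY : 0 ≤ Y) (h1 : |c - c'| ≤ δ) (h2 : |x - x'| ≤ δ * X) (h3 : |y - y'| ≤ δ * Y)
    (hc' : |c'| ≤ C) (hx' : |x'| ≤ C * X) (hy' : |y'| ≤ C * Y) :
    |c * (x * y) - c' * (x' * y')| ≤ δ * (3 * (C + 1) ^ 2) * (X * Y) := by
  have e : c * (x * y) - c' * (x' * y') =
      (c - c') * (x * y) + c' * ((x - x') * y) + c' * (x' * (y - y')) := by ring
  have hx : |x| ≤ (C + 1) * X := by
    have : |x| ≤ |x - x'| + |x'| := by simpa using abs_add_le (x - x') x'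
    nlinarith
  have hy : |y| ≤ (C + 1) * Y := by
    have : |y| ≤ |y - y'| + |y'| := by simpa using abs_add_le (y - y') y'
    nlinarith
  have t1 : |(c - c') * (x * y)| ≤ δ * (((C + 1) * X) * ((C + 1) * Y)) := by
    rw [abs_mul, abs_mul]
    exact mul_le_mul h1 (mul_le_mul hx hy (abs_nonneg _) (by positivity)) (by positivity) hδ0
  have t2 : |c' * ((x - x') * y)| ≤ (C + 1) * ((δ * X) * ((C + 1) * Y)) := by
    rw [abs_mul, abs_mul]
    exact mul_le_mul (by linarith) (mul_le_mul h2 hy (abs_nonneg _) (by positivity)) (by positivity)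
      (by positivity)
  have t3 : |c' * (x' * (y - y'))| ≤ (C + 1) * ((C + 1) * X * (δ * Y)) := by
    rw [abs_mul, abs_mul]
    exact mul_le_mul (by linarith) (mul_le_mul (hx'.trans (by nlinarith)) h3 (abs_nonneg _)
      (by positivity)) (by positivity) (by positivity)
  rw [e]
  refine (abs_add_le _ _).trans ((add_le_add (abs_add_le _ _) le_rfl).trans ?_)
  calc _ ≤ δ * (((C + 1) * X) * ((C + 1) * Y)) + (C + 1) * ((δ * X) * ((C + 1) * Y)) +
        (C + 1) * ((C + 1) * X * (δ * Y)) := add_le_add (add_le_add t1 t2) t3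
    _ = _ := by ring

theorem BilTendsto.conv (hU : IsOpen U) (h : BilTendsto U k c c' T T') (hLU : L ⊆ U)
    (hL : IsCompact L) {ε : ℝ} (hε : 0 < ε) : ∀ᶠ i in atTop, ∀ u v, ContDiffOn ℝ ∞ u U →
      ContDiffOn ℝ ∞ v U → ∀ y ∈ L, |bil (c i) (T i) u v y - bil c' T' u v y| ≤
        ε * (jetNorm (k + 1) u y * jetNorm (k + 1) v y) := by
  have h1 := fun a b => exists_bound_abs hU (h.coeff a b).lim hLU hL
  have h2 := fun a => (h.op a).lim.bound 1 L hLU hL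
  choose C hC0 hC using h1
  choose D hD0 hD using h2
  set M : ℝ := (∑ a, ∑ b, C a b) + ∑ a, D a with hM
  have hM0 : 0 ≤ M := add_nonneg (Finset.sum_nonneg fun a _ => Finset.sum_nonneg fun b _ => hC0 a b)
    (Finset.sum_nonneg fun a _ => hD0 a)
  have hCM : ∀ a b, C a b ≤ M := fun a b => by
    have e1 := Finset.single_le_sum (f := fun b => C a b) (fun b _ => hC0 a b) (Finset.mem_univ b)
    have e2 := Finset.single_le_sum (f := fun a => ∑ b, C a b)
      (fun a _ => Finset.sum_nonneg fun b _ => hC0 a b) (Finset.mem_univ a)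
    have e3 : 0 ≤ ∑ a, D a := Finset.sum_nonneg fun a _ => hD0 a
    linarith
  have hDM : ∀ a, D a ≤ M := fun a => by
    have e1 := Finset.single_le_sum (f := D) (fun b _ => hD0 b) (Finset.mem_univ a)
    have e3 : 0 ≤ ∑ a, ∑ b, C a b := Finset.sum_nonneg fun a _ => Finset.sum_nonneg fun b _ => hC0 a b
    linarith
  -- `m * m` counts the summands, `3 * (M + 1) ^ 2` is the telescoping constant, and the final 1
  -- makes `K` positive.
  set K : ℝ := m * m * (3 * (M + 1) ^ 2) + 1 with hK
  have hK0 : 0 < K := by positivity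
  set δ : ℝ := min 1 (ε / K) with hδ
  have hδ0 : 0 < δ := lt_min one_pos (div_pos hε hK0)
  have ev : ∀ᶠ i in atTop, (∀ a b, ∀ y ∈ L, |c i a b y - c' a b y| ≤ δ) ∧
      ∀ a, ∀ f, ContDiffOn ℝ ∞ f U → ∀ y ∈ L, |T i a f y - T' a f y| ≤ δ * jetNorm (k + 1) f y := by
    refine (eventually_all.2 fun a => eventually_all.2 fun b => ?_).and (eventually_all.2 fun a => ?_)
    · filter_upwards [(h.coeff a b).conv 1 L hLU hL δ hδ0] with i hi y hy
      rw [← jetNorm_one (fun z => c i a b z - c' a b z)]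
      exact hi y hy
    · filter_upwards [(h.op a).conv 1 L hLU hL δ hδ0] with i hi f hf y hy
      have := hi f hf y hy
      rwa [jetNorm_one, add_comm 1 k] at this
  filter_upwards [ev] with i hi u v hu hv y hy
  have hX := jetNorm_nonneg (k + 1) u y
  have hY := jetNorm_nonneg (k + 1) v y
  have key : ∀ a b, |c i a b y * (T i a u y * T i b v y) - c' a b y * (T' a u y * T' b v y)| ≤
      δ * (3 * (M + 1) ^ 2) * (jetNorm (k + 1) u y * jetNorm (k + 1) v y) := fun a b => by
    have e1 := hD a u hu y hy
    have e2 := hD b v hv y hy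
    rw [jetNorm_one, add_comm 1 k] at e1 e2
    exact abs_mul_mul_sub_le (min_le_left _ _) hδ0.le hM0 hX hY (hi.1 a b y hy) (hi.2 a u hu y hy)
      (hi.2 b v hv y hy) ((hC a b y hy).trans (hCM a b))
      (e1.trans (mul_le_mul_of_nonneg_right (hDM a) hX))
      (e2.trans (mul_le_mul_of_nonneg_right (hDM b) hY))
  unfold bil
  simp only [← Finset.sum_sub_distrib]
  calc _ ≤ ∑ a : Fin m, ∑ b : Fin m, δ * (3 * (M + 1) ^ 2) *
        (jetNorm (k + 1) u y * jetNorm (k + 1) v y) :=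
        (Finset.abs_sum_le_sum_abs _ _).trans (Finset.sum_le_sum fun a _ =>
          (Finset.abs_sum_le_sum_abs _ _).trans (Finset.sum_le_sum fun b _ => key a b))
    _ = δ * (m * m * (3 * (M + 1) ^ 2)) * (jetNorm (k + 1) u y * jetNorm (k + 1) v y) := by
        simp; ring
    _ ≤ ε * (jetNorm (k + 1) u y * jetNorm (k + 1) v y) := by
        refine mul_le_mul_of_nonneg_right ?_ (mul_nonneg hX hY)
        calc δ * (m * m * (3 * (M + 1) ^ 2)) ≤ (ε / K) * K :=
              mul_le_mul (min_le_right _ _) (by rw [hK]; linarith) (by positivity) (by positivity)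
          _ = ε := div_mul_cancel₀ _ hK0.ne'

/-- Moving a cut-off function from one argument to the other costs lower order terms. -/
theorem BilTendsto.comm (hU : IsOpen U) (h : BilTendsto U k c c' T T') (hLU : L ⊆ U)
    (hL : IsCompact L) {η : E n → ℝ} (hη : ContDiffOn ℝ ∞ η U) :
    ∃ C : ℝ, 0 ≤ C ∧ ∀ u v, ContDiffOn ℝ ∞ u U → ContDiffOn ℝ ∞ v U → ∀ y ∈ L,
      |bil c' T' u (fun z => η z * v z) y - bil c' T' (fun z => η z * u z) v y| ≤
        C * (jetNorm k u y * jetNorm (k + 1) v y + jetNorm (k + 1) u y * jetNorm k v y) := by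
  have h1 := fun a b => exists_bound_abs hU (h.coeff a b).lim hLU hL
  have h2 := fun a => (h.op a).lim.bound 1 L hLU hL
  have h3 := fun a => (h.op a).lim.comm η hη 0 L hLU hL
  choose C hC0 hC using h1
  choose D hD0 hD using h2
  choose K hK0 hK using h3
  refine ⟨∑ a, ∑ b, C a b * (D a * K b + K a * D b), Finset.sum_nonneg fun a _ =>
    Finset.sum_nonneg fun b _ => mul_nonneg (hC0 a b) (add_nonneg (mul_nonneg (hD0 a) (hK0 b))
      (mul_nonneg (hK0 a) (hD0 b))), fun u v hu hv y hy => ?_⟩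
  unfold bil
  simp only [← Finset.sum_sub_distrib]
  rw [Finset.sum_mul]
  refine (Finset.abs_sum_le_sum_abs _ _).trans (Finset.sum_le_sum fun a _ => ?_)
  rw [Finset.sum_mul]
  refine (Finset.abs_sum_le_sum_abs _ _).trans (Finset.sum_le_sum fun b _ => ?_)
  have e1 := hD a u hu y hy
  have e2 := hD b v hv y hy
  have e3 := hK a u hu y hy
  have e4 := hK b v hv y hy
  rw [zero_add, zero_add] at e3 e4
  rw [jetNorm_one, add_comm 1 k] at e1 e2
  rw [jetNorm_one] at e3 e4
  have f1 := jetNorm_nonneg k u y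
  have f2 := jetNorm_nonneg k v y
  have f3 := jetNorm_nonneg (k + 1) u y
  have f4 := jetNorm_nonneg (k + 1) v y
  rw [← mul_sub, abs_mul, mul_assoc]
  refine mul_le_mul (hC a b y hy) ?_ (abs_nonneg _) (hC0 a b)
  -- The difference is T_a u [T_b, η] v - [T_a, η] u T_b v, and each product contains a commutator
  -- of order k - 1.
  have e : T' a u y * T' b (fun z => η z * v z) y - T' a (fun z => η z * u z) y * T' b v y =
      T' a u y * (T' b (fun z => η z * v z) y - η y * T' b v y) -
        (T' a (fun z => η z * u z) y - η y * T' a u y) * T' b v y := by ring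
  rw [e]
  refine (abs_sub _ _).trans ?_
  rw [abs_mul, abs_mul]
  calc _ ≤ (D a * jetNorm (k + 1) u y) * (K b * jetNorm k v y) +
        (K a * jetNorm k u y) * (D b * jetNorm (k + 1) v y) :=
        add_le_add (mul_le_mul e1 e4 (abs_nonneg _) (mul_nonneg (hD0 a) f3))
          (mul_le_mul e3 e2 (abs_nonneg _) (mul_nonneg (hK0 a) f1))
    _ ≤ _ := by
      have p1 : 0 ≤ D a * K b * (jetNorm k u y * jetNorm (k + 1) v y) :=
        mul_nonneg (mul_nonneg (hD0 a) (hK0 b)) (mul_nonneg f1 f4)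
      have p2 : 0 ≤ K a * D b * (jetNorm (k + 1) u y * jetNorm k v y) :=
        mul_nonneg (mul_nonneg (hK0 a) (hD0 b)) (mul_nonneg f3 f2)
      nlinarith

end BilinearForms
end SmallEnergy

namespace SmallEnergy

/-! ### Weakly null sequences and elementary inequalities for powers. -/

section Estimates

variable {n : ℕ} {U L : Set (E n)} {G : ℕ → E n → Matrix (Fin n) (Fin n) ℝ}
  {H : E n → Matrix (Fin n) (Fin n) ℝ}

theorem IsBumpOn.add_mul {u v : E n → ℝ} (hu : IsBumpOn L u) (hv : IsBumpOn L v) (c : ℝ) :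
    IsBumpOn L (fun z => u z + c * v z) := by
  refine ⟨hu.smooth.add (contDiff_const.mul hv.smooth), ?_⟩
  refine (tsupport_add u (fun z => c * v z)).trans (union_subset hu.supp ?_)
  exact (tsupport_mul_subset_right (f := fun _ => c) (g := v)).trans hv.supp

theorem IsBumpOn.sub {u v : E n → ℝ} (hu : IsBumpOn L u) (hv : IsBumpOn L v) :
    IsBumpOn L (fun z => u z - v z) := by
  have := hu.add_mul hv (-1)
  simpa [sub_eq_add_neg] using this

theorem IsBumpOn.mul {u v : E n → ℝ} (hu : ContDiff ℝ ∞ u) (hv : IsBumpOn L v) :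
    IsBumpOn L (fun z => u z * v z) :=
  ⟨hu.mul hv.smooth, (tsupport_mul_subset_right (f := u) (g := v)).trans hv.supp⟩

theorem sobSq_eq_setIntegral {v : E n → ℝ} (hv : IsBumpOn L v) (m : ℕ) :
    sobSq m v = ∫ y in L, (jetNorm m v y) ^ 2 := by
  rw [setIntegral_eq_integral_of_forall_compl_eq_zero]
  · rfl
  · intro y hy
    simp [hv.jetNorm_eq_zero hy]

theorem setIntegral_jetNorm_mul_le (hL : IsCompact L) {u v : E n → ℝ} (hu : IsBumpOn L u)
    (hv : IsBumpOn L v) (a b : ℕ) :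
    ∫ y in L, jetNorm a u y * jetNorm b v y ≤ √(sobSq a u) * √(sobSq b v) := by
  have hm : ∀ {w : E n → ℝ} (_ : IsBumpOn L w) (a : ℕ),
      MemLp (jetNorm a w) (ENNReal.ofReal 2) (volume.restrict L) := fun hw a => by
    have h1 : MemLp (jetNorm a _) 2 volume :=
      (hw.continuous_jetNorm a).memLp_of_hasCompactSupport
        (HasCompactSupport.intro hL fun y hy => hw.jetNorm_eq_zero hy a)
    simpa using h1.restrict L
  have h := integral_mul_le_Lp_mul_Lq_of_nonneg (μ := volume.restrict L) Real.HolderConjugate.two_two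
    (Eventually.of_forall fun y => jetNorm_nonneg a u y)
    (Eventually.of_forall fun y => jetNorm_nonneg b v y) (hm hu a) (hm hv b)
  rw [sobSq_eq_setIntegral hu, sobSq_eq_setIntegral hv, Real.sqrt_eq_rpow, Real.sqrt_eq_rpow]
  simpa using h

theorem exists_sobSq_mul_le (hL : IsCompact L) {η : E n → ℝ} (hη : ContDiff ℝ ∞ η) (m : ℕ) :
    ∃ C : ℝ, 0 ≤ C ∧ ∀ v, IsBumpOn L v → sobSq m (fun z => η z * v z) ≤ C * sobSq m v := by
  obtain ⟨D, hD0, hD⟩ := exists_jetNorm_le isOpen_univ hη.contDiffOn (subset_univ L) hL m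
  refine ⟨(m * 2 ^ m * m * D) ^ 2, by positivity, fun v hv => ?_⟩
  have hP : IsBumpOn L (fun z : E n => η z * v z) := IsBumpOn.mul (u := η) hη hv
  have := sobSq_le_of_bound (P := fun (v : E n → ℝ) z => η z * v z) (C := m * 2 ^ m * m * D) (m := m)
    (r := 0) hL hv hP fun y hy => by
      refine (jetNorm_mul_le isOpen_univ hη.contDiffOn hv.smooth.contDiffOn (mem_univ y) m).trans ?_
      have h0 : (0 : ℝ) ≤ m * 2 ^ m * m := by positivity
      calc _ ≤ (m * 2 ^ m * m : ℝ) * (D * jetNorm m v y) := mul_le_mul_of_nonneg_left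
            (mul_le_mul_of_nonneg_right (hD y hy) (jetNorm_nonneg _ _ _)) h0
        _ = _ := by rw [add_zero]; ring
  simpa using this

/-- Sequences on which all bounded linear functionals tend to zero. -/
def WeaklyNull (L : Set (E n)) (k : ℕ) (W : ℕ → E n → ℝ) : Prop :=
  ∀ ℓ : (E n → ℝ) → ℝ, (∀ u v, IsBumpOn L u → IsBumpOn L v → ∀ c : ℝ,
    ℓ (fun z => u z + c * v z) = ℓ u + c * ℓ v) →
    (∃ C : ℝ, ∀ v, IsBumpOn L v → |ℓ v| ≤ C * √(sobSq (k + 1) v)) →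
      Tendsto (fun i => ℓ (W i)) atTop (𝓝 0)

theorem WeaklyNull.pd {k : ℕ} {W : ℕ → E n → ℝ} (hL : IsCompact L) (h : WeaklyNull L (k + 1) W)
    (a : Fin n) : WeaklyNull L k (fun i => pd a (W i)) := by
  rintro ℓ hl ⟨C, hC⟩
  refine h (fun v => ℓ (SmallEnergy.pd a v)) (fun u v hu hv c => ?_) ⟨|C|, fun v hv => ?_⟩
  · rw [← hl _ _ (hu.pd a) (hv.pd a) c]
    congr 1
    funext y
    have du := hu.smooth.differentiable (by simp) y
    have dv := hv.smooth.differentiable (by simp) y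
    rw [pd_add du (dv.const_mul c), pd_const_mul dv]
  · refine (hC _ (hv.pd a)).trans ((mul_le_mul_of_nonneg_right (le_abs_self C)
      (Real.sqrt_nonneg _)).trans (mul_le_mul_of_nonneg_left ?_ (abs_nonneg C)))
    exact Real.sqrt_le_sqrt (sobSq_pd_le hL hv a (k + 1))

/-- On the compact set `L` the function ψ is bounded, so integration against it is a bounded
functional by Cauchy-Schwarz. -/
theorem WeaklyNull.tendsto_integral {k : ℕ} {W : ℕ → E n → ℝ} (hL : IsCompact L)
    (hW : ∀ i, IsBumpOn L (W i)) (h : WeaklyNull L k W) (ψ : E n → ℝ) (hψ : Continuous ψ) :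
    Tendsto (fun i => ∫ y, W i y * ψ y) atTop (𝓝 0) := by
  have hint : ∀ v, IsBumpOn L v → Integrable (fun y => v y * ψ y) := fun v hv =>
    (hv.smooth.continuous.mul hψ).integrable_of_hasCompactSupport ((hv.hasCompactSupport hL).mul_right)
  refine h (fun v => ∫ y, v y * ψ y) (fun u v hu hv c => ?_) ?_
  · rw [← integral_const_mul, ← integral_add (hint u hu) ((hint v hv).const_mul c)]
    exact integral_congr_ae (Eventually.of_forall fun y => by ring)
  · obtain ⟨B, hB⟩ := hL.exists_bound_of_continuousOn hψ.continuousOn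
    have hv2 : volume L ≠ ⊤ := hL.measure_lt_top.ne
    refine ⟨|B| * √(volume.real L), fun v hv => ?_⟩
    have e1 : ∫ y, v y * ψ y = ∫ y in L, v y * ψ y :=
      (setIntegral_eq_integral_of_forall_compl_eq_zero fun y hy => by
        rw [image_eq_zero_of_notMem_tsupport fun h => hy (hv.supp h), zero_mul]).symm
    have m1 : MemLp (fun y => |v y|) (ENNReal.ofReal 2) (volume.restrict L) := by
      have : MemLp v 2 volume := hv.smooth.continuous.memLp_of_hasCompactSupport (hv.hasCompactSupport hL)
      rw [ENNReal.ofReal_ofNat]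
      exact (this.restrict L).abs
    have m2 : MemLp (fun _ : E n => |B|) (ENNReal.ofReal 2) (volume.restrict L) := by
      haveI : IsFiniteMeasure (volume.restrict L) := ⟨by simpa using hL.measure_lt_top⟩
      exact memLp_const _
    have h2 := integral_mul_le_Lp_mul_Lq_of_nonneg (μ := volume.restrict L)
      Real.HolderConjugate.two_two (Eventually.of_forall fun y => abs_nonneg (v y))
      (Eventually.of_forall fun _ => abs_nonneg B) m1 m2
    have e2 : |∫ y in L, v y * ψ y| ≤ ∫ y in L, |v y| * |B| := by
      refine (abs_integral_le_integral_abs).trans (setIntegral_mono_on ?_ ?_ hL.measurableSet fun y hy => ?_)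
      · exact (hint v hv).abs.integrableOn
      · exact ((hv.integrable hL).abs.mul_const _).integrableOn
      · rw [abs_mul]
        exact mul_le_mul_of_nonneg_left ((hB y hy).trans (le_abs_self B)) (abs_nonneg _)
    have e3 : (∫ y in L, |v y| ^ (2 : ℝ)) ≤ sobSq (k + 1) v := by
      refine le_trans (le_of_eq ?_) (sobSq_mono hL hv (by lia : 1 ≤ k + 1))
      rw [sobSq_eq_setIntegral hv]
      refine setIntegral_congr_fun hL.measurableSet fun y _ => ?_
      simp [jetNorm_one]
    rw [e1]
    refine e2.trans (h2.trans ?_)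
    have e4 : (∫ y in L, |B| ^ (2 : ℝ)) ^ ((1 : ℝ) / 2) = |B| * √(volume.real L) := by
      rw [← Real.sqrt_eq_rpow]
      simp [Real.sqrt_mul, Real.sqrt_sq_eq_abs, mul_comm]
    rw [e4, mul_comm]
    refine mul_le_mul_of_nonneg_left ?_ (by positivity)
    rw [← Real.sqrt_eq_rpow]
    exact Real.sqrt_le_sqrt e3

/-- Induction on the order: Rellich's theorem treats the function itself, and the partial
derivatives are weakly null and bounded one order lower. -/
theorem WeaklyNull.tendsto_sobSq (hL : IsCompact L) : ∀ (k : ℕ) {W : ℕ → E n → ℝ} {C : ℝ}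
    (_ : ∀ i, IsBumpOn L (W i)) (_ : WeaklyNull L k W) (_ : ∀ i, sobSq (k + 1) (W i) ≤ C),
    Tendsto (fun i => sobSq k (W i)) atTop (𝓝 0)
  | 0, W, C, _, _, _ => by simp [sobSq]
  | k + 1, W, C, hW, h, hC => by
    obtain ⟨D, hD0, hD⟩ := sobSq_succ_le hL k
    have h1 : Tendsto (fun i => sobSq 1 (W i)) atTop (𝓝 0) :=
      rellich hL hW (fun i => (sobSq_mono hL (hW i) (by lia)).trans (hC i))
        (h.tendsto_integral hL hW)
    have h2 : ∀ a, Tendsto (fun i => sobSq k (SmallEnergy.pd a (W i))) atTop (𝓝 0) := fun a =>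
      WeaklyNull.tendsto_sobSq hL k (fun i => (hW i).pd a) (h.pd hL a)
        (fun i => (sobSq_pd_le hL (hW i) a (k + 1)).trans (hC i))
    have h3 := (h1.add (tendsto_finsetSum Finset.univ fun a _ => h2 a)).const_mul D
    simp only [Finset.sum_const_zero, add_zero, mul_zero] at h3
    exact squeeze_zero (fun i => sobSq_nonneg _ _) (fun i => hD _ (hW i)) h3

section Pointwise

variable {a b c p : ℝ}

/-- For a ≤ M the power is bounded by its value at M. For a > M, with m = max(a, b), the product is
at most m^{p-1} = m^p / m ≤ m^p / M. Hence a sequence b that is bounded in L^p and null in L¹ makes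
the left side null in L¹. -/
theorem rpow_mul_le_aux (ha : 0 ≤ a) (hb : 0 ≤ b) (hp : 2 < p) {M : ℝ} (hM : 0 < M) :
    a ^ (p - 2) * b ≤ M ^ (p - 2) * b + (a ^ p + b ^ p) / M := by
  have h0 : 0 ≤ (a ^ p + b ^ p) / M := by positivity
  rcases le_or_gt a M with h | h
  · have : a ^ (p - 2) * b ≤ M ^ (p - 2) * b :=
      mul_le_mul_of_nonneg_right (Real.rpow_le_rpow ha h (by linarith)) hb
    linarith
  · set m := max a b with hm
    have hm0 : 0 < m := (hM.trans h).trans_le (le_max_left _ _)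
    have h1 : a ^ (p - 2) * b ≤ m ^ p / m := by
      rw [← Real.rpow_sub_one hm0.ne']
      calc a ^ (p - 2) * b ≤ m ^ (p - 2) * m := mul_le_mul
            (Real.rpow_le_rpow ha (le_max_left _ _) (by linarith)) (le_max_right _ _) hb (by positivity)
        _ = m ^ (p - 1) := by
            rw [← Real.rpow_add_one hm0.ne']
            congr 1
            ring
    have h2 : m ^ p / m ≤ m ^ p / M :=
      div_le_div_of_nonneg_left (by positivity) hM (h.le.trans (le_max_left _ _))
    have h3 : m ^ p ≤ a ^ p + b ^ p := by
      rcases max_choice a b with e | e <;> rw [hm, e]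
      · linarith [Real.rpow_nonneg hb p]
      · linarith [Real.rpow_nonneg ha p]
    have h4 : m ^ p / M ≤ (a ^ p + b ^ p) / M := div_le_div_of_nonneg_right h3 hM.le
    have h5 : 0 ≤ M ^ (p - 2) * b := by positivity
    linarith

/-- With m = max(a, c) the left side is at most m^{p-1} b. If b ≤ ε m this is at most ε m^p;
otherwise m < b/ε and it is at most ε^{1-p} b^p. -/
theorem rpow_mul_mul_le_aux (ha : 0 ≤ a) (hb : 0 ≤ b) (hc : 0 ≤ c) (hp : 2 < p) {ε : ℝ} (hε : 0 < ε) :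
    a ^ (p - 2) * b * c ≤ ε * (a ^ p + c ^ p) + (ε⁻¹) ^ (p - 1) * b ^ p := by
  set m := max a c with hm
  have hm0 : 0 ≤ m := ha.trans (le_max_left _ _)
  have h3 : m ^ p ≤ a ^ p + c ^ p := by
    rcases max_choice a c with e | e <;> rw [hm, e]
    · linarith [Real.rpow_nonneg hc p]
    · linarith [Real.rpow_nonneg ha p]
  have h6 : 0 ≤ (ε⁻¹) ^ (p - 1) * b ^ p := by positivity
  rcases hm0.eq_or_lt with h0 | h0
  · have ha0 : a = 0 := le_antisymm ((le_max_left a c).trans h0.ge) ha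
    rw [ha0, Real.zero_rpow (by linarith)]
    have : 0 ≤ ε * ((0 : ℝ) ^ p + c ^ p) := by positivity
    linarith
  have h1 : a ^ (p - 2) * b * c ≤ m ^ (p - 1) * b := by
    calc a ^ (p - 2) * b * c ≤ m ^ (p - 2) * b * m := mul_le_mul
          (mul_le_mul_of_nonneg_right (Real.rpow_le_rpow ha (le_max_left _ _) (by linarith)) hb)
          (le_max_right _ _) hc (by positivity)
      _ = (m ^ (p - 2) * m) * b := by ring
      _ = m ^ (p - 1) * b := by
          rw [← Real.rpow_add_one h0.ne']
          ring_nf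
  rcases le_or_gt b (ε * m) with h | h
  · have h2 : m ^ (p - 1) * b ≤ m ^ (p - 1) * (ε * m) := mul_le_mul_of_nonneg_left h (by positivity)
    have h4 : m ^ (p - 1) * (ε * m) = ε * m ^ p := by
      have : m ^ p = m ^ (p - 1) * m := by
        rw [← Real.rpow_add_one h0.ne']; ring_nf
      rw [this]; ring
    have h5 : ε * m ^ p ≤ ε * (a ^ p + c ^ p) := mul_le_mul_of_nonneg_left h3 hε.le
    linarith
  · have hb0 : 0 < b := lt_of_le_of_lt (by positivity) h
    have h2 : m ≤ ε⁻¹ * b := by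
      rw [inv_mul_eq_div, le_div_iff₀ hε]
      linarith
    have h4 : m ^ (p - 1) * b ≤ (ε⁻¹ * b) ^ (p - 1) * b :=
      mul_le_mul_of_nonneg_right (Real.rpow_le_rpow hm0 h2 (by linarith)) hb
    have h5 : (ε⁻¹ * b) ^ (p - 1) * b = (ε⁻¹) ^ (p - 1) * b ^ p := by
      rw [Real.mul_rpow (by positivity) hb, mul_assoc, ← Real.rpow_add_one hb0.ne']
      ring_nf
    have h7 : 0 ≤ ε * (a ^ p + c ^ p) := by positivity
    linarith

end Pointwise

end Estimates
end SmallEnergy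

namespace SmallEnergy

/-! ### Integrals of bilinear forms along converging metrics. -/

section LocalCompactness

variable {n : ℕ} {U L : Set (E n)} {G : ℕ → E n → Matrix (Fin n) (Fin n) ℝ}
  {H : E n → Matrix (Fin n) (Fin n) ℝ}

theorem exists_dens_bounds (hH : IsMetric U H) (hLU : L ⊆ U) (hL : IsCompact L) :
    ∃ r R : ℝ, 0 < r ∧ 0 < R ∧ ∀ y ∈ L, r ≤ dens H y ∧ dens H y ≤ R := by
  rcases L.eq_empty_or_nonempty with rfl | hne
  · exact ⟨1, 1, one_pos, one_pos, by simp⟩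
  · obtain ⟨y0, hy0, h0⟩ := hL.exists_isMinOn hne (hH.continuousOn_dens.mono hLU)
    obtain ⟨y1, hy1, h1⟩ := hL.exists_isMaxOn hne (hH.continuousOn_dens.mono hLU)
    exact ⟨_, _, hH.dens_pos (hLU hy0), hH.dens_pos (hLU hy1), fun y hy => ⟨h0 hy, h1 hy⟩⟩

/-- |√a - √b| √b ≤ |a - b| because √a + √b ≥ √b. For negative `a` the root is 0 and the left side is
b ≤ b - a. -/
theorem abs_sqrt_sub_le {a b ε : ℝ} (hb : 0 < b) (h : |a - b| ≤ ε * b) :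
    |√a - √b| ≤ ε * √b := by
  have hε : 0 ≤ ε := by
    by_contra hneg
    have := (abs_nonneg _).trans h
    nlinarith
  have hsb : 0 < √b := Real.sqrt_pos.2 hb
  have h1 : |√a - √b| * √b ≤ |a - b| := by
    rcases le_or_gt 0 a with ha | ha
    · have e : a - b = (√a - √b) * (√a + √b) := by
        have := Real.mul_self_sqrt ha
        have := Real.mul_self_sqrt hb.le
        nlinarith
      rw [e, abs_mul]
      refine mul_le_mul_of_nonneg_left ?_ (abs_nonneg _)
      rw [abs_of_nonneg (by positivity)]
      linarith [Real.sqrt_nonneg a]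
    · rw [Real.sqrt_eq_zero_of_nonpos ha.le, zero_sub, abs_neg, abs_of_pos hsb,
        Real.mul_self_sqrt hb.le, abs_of_neg (by linarith)]
      linarith
  have h2 : |√a - √b| * √b ≤ (ε * √b) * √b := by
    rw [mul_assoc, Real.mul_self_sqrt hb.le]
    exact h1.trans h
  exact le_of_mul_le_mul_right h2 hsb

theorem MetricConv.dens (hU : IsOpen U) (h : MetricConv U G H) (hLU : L ⊆ U) (hL : IsCompact L)
    {ε : ℝ} (hε : 0 < ε) :
    ∀ᶠ i in atTop, ∀ y ∈ L, |dens (G i) y - dens H y| ≤ ε * dens H y := by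
  obtain ⟨r, R, hr, -, hrR⟩ := exists_dens_bounds h.lim hLU hL
  filter_upwards [(smoothTendsto_det hU h.conv).conv 1 L hLU hL (ε * r ^ 2) (by positivity)] with
    i hi y hy
  have h1 := hi y hy
  rw [jetNorm_one] at h1
  have hd := h.lim.det_pos (hLU hy)
  refine abs_sqrt_sub_le hd (h1.trans (mul_le_mul_of_nonneg_left ?_ hε.le))
  calc r ^ 2 ≤ (SmallEnergy.dens H y) ^ 2 := pow_le_pow_left₀ hr.le (hrR y hy).1 2
    _ = _ := Real.sq_sqrt hd.le

variable {k m : ℕ} {c : ℕ → Fin m → Fin m → E n → ℝ} {c' : Fin m → Fin m → E n → ℝ}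
  {T : ℕ → Fin m → (E n → ℝ) → E n → ℝ} {T' : Fin m → (E n → ℝ) → E n → ℝ}

theorem continuousOn_bil {d : Fin m → Fin m → E n → ℝ} {S : Fin m → (E n → ℝ) → E n → ℝ}
    (hd : ∀ a b, ContDiffOn ℝ ∞ (d a b) U) (hS : ∀ a, IsDiffOp U k (S a)) {u v : E n → ℝ}
    (hu : ContDiffOn ℝ ∞ u U) (hv : ContDiffOn ℝ ∞ v U) : ContinuousOn (bil d S u v) U :=
  continuousOn_finsetSum _ fun a _ => continuousOn_finsetSum _ fun b _ =>
    (hd a b).continuousOn.mul (((hS a).smooth u hu).continuousOn.mul ((hS b).smooth v hv).continuousOn)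

theorem BilTendsto.integrableOn (h : BilTendsto U k c c' T T') (hH : IsMetric U H) (hLU : L ⊆ U)
    (hL : IsCompact L) {u v : E n → ℝ} (hu : IsBumpOn L u) (hv : IsBumpOn L v) :
    IntegrableOn (fun y => bil c' T' u v y * dens H y) L :=
  (((continuousOn_bil (fun a b => (h.coeff a b).lim) (fun a => (h.op a).lim) hu.smooth.contDiffOn
    hv.smooth.contDiffOn).mul hH.continuousOn_dens).mono hLU).integrableOn_compact hL

theorem BilTendsto.integrableOn_seq (h : BilTendsto U k c c' T T') (hG : MetricConv U G H)
    (hLU : L ⊆ U) (hL : IsCompact L) (i : ℕ) {u v : E n → ℝ} (hu : IsBumpOn L u)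
    (hv : IsBumpOn L v) : IntegrableOn (fun y => bil (c i) (T i) u v y * SmallEnergy.dens (G i) y) L :=
  (((continuousOn_bil (fun a b => (h.coeff a b).smooth i) (fun a => (h.op a).op i) hu.smooth.contDiffOn
    hv.smooth.contDiffOn).mul (hG.metric i).continuousOn_dens).mono hLU).integrableOn_compact hL

theorem IsBumpOn.integrableOn_jetNorm_mul (hL : IsCompact L) {u v : E n → ℝ} (hu : IsBumpOn L u)
    (hv : IsBumpOn L v) (a b : ℕ) : IntegrableOn (fun y => jetNorm a u y * jetNorm b v y) L :=
  ((hu.continuous_jetNorm a).mul (hv.continuous_jetNorm b)).continuousOn.integrableOn_compact hL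

theorem abs_setIntegral_le {f g : E n → ℝ} (hL : IsCompact L) (hf : IntegrableOn f L)
    (hg : IntegrableOn g L) (h : ∀ y ∈ L, |f y| ≤ g y) : |∫ y in L, f y| ≤ ∫ y in L, g y :=
  abs_integral_le_integral_abs.trans (setIntegral_mono_on hf.abs hg hL.measurableSet h)

theorem BilTendsto.integral_bound (hU : IsOpen U) (h : BilTendsto U k c c' T T') (hH : IsMetric U H)
    (hLU : L ⊆ U) (hL : IsCompact L) : ∃ C : ℝ, 0 ≤ C ∧ ∀ u v, IsBumpOn L u → IsBumpOn L v →
      |∫ y in L, bil c' T' u v y * dens H y| ≤ C * (√(sobSq (k + 1) u) * √(sobSq (k + 1) v)) := by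
  obtain ⟨C, hC0, hC⟩ := h.bound hU hLU hL
  obtain ⟨r, R, hr, hR, hrR⟩ := exists_dens_bounds hH hLU hL
  refine ⟨C * R, by positivity, fun u v hu hv => ?_⟩
  have hi := IsBumpOn.integrableOn_jetNorm_mul hL hu hv (k + 1) (k + 1)
  refine (abs_setIntegral_le hL (h.integrableOn hH hLU hL hu hv)
    (hi.const_mul (C * R)) fun y hy => ?_).trans ?_
  · rw [abs_mul, abs_of_pos (hH.dens_pos (hLU hy))]
    have h1 := hC u v hu.smooth.contDiffOn hv.smooth.contDiffOn y hy
    calc _ ≤ C * (jetNorm (k + 1) u y * jetNorm (k + 1) v y) * R :=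
          mul_le_mul h1 (hrR y hy).2 (hH.dens_pos (hLU hy)).le ((abs_nonneg _).trans h1)
      _ = _ := by ring
  · rw [integral_const_mul]
    exact mul_le_mul_of_nonneg_left (setIntegral_jetNorm_mul_le hL hu hv _ _) (by positivity)

/-- Coefficients and densities converge uniformly on `L`, and the arguments are only required to
stay bounded in H^k; they need not converge. -/
theorem BilTendsto.integral_conv (hU : IsOpen U) (h : BilTendsto U k c c' T T')
    (hG : MetricConv U G H) (hLU : L ⊆ U) (hL : IsCompact L) {u v : ℕ → E n → ℝ} {M : ℝ}
    (hu : ∀ i, IsBumpOn L (u i)) (hv : ∀ i, IsBumpOn L (v i)) (hM : 0 ≤ M)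
    (huM : ∀ i, sobSq (k + 1) (u i) ≤ M) (hvM : ∀ i, sobSq (k + 1) (v i) ≤ M) :
    Tendsto (fun i => (∫ y in L, bil (c i) (T i) (u i) (v i) y * SmallEnergy.dens (G i) y) -
      ∫ y in L, bil c' T' (u i) (v i) y * SmallEnergy.dens H y) atTop (𝓝 0) := by
  obtain ⟨C, hC0, hC⟩ := h.bound hU hLU hL
  obtain ⟨r, R, hr, hR, hrR⟩ := exists_dens_bounds hG.lim hLU hL
  rw [Metric.tendsto_atTop']
  intro ε hε
  set K : ℝ := (2 + C) * R * M + 1 with hK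
  have hK0 : 0 < K := by positivity
  set δ : ℝ := min 1 (ε / (2 * K)) with hδ
  have hδ0 : 0 < δ := lt_min one_pos (by positivity)
  have ev := (h.conv hU hLU hL hδ0).and (hG.dens hU hLU hL hδ0)
  obtain ⟨i0, hi0⟩ := eventually_atTop.1 ev
  refine ⟨i0, fun i hi => ?_⟩
  obtain ⟨h1, h2⟩ := hi0 i hi.le
  have hint := IsBumpOn.integrableOn_jetNorm_mul hL (hu i) (hv i) (k + 1) (k + 1)
  have i1 := h.integrableOn_seq hG hLU hL i (hu i) (hv i)
  have i2 := h.integrableOn hG.lim hLU hL (hu i) (hv i)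
  rw [dist_zero_right, Real.norm_eq_abs, ← integral_sub i1 i2]
  have hb : |∫ y in L, (bil (c i) (T i) (u i) (v i) y * SmallEnergy.dens (G i) y -
      bil c' T' (u i) (v i) y * SmallEnergy.dens H y)| ≤
      ∫ y in L, (δ * ((2 + C) * R)) * (jetNorm (k + 1) (u i) y * jetNorm (k + 1) (v i) y) := by
    refine abs_setIntegral_le hL (i1.sub i2) (hint.const_mul _) fun y hy => ?_
    have e1 := h1 _ _ (hu i).smooth.contDiffOn (hv i).smooth.contDiffOn y hy
    have e2 := h2 y hy
    have e3 := hC _ _ (hu i).smooth.contDiffOn (hv i).smooth.contDiffOn y hy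
    have e4 := (hrR y hy).2
    have e5 := hG.lim.dens_pos (hLU hy)
    have hd : |SmallEnergy.dens (G i) y| ≤ 2 * R := by
      have t1 : |SmallEnergy.dens (G i) y| ≤ |SmallEnergy.dens (G i) y - SmallEnergy.dens H y| +
          |SmallEnergy.dens H y| := by
        simpa using abs_add_le (SmallEnergy.dens (G i) y - SmallEnergy.dens H y) (SmallEnergy.dens H y)
      have t2 : δ ≤ 1 := min_le_left _ _
      rw [abs_of_pos e5] at t1
      nlinarith
    set X := jetNorm (k + 1) (u i) y * jetNorm (k + 1) (v i) y with hX
    have hX0 : 0 ≤ X := mul_nonneg (jetNorm_nonneg _ _ _) (jetNorm_nonneg _ _ _)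
    have e : bil (c i) (T i) (u i) (v i) y * SmallEnergy.dens (G i) y -
        bil c' T' (u i) (v i) y * SmallEnergy.dens H y =
        (bil (c i) (T i) (u i) (v i) y - bil c' T' (u i) (v i) y) * SmallEnergy.dens (G i) y +
        bil c' T' (u i) (v i) y * (SmallEnergy.dens (G i) y - SmallEnergy.dens H y) := by ring
    rw [e]
    refine (abs_add_le _ _).trans ?_
    rw [abs_mul, abs_mul]
    calc _ ≤ (δ * X) * (2 * R) + (C * X) * (δ * R) := by
          refine add_le_add (mul_le_mul e1 hd (abs_nonneg _) (by positivity))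
            (mul_le_mul e3 (e2.trans (mul_le_mul_of_nonneg_left e4 hδ0.le)) (abs_nonneg _)
              (by positivity))
      _ = _ := by ring
  refine hb.trans_lt ?_
  rw [integral_const_mul]
  have hs : ∫ y in L, jetNorm (k + 1) (u i) y * jetNorm (k + 1) (v i) y ≤ M := by
    refine (setIntegral_jetNorm_mul_le hL (hu i) (hv i) _ _).trans ?_
    calc _ ≤ √M * √M := mul_le_mul (Real.sqrt_le_sqrt (huM i)) (Real.sqrt_le_sqrt (hvM i))
          (Real.sqrt_nonneg _) (Real.sqrt_nonneg _)
      _ = M := Real.mul_self_sqrt hM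
  calc _ ≤ δ * ((2 + C) * R) * M := mul_le_mul_of_nonneg_left hs (by positivity)
    _ = δ * ((2 + C) * R * M) := by ring
    _ ≤ (ε / (2 * K)) * K := mul_le_mul (min_le_right _ _) (by rw [hK]; linarith) (by positivity)
        (by positivity)
    _ = ε / 2 := by field_simp
    _ < ε := half_lt_self hε

theorem BilTendsto.integral_comm (hU : IsOpen U) (h : BilTendsto U k c c' T T') (hH : IsMetric U H)
    (hLU : L ⊆ U) (hL : IsCompact L) {η : E n → ℝ} (hη : ContDiff ℝ ∞ η) :
    ∃ C : ℝ, 0 ≤ C ∧ ∀ u v, IsBumpOn L u → IsBumpOn L v →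
      |(∫ y in L, bil c' T' u (fun z => η z * v z) y * dens H y) -
        ∫ y in L, bil c' T' (fun z => η z * u z) v y * dens H y| ≤
      C * (√(sobSq k u) * √(sobSq (k + 1) v) + √(sobSq (k + 1) u) * √(sobSq k v)) := by
  obtain ⟨C, hC0, hC⟩ := h.comm hU hLU hL hη.contDiffOn
  obtain ⟨r, R, hr, hR, hrR⟩ := exists_dens_bounds hH hLU hL
  refine ⟨C * R, by positivity, fun u v hu hv => ?_⟩
  have hj1 := IsBumpOn.integrableOn_jetNorm_mul hL hu hv k (k + 1)
  have hj2 := IsBumpOn.integrableOn_jetNorm_mul hL hu hv (k + 1) k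
  have i1 := h.integrableOn hH hLU hL hu (IsBumpOn.mul hη hv)
  have i2 := h.integrableOn hH hLU hL (IsBumpOn.mul hη hu) hv
  rw [← integral_sub i1 i2]
  refine (abs_setIntegral_le hL (i1.sub i2) ((hj1.add hj2).const_mul (C * R)) fun y hy => ?_).trans ?_
  · simp only [Pi.sub_apply, Pi.add_apply]
    rw [← sub_mul, abs_mul, abs_of_pos (hH.dens_pos (hLU hy))]
    have h1 := hC u v hu.smooth.contDiffOn hv.smooth.contDiffOn y hy
    calc _ ≤ _ * R := mul_le_mul h1 (hrR y hy).2 (hH.dens_pos (hLU hy)).le ((abs_nonneg _).trans h1)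
      _ = _ := by ring
  · rw [integral_const_mul, integral_add' hj1 hj2]
    exact mul_le_mul_of_nonneg_left (add_le_add (setIntegral_jetNorm_mul_le hL hu hv _ _)
      (setIntegral_jetNorm_mul_le hL hu hv _ _)) (by positivity)

/-- Sequences that are Cauchy in the Sobolev norm. -/
def SobCauchy (m : ℕ) (h : ℕ → E n → ℝ) : Prop :=
  ∀ ε : ℝ, 0 < ε → ∃ j, ∀ᶠ i in atTop, sobSq m (fun y => h i y - h j y) ≤ ε

/-- Strong times weak convergence. For a fixed index j the form is a bounded functional of the
weakly null argument; replacing u_i by u_j costs at most a multiple of ‖u_i - u_j‖. The Cauchy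
condition is used because the limit of `u` need not be smooth. -/
theorem BilTendsto.integral_weak (hU : IsOpen U) (h : BilTendsto U k c c' T T') (hH : IsMetric U H)
    (hLU : L ⊆ U) (hL : IsCompact L) {θ : E n → ℝ} (hθ : ContDiff ℝ ∞ θ) {u W : ℕ → E n → ℝ} {M : ℝ}
    (hu : ∀ i, IsBumpOn L (u i)) (hW : ∀ i, IsBumpOn L (W i)) (hM : 0 ≤ M)
    (hWM : ∀ i, sobSq (k + 1) (W i) ≤ M) (huC : SobCauchy (k + 1) u) (hnull : WeaklyNull L k W) :
    Tendsto (fun i => ∫ y in L, bil c' T' (u i) (fun z => θ z * W i z) y * dens H y) atTop (𝓝 0) := by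
  obtain ⟨C, hC0, hC⟩ := h.integral_bound hU hH hLU hL
  obtain ⟨D, hD0, hD⟩ := exists_sobSq_mul_le hL hθ (k + 1)
  have hθW : ∀ v, IsBumpOn L v → IsBumpOn L (fun z => θ z * v z) := fun v hv => IsBumpOn.mul hθ hv
  have hop := fun a => (h.op a).lim
  have hj : ∀ j, Tendsto (fun i => ∫ y in L, bil c' T' (u j) (fun z => θ z * W i z) y * dens H y) atTop
      (𝓝 0) := by
    intro j
    refine hnull (fun v => ∫ y in L, bil c' T' (u j) (fun z => θ z * v z) y * dens H y)
      (fun v w hv hw t => ?_) ⟨C * (√(sobSq (k + 1) (u j)) * √D), fun v hv => ?_⟩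
    · have i1 := h.integrableOn hH hLU hL (hu j) (hθW v hv)
      have i2 := h.integrableOn hH hLU hL (hu j) (hθW w hw)
      rw [← integral_const_mul, ← integral_add i1 (i2.const_mul t)]
      refine setIntegral_congr_fun hL.measurableSet fun y hy => ?_
      have hs : ∀ p q, bil c' T' p q y = bil c' T' q p y := bil_comm fun a b => h.symm' a b y (hLU hy)
      have e : (fun z => θ z * (v z + t * w z)) = fun z => θ z * v z + t * (θ z * w z) := by
        funext z; ring
      simp only
      rw [e, hs, bil_add_mul_left hop (hθW v hv).smooth.contDiffOn (hθW w hw).smooth.contDiffOn t _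
        (hLU hy), hs _ (u j), hs _ (u j)]
      ring
    · refine (hC _ _ (hu j) (hθW v hv)).trans ?_
      rw [mul_assoc, mul_assoc]
      refine mul_le_mul_of_nonneg_left (mul_le_mul_of_nonneg_left ?_ (Real.sqrt_nonneg _)) hC0
      rw [← Real.sqrt_mul hD0]
      exact Real.sqrt_le_sqrt (hD v hv)
  rw [Metric.tendsto_atTop']
  intro ε hε
  set K : ℝ := C * √(D * M) + 1 with hK
  have hK0 : 0 < K := by positivity
  obtain ⟨j, hjε⟩ := huC ((ε / (2 * K)) ^ 2) (by positivity)
  obtain ⟨i0, hi0⟩ := eventually_atTop.1 (hjε.and (Metric.tendsto_nhds.1 (hj j) (ε / 2) (half_pos hε)))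
  refine ⟨i0, fun i hi => ?_⟩
  obtain ⟨h1, h2⟩ := hi0 i hi.le
  rw [dist_zero_right, Real.norm_eq_abs] at h2 ⊢
  have hd : IsBumpOn L (fun y => u i y - u j y) := (hu i).sub (hu j)
  have e : ∫ y in L, bil c' T' (u i) (fun z => θ z * W i z) y * dens H y =
      (∫ y in L, bil c' T' (u j) (fun z => θ z * W i z) y * dens H y) +
      ∫ y in L, bil c' T' (fun y => u i y - u j y) (fun z => θ z * W i z) y * dens H y := by
    rw [← integral_add (h.integrableOn hH hLU hL (hu j) (hθW _ (hW i)))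
      (h.integrableOn hH hLU hL hd (hθW _ (hW i)))]
    refine setIntegral_congr_fun hL.measurableSet fun y hy => ?_
    have e1 : u i = fun z => u j z + 1 * (u i z - u j z) := by funext z; ring
    have := bil_add_mul_left (d := c') hop (hu j).smooth.contDiffOn hd.smooth.contDiffOn 1
      (fun z => θ z * W i z) (hLU hy)
    rw [← e1] at this
    rw [this]
    ring
  rw [e]
  have h3 := hC _ _ hd (hθW _ (hW i))
  have h4 : √(sobSq (k + 1) fun y => u i y - u j y) ≤ ε / (2 * K) :=
    Real.sqrt_le_iff.2 ⟨by positivity, h1⟩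
  have h5 : √(sobSq (k + 1) fun z => θ z * W i z) ≤ √(D * M) :=
    Real.sqrt_le_sqrt ((hD _ (hW i)).trans (mul_le_mul_of_nonneg_left (hWM i) hD0))
  have h6 : C * (√(sobSq (k + 1) fun y => u i y - u j y) * √(sobSq (k + 1) fun z => θ z * W i z)) ≤
      ε / 2 := by
    calc _ ≤ C * ((ε / (2 * K)) * √(D * M)) := mul_le_mul_of_nonneg_left
          (mul_le_mul h4 h5 (Real.sqrt_nonneg _) (by positivity)) hC0
      _ = (ε / (2 * K)) * (C * √(D * M)) := by ring
      _ ≤ (ε / (2 * K)) * K := mul_le_mul_of_nonneg_left (by rw [hK]; linarith) (by positivity)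
      _ = ε / 2 := by field_simp
  refine (abs_add_le _ _).trans_lt ?_
  linarith

end LocalCompactness
end SmallEnergy

namespace SmallEnergy

/-! ### The compactness argument in a chart. -/

section LocalCompactness

variable {n : ℕ} {U L : Set (E n)} {G : ℕ → E n → Matrix (Fin n) (Fin n) ℝ}
  {H : E n → Matrix (Fin n) (Fin n) ℝ} {p : ℝ}

theorem Continuous.abs_rpow {v : E n → ℝ} (hv : Continuous v) {q : ℝ} (hq : 0 ≤ q) :
    Continuous fun y => |v y| ^ q := hv.abs.rpow_const fun _ => Or.inr hq

theorem setIntegral_abs_le (hL : IsCompact L) {v : E n → ℝ} (hv : IsBumpOn L v) :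
    ∫ y in L, |v y| ≤ √(volume.real L) * √(sobSq 1 v) := by
  have m1 : MemLp (fun y => |v y|) (ENNReal.ofReal 2) (volume.restrict L) := by
    have : MemLp v 2 volume := hv.smooth.continuous.memLp_of_hasCompactSupport (hv.hasCompactSupport hL)
    rw [ENNReal.ofReal_ofNat]
    exact (this.restrict L).abs
  have m2 : MemLp (fun _ : E n => (1 : ℝ)) (ENNReal.ofReal 2) (volume.restrict L) := by
    haveI : IsFiniteMeasure (volume.restrict L) := ⟨by simpa using hL.measure_lt_top⟩
    exact memLp_const _
  have h := integral_mul_le_Lp_mul_Lq_of_nonneg (μ := volume.restrict L)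
    Real.HolderConjugate.two_two (Eventually.of_forall fun y => abs_nonneg (v y))
    (Eventually.of_forall fun _ => zero_le_one) m1 m2
  rw [← Real.sqrt_eq_rpow, ← Real.sqrt_eq_rpow] at h
  simp only [mul_one, Real.one_rpow, integral_const, smul_eq_mul, measureReal_restrict_apply_univ,
    Real.rpow_ofNat, sq_abs] at h
  rw [sobSq_eq_setIntegral hv, mul_comm]
  simpa [jetNorm_one] using h

theorem sobSq_sub_le (hL : IsCompact L) {u v : E n → ℝ} (hu : IsBumpOn L u) (hv : IsBumpOn L v)
    (m : ℕ) : sobSq m (fun y => u y - v y) ≤ 2 * sobSq m u + 2 * sobSq m v := by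
  have i1 := hu.integrable_jetNorm_sq hL m
  have i2 := hv.integrable_jetNorm_sq hL m
  unfold sobSq
  rw [← integral_const_mul, ← integral_const_mul, ← integral_add (i1.const_mul _) (i2.const_mul _)]
  refine integral_mono ((hu.sub hv).integrable_jetNorm_sq hL m) ((i1.const_mul _).add (i2.const_mul _))
    fun y => ?_
  have h := jetNorm_sub_le isOpen_univ hu.smooth.contDiffOn hv.smooth.contDiffOn (mem_univ y) m
  have h0 := jetNorm_nonneg m (fun z => u z - v z) y
  simp only [Pi.add_apply]
  nlinarith [sq_nonneg (jetNorm m u y - jetNorm m v y)]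

/-- Replace h_i by a fixed h_j, which is bounded on `L`; the error is small because `h` is Cauchy in
L^p. What remains is |F|^{p-2} |W|, which is null since `W` is null in L¹ while `F` and `W` are
bounded in L^p. -/
theorem tendsto_cross_term (hL : IsCompact L) (hp : 2 < p) {F h W : ℕ → E n → ℝ} {A : ℝ}
    (hF : ∀ i, IsBumpOn L (F i)) (hh : ∀ i, IsBumpOn L (h i)) (hW : ∀ i, IsBumpOn L (W i))
    (hFA : ∀ i, ∫ y in L, |F i y| ^ p ≤ A) (hWA : ∀ i, ∫ y in L, |W i y| ^ p ≤ A)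
    (hW0 : Tendsto (fun i => sobSq 1 (W i)) atTop (𝓝 0))
    (hC : ∀ ε : ℝ, 0 < ε → ∃ j, ∀ᶠ i in atTop, ∫ y in L, |h i y - h j y| ^ p ≤ ε) :
    Tendsto (fun i => ∫ y in L, |F i y| ^ (p - 2) * |h i y| * |W i y|) atTop (𝓝 0) := by
  have hA : 0 ≤ A := (integral_nonneg fun y => by positivity).trans (hFA 0)
  have hp0 : 0 ≤ p := by linarith
  have hp2 : 0 ≤ p - 2 := by linarith
  have hcF := fun i => (hF i).smooth.continuous
  have hcW := fun i => (hW i).smooth.continuous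
  have hch := fun i => (hh i).smooth.continuous
  have ion : ∀ {f : E n → ℝ}, Continuous f → IntegrableOn f L := fun hf =>
    hf.continuousOn.integrableOn_compact hL
  have hWabs : Tendsto (fun i => ∫ y in L, |W i y|) atTop (𝓝 0) := by
    have h1 : Tendsto (fun i => √(volume.real L) * √(sobSq 1 (W i))) atTop (𝓝 0) := by
      have := (Real.continuous_sqrt.tendsto 0).comp hW0
      simpa using this.const_mul √(volume.real L)
    exact squeeze_zero (fun i => integral_nonneg fun y => abs_nonneg _)
      (fun i => setIntegral_abs_le hL (hW i)) h1
  rw [Metric.tendsto_atTop']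
  intro ε hε
  -- `δ` makes the share of |F|^p + |W|^p less than ε/4; `κ` is the resulting factor of |h_i -
  -- h_j|^p, which determines how large j has to be.
  set δ : ℝ := ε / (4 * (2 * A + 1)) with hδ
  have hδ0 : 0 < δ := by positivity
  set κ : ℝ := δ⁻¹ ^ (p - 1) with hκ
  have hκ0 : 0 < κ := by positivity
  obtain ⟨j, hj⟩ := hC (ε / (4 * κ)) (by positivity)
  obtain ⟨B, hB⟩ := hL.exists_bound_of_continuousOn (hch j).continuousOn
  set B' : ℝ := |B| + 1 with hB'
  have hB0 : 0 < B' := by positivity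
  -- The truncation level for |F|: the part above it contributes at most ε/8, the part below is
  -- controlled by the L¹ norm of `W`.
  set R : ℝ := 8 * B' * (2 * A + 1) / ε with hR
  have hR0 : 0 < R := by positivity
  have hlim : Tendsto (fun i => B' * (R ^ (p - 2) * ∫ y in L, |W i y|)) atTop (𝓝 0) := by
    simpa using (hWabs.const_mul (R ^ (p - 2))).const_mul B'
  obtain ⟨i0, hi0⟩ := eventually_atTop.1 (hj.and (hlim.eventually (gt_mem_nhds (by positivity : 0 < ε / 4))))
  refine ⟨i0, fun i hi => ?_⟩
  obtain ⟨h1, h2⟩ := hi0 i hi.le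
  have hnn : 0 ≤ ∫ y in L, |F i y| ^ (p - 2) * |h i y| * |W i y| := integral_nonneg fun y => by positivity
  rw [dist_zero_right, Real.norm_eq_abs, abs_of_nonneg hnn]
  have cF := Continuous.abs_rpow (hcF i) hp0
  have cF2 := Continuous.abs_rpow (hcF i) hp2
  have cW := Continuous.abs_rpow (hcW i) hp0
  have cd := Continuous.abs_rpow ((hch i).sub (hch j)) hp0
  have I1 := ion cF
  have I2 := ion cW
  have I3 := ion cd
  have I4 := ion (hcW i).abs
  have hpt : ∀ y ∈ L, |F i y| ^ (p - 2) * |h i y| * |W i y| ≤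
      (δ * (|F i y| ^ p + |W i y| ^ p) + κ * |h i y - h j y| ^ p) +
      (B' * (R ^ (p - 2) * |W i y|) + (B' / R) * (|F i y| ^ p + |W i y| ^ p)) := by
    intro y hy
    have e1 := rpow_mul_mul_le_aux (abs_nonneg (F i y)) (abs_nonneg (h i y - h j y))
      (abs_nonneg (W i y)) hp hδ0
    have e2 := rpow_mul_le_aux (abs_nonneg (F i y)) (abs_nonneg (W i y)) hp hR0
    have e3 : |h j y| ≤ B' := (hB y hy).trans ((le_abs_self B).trans (by rw [hB']; linarith))
    have e4 : |h i y| ≤ |h i y - h j y| + |h j y| := by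
      simpa using abs_add_le (h i y - h j y) (h j y)
    have e5 : 0 ≤ |F i y| ^ (p - 2) * |W i y| := by positivity
    have e6 : |F i y| ^ (p - 2) * |h i y| * |W i y| ≤
        |F i y| ^ (p - 2) * |h i y - h j y| * |W i y| + B' * (|F i y| ^ (p - 2) * |W i y|) := by
      calc _ = |h i y| * (|F i y| ^ (p - 2) * |W i y|) := by ring
        _ ≤ (|h i y - h j y| + B') * (|F i y| ^ (p - 2) * |W i y|) :=
            mul_le_mul_of_nonneg_right (by linarith) e5
        _ = _ := by ring
    have e7 := mul_le_mul_of_nonneg_left e2 hB0.le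
    have e8 : B' * (R ^ (p - 2) * |W i y| + (|F i y| ^ p + |W i y| ^ p) / R) =
        B' * (R ^ (p - 2) * |W i y|) + (B' / R) * (|F i y| ^ p + |W i y| ^ p) := by ring
    rw [← hκ] at e1
    linarith
  have hI := setIntegral_mono_on (ion (by fun_prop)) (ion (by fun_prop)) hL.measurableSet hpt
  have hIeq : ∫ y in L, ((δ * (|F i y| ^ p + |W i y| ^ p) + κ * |h i y - h j y| ^ p) +
      (B' * (R ^ (p - 2) * |W i y|) + (B' / R) * (|F i y| ^ p + |W i y| ^ p))) =
      (δ * ((∫ y in L, |F i y| ^ p) + ∫ y in L, |W i y| ^ p) + κ * ∫ y in L, |h i y - h j y| ^ p) +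
      (B' * (R ^ (p - 2) * ∫ y in L, |W i y|) +
        (B' / R) * ((∫ y in L, |F i y| ^ p) + ∫ y in L, |W i y| ^ p)) := by
    rw [integral_add (ion (by fun_prop)) (ion (by fun_prop)),
      integral_add (ion (by fun_prop)) (ion (by fun_prop)),
      integral_add (ion (by fun_prop)) (ion (by fun_prop))]
    simp only [integral_const_mul]
    rw [integral_add I1 I2]
  rw [hIeq] at hI
  have b1 := hFA i
  have b2 := hWA i
  have t1 : δ * ((∫ y in L, |F i y| ^ p) + ∫ y in L, |W i y| ^ p) < ε / 4 := by
    calc _ ≤ δ * (2 * A) := mul_le_mul_of_nonneg_left (by linarith) hδ0.le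
      _ < δ * (2 * A + 1) := mul_lt_mul_of_pos_left (by linarith) hδ0
      _ = ε / 4 := by rw [hδ]; field_simp
  have t2 : κ * ∫ y in L, |h i y - h j y| ^ p ≤ ε / 4 := by
    calc _ ≤ κ * (ε / (4 * κ)) := mul_le_mul_of_nonneg_left h1 hκ0.le
      _ = ε / 4 := by field_simp
  have t3 : (B' / R) * ((∫ y in L, |F i y| ^ p) + ∫ y in L, |W i y| ^ p) ≤ ε / 8 := by
    calc _ ≤ (B' / R) * (2 * A + 1) := mul_le_mul_of_nonneg_left (by linarith) (by positivity)
      _ = ε / 8 := by rw [hR]; field_simp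
  linarith

/-- Hölder's inequality with exponents p/(p-2) and p/2, the weight being split as ρ = ρ^{(p-2)/p}
ρ^{2/p}. -/
theorem setIntegral_holder {D : Set (E n)} (hD : IsCompact D) (hp : 2 < p) {F v ρ : E n → ℝ}
    (hF : Continuous F) (hv : Continuous v) (hρ : ContinuousOn ρ D) (hρ0 : ∀ y ∈ D, 0 ≤ ρ y) :
    ∫ y in D, |F y| ^ (p - 2) * v y ^ 2 * ρ y ≤
      (∫ y in D, |F y| ^ p * ρ y) ^ ((p - 2) / p) * (∫ y in D, |v y| ^ p * ρ y) ^ (2 / p) := by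
  have hp0 : 0 < p := by linarith
  have hp2 : 0 < p - 2 := by linarith
  have hPQ : (p / (p - 2)).HolderConjugate (p / 2) := by
    rw [Real.holderConjugate_iff]
    refine ⟨by rw [lt_div_iff₀ hp2]; linarith, ?_⟩
    field_simp
    ring
  haveI : IsFiniteMeasure (volume.restrict D) := ⟨by simpa using hD.measure_lt_top⟩
  have hmem : ∀ {f : E n → ℝ} (q : ℝ≥0∞), ContinuousOn f D → MemLp f q (volume.restrict D) := by
    intro f q hf
    obtain ⟨B, hB⟩ := hD.exists_bound_of_continuousOn hf
    exact MemLp.of_bound (hf.aestronglyMeasurable hD.measurableSet) B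
      ((ae_restrict_iff' hD.measurableSet).2 (Eventually.of_forall hB))
  have c1 : ContinuousOn (fun y => |F y| ^ (p - 2) * ρ y ^ ((p - 2) / p)) D :=
    (Continuous.abs_rpow hF hp2.le).continuousOn.mul
      (hρ.rpow_const fun _ _ => Or.inr (by positivity))
  have c2 : ContinuousOn (fun y => v y ^ 2 * ρ y ^ (2 / p)) D :=
    (hv.pow 2).continuousOn.mul (hρ.rpow_const fun _ _ => Or.inr (by positivity))
  have h := integral_mul_le_Lp_mul_Lq_of_nonneg (μ := volume.restrict D) hPQ
    (f := fun y => |F y| ^ (p - 2) * ρ y ^ ((p - 2) / p)) (g := fun y => v y ^ 2 * ρ y ^ (2 / p))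
    ((ae_restrict_iff' hD.measurableSet).2 (Eventually.of_forall fun y hy =>
      mul_nonneg (by positivity) (Real.rpow_nonneg (hρ0 y hy) _)))
    ((ae_restrict_iff' hD.measurableSet).2 (Eventually.of_forall fun y hy =>
      mul_nonneg (by positivity) (Real.rpow_nonneg (hρ0 y hy) _)))
    (hmem _ c1) (hmem _ c2)
  have e0 : ∫ y in D, |F y| ^ (p - 2) * v y ^ 2 * ρ y =
      ∫ y in D, |F y| ^ (p - 2) * ρ y ^ ((p - 2) / p) * (v y ^ 2 * ρ y ^ (2 / p)) := by
    refine setIntegral_congr_fun hD.measurableSet fun y hy => ?_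
    have : ρ y = ρ y ^ ((p - 2) / p) * ρ y ^ (2 / p) := by
      rcases (hρ0 y hy).eq_or_lt with h0 | h0
      · rw [← h0, Real.zero_rpow (by positivity), zero_mul]
      · rw [← Real.rpow_add h0, ← add_div, sub_add_cancel, div_self hp0.ne', Real.rpow_one]
    nth_rewrite 1 [this]
    ring
  have e1 : ∫ y in D, (|F y| ^ (p - 2) * ρ y ^ ((p - 2) / p)) ^ (p / (p - 2)) =
      ∫ y in D, |F y| ^ p * ρ y := by
    refine setIntegral_congr_fun hD.measurableSet fun y hy => ?_
    rw [Real.mul_rpow (by positivity) (Real.rpow_nonneg (hρ0 y hy) _), ← Real.rpow_mul (abs_nonneg _),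
      ← Real.rpow_mul (hρ0 y hy), mul_div_cancel₀ _ hp2.ne', div_mul_div_cancel₀ hp0.ne',
      div_self hp2.ne', Real.rpow_one]
  have e2 : ∫ y in D, (v y ^ 2 * ρ y ^ (2 / p)) ^ (p / 2) = ∫ y in D, |v y| ^ p * ρ y := by
    refine setIntegral_congr_fun hD.measurableSet fun y hy => ?_
    rw [Real.mul_rpow (by positivity) (Real.rpow_nonneg (hρ0 y hy) _), ← Real.rpow_mul (hρ0 y hy),
      ← sq_abs, ← Real.rpow_natCast, ← Real.rpow_mul (abs_nonneg _)]
    push_cast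
    rw [mul_div_cancel₀ _ two_ne_zero, div_mul_div_cancel₀ hp0.ne', div_self two_ne_zero, Real.rpow_one]
  rw [e0]
  refine h.trans (le_of_eq ?_)
  rw [e1, e2, one_div_div, one_div_div]

/-- The lower bound of the density on `L` passes to Lebesgue measure, and raising the Sobolev
inequality to the power p/2 removes the outer exponent. -/
theorem exists_setIntegral_rpow_le (hH : IsMetric U H) (hLU : L ⊆ U) (hL : IsCompact L) (hp : 2 < p)
    {B : ℝ} {k : ℕ} (hB : 0 ≤ B) (hS : ∀ v, IsBumpOn L v →
      (∫ y in L, |v y| ^ p * dens H y) ^ (2 / p) ≤ B * sobSq (k + 1) v) :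
    ∃ C : ℝ, 0 ≤ C ∧ ∀ v, IsBumpOn L v → ∫ y in L, |v y| ^ p ≤ C * (sobSq (k + 1) v) ^ (p / 2) := by
  obtain ⟨r, R, hr, hR, hrR⟩ := exists_dens_bounds hH hLU hL
  refine ⟨r⁻¹ * B ^ (p / 2), by positivity, fun v hv => ?_⟩
  have hp0 : 0 < p := by linarith
  have hc := Continuous.abs_rpow hv.smooth.continuous hp0.le
  have hi : IntegrableOn (fun y => |v y| ^ p * dens H y) L :=
    (hc.continuousOn.mul (hH.continuousOn_dens.mono hLU)).integrableOn_compact hL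
  have hX : 0 ≤ ∫ y in L, |v y| ^ p * dens H y :=
    setIntegral_nonneg hL.measurableSet fun y hy => mul_nonneg (by positivity) (hH.dens_pos (hLU hy)).le
  have h1 : ∫ y in L, |v y| ^ p ≤ r⁻¹ * ∫ y in L, |v y| ^ p * dens H y := by
    rw [← integral_const_mul]
    refine setIntegral_mono_on (hc.continuousOn.integrableOn_compact hL) (hi.const_mul _)
      hL.measurableSet fun y hy => ?_
    have := (hrR y hy).1
    have h0 : 0 ≤ |v y| ^ p := by positivity
    rw [inv_mul_eq_div, le_div_iff₀ hr]
    exact mul_le_mul_of_nonneg_left this h0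
  have h2 : ∫ y in L, |v y| ^ p * dens H y ≤ (B * sobSq (k + 1) v) ^ (p / 2) := by
    have := Real.rpow_le_rpow (Real.rpow_nonneg hX _) (hS v hv) (by positivity : 0 ≤ p / 2)
    rwa [← Real.rpow_mul hX, div_mul_div_cancel₀ hp0.ne', div_self two_ne_zero, Real.rpow_one] at this
  rw [mul_assoc, ← Real.mul_rpow hB (sobSq_nonneg _ _)]
  exact h1.trans (mul_le_mul_of_nonneg_left h2 (by positivity))

theorem lapHalfE_nonneg (hH : IsMetric U H) (k : ℕ) (v : E n → ℝ) {y : E n} (hy : y ∈ U) :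
    0 ≤ lapHalfE H k v y := by
  unfold lapHalfE
  split_ifs
  · positivity
  · obtain ⟨F, hF⟩ := exists_isFrame (hH.posDef y hy)
    rw [hF.quad_eq]
    positivity

/-- The factor equals 1/2 at ε = 0 and is continuous there, so it stays below 3/4 for small ε. The
gap pays for the limit in the energy bound and for comparing the densities of G_i and H. -/
theorem exists_rpow_small {κ K q r : ℝ} (hκ : 0 ≤ κ) (hq : 0 < q) (hr : 0 < r)
    (h : κ ^ q * K = 1 / 2) : ∃ ε : ℝ, 0 < ε ∧ (κ + ε) ^ q * (1 + ε) ^ r * K ≤ 3 / 4 := by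
  have hc : ContinuousAt (fun ε : ℝ => (κ + ε) ^ q * (1 + ε) ^ r * K) 0 := by
    refine ((ContinuousAt.rpow_const (by fun_prop) (Or.inr hq.le)).mul
      (ContinuousAt.rpow_const (by fun_prop) (Or.inr hr.le))).mul continuousAt_const
  have h0 : (κ + 0) ^ q * (1 + 0) ^ r * K < 3 / 4 := by
    rw [add_zero, add_zero, Real.one_rpow, mul_one, h]
    norm_num
  have h1 := (hc.eventually (gt_mem_nhds h0))
  have h2 : ∀ᶠ ε in 𝓝[>] (0 : ℝ), (κ + ε) ^ q * (1 + ε) ^ r * K < 3 / 4 := h1.filter_mono nhdsWithin_le_nhds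
  obtain ⟨ε, h3, h4⟩ := (h2.and self_mem_nhdsWithin).exists
  exact ⟨ε, h4, h3.le⟩

variable {k m : ℕ} {c : ℕ → Fin m → Fin m → E n → ℝ} {c' : Fin m → Fin m → E n → ℝ}
  {T : ℕ → Fin m → (E n → ℝ) → E n → ℝ} {T' : Fin m → (E n → ℝ) → E n → ℝ}

/-- Local strong convergence of Palais-Smale sequences of small energy, in a chart. -/
theorem local_strong_convergence (hU : IsOpen U) (hG : MetricConv U G H) (hLU : L ⊆ U)
    (hL : IsCompact L) (hp : 2 < p) (hbil : BilTendsto U k c c' T T') (hk : 1 ≤ k)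
    (hQ : ∀ v y, lapHalfE H k v y = bil c' T' v v y)
    {η : E n → ℝ} (hη : ContDiff ℝ ∞ η) (hη01 : ∀ y, 0 ≤ η y ∧ η y ≤ 1) (hηL : tsupport η ⊆ L)
    {F h W : ℕ → E n → ℝ} (hF : ∀ i, IsBumpOn L (F i)) (hh : ∀ i, IsBumpOn L (h i))
    (hFhW : ∀ i y, W i y = F i y - h i y) {M : ℝ} (hFM : ∀ i, sobSq (k + 1) (F i) ≤ M)
    (hhM : ∀ i, sobSq (k + 1) (h i) ≤ M) (hCau : SobCauchy (k + 1) h) (hnull : WeaklyNull L k W)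
    {K C₀ : ℝ} (hK : 0 < K) (hC₀ : 0 ≤ C₀)
    (hSob : ∀ v, IsBumpOn L v → (∫ y in L, |v y| ^ p * dens H y) ^ (2 / p) ≤
      K * (∫ y in L, lapHalfE H k v y * dens H y) + C₀ * sobSq k v)
    (henergy : ∀ ε : ℝ, 0 < ε → ∀ᶠ i in atTop,
      ∫ y in tsupport η, |F i y| ^ p * dens (G i) y ≤ (1 / (2 * K)) ^ (p / (p - 2)) + ε)
    {Cₐ : ℝ} (hCₐ : 0 ≤ Cₐ) (hPS : ∀ ε : ℝ, 0 < ε → ∀ᶠ i in atTop,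
      (∫ y in L, bil (c i) (T i) (F i) (fun z => η z * (η z * W i z)) y * dens (G i) y) -
        (∫ y in L, |F i y| ^ (p - 2) * F i y * (η y * (η y * W i y)) * dens (G i) y) ≤
      ε + Cₐ * (√(sobSq k (F i)) * √(sobSq k fun z => η z * (η z * W i z)))) :
    Tendsto (fun i => sobSq (k + 1) (fun z => η z * W i z)) atTop (𝓝 0) := by
  have hp0 : 0 < p := by linarith
  have hp2 : 0 < p - 2 := by linarith
  have hM : 0 ≤ M := (sobSq_nonneg _ _).trans (hFM 0)
  have hWeq : W = fun i y => F i y - h i y := by funext i y; exact hFhW i y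
  have hW : ∀ i, IsBumpOn L (W i) := fun i => by rw [hWeq]; exact (hF i).sub (hh i)
  have hWM : ∀ i, sobSq (k + 1) (W i) ≤ 4 * M := fun i => by
    rw [hWeq]
    have := sobSq_sub_le hL (hF i) (hh i) (k + 1)
    linarith [hFM i, hhM i]
  obtain ⟨D, hD0, hD⟩ := exists_sobSq_mul_le hL hη (k + 1)
  obtain ⟨D', hD0', hD'⟩ := exists_sobSq_mul_le hL hη k
  set v : ℕ → E n → ℝ := fun i z => η z * W i z with hv_def
  set φ : ℕ → E n → ℝ := fun i z => η z * v i z with hφ_def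
  have hv : ∀ i, IsBumpOn L (v i) := fun i => IsBumpOn.mul hη (hW i)
  have hφ : ∀ i, IsBumpOn L (φ i) := fun i => IsBumpOn.mul hη (hv i)
  have hvM : ∀ i, sobSq (k + 1) (v i) ≤ D * (4 * M) := fun i =>
    (hD _ (hW i)).trans (mul_le_mul_of_nonneg_left (hWM i) hD0)
  have hφM : ∀ i, sobSq (k + 1) (φ i) ≤ D * (D * (4 * M)) := fun i =>
    (hD _ (hv i)).trans (mul_le_mul_of_nonneg_left (hvM i) hD0)
  -- lower order norms tend to zero
  have hWk : Tendsto (fun i => sobSq k (W i)) atTop (𝓝 0) := hnull.tendsto_sobSq hL k hW hWM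
  have hvk : Tendsto (fun i => sobSq k (v i)) atTop (𝓝 0) :=
    squeeze_zero (fun i => sobSq_nonneg _ _) (fun i => hD' _ (hW i)) (by simpa using hWk.const_mul D')
  have hφk : Tendsto (fun i => sobSq k (φ i)) atTop (𝓝 0) :=
    squeeze_zero (fun i => sobSq_nonneg _ _) (fun i => hD' _ (hv i)) (by simpa using hvk.const_mul D')
  have hW1 : Tendsto (fun i => sobSq 1 (W i)) atTop (𝓝 0) :=
    squeeze_zero (fun i => sobSq_nonneg _ _) (fun i => sobSq_mono hL (hW i) hk) hWk
  have hsqrt : ∀ {x : ℕ → ℝ}, Tendsto x atTop (𝓝 0) → Tendsto (fun i => √(x i)) atTop (𝓝 0) := by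
    intro x hx
    have := (Real.continuous_sqrt.tendsto 0).comp hx
    rwa [Real.sqrt_zero] at this
  -- bounds in `L^p`
  obtain ⟨CB, hCB0, hCB⟩ := hbil.integral_bound hU hG.lim hLU hL
  have hQint : ∀ w, IsBumpOn L w → ∫ y in L, lapHalfE H k w y * dens H y ≤ CB * sobSq (k + 1) w := by
    intro w hw
    have := (le_abs_self _).trans (hCB w w hw hw)
    rw [Real.mul_self_sqrt (sobSq_nonneg _ _)] at this
    simpa only [hQ] using this
  obtain ⟨CP, hCP0, hCP⟩ := exists_setIntegral_rpow_le (B := K * CB + C₀) (k := k) hG.lim hLU hL hp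
    (by positivity) fun w hw => by
      refine (hSob w hw).trans ?_
      have h1 := mul_le_mul_of_nonneg_left (hQint w hw) hK.le
      have h2 := mul_le_mul_of_nonneg_left (sobSq_mono hL hw (by lia : k ≤ k + 1)) hC₀
      linarith
  set A : ℝ := CP * (4 * M) ^ (p / 2) with hA
  have hLp : ∀ w, IsBumpOn L w → sobSq (k + 1) w ≤ 4 * M → ∫ y in L, |w y| ^ p ≤ A := fun w hw hwM =>
    (hCP w hw).trans (mul_le_mul_of_nonneg_left
      (Real.rpow_le_rpow (sobSq_nonneg _ _) hwM (by positivity)) hCP0)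
  -- The L^p bounds and the L^p Cauchy property follow from those in H^k by the Sobolev inequality,
  -- applied to bumps only.
  have hcross := tendsto_cross_term hL hp hF hh hW (fun i => hLp _ (hF i) (by linarith [hFM i]))
    (fun i => hLp _ (hW i) (hWM i)) hW1 fun ε hε => by
      have hlim : Tendsto (fun t : ℝ => CP * t ^ (p / 2)) (𝓝[>] 0) (𝓝 0) := by
        have : ContinuousAt (fun t : ℝ => CP * t ^ (p / 2)) 0 :=
          continuousAt_const.mul (ContinuousAt.rpow_const continuousAt_id (Or.inr (by positivity)))
        have h2 := this.tendsto
        simp only [Real.zero_rpow (by positivity : p / 2 ≠ 0), mul_zero] at h2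
        exact h2.mono_left nhdsWithin_le_nhds
      obtain ⟨t, ht1, ht2⟩ := ((hlim.eventually (gt_mem_nhds hε)).and self_mem_nhdsWithin).exists
      obtain ⟨j, hj⟩ := hCau t ht2
      refine ⟨j, hj.mono fun i hi => ?_⟩
      refine (hCP _ ((hh i).sub (hh j))).trans (le_trans ?_ ht1.le)
      exact mul_le_mul_of_nonneg_left (Real.rpow_le_rpow (sobSq_nonneg _ _) hi (by positivity)) hCP0
  -- the three error terms of the quadratic part
  have e1 := hbil.integral_conv hU hG hLU hL (M := M + D * (D * (4 * M))) hF hφ (by positivity)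
    (fun i => (hFM i).trans (by linarith [mul_nonneg hD0 (mul_nonneg hD0 (by linarith : 0 ≤ 4 * M))]))
    (fun i => (hφM i).trans (by linarith))
  -- The multiplier η² is kept as a separate factor, so that the pairing is with the weakly null `W`
  -- itself.
  have e2 : Tendsto (fun i => ∫ y in L, bil c' T' (h i) (φ i) y * dens H y) atTop (𝓝 0) := by
    have := hbil.integral_weak hU hG.lim hLU hL (hη.mul hη) hh hW (by positivity) hWM hCau hnull
    refine this.congr fun i => ?_
    have : (fun z => η z * η z * W i z) = φ i := by
      funext z
      simp only [hφ_def, hv_def, mul_assoc]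
    rw [this]
  obtain ⟨CC, hCC0, hCC⟩ := hbil.integral_comm hU hG.lim hLU hL hη
  have e3 : Tendsto (fun i => (∫ y in L, bil c' T' (W i) (φ i) y * dens H y) -
      ∫ y in L, bil c' T' (v i) (v i) y * dens H y) atTop (𝓝 0) := by
    refine squeeze_zero_norm (a := fun i => CC * (√(sobSq k (W i)) * √(D * (4 * M)) +
      √(4 * M) * √(sobSq k (v i)))) (fun i => (hCC _ _ (hW i) (hv i)).trans ?_) ?_
    · refine mul_le_mul_of_nonneg_left (add_le_add ?_ ?_) hCC0
      · exact mul_le_mul_of_nonneg_left (Real.sqrt_le_sqrt (hvM i)) (Real.sqrt_nonneg _)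
      · exact mul_le_mul_of_nonneg_right (Real.sqrt_le_sqrt (hWM i)) (Real.sqrt_nonneg _)
    · simpa using (((hsqrt hWk).mul_const √(D * (4 * M))).add
        ((hsqrt hvk).const_mul √(4 * M))).const_mul CC
  obtain ⟨r, R, hr, hR, hrR⟩ := exists_dens_bounds hG.lim hLU hL
  set κ : ℝ := (1 / (2 * K)) ^ (p / (p - 2)) with hκ
  have hκ0 : 0 ≤ κ := by positivity
  -- The threshold κ is such that κ^{(p-2)/p} = 1/(2K); hence κ^{(p-2)/p} K = 1/2 exactly.
  obtain ⟨ε, hε, hεK⟩ := exists_rpow_small (κ := κ) (K := K) (q := (p - 2) / p) (r := 2 / p) hκ0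
    (by positivity) (by positivity) (by
      rw [hκ, ← Real.rpow_mul (by positivity), div_mul_div_cancel₀ hp2.ne', div_self hp0.ne',
        Real.rpow_one]
      field_simp)
  set Θ : ℝ := (κ + ε) ^ ((p - 2) / p) * (1 + ε) ^ (2 / p) with hΘ
  have hΘ0 : 0 ≤ Θ := by positivity
  set Q : ℕ → ℝ := fun i => ∫ y in L, lapHalfE H k (v i) y * dens H y with hQ_def
  have hQ0 : ∀ i, 0 ≤ Q i := fun i => setIntegral_nonneg hL.measurableSet fun y hy =>
    mul_nonneg (lapHalfE_nonneg hG.lim k _ (hLU hy)) (hG.lim.dens_pos (hLU hy)).le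
  have hdens : ∀ᶠ i in atTop, ∀ y ∈ L, dens (G i) y ≤ (1 + ε) * dens H y := by
    filter_upwards [hG.dens hU hLU hL hε] with i hi y hy
    have := (le_abs_self _).trans (hi y hy)
    linarith
  have hcontρ : ∀ i, ContinuousOn (dens (G i)) L := fun i =>
    (hG.metric i).continuousOn_dens.mono hLU
  have hρ0 : ∀ i, ∀ y ∈ L, 0 ≤ dens (G i) y := fun i y hy => ((hG.metric i).dens_pos (hLU hy)).le
  have hηc : IsCompact (tsupport η) := hL.of_isClosed_subset (isClosed_tsupport η) hηL
  -- the nonlinear term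
  have hNL : ∀ᶠ i in atTop, ∫ y in L, |F i y| ^ (p - 2) * F i y * φ i y * dens (G i) y ≤
      Θ * (K * Q i + C₀ * sobSq k (v i)) +
        ((1 + ε) * R) * ∫ y in L, |F i y| ^ (p - 2) * |h i y| * |W i y| := by
    filter_upwards [hdens, henergy ε hε] with i hi hen
    have cF := (hF i).smooth.continuous
    have cF2 := Continuous.abs_rpow cF hp2.le
    have ch := (hh i).smooth.continuous
    have cW := (hW i).smooth.continuous
    have cv := (hv i).smooth.continuous
    have I1 : IntegrableOn (fun y => |F i y| ^ (p - 2) * v i y ^ 2 * dens (G i) y) L :=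
      ((by fun_prop : Continuous fun y => |F i y| ^ (p - 2) * v i y ^ 2).continuousOn.mul
        (hcontρ i)).integrableOn_compact hL
    have I2 : IntegrableOn (fun y => |F i y| ^ (p - 2) * |h i y| * |W i y|) L :=
      (by fun_prop : Continuous fun y => |F i y| ^ (p - 2) * |h i y| * |W i y|).continuousOn.integrableOn_compact hL
    have I3 : IntegrableOn (fun y => |F i y| ^ (p - 2) * F i y * φ i y * dens (G i) y) L := by
      have := (hφ i).smooth.continuous
      exact ((by fun_prop : Continuous fun y => |F i y| ^ (p - 2) * F i y * φ i y).continuousOn.mul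
        (hcontρ i)).integrableOn_compact hL
    -- As F = W + h, φ = η² W and v = η W, one has F φ = v² + h φ. The second term is at most |h|
    -- |W| because 0 ≤ η ≤ 1, and feeds the cross term.
    have hstep : ∫ y in L, |F i y| ^ (p - 2) * F i y * φ i y * dens (G i) y ≤
        (∫ y in L, |F i y| ^ (p - 2) * v i y ^ 2 * dens (G i) y) +
          ((1 + ε) * R) * ∫ y in L, |F i y| ^ (p - 2) * |h i y| * |W i y| := by
      rw [← integral_const_mul, ← integral_add I1 (I2.const_mul _)]
      refine setIntegral_mono_on I3 (I1.add (I2.const_mul _)) hL.measurableSet fun y hy => ?_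
      have a0 : 0 ≤ |F i y| ^ (p - 2) := by positivity
      have a1 : F i y = W i y + h i y := by rw [hFhW]; ring
      have a2 : h i y * φ i y ≤ |h i y| * |W i y| := by
        refine (le_abs_self _).trans ?_
        rw [abs_mul]
        refine mul_le_mul_of_nonneg_left ?_ (abs_nonneg _)
        have b := hη01 y
        simp only [hφ_def, hv_def, abs_mul, abs_of_nonneg b.1]
        have b1 : η y * |W i y| ≤ |W i y| := mul_le_of_le_one_left (abs_nonneg _) b.2
        exact (mul_le_of_le_one_left (mul_nonneg b.1 (abs_nonneg _)) b.2).trans b1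
      have a3 : F i y * φ i y = v i y ^ 2 + h i y * φ i y := by
        conv_lhs => rw [a1]
        simp only [hφ_def, hv_def]
        ring
      have a4 := hρ0 i y hy
      have a5 : dens (G i) y ≤ (1 + ε) * R :=
        (hi y hy).trans (mul_le_mul_of_nonneg_left (hrR y hy).2 (by positivity))
      calc |F i y| ^ (p - 2) * F i y * φ i y * dens (G i) y
          = |F i y| ^ (p - 2) * v i y ^ 2 * dens (G i) y +
            |F i y| ^ (p - 2) * (h i y * φ i y) * dens (G i) y := by rw [mul_assoc (|F i y| ^ (p - 2)), a3]; ring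
        _ ≤ |F i y| ^ (p - 2) * v i y ^ 2 * dens (G i) y +
            |F i y| ^ (p - 2) * (|h i y| * |W i y|) * ((1 + ε) * R) := by
            refine add_le_add le_rfl (mul_le_mul (mul_le_mul_of_nonneg_left a2 a0) a5 a4 (by positivity))
        _ = _ := by ring
    have hvsupp : ∀ y, y ∉ tsupport η → v i y = 0 := fun y hy => by
      simp only [hv_def, image_eq_zero_of_notMem_tsupport hy, zero_mul]
    -- The integral is restricted to the support of η before Hölder's inequality, since the energy
    -- of `F` is small only there.
    have hres : ∫ y in L, |F i y| ^ (p - 2) * v i y ^ 2 * dens (G i) y =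
        ∫ y in tsupport η, |F i y| ^ (p - 2) * v i y ^ 2 * dens (G i) y :=
      (setIntegral_eq_of_subset_of_forall_sdiff_eq_zero
        (f := fun y => |F i y| ^ (p - 2) * v i y ^ 2 * dens (G i) y) hL.measurableSet hηL
        fun y hy => by simp only [hvsupp y hy.2]; ring)
    have hhol := setIntegral_holder hηc hp cF cv ((hcontρ i).mono hηL) fun y hy => hρ0 i y (hηL hy)
    have cvp := Continuous.abs_rpow cv hp0.le
    have hvp0 : 0 ≤ ∫ y in L, |v i y| ^ p * dens H y := setIntegral_nonneg hL.measurableSet fun y hy =>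
      mul_nonneg (by positivity) (hG.lim.dens_pos (hLU hy)).le
    have hvp : ∫ y in tsupport η, |v i y| ^ p * dens (G i) y ≤
        (1 + ε) * ∫ y in L, |v i y| ^ p * dens H y := by
      have e : ∫ y in tsupport η, |v i y| ^ p * dens (G i) y = ∫ y in L, |v i y| ^ p * dens (G i) y :=
        (setIntegral_eq_of_subset_of_forall_sdiff_eq_zero
          (f := fun y => |v i y| ^ p * dens (G i) y) hL.measurableSet hηL fun y hy => by
            simp only [hvsupp y hy.2, abs_zero, Real.zero_rpow hp0.ne', zero_mul]).symm
      rw [e, ← integral_const_mul]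
      refine setIntegral_mono_on ((cvp.continuousOn.mul (hcontρ i)).integrableOn_compact hL)
        (((cvp.continuousOn.mul (hG.lim.continuousOn_dens.mono hLU)).integrableOn_compact hL).const_mul _)
        hL.measurableSet fun y hy => ?_
      calc _ ≤ |v i y| ^ p * ((1 + ε) * dens H y) := mul_le_mul_of_nonneg_left (hi y hy) (by positivity)
        _ = _ := by ring
    have hFp0 : 0 ≤ ∫ y in tsupport η, |F i y| ^ p * dens (G i) y :=
      setIntegral_nonneg hηc.measurableSet fun y hy => mul_nonneg (by positivity) (hρ0 i y (hηL hy))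
    have hvp1 : 0 ≤ ∫ y in tsupport η, |v i y| ^ p * dens (G i) y :=
      setIntegral_nonneg hηc.measurableSet fun y hy => mul_nonneg (by positivity) (hρ0 i y (hηL hy))
    have hmain : ∫ y in tsupport η, |F i y| ^ (p - 2) * v i y ^ 2 * dens (G i) y ≤
        Θ * (K * Q i + C₀ * sobSq k (v i)) := by
      refine hhol.trans ?_
      calc _ ≤ (κ + ε) ^ ((p - 2) / p) * ((1 + ε) * ∫ y in L, |v i y| ^ p * dens H y) ^ (2 / p) :=
            mul_le_mul (Real.rpow_le_rpow hFp0 hen (by positivity))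
              (Real.rpow_le_rpow hvp1 hvp (by positivity)) (Real.rpow_nonneg hvp1 _) (by positivity)
        _ = Θ * (∫ y in L, |v i y| ^ p * dens H y) ^ (2 / p) := by
            rw [Real.mul_rpow (by positivity) hvp0, hΘ]; ring
        _ ≤ _ := mul_le_mul_of_nonneg_left (hSob _ (hv i)) hΘ0
    rw [hres] at hstep
    linarith
  -- conclusion
  have hQlim : Tendsto Q atTop (𝓝 0) := by
    set err : ℕ → ℝ := fun i => Cₐ * (√M * √(sobSq k (φ i))) + Θ * (C₀ * sobSq k (v i)) +
        ((1 + ε) * R) * (∫ y in L, |F i y| ^ (p - 2) * |h i y| * |W i y|) +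
        |(∫ y in L, bil (c i) (T i) (F i) (φ i) y * dens (G i) y) -
          ∫ y in L, bil c' T' (F i) (φ i) y * dens H y| +
        |∫ y in L, bil c' T' (h i) (φ i) y * dens H y| +
        |(∫ y in L, bil c' T' (W i) (φ i) y * dens H y) -
          ∫ y in L, bil c' T' (v i) (v i) y * dens H y| with herr
    have herr0 : Tendsto err atTop (𝓝 0) := by
      have t1 := ((hsqrt hφk).const_mul √M).const_mul Cₐ
      have t2 := (hvk.const_mul C₀).const_mul Θ
      have t3 := hcross.const_mul ((1 + ε) * R)
      have := ((((t1.add t2).add t3).add e1.abs).add e2.abs).add e3.abs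
      simpa using this
    -- Collecting all terms gives Q ≤ 3/4 Q + ε' + err, hence the factor 4.
    have hineq : ∀ ε' : ℝ, 0 < ε' → ∀ᶠ i in atTop, Q i ≤ 4 * (ε' + err i) := by
      intro ε' hε'
      filter_upwards [hPS ε' hε', hNL] with i h1 h2
      have hsplit : ∫ y in L, bil c' T' (F i) (φ i) y * dens H y =
          (∫ y in L, bil c' T' (W i) (φ i) y * dens H y) +
          ∫ y in L, bil c' T' (h i) (φ i) y * dens H y := by
        rw [← integral_add (hbil.integrableOn hG.lim hLU hL (hW i) (hφ i))
          (hbil.integrableOn hG.lim hLU hL (hh i) (hφ i))]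
        refine setIntegral_congr_fun hL.measurableSet fun y hy => ?_
        have a1 : F i = fun z => W i z + 1 * h i z := by funext z; rw [hFhW]; ring
        have := bil_add_mul_left (d := c') (fun a => (hbil.op a).lim) (hW i).smooth.contDiffOn
          (hh i).smooth.contDiffOn 1 (φ i) (hLU hy)
        rw [← a1] at this
        rw [this]
        ring
      have hQi : Q i = ∫ y in L, bil c' T' (v i) (v i) y * dens H y := by simp only [hQ_def, hQ]
      have h3 : √(sobSq k (F i)) * √(sobSq k (φ i)) ≤ √M * √(sobSq k (φ i)) :=
        mul_le_mul_of_nonneg_right (Real.sqrt_le_sqrt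
          ((sobSq_mono hL (hF i) (by lia)).trans (hFM i))) (Real.sqrt_nonneg _)
      have h4 := mul_le_mul_of_nonneg_left h3 hCₐ
      have h5 : Θ * (K * Q i) ≤ 3 / 4 * Q i := by
        rw [← mul_assoc]
        exact mul_le_mul_of_nonneg_right hεK (hQ0 i)
      have a1 := neg_abs_le ((∫ y in L, bil (c i) (T i) (F i) (φ i) y * dens (G i) y) -
          ∫ y in L, bil c' T' (F i) (φ i) y * dens H y)
      have a2 := neg_abs_le (∫ y in L, bil c' T' (h i) (φ i) y * dens H y)
      have a3 := neg_abs_le ((∫ y in L, bil c' T' (W i) (φ i) y * dens H y) -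
          ∫ y in L, bil c' T' (v i) (v i) y * dens H y)
      simp only [herr]
      rw [mul_add Θ] at h2
      linarith
    rw [Metric.tendsto_atTop']
    intro ε' hε'
    obtain ⟨i0, hi0⟩ := eventually_atTop.1 ((hineq (ε' / 16) (by positivity)).and
      (herr0.eventually (gt_mem_nhds (by positivity : 0 < ε' / 16))))
    refine ⟨i0, fun i hi => ?_⟩
    obtain ⟨h1, h2⟩ := hi0 i hi.le
    rw [dist_zero_right, Real.norm_eq_abs, abs_of_nonneg (hQ0 i)]
    linarith
  obtain ⟨CE, hCE0, hCE⟩ := elliptic_lapHalf hU hG.lim hLU hL k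
  -- The elliptic estimate is with respect to Lebesgue measure, so the density is bounded below by
  -- `r`.
  have hQ' : ∀ i, ∫ y, lapHalfE H k (v i) y ≤ r⁻¹ * Q i := by
    intro i
    have hb := (hv i).lapHalfE_bump hU hG.lim hLU k
    have e : ∫ y, lapHalfE H k (v i) y = ∫ y in L, lapHalfE H k (v i) y :=
      (setIntegral_eq_integral_of_forall_compl_eq_zero fun y hy =>
        image_eq_zero_of_notMem_tsupport fun h => hy (hb.supp h)).symm
    rw [e, hQ_def, ← integral_const_mul]
    refine setIntegral_mono_on (hb.smooth.continuous.continuousOn.integrableOn_compact hL)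
      (((hb.smooth.continuous.continuousOn.mul
        (hG.lim.continuousOn_dens.mono hLU)).integrableOn_compact hL).const_mul _)
      hL.measurableSet fun y hy => ?_
    rw [inv_mul_eq_div, le_div_iff₀ hr]
    exact mul_le_mul_of_nonneg_left (hrR y hy).1 (lapHalfE_nonneg hG.lim k _ (hLU hy))
  refine squeeze_zero (fun i => sobSq_nonneg _ _) (fun i => (hCE _ (hv i)).trans
    (mul_le_mul_of_nonneg_left (add_le_add (hQ' i) le_rfl) hCE0)) ?_
  simpa using ((hQlim.const_mul r⁻¹).add hvk).const_mul CE

end LocalCompactness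
end SmallEnergy

namespace SmallEnergy

/-! ### Comparison of covariant and coordinate jets. -/

section JetsInCharts

variable {n : ℕ} {N : Type*} [TopologicalSpace N] [ChartedSpace (E n) N] [IsManifold (𝓡 n) ∞ N]

theorem MetricTendsto.metricConv {g : ℕ → RMetric n N} {g' : RMetric n N} (h : MetricTendsto g g')
    (p : N) : MetricConv (extChartAt (𝓡 n) p).target (fun i => gram (g i) p) (gram g' p) :=
  ⟨fun i => isMetric_gram (g i) p, isMetric_gram g' p, fun a b =>
    SmoothTendsto.of_tendstoSmoothLoc (isOpen_target p) (fun i => contDiffOn_gram (g i) p a b)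
      (contDiffOn_gram g' p a b) (h p a b)⟩

theorem SmoothFn.add_mul {f f' : N → ℝ} (hf : SmoothFn (n := n) f) (hf' : SmoothFn (n := n) f')
    (c : ℝ) : SmoothFn (n := n) (fun x => f x + c * f' x) := fun p =>
  (hf p).add (contDiffOn_const.mul (hf' p))

theorem SmoothFn.sub {f f' : N → ℝ} (hf : SmoothFn (n := n) f) (hf' : SmoothFn (n := n) f') :
    SmoothFn (n := n) (fun x => f x - f' x) := fun p => (hf p).sub (hf' p)

variable {U L : Set (E n)} {G : ℕ → E n → Matrix (Fin n) (Fin n) ℝ} {H : E n → Matrix (Fin n) (Fin n) ℝ}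

theorem MetricConv.exists_trace_inv_le (hU : IsOpen U) (h : MetricConv U G H) (hLU : L ⊆ U)
    (hL : IsCompact L) : ∃ C : ℝ, 0 ≤ C ∧ ∀ᶠ i in atTop, ∀ y ∈ L, 1 + ((G i y)⁻¹).trace ≤ C := by
  obtain ⟨C, hC0, hC⟩ := (SmoothTendsto.sum hU Finset.univ fun j _ => h.inv hU j j).exists_bound
    hU hLU hL
  refine ⟨1 + C, by positivity, hC.mono fun i hi y hy => ?_⟩
  exact add_le_add le_rfl ((le_abs_self _).trans (hi y hy))

theorem IsMetric.exists_trace_le (h : IsMetric U H) (hLU : L ⊆ U) (hL : IsCompact L) :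
    ∃ C : ℝ, 0 ≤ C ∧ ∀ y ∈ L, 1 + (H y).trace ≤ C := by
  obtain ⟨C, hC⟩ := hL.exists_bound_of_continuousOn (f := fun y => (H y).trace)
    ((continuousOn_finsetSum _ fun j _ => (h.smooth j j).continuousOn).mono hLU)
  refine ⟨1 + |C|, by positivity, fun y hy => ?_⟩
  exact add_le_add le_rfl ((le_abs_self _).trans ((hC y hy).trans (le_abs_self _)))

variable [SecondCountableTopology N] [Nonempty N]

/-- Uniformity in the index comes from two bounds: the trace of G_i⁻¹ bounds the components of the
orthonormal frame, and the coordinate covariant derivatives converge as operators. -/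
theorem MetricTendsto.exists_abs_cov_le {g : ℕ → RMetric n N} {g' : RMetric n N}
    (h : MetricTendsto g g') {p : N} (hLU : L ⊆ (extChartAt (𝓡 n) p).target) (hL : IsCompact L)
    (l : ℕ) : ∃ C : ℝ, 0 ≤ C ∧ ∀ᶠ i in atTop, ∀ f, SmoothFn (n := n) f → ∀ a, ∀ y ∈ L,
      |cov (g i) f l a ((extChartAt (𝓡 n) p).symm y)| ≤
        C * jetNorm (l + 1) (f ∘ (extChartAt (𝓡 n) p).symm) y := by
  have hU := isOpen_target (n := n) p
  have hG := h.metricConv p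
  obtain ⟨B, hB0, hB⟩ := hG.exists_trace_inv_le hU hLU hL
  choose D hD0 hD using fun I : Fin l → Fin n => (hG.covE hU l I).exists_bound hU 1 hLU hL
  refine ⟨B ^ l * ∑ I, D I, mul_nonneg (by positivity) (Finset.sum_nonneg fun I _ => hD0 I), ?_⟩
  filter_upwards [hB, eventually_all.2 hD] with i hBi hDi f hf a y hy
  have hx : (extChartAt (𝓡 n) p).symm y ∈ (extChartAt (𝓡 n) p).source :=
    (extChartAt (𝓡 n) p).map_target (hLU hy)
  have hfr := isFrame_frameIn (g i) hx
  rw [cov_eq (g i) hf hx]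
  refine (hfr.abs_tev_le _ a).trans ?_
  rw [(extChartAt (𝓡 n) p).right_inv (hLU hy), mul_assoc, Finset.sum_mul]
  have ht : 0 ≤ 1 + ((gram (g i) p y)⁻¹).trace := by
    have := hfr.sum_sq
    rw [(extChartAt (𝓡 n) p).right_inv (hLU hy)] at this
    rw [← this]
    positivity
  refine mul_le_mul (pow_le_pow_left₀ ht (hBi y hy) l) (Finset.sum_le_sum fun I _ => ?_)
    (by positivity) (by positivity)
  have := hDi I _ (hf p) y hy
  rwa [jetNorm_one, add_comm 1 l] at this

theorem MetricTendsto.const (g : RMetric n N) : MetricTendsto (fun _ => g) g := fun _ _ _ _ _ _ _ =>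
  tendstoUniformlyOn_iff_tendsto.2 (tendsto_diag_uniformity _ _)

theorem exists_abs_cov_le (g : RMetric n N) {p : N} (hLU : L ⊆ (extChartAt (𝓡 n) p).target)
    (hL : IsCompact L) (l : ℕ) : ∃ C : ℝ, 0 ≤ C ∧ ∀ f, SmoothFn (n := n) f → ∀ a, ∀ y ∈ L,
      |cov g f l a ((extChartAt (𝓡 n) p).symm y)| ≤
        C * jetNorm (l + 1) (f ∘ (extChartAt (𝓡 n) p).symm) y := by
  obtain ⟨C, hC0, hC⟩ := (MetricTendsto.const g).exists_abs_cov_le hLU hL l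
  exact ⟨C, hC0, hC.exists.choose_spec⟩

theorem exists_norm_jet_le (g : RMetric n N) {p : N} (hLU : L ⊆ (extChartAt (𝓡 n) p).target)
    (hL : IsCompact L) (k : ℕ) : ∃ C : ℝ, 0 ≤ C ∧ ∀ f, SmoothFn (n := n) f → ∀ y ∈ L,
      ‖jet g k f ((extChartAt (𝓡 n) p).symm y)‖ ≤
        C * jetNorm (k + 1) (f ∘ (extChartAt (𝓡 n) p).symm) y := by
  choose D hD0 hD using fun l => exists_abs_cov_le g hLU hL l
  refine ⟨√(∑ c : JetIdx n k, (D c.1) ^ 2), Real.sqrt_nonneg _, fun f hf y hy => ?_⟩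
  have hj := jetNorm_nonneg (k + 1) (f ∘ (extChartAt (𝓡 n) p).symm) y
  rw [EuclideanSpace.norm_eq, ← Real.sqrt_sq hj, ← Real.sqrt_mul (by positivity)]
  refine Real.sqrt_le_sqrt ?_
  rw [Finset.sum_mul]
  refine Finset.sum_le_sum fun c _ => ?_
  rw [← mul_pow]
  refine pow_le_pow_left₀ (norm_nonneg _) ?_ 2
  refine (hD c.1 f hf c.2 y hy).trans (mul_le_mul_of_nonneg_left (jetNorm_mono ?_ _ _) (hD0 _))
  have := c.1.2
  lia

theorem abs_cov_le_norm_jet (g : RMetric n N) {k l : ℕ} (hl : l ≤ k) (f : N → ℝ) (a : Fin l → Fin n)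
    (x : N) : |cov g f l a x| ≤ ‖jet g k f x‖ :=
  PiLp.norm_apply_le (jet g k f x) (⟨⟨l, Nat.lt_succ_of_le hl⟩, a⟩ : JetIdx n k)

/-- Frame components control coordinate components through the trace of the metric, and covariant
derivatives control partial derivatives. Hence membership in H^k can be read in the chart. -/
theorem exists_jetNorm_le_norm_jet (g : RMetric n N) {p : N}
    (hLU : L ⊆ (extChartAt (𝓡 n) p).target) (hL : IsCompact L) (k : ℕ) :
    ∃ C : ℝ, 0 ≤ C ∧ ∀ f, SmoothFn (n := n) f → ∀ y ∈ L,
      jetNorm (k + 1) (f ∘ (extChartAt (𝓡 n) p).symm) y ≤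
        C * ‖jet g k f ((extChartAt (𝓡 n) p).symm y)‖ := by
  have hg := isMetric_gram g p
  obtain ⟨C, hC0, hC⟩ := hg.jetNorm_le_covE (isOpen_target p) hLU hL (k + 1)
  obtain ⟨B, hB0, hB⟩ := hg.exists_trace_le hLU hL
  refine ⟨C * ∑ l ∈ Finset.range (k + 1), ∑ _I : Fin l → Fin n, B ^ l * ∑ _a : Fin l → Fin n, 1,
    by positivity, fun f hf y hy => (hC _ (hf p) y hy).trans ?_⟩
  rw [mul_assoc]
  refine mul_le_mul_of_nonneg_left ?_ hC0
  simp only [Finset.sum_mul]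
  refine Finset.sum_le_sum fun l hl => Finset.sum_le_sum fun I _ => ?_
  have hx : (extChartAt (𝓡 n) p).symm y ∈ (extChartAt (𝓡 n) p).source :=
    (extChartAt (𝓡 n) p).map_target (hLU hy)
  have hfr := isFrame_frameIn g hx
  rw [(extChartAt (𝓡 n) p).right_inv (hLU hy)] at hfr
  have ht : 0 ≤ 1 + (gram g p y).trace := by rw [← hfr.sum_inv_sq]; positivity
  refine (hfr.abs_le (fun I => covE (gram g p) (f ∘ (extChartAt (𝓡 n) p).symm) l I y) I).trans ?_
  rw [mul_assoc, Finset.sum_mul]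
  refine mul_le_mul (pow_le_pow_left₀ ht (hB y hy) l) (Finset.sum_le_sum fun a _ => ?_)
    (by positivity) (by positivity)
  rw [one_mul]
  have := abs_cov_le_norm_jet g (Nat.lt_succ_iff.1 (Finset.mem_range.1 hl)) f a
    ((extChartAt (𝓡 n) p).symm y)
  rwa [cov_eq g hf hx, (extChartAt (𝓡 n) p).right_inv (hLU hy)] at this

theorem cov_add_mul (g : RMetric n N) {f f' : N → ℝ} (hf : SmoothFn (n := n) f)
    (hf' : SmoothFn (n := n) f') (c : ℝ) (l : ℕ) (a : Fin l → Fin n) (x : N) :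
    cov g (fun x => f x + c * f' x) l a x = cov g f l a x + c * cov g f' l a x := by
  have hx := mem_source_ctr (n := n) x
  rw [cov_eq g (hf.add_mul hf' c) hx, cov_eq g hf hx, cov_eq g hf' hx]
  simp only [tev, Finset.mul_sum, ← Finset.sum_add_distrib]
  refine Finset.sum_congr rfl fun J _ => ?_
  have := ((isMetric_gram g (ctr n x)).covE (isOpen_target _) l J).lin _ _ (hf _) (hf' _) c _
    ((extChartAt (𝓡 n) _).map_source hx)
  rw [show ((fun x => f x + c * f' x) ∘ (extChartAt (𝓡 n) (ctr n x)).symm) = fun z =>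
    (f ∘ (extChartAt (𝓡 n) (ctr n x)).symm) z + c * (f' ∘ (extChartAt (𝓡 n) (ctr n x)).symm) z from rfl,
    this]
  ring

theorem jet_add_mul (g : RMetric n N) (k : ℕ) {f f' : N → ℝ} (hf : SmoothFn (n := n) f)
    (hf' : SmoothFn (n := n) f') (c : ℝ) (x : N) :
    jet g k (fun x => f x + c * f' x) x = jet g k f x + c • jet g k f' x := by
  ext b
  simp [jet, cov_add_mul g hf hf']

theorem jet_sub (g : RMetric n N) (k : ℕ) {f f' : N → ℝ} (hf : SmoothFn (n := n) f)
    (hf' : SmoothFn (n := n) f') (x : N) :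
    jet g k (fun x => f x - f' x) x = jet g k f x - jet g k f' x := by
  have := jet_add_mul g k hf hf' (-1) x
  simpa [sub_eq_add_neg] using this

/-- The jets of order `k` of `f` and `f'` agree at `x`. -/
def SameJet (k : ℕ) (f f' : N → ℝ) (x : N) : Prop :=
  ∀ p : N, x ∈ (extChartAt (𝓡 n) p).source → jetNorm (k + 1)
    (fun y => f ((extChartAt (𝓡 n) p).symm y) - f' ((extChartAt (𝓡 n) p).symm y)) (extChartAt (𝓡 n) p x) = 0

/-- The covariant jet for one metric controls all coordinate derivatives up to order k. Equality of
jets is therefore independent of the metric, and operators of other metrics can be applied to a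
representative. -/
theorem sameJet_of_jet_eq (g : RMetric n N) {k : ℕ} {f f' : N → ℝ} (hf : SmoothFn (n := n) f)
    (hf' : SmoothFn (n := n) f') {x : N} (h : jet g k f x = jet g k f' x) :
    SameJet (n := n) k f f' x := fun p hx => by
  obtain ⟨C, -, hC⟩ := exists_jetNorm_le_norm_jet g (p := p) (L := {extChartAt (𝓡 n) p x})
    (by simpa using (extChartAt (𝓡 n) p).map_source hx) isCompact_singleton k
  have h1 := hC _ (hf.sub hf') _ rfl
  rw [(extChartAt (𝓡 n) p).left_inv hx, jet_sub g k hf hf', h, sub_self, norm_zero, mul_zero] at h1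
  exact le_antisymm h1 (jetNorm_nonneg _ _ _)

theorem sameJet_of_eventuallyEq {k : ℕ} {f f' : N → ℝ} {x : N} (h : f =ᶠ[𝓝 x] f') :
    SameJet (n := n) k f f' x := fun p hx => by
  have hc : ContinuousAt (extChartAt (𝓡 n) p).symm (extChartAt (𝓡 n) p x) :=
    continuousAt_extChartAt_symm' hx
  rw [ContinuousAt, (extChartAt (𝓡 n) p).left_inv hx] at hc
  rw [jetNorm_congr (g := fun _ => (0 : ℝ)) (by filter_upwards [hc h] with z hz; simpa [sub_eq_zero] using hz)]
  simp

theorem SameJet.isDiffOp_eq {k r : ℕ} {f f' : N → ℝ} {x : N} (h : SameJet (n := n) k f f' x)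
    (hf : SmoothFn (n := n) f) (hf' : SmoothFn (n := n) f') {p : N}
    (hx : x ∈ (extChartAt (𝓡 n) p).source) {P : (E n → ℝ) → E n → ℝ} (hr : r ≤ k)
    (hP : IsDiffOp (extChartAt (𝓡 n) p).target r P) :
    P (f ∘ (extChartAt (𝓡 n) p).symm) (extChartAt (𝓡 n) p x) =
      P (f' ∘ (extChartAt (𝓡 n) p).symm) (extChartAt (𝓡 n) p x) := by
  refine hP.eq_of_jetNorm_sub_eq_zero (hf p) (hf' p) ((extChartAt (𝓡 n) p).map_source hx) ?_
  exact le_antisymm ((jetNorm_mono (by lia) _ _).trans (h p hx).le) (jetNorm_nonneg _ _ _)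

theorem SameJet.cov_eq {k l : ℕ} {f f' : N → ℝ} {x : N} (h : SameJet (n := n) k f f' x)
    (hf : SmoothFn (n := n) f) (hf' : SmoothFn (n := n) f') (g : RMetric n N) (hl : l ≤ k)
    (a : Fin l → Fin n) : cov g f l a x = cov g f' l a x := by
  have hx := mem_source_ctr (n := n) x
  rw [SmallEnergy.cov_eq g hf hx, SmallEnergy.cov_eq g hf' hx]
  refine Finset.sum_congr rfl fun J _ => ?_
  beta_reduce
  rw [h.isDiffOp_eq hf hf' hx hl ((isMetric_gram g _).covE (isOpen_target _) l J)]

theorem SameJet.jet_eq {k : ℕ} {f f' : N → ℝ} {x : N} (h : SameJet (n := n) k f f' x)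
    (hf : SmoothFn (n := n) f) (hf' : SmoothFn (n := n) f') (g : RMetric n N) :
    jet g k f x = jet g k f' x := by
  ext c
  exact h.cov_eq hf hf' g (Nat.lt_succ_iff.1 c.1.2) c.2

theorem SameJet.lapHalfSq_eq {k : ℕ} {f f' : N → ℝ} {x : N} (h : SameJet (n := n) k f f' x)
    (hf : SmoothFn (n := n) f) (hf' : SmoothFn (n := n) f') (g : RMetric n N) :
    lapHalfSq g k f x = lapHalfSq g k f' x := by
  have hx := mem_source_ctr (n := n) x
  rw [SmallEnergy.lapHalfSq_eq g hf hx, SmallEnergy.lapHalfSq_eq g hf' hx]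
  obtain ⟨m, c, c', T, T', hT, -, he⟩ := exists_bil_lapHalfE (isOpen_target (ctr n x))
    (MetricConv.const (isMetric_gram g (ctr n x))) k
  simp only [he, bil, fun a => h.isDiffOp_eq hf hf' hx le_rfl (hT.op a).lim]

theorem SameJet.tensorQuad_eq {k l : ℕ} {f f' : N → ℝ} {x : N} (h : SameJet (n := n) k f f' x)
    (hf : SmoothFn (n := n) f) (hf' : SmoothFn (n := n) f') (g : RMetric n N) (hl : l ≤ k)
    (A : TensorField n N l) : tensorQuad g A f x = tensorQuad g A f' x := by
  simp only [tensorQuad, h.cov_eq hf hf' g hl]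

theorem SameJet.quadDensity_eq {k : ℕ} {f f' : N → ℝ} {x : N} (h : SameJet (n := n) k f f' x)
    (hf : SmoothFn (n := n) f) (hf' : SmoothFn (n := n) f') (g : RMetric n N)
    (A : (l : ℕ) → TensorField n N l) : quadDensity g k A f x = quadDensity g k A f' x := by
  rw [quadDensity, quadDensity, h.lapHalfSq_eq hf hf' g]
  congr 1
  exact Finset.sum_congr rfl fun l hl => h.tensorQuad_eq hf hf' g (Finset.mem_range.1 hl).le (A l)

theorem cov_zero_left (g : RMetric n N) (f : N → ℝ) (a : Fin 0 → Fin n) (x : N) : cov g f 0 a x = f x := by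
  simp only [cov, covCoord, (extChartAt (𝓡 n) (ctr n x)).left_inv (mem_source_ctr x)]
  simp

theorem smoothFn_zero : SmoothFn (n := n) (fun _ : N => (0 : ℝ)) := fun _ => contDiffOn_const

theorem jet_zero (g : RMetric n N) (k : ℕ) (x : N) : jet g k (fun _ => (0 : ℝ)) x = 0 := by
  have := jet_sub g k (smoothFn_zero (n := n) (N := N)) smoothFn_zero x
  simpa using this

theorem jet_eq_zero_of_notMem_tsupport (g : RMetric n N) (k : ℕ) {f : N → ℝ} (hf : SmoothFn (n := n) f)
    {x : N} (hx : x ∉ tsupport f) : jet g k f x = 0 := by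
  rw [(sameJet_of_eventuallyEq (notMem_tsupport_iff_eventuallyEq.1 hx)).jet_eq hf smoothFn_zero g]
  exact jet_zero g k x

end JetsInCharts
end SmallEnergy

namespace SmallEnergy

/-! ### Extension by zero of functions given in a chart. -/

section Lift

variable {n : ℕ} {N : Type*} [TopologicalSpace N] [ChartedSpace (E n) N]

/-- The function on `N` that a function on the range of a chart represents, extended by zero. -/
noncomputable def lift (p : N) (v : E n → ℝ) : N → ℝ :=
  (extChartAt (𝓡 n) p).source.indicator (v ∘ extChartAt (𝓡 n) p)

variable {p : N} {L : Set (E n)} {v : E n → ℝ}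

theorem lift_symm (v : E n → ℝ) {y : E n} (hy : y ∈ (extChartAt (𝓡 n) p).target) :
    lift p v ((extChartAt (𝓡 n) p).symm y) = v y := by
  rw [lift, indicator_of_mem ((extChartAt (𝓡 n) p).map_target hy), Function.comp_apply,
    (extChartAt (𝓡 n) p).right_inv hy]

theorem lift_eq_zero (hv : ∀ y ∉ L, v y = 0) {x : N} (hx : x ∉ (extChartAt (𝓡 n) p).symm '' L) :
    lift p v x = 0 := by
  classical
  rw [lift, indicator_apply]
  split_ifs with h
  · exact hv _ fun h' => hx ⟨_, h', (extChartAt (𝓡 n) p).left_inv h⟩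
  · rfl

theorem IsBumpOn.eq_zero (hv : IsBumpOn L v) : ∀ y ∉ L, v y = 0 := fun _ hy =>
  image_eq_zero_of_notMem_tsupport fun h => hy (hv.supp h)

theorem lift_mul_comp (p : N) (θ : E n → ℝ) (f : N → ℝ) :
    lift p (fun y => θ y * f ((extChartAt (𝓡 n) p).symm y)) = fun x => lift p θ x * f x := by
  classical
  funext x
  simp only [lift, indicator_apply]
  split_ifs with h
  · simp only [Function.comp_apply, (extChartAt (𝓡 n) p).left_inv h]
  · simp

theorem isCompact_symm_image (hLU : L ⊆ (extChartAt (𝓡 n) p).target) (hL : IsCompact L) :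
    IsCompact ((extChartAt (𝓡 n) p).symm '' L) :=
  hL.image_of_continuousOn ((continuousOn_extChartAt_symm p).mono hLU)

theorem symm_image_subset (hLU : L ⊆ (extChartAt (𝓡 n) p).target) :
    (extChartAt (𝓡 n) p).symm '' L ⊆ (extChartAt (𝓡 n) p).source := by
  rintro _ ⟨y, hy, rfl⟩
  exact (extChartAt (𝓡 n) p).map_target (hLU hy)

theorem target_inter_preimage (hLU : L ⊆ (extChartAt (𝓡 n) p).target) :
    (extChartAt (𝓡 n) p).target ∩ (extChartAt (𝓡 n) p).symm ⁻¹' ((extChartAt (𝓡 n) p).symm '' L) = L := by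
  ext y
  constructor
  · rintro ⟨hy, z, hz, h⟩
    rwa [← (extChartAt (𝓡 n) p).symm.injOn (hLU hz) hy h]
  · exact fun hy => ⟨hLU hy, y, hy, rfl⟩

variable [T2Space N]

theorem tsupport_lift_subset (hLU : L ⊆ (extChartAt (𝓡 n) p).target) (hL : IsCompact L)
    (hv : IsBumpOn L v) : tsupport (lift p v) ⊆ (extChartAt (𝓡 n) p).symm '' L :=
  closure_minimal (fun _ hx => by_contra fun h => hx (lift_eq_zero hv.eq_zero h))
    (isCompact_symm_image hLU hL).isClosed

variable [IsManifold (𝓡 n) ∞ N]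

theorem contMDiff_lift (hLU : L ⊆ (extChartAt (𝓡 n) p).target) (hL : IsCompact L)
    (hv : IsBumpOn L v) : ContMDiff (𝓡 n) 𝓘(ℝ, ℝ) ∞ (lift p v) := by
  intro x
  by_cases hx : x ∈ (extChartAt (𝓡 n) p).source
  · have h1 : ContMDiffAt (𝓡 n) 𝓘(ℝ, ℝ) ∞ (v ∘ extChartAt (𝓡 n) p) x :=
      (hv.smooth.contMDiff _).comp x
        (contMDiffAt_extChartAt' (by rwa [extChartAt_source] at hx))
    refine h1.congr_of_eventuallyEq ?_
    filter_upwards [(isOpen_source p).mem_nhds hx] with z hz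
    rw [lift, indicator_of_mem hz]
  · have h2 : lift p v =ᶠ[𝓝 x] fun _ => (0 : ℝ) := notMem_tsupport_iff_eventuallyEq.1 fun h =>
      hx (symm_image_subset hLU (tsupport_lift_subset hLU hL hv h))
    exact contMDiffAt_const.congr_of_eventuallyEq h2

theorem isTest_lift (hLU : L ⊆ (extChartAt (𝓡 n) p).target) (hL : IsCompact L)
    (hv : IsBumpOn L v) : IsTest n univ (lift p v) :=
  ⟨contMDiff_lift hLU hL hv, (isCompact_symm_image hLU hL).of_isClosed_subset (isClosed_tsupport _)
    (tsupport_lift_subset hLU hL hv), subset_univ _⟩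

variable {Ω : Set N} {f f' : N → ℝ}

theorem IsTest.smoothFn (hf : IsTest n Ω f) : SmoothFn (n := n) f := hf.1.smoothFn

theorem IsTest.add_mul (hf : IsTest n Ω f) (hf' : IsTest n Ω f') (c : ℝ) :
    IsTest n Ω (fun x => f x + c * f' x) :=
  ⟨hf.1.add (contMDiff_const.mul hf'.1), hf.2.1.add (hf'.2.1.mul_left (f := fun _ => c)),
    (tsupport_add f (fun x => c * f' x)).trans (union_subset hf.2.2
      ((tsupport_mul_subset_right (f := fun _ => c) (g := f')).trans hf'.2.2))⟩

theorem IsTest.sub (hf : IsTest n Ω f) (hf' : IsTest n Ω f') : IsTest n Ω (fun x => f x - f' x) := by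
  have := hf.add_mul hf' (-1)
  simpa [sub_eq_add_neg] using this

theorem isTest_zero : IsTest n Ω (fun _ => 0) :=
  ⟨contMDiff_const, HasCompactSupport.zero, by simp [tsupport_eq_empty_iff.2 (rfl : (fun _ : N => (0 : ℝ)) = 0)]⟩

theorem IsTest.eq_zero (hf : IsTest n Ω f) {x : N} (hx : x ∉ Ω) : f x = 0 :=
  image_eq_zero_of_notMem_tsupport fun h => hx (hf.2.2 h)

/-- Multiplying by a cut-off from the chart only shrinks the support, so the product is still
supported in Ω. This is why no regularity of the boundary is needed. -/
theorem IsTest.lift_mul (hf : IsTest n Ω f) (hLU : L ⊆ (extChartAt (𝓡 n) p).target) (hL : IsCompact L)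
    (hv : IsBumpOn L v) :
    IsTest n Ω (lift p (fun y => v y * f ((extChartAt (𝓡 n) p).symm y))) := by
  rw [lift_mul_comp]
  exact ⟨(contMDiff_lift hLU hL hv).mul hf.1, hf.2.1.mul_left (f := lift p v),
    (tsupport_mul_subset_right (f := lift p v) (g := f)).trans hf.2.2⟩

theorem SmoothFn.isBumpOn_mul (hf : SmoothFn (n := n) f) (hLU : L ⊆ (extChartAt (𝓡 n) p).target)
    (hv : IsBumpOn L v) : IsBumpOn L (fun y => v y * f ((extChartAt (𝓡 n) p).symm y)) := by
  have hs := tsupport_mul_subset_left (f := v) (g := fun y => f ((extChartAt (𝓡 n) p).symm y))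
  exact ⟨contDiff_of_tsupport (isOpen_target p) (hv.smooth.contDiffOn.mul (hf p))
    (hs.trans (hv.supp.trans hLU)), hs.trans hv.supp⟩

end Lift

/-! ### Integrals, Sobolev norms and the Sobolev inequality in a chart. -/

section Integrals

variable {n : ℕ} {N : Type*} [TopologicalSpace N] [ChartedSpace (E n) N] [IsManifold (𝓡 n) ∞ N]
  [T2Space N] [MeasurableSpace N] [BorelSpace N] [SecondCountableTopology N] [Nonempty N]

variable {p : N} {L : Set (E n)} {v : E n → ℝ} {Ω : Set N} {f f' : N → ℝ}

theorem setIntegral_symm_image (g : RMetric n N) {F : N → ℝ} (hF : AEStronglyMeasurable F (vol g))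
    (hLU : L ⊆ (extChartAt (𝓡 n) p).target) (hL : IsCompact L) :
    ∫ x in (extChartAt (𝓡 n) p).symm '' L, F x ∂(vol g) =
      ∫ y in L, F ((extChartAt (𝓡 n) p).symm y) * dens (gram g p) y := by
  have hS := (isCompact_symm_image hLU hL).measurableSet
  have h := setIntegral_source g p (hF.indicator hS)
  rw [setIntegral_indicator hS, inter_eq_self_of_subset_right (symm_image_subset hLU)] at h
  rw [h]
  have e : ∀ y ∈ (extChartAt (𝓡 n) p).target, dens (gram g p) y *
      ((extChartAt (𝓡 n) p).symm '' L).indicator F ((extChartAt (𝓡 n) p).symm y) =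
      L.indicator (fun y => F ((extChartAt (𝓡 n) p).symm y) * dens (gram g p) y) y := fun y hy => by
    by_cases hyL : y ∈ L
    · rw [indicator_of_mem (mem_image_of_mem _ hyL), indicator_of_mem hyL, mul_comm]
    · rw [indicator_of_notMem hyL, indicator_of_notMem, mul_zero]
      exact fun h' => hyL ((target_inter_preimage hLU).subset ⟨hy, h'⟩)
  rw [setIntegral_congr_fun (isOpen_target p).measurableSet e, setIntegral_indicator hL.measurableSet,
    inter_eq_self_of_subset_right hLU]

theorem _root_.MeasureTheory.IntegrableOn.chart {g : RMetric n N} {F : N → ℝ}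
    (hF : IntegrableOn F (extChartAt (𝓡 n) p).source (vol g))
    (hLU : L ⊆ (extChartAt (𝓡 n) p).target) (hL : IsCompact L) :
    IntegrableOn (fun y => F ((extChartAt (𝓡 n) p).symm y) * dens (gram g p) y) L := by
  rw [IntegrableOn, vol_restrict_source, chartMeas] at hF
  have h2 := hF.comp_aemeasurable (aemeasurable_symm p _)
  rw [restrict_withDensity (isOpen_target p).measurableSet,
    integrable_withDensity_iff_integrable_smul₀' (aemeasurable_dens g p) (by simp)] at h2
  refine (IntegrableOn.mono_set h2 hLU).congr_fun (fun y hy => ?_) hL.measurableSet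
  simp only [Function.comp_apply, smul_eq_mul,
    ENNReal.toReal_ofReal ((isMetric_gram g p).dens_pos (hLU hy)).le, mul_comm]

theorem integral_eq_chart (g : RMetric n N) {F : N → ℝ} (hF : AEStronglyMeasurable F (vol g))
    (hLU : L ⊆ (extChartAt (𝓡 n) p).target) (hL : IsCompact L)
    (h0 : ∀ x ∉ (extChartAt (𝓡 n) p).symm '' L, F x = 0) :
    ∫ x, F x ∂(vol g) = ∫ y in L, F ((extChartAt (𝓡 n) p).symm y) * dens (gram g p) y := by
  rw [← setIntegral_symm_image g hF hLU hL, setIntegral_eq_integral_of_forall_compl_eq_zero h0]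

theorem vol_symm_image_lt_top (g : RMetric n N) (hLU : L ⊆ (extChartAt (𝓡 n) p).target)
    (hL : IsCompact L) : vol g ((extChartAt (𝓡 n) p).symm '' L) < ⊤ := by
  have hS := (isCompact_symm_image hLU hL).measurableSet
  rw [vol_apply g hS (symm_image_subset hLU), chartMeas_apply g p hS, target_inter_preimage hLU]
  obtain ⟨r, R, -, -, hR⟩ := exists_dens_bounds (isMetric_gram g p) hLU hL
  refine (setLIntegral_mono' hL.measurableSet fun y hy => ENNReal.ofReal_le_ofReal (hR y hy).2).trans_lt ?_
  rw [setLIntegral_const]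
  exact ENNReal.mul_lt_top ENNReal.ofReal_lt_top hL.measure_lt_top

/-- Each point has a compact coordinate ball as a neighbourhood; it has finite volume and `F` is
bounded on it. -/
theorem locallyIntegrable_of_chart {F' : Type*} [NormedAddCommGroup F'] (g : RMetric n N) {F : N → F'}
    (hF : AEStronglyMeasurable F (vol g)) (hb : ∀ (p : N) (L : Set (E n)),
      L ⊆ (extChartAt (𝓡 n) p).target → IsCompact L →
        ∃ C : ℝ, ∀ y ∈ L, ‖F ((extChartAt (𝓡 n) p).symm y)‖ ≤ C) : LocallyIntegrable F (vol g) := by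
  intro x
  obtain ⟨r, hr, hrb⟩ := Metric.nhds_basis_closedBall.mem_iff.1 (extChartAt_target_mem_nhds (I := 𝓡 n) x)
  have hL := isCompact_closedBall (extChartAt (𝓡 n) x x) r
  obtain ⟨C, hC⟩ := hb x _ hrb hL
  refine ⟨(extChartAt (𝓡 n) x).symm '' Metric.closedBall (extChartAt (𝓡 n) x x) r, ?_, ?_⟩
  · filter_upwards [(continuousAt_extChartAt (I := 𝓡 n) x) (Metric.closedBall_mem_nhds _ hr),
      extChartAt_source_mem_nhds (I := 𝓡 n) x] with z hz hz'
    exact ⟨_, hz, (extChartAt (𝓡 n) x).left_inv hz'⟩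
  · refine Measure.integrableOn_of_bounded (M := C) (vol_symm_image_lt_top g hrb hL).ne hF ?_
    refine ae_restrict_of_forall_mem (isCompact_symm_image hrb hL).measurableSet ?_
    rintro _ ⟨y, hy, rfl⟩
    exact hC y hy

theorem IsTest.memLp_jet (hf : IsTest n Ω f) (g : RMetric n N) (k : ℕ) : MemLp (jet g k f) 2 (vol g) := by
  have hm := measurable_jet g hf.smoothFn k
  rw [← integrable_norm_rpow_iff hm.aestronglyMeasurable (by simp) (by simp)]
  have hm' : Measurable fun x => ‖jet g k f x‖ ^ (2 : ℝ≥0∞).toReal := hm.norm.pow_const _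
  have h : LocallyIntegrable (fun x => ‖jet g k f x‖ ^ (2 : ℝ≥0∞).toReal) (vol g) := by
    refine locallyIntegrable_of_chart g hm'.aestronglyMeasurable fun p L hLU hL => ?_
    obtain ⟨C, hC0, hC⟩ := exists_norm_jet_le g hLU hL k
    obtain ⟨D, hD0, hD⟩ := exists_jetNorm_le (isOpen_target p) (hf.smoothFn p) hLU hL (k + 1)
    refine ⟨(C * D) ^ 2, fun y hy => ?_⟩
    simp only [ENNReal.toReal_ofNat, Real.rpow_ofNat, norm_pow, norm_norm]
    exact pow_le_pow_left₀ (norm_nonneg _)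
      ((hC f hf.smoothFn y hy).trans (mul_le_mul_of_nonneg_left (hD y hy) hC0)) 2
  refine (integrableOn_iff_integrable_of_support_subset fun x hx => ?_).1
    (h.integrableOn_isCompact hf.2.1)
  by_contra hx'
  refine hx ?_
  simp only [jet_eq_zero_of_notMem_tsupport g k hf.smoothFn hx', norm_zero]
  simp

theorem IsTest.integrable_norm_jet_sq (hf : IsTest n Ω f) (g : RMetric n N) (k : ℕ) :
    Integrable (fun x => ‖jet g k f x‖ ^ 2) (vol g) := (hf.memLp_jet g k).integrable_norm_pow (by simp)

/-- The constant collects Leibniz' rule for the cut-off, the comparison of coordinate and covariant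
jets, and the lower bound of the density on `L`. -/
theorem exists_sobSq_loc_le (g : RMetric n N) (hLU : L ⊆ (extChartAt (𝓡 n) p).target)
    (hL : IsCompact L) {χ : E n → ℝ} (hχ : IsBumpOn L χ) (k : ℕ) :
    ∃ C : ℝ, 0 ≤ C ∧ ∀ f, IsTest n (univ : Set N) f →
      sobSq (k + 1) (fun y => χ y * f ((extChartAt (𝓡 n) p).symm y)) ≤
        C * ∫ x, ‖jet g k f x‖ ^ 2 ∂(vol g) := by
  obtain ⟨C, hC0, hC⟩ := exists_jetNorm_le_norm_jet g hLU hL k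
  obtain ⟨D, hD0, hD⟩ := exists_jetNorm_le (isOpen_target p) hχ.smooth.contDiffOn hLU hL (k + 1)
  obtain ⟨r, R, hr, hR, hrR⟩ := exists_dens_bounds (isMetric_gram g p) hLU hL
  set B : ℝ := ((k + 1 : ℕ) : ℝ) * 2 ^ (k + 1) * ((k + 1 : ℕ) : ℝ) with hB
  have hB0 : 0 ≤ B := by positivity
  refine ⟨(B * (D * C)) ^ 2 * r⁻¹, by positivity, fun f hf => ?_⟩
  have hbump := hf.smoothFn.isBumpOn_mul hLU hχ
  rw [sobSq_eq_setIntegral hbump]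
  have hm := (measurable_jet g hf.smoothFn k).norm.pow_const 2
  have hint : IntegrableOn (fun y => ‖jet g k f ((extChartAt (𝓡 n) p).symm y)‖ ^ 2 *
      dens (gram g p) y) L :=
    (hf.integrable_norm_jet_sq g k).integrableOn.chart hLU hL
  calc ∫ y in L, jetNorm (k + 1) (fun y => χ y * f ((extChartAt (𝓡 n) p).symm y)) y ^ 2
      ≤ ∫ y in L, (B * (D * C)) ^ 2 * r⁻¹ *
          (‖jet g k f ((extChartAt (𝓡 n) p).symm y)‖ ^ 2 * dens (gram g p) y) := by
        refine setIntegral_mono_on ((hbump.integrable_jetNorm_sq hL _).integrableOn)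
          (hint.const_mul _) hL.measurableSet fun y hy => ?_
        have h1 : jetNorm (k + 1) (fun y => χ y * f ((extChartAt (𝓡 n) p).symm y)) y ≤
            B * (D * (C * ‖jet g k f ((extChartAt (𝓡 n) p).symm y)‖)) :=
          (jetNorm_mul_le (isOpen_target p) hχ.smooth.contDiffOn (hf.smoothFn p) (hLU hy) _).trans
            (mul_le_mul_of_nonneg_left (mul_le_mul (hD y hy) (hC f hf.smoothFn y hy)
              (jetNorm_nonneg _ _ _) hD0) hB0)
        have h2 : (1 : ℝ) ≤ r⁻¹ * dens (gram g p) y := by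
          rw [inv_mul_eq_div, one_le_div hr]; exact (hrR y hy).1
        calc _ ≤ (B * (D * (C * ‖jet g k f ((extChartAt (𝓡 n) p).symm y)‖))) ^ 2 * 1 := by
              rw [mul_one]; exact pow_le_pow_left₀ (jetNorm_nonneg _ _ _) h1 2
          _ ≤ (B * (D * (C * ‖jet g k f ((extChartAt (𝓡 n) p).symm y)‖))) ^ 2 *
              (r⁻¹ * dens (gram g p) y) := mul_le_mul_of_nonneg_left h2 (sq_nonneg _)
          _ = _ := by ring
    _ = (B * (D * C)) ^ 2 * r⁻¹ * ∫ x in (extChartAt (𝓡 n) p).symm '' L, ‖jet g k f x‖ ^ 2 ∂(vol g) := by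
        rw [integral_const_mul, setIntegral_symm_image g hm.aestronglyMeasurable hLU hL]
    _ ≤ _ := mul_le_mul_of_nonneg_left (setIntegral_le_integral (hf.integrable_norm_jet_sq g k)
        (ae_of_all _ fun x => sq_nonneg _)) (by positivity)

theorem integral_le_sobSq_of_chart {m : ℕ} (g : RMetric n N) {F : N → ℝ} (hF : AEStronglyMeasurable F (vol g))
    (hLU : L ⊆ (extChartAt (𝓡 n) p).target) (hL : IsCompact L) (hv : IsBumpOn L v) {B R : ℝ}
    (hR : ∀ y ∈ L, dens (gram g p) y ≤ R) (hF0 : ∀ x, 0 ≤ F x)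
    (h0 : ∀ x ∉ (extChartAt (𝓡 n) p).symm '' L, F x = 0)
    (hB : ∀ y ∈ L, F ((extChartAt (𝓡 n) p).symm y) ≤ B * jetNorm m v y ^ 2) :
    ∫ x, F x ∂(vol g) ≤ B * R * sobSq m v := by
  rw [integral_eq_chart g hF hLU hL h0, sobSq_eq_setIntegral hv, ← integral_const_mul]
  refine integral_mono_of_nonneg ?_ ((hv.integrable_jetNorm_sq hL m).integrableOn.const_mul _) ?_
  · exact ae_restrict_of_forall_mem hL.measurableSet fun y hy =>
      mul_nonneg (hF0 _) ((isMetric_gram g p).dens_pos (hLU hy)).le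
  · refine ae_restrict_of_forall_mem hL.measurableSet fun y hy => ?_
    calc _ ≤ B * jetNorm m v y ^ 2 * R := mul_le_mul (hB y hy) (hR y hy)
          ((isMetric_gram g p).dens_pos (hLU hy)).le ((hF0 _).trans (hB y hy))
      _ = _ := by ring

theorem lift_comp_symm_eqOn (v : E n → ℝ) : EqOn (lift p v ∘ (extChartAt (𝓡 n) p).symm) v
    (extChartAt (𝓡 n) p).target := fun _ hy => lift_symm v hy

theorem exists_integral_jet_lift_le (g : RMetric n N) (hLU : L ⊆ (extChartAt (𝓡 n) p).target)
    (hL : IsCompact L) (k : ℕ) : ∃ C : ℝ, 0 ≤ C ∧ ∀ v, IsBumpOn L v →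
      ∫ x, ‖jet g k (lift p v) x‖ ^ 2 ∂(vol g) ≤ C * sobSq (k + 1) v := by
  obtain ⟨C, hC0, hC⟩ := exists_norm_jet_le g hLU hL k
  obtain ⟨r, R, hr, hR, hrR⟩ := exists_dens_bounds (isMetric_gram g p) hLU hL
  refine ⟨C ^ 2 * R, by positivity, fun v hv => ?_⟩
  have hs := (isTest_lift hLU hL hv).smoothFn
  refine integral_le_sobSq_of_chart g ((measurable_jet g hs k).norm.pow_const 2).aestronglyMeasurable
    hLU hL hv (fun y hy => (hrR y hy).2) (fun x => sq_nonneg _) (fun x hx => ?_) fun y hy => ?_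
  · rw [jet_eq_zero_of_notMem_tsupport g k hs fun h => hx (tsupport_lift_subset hLU hL hv h)]
    simp
  · rw [← mul_pow, ← jetNorm_congr_on (isOpen_target p) (lift_comp_symm_eqOn v) (hLU hy)]
    exact pow_le_pow_left₀ (norm_nonneg _) (hC _ hs y hy) 2

theorem exists_lowerNormSq_lift_le (g : RMetric n N) (hLU : L ⊆ (extChartAt (𝓡 n) p).target)
    (hL : IsCompact L) (k : ℕ) : ∃ C : ℝ, 0 ≤ C ∧ ∀ v, IsBumpOn L v →
      lowerNormSq g k (lift p v) ≤ C * sobSq k v := by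
  choose C hC0 hC using fun l => exists_abs_cov_le g hLU hL l
  obtain ⟨r, R, hr, hR, hrR⟩ := exists_dens_bounds (isMetric_gram g p) hLU hL
  refine ⟨∑ l ∈ Finset.range k, (∑ _a : Fin l → Fin n, C l ^ 2) * R, by positivity, fun v hv => ?_⟩
  have hs := (isTest_lift hLU hL hv).smoothFn
  rw [lowerNormSq, Finset.sum_mul]
  refine Finset.sum_le_sum fun l hl => ?_
  refine integral_le_sobSq_of_chart g (Finset.measurable_sum _ fun a _ =>
    (measurable_cov g hs l a).pow_const 2).aestronglyMeasurable
    hLU hL hv (fun y hy => (hrR y hy).2) (fun x => by positivity) (fun x hx => ?_) fun y hy => ?_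
  · refine Finset.sum_eq_zero fun a _ => ?_
    have h := abs_cov_le_norm_jet g le_rfl (lift p v) a x
    rw [jet_eq_zero_of_notMem_tsupport g l hs fun h => hx (tsupport_lift_subset hLU hL hv h),
      norm_zero] at h
    rw [abs_nonpos_iff.1 h]
    simp
  · rw [Finset.sum_mul]
    refine Finset.sum_le_sum fun a _ => ?_
    rw [← mul_pow, ← jetNorm_congr_on (isOpen_target p) (lift_comp_symm_eqOn v) (hLU hy), ← sq_abs]
    refine pow_le_pow_left₀ (abs_nonneg _) ((hC l _ hs a y hy).trans ?_) 2
    exact mul_le_mul_of_nonneg_left (jetNorm_mono (Finset.mem_range.1 hl) _ _) (hC0 l)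

theorem lapHalfSq_zero (g : RMetric n N) (k : ℕ) (x : N) : lapHalfSq g k (fun _ => (0 : ℝ)) x = 0 := by
  have hc : ∀ (l : ℕ) (a : Fin l → Fin n) (x : N), cov g (fun _ => (0 : ℝ)) l a x = 0 := fun l a x => by
    have h := abs_cov_le_norm_jet g le_rfl (fun _ => (0 : ℝ)) a x
    rw [jet_zero, norm_zero] at h
    exact abs_nonpos_iff.1 h
  have hl : (lap g)^[k / 2] (fun _ => (0 : ℝ)) = fun _ => 0 :=
    Function.iterate_fixed (by funext x; simp [lap, hc]) _
  simp [lapHalfSq, hl, hc]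

/-- The global inequality is applied to the lift of `v`, a test function on `N`. All integrals then
localise to `L`, and the lower order terms are bounded by the coordinate H^{k-1} norm. -/
theorem SobolevIneq.chart {g : RMetric n N} {k : ℕ} {K C : ℝ} (hkn : 2 * k < n) (hC : 0 ≤ C)
    (h : SobolevIneq g k K C) (hLU : L ⊆ (extChartAt (𝓡 n) p).target) (hL : IsCompact L) :
    ∃ C₀ : ℝ, 0 ≤ C₀ ∧ ∀ v, IsBumpOn L v →
      (∫ y in L, |v y| ^ crit n k * dens (gram g p) y) ^ (2 / crit n k) ≤
        K * (∫ y in L, lapHalfE (gram g p) k v y * dens (gram g p) y) + C₀ * sobSq k v := by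
  obtain ⟨D, hD0, hD⟩ := exists_lowerNormSq_lift_le g hLU hL k
  refine ⟨C * D, by positivity, fun v hv => ?_⟩
  have ht := isTest_lift hLU hL hv
  have h1 := h _ ht
  have hn : (2 * k : ℝ) < n := by exact_mod_cast hkn
  -- A zero exponent would make `|0| ^ crit n k` equal to 1 outside the chart.
  have hp : crit n k ≠ 0 := by
    unfold crit
    have : (0 : ℝ) < n := by have : (0 : ℝ) ≤ k := k.cast_nonneg; linarith
    have : (0 : ℝ) < n - 2 * k := by linarith
    positivity
  have e1 : ∫ x, |lift p v x| ^ crit n k ∂(vol g) = ∫ y in L, |v y| ^ crit n k * dens (gram g p) y := by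
    rw [integral_eq_chart g ?_ hLU hL fun x hx => by
      rw [lift_eq_zero hv.eq_zero hx, abs_zero, Real.zero_rpow hp]]
    · exact setIntegral_congr_fun hL.measurableSet fun y hy => by simp only [lift_symm v (hLU hy)]
    · exact (ht.1.continuous.measurable.abs.pow_const _).aestronglyMeasurable
  have e2 : ∀ y ∈ L, lapHalfSq g k (lift p v) ((extChartAt (𝓡 n) p).symm y) =
      lapHalfE (gram g p) k v y := fun y hy => by
    rw [lapHalfSq_eq g ht.smoothFn ((extChartAt (𝓡 n) p).map_target (hLU hy)),
      (extChartAt (𝓡 n) p).right_inv (hLU hy)]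
    obtain ⟨m, c, c', T, T', hT, -, he⟩ := exists_bil_lapHalfE (isOpen_target p)
      (MetricConv.const (isMetric_gram g p)) k
    simp only [he, bil, fun a => (hT.op a).lim.congr_on (isOpen_target p) (ht.smoothFn p)
      (lift_comp_symm_eqOn v) (hLU hy)]
  have e3 : ∫ x, lapHalfSq g k (lift p v) x ∂(vol g) =
      ∫ y in L, lapHalfE (gram g p) k v y * dens (gram g p) y := by
    rw [integral_eq_chart g ?_ hLU hL fun x hx => ?_]
    · exact setIntegral_congr_fun hL.measurableSet fun y hy => by simp only [e2 y hy]
    · unfold lapHalfSq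
      split_ifs
      · have hm := measurable_cov g (ht.smoothFn.iterate_lap g (k / 2)) 0 Fin.elim0
        rw [show cov g ((lap g)^[k / 2] (lift p v)) 0 Fin.elim0 = (lap g)^[k / 2] (lift p v) from
          funext fun x => cov_zero_left g _ _ x] at hm
        exact (hm.pow_const 2).aestronglyMeasurable
      · exact (Finset.measurable_sum _ fun a _ =>
          (measurable_cov g (ht.smoothFn.iterate_lap g _) 1 a).pow_const 2).aestronglyMeasurable
    · rw [(sameJet_of_eventuallyEq (notMem_tsupport_iff_eventuallyEq.1 fun h' =>
        hx (tsupport_lift_subset hLU hL hv h'))).lapHalfSq_eq ht.smoothFn smoothFn_zero g]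
      exact lapHalfSq_zero g k x
  rw [e1, e3] at h1
  refine h1.trans (add_le_add le_rfl ?_)
  rw [mul_assoc]
  exact mul_le_mul_of_nonneg_left (hD v hv) hC

end Integrals
end SmallEnergy

namespace SmallEnergy

/-! ### Test functions inside the Sobolev space, and weak convergence. -/

section TestSpace

variable {n : ℕ} {N : Type*} [TopologicalSpace N] [ChartedSpace (E n) N] [IsManifold (𝓡 n) ∞ N]
  [T2Space N] [MeasurableSpace N] [BorelSpace N] [SecondCountableTopology N] [Nonempty N]

variable {Ω : Set N} {f f' : N → ℝ}

theorem IsTest.ext_fun (hf : IsTest n Ω f) (h : ∀ x, f x = f' x) : IsTest n Ω f' := by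
  rwa [← funext h]

variable (n Ω) in
/-- The space `C^∞_c(Ω)`. -/
def testSpace : Submodule ℝ (N → ℝ) where
  carrier := {f | IsTest n Ω f}
  add_mem' {f f'} hf hf' := (hf.add_mul hf' 1).ext_fun fun x => by simp
  zero_mem' := isTest_zero
  smul_mem' c f hf := (isTest_zero.add_mul hf c).ext_fun fun x => by simp

/-- The jet of a test function as an element of `L²`. -/
noncomputable def testLp (g : RMetric n N) (k : ℕ) (Ω : Set N) :
    testSpace n Ω →ₗ[ℝ] Lp (EuclideanSpace ℝ (JetIdx n k)) 2 ((vol g).restrict Ω) where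
  toFun f := ((IsTest.memLp_jet f.2 g k).restrict Ω).toLp (jet g k f)
  map_add' f f' := by
    have hf := (IsTest.memLp_jet f.2 g k).restrict Ω
    have hf' := (IsTest.memLp_jet f'.2 g k).restrict Ω
    rw [← MemLp.toLp_add hf hf']
    refine MemLp.toLp_congr _ _ (ae_of_all _ fun x => ?_)
    have := jet_add_mul g k (IsTest.smoothFn f.2) (IsTest.smoothFn f'.2) 1 x
    rw [one_smul] at this
    simp only [one_mul] at this
    exact this
  map_smul' c f := by
    have hf := (IsTest.memLp_jet f.2 g k).restrict Ω
    rw [RingHom.id_apply, ← MemLp.toLp_const_smul c hf]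
    refine MemLp.toLp_congr _ _ (ae_of_all _ fun x => ?_)
    have := jet_add_mul g k smoothFn_zero (IsTest.smoothFn f.2) c x
    simp only [zero_add, jet_zero] at this
    exact this

/-- A test function as an element of the Sobolev space. -/
noncomputable def testEmb (g : RMetric n N) (k : ℕ) (Ω : Set N) : testSpace n Ω →ₗ[ℝ] Hk0 g k Ω :=
  (testLp g k Ω).codRestrict (Hk0 g k Ω) fun f =>
    Submodule.le_topologicalClosure _ (Submodule.subset_span ⟨f, f.2,
      MemLp.coeFn_toLp ((IsTest.memLp_jet f.2 g k).restrict Ω)⟩)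

/-- The class of a test function in the Sobolev space. -/
noncomputable def IsTest.cls (hf : IsTest n Ω f) (g : RMetric n N) (k : ℕ) : Hk0 g k Ω :=
  testEmb g k Ω ⟨f, hf⟩

variable (g : RMetric n N) (k : ℕ)

theorem IsTest.cls_add_mul (hf : IsTest n Ω f) (hf' : IsTest n Ω f') (c : ℝ) :
    (hf.add_mul hf' c).cls g k = hf.cls g k + c • hf'.cls g k := by
  have h : (⟨_, hf.add_mul hf' c⟩ : testSpace n Ω) = ⟨f, hf⟩ + c • ⟨f', hf'⟩ := rfl
  rw [IsTest.cls, h, map_add, map_smul]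
  rfl

theorem IsTest.cls_sub (hf : IsTest n Ω f) (hf' : IsTest n Ω f') :
    (hf.sub hf').cls g k = hf.cls g k - hf'.cls g k := by
  have h : (⟨_, hf.sub hf'⟩ : testSpace n Ω) = ⟨f, hf⟩ - ⟨f', hf'⟩ := rfl
  rw [IsTest.cls, h, map_sub]
  rfl

theorem IsTest.jetAt_cls (hf : IsTest n Ω f) :
    Hk0.jetAt (hf.cls g k) =ᵐ[(vol g).restrict Ω] jet g k f :=
  MemLp.coeFn_toLp ((IsTest.memLp_jet hf g k).restrict Ω)

theorem IsTest.norm_cls_sq (hf : IsTest n Ω f) :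
    ‖hf.cls g k‖ ^ 2 = ∫ x, ‖jet g k f x‖ ^ 2 ∂(vol g) := by
  have h0 : ∀ F : Lp (EuclideanSpace ℝ (JetIdx n k)) 2 ((vol g).restrict Ω),
      ‖F‖ ^ 2 = ∫ x, ‖F x‖ ^ 2 ∂((vol g).restrict Ω) := fun F => by
    rw [← real_inner_self_eq_norm_sq, L2.inner_def]
    simp only [real_inner_self_eq_norm_sq]
  have h1 : ‖hf.cls g k‖ ^ 2 = ∫ x, ‖Hk0.jetAt (hf.cls g k) x‖ ^ 2 ∂((vol g).restrict Ω) := h0 _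
  rw [h1, integral_congr_ae ((hf.jetAt_cls g k).mono fun x hx => congrArg (fun v => ‖v‖ ^ 2) hx),
    setIntegral_eq_integral_of_forall_compl_eq_zero (s := Ω) fun x hx => ?_]
  rw [jet_eq_zero_of_notMem_tsupport g k hf.smoothFn fun h => hx (hf.2.2 h)]
  simp

theorem IsTest.enorm_cls (hf : IsTest n Ω f) :
    ENNReal.ofReal ‖hf.cls g k‖ = eLpNorm (jet g k f) 2 ((vol g).restrict Ω) := by
  have : ‖hf.cls g k‖ = (eLpNorm (jet g k f) 2 ((vol g).restrict Ω)).toReal :=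
    Lp.norm_toLp _ ((IsTest.memLp_jet hf g k).restrict Ω)
  rw [this, ENNReal.ofReal_toReal ((IsTest.memLp_jet hf g k).restrict Ω).2.ne]

/-- The jets of test functions already form a subspace, so the span in the definition adds nothing.
-/
theorem denseRange_testEmb (Ω : Set N) : DenseRange (testEmb g k Ω) := by
  rw [Metric.denseRange_iff]
  intro u r hr
  obtain ⟨b, hb, hub⟩ := Metric.mem_closure_iff.1 u.2 r hr
  have hle : Submodule.span ℝ {F : Lp (EuclideanSpace ℝ (JetIdx n k)) 2 ((vol g).restrict Ω) |
      ∃ f : N → ℝ, IsTest n Ω f ∧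
        (F : N → EuclideanSpace ℝ (JetIdx n k)) =ᵐ[(vol g).restrict Ω] jet g k f} ≤
      LinearMap.range ((Hk0 g k Ω).subtype ∘ₗ testEmb g k Ω) := by
    refine Submodule.span_le.2 ?_
    rintro F ⟨f, hf, hF⟩
    exact ⟨⟨f, hf⟩, Lp.ext ((hf.jetAt_cls g k).trans hF.symm)⟩
  obtain ⟨f, rfl⟩ := hle hb
  exact ⟨f, hub⟩

theorem IsTest.val_cls (hf : IsTest n Ω f) : ∀ᵐ x ∂(vol g).restrict Ω, Hk0.val (hf.cls g k) x = f x := by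
  filter_upwards [hf.jetAt_cls g k] with x hx
  rw [Hk0.val, hx]
  exact cov_zero_left g f _ x

variable {g k}

/-- Convergence in L² implies convergence in measure, hence almost everywhere along a subsequence.
The pointwise statement is used later for Fatou's lemma. -/
theorem exists_test_seq (u : Hk0 g k Ω) : ∃ (f : ℕ → N → ℝ) (hf : ∀ m, IsTest n Ω (f m)),
    Tendsto (fun m => (hf m).cls g k) atTop (𝓝 u) ∧
      ∀ᵐ x ∂(vol g).restrict Ω, Tendsto (fun m => f m x) atTop (𝓝 (Hk0.val u x)) := by
  choose F hF using fun m : ℕ => Metric.denseRange_iff.1 (denseRange_testEmb g k Ω) u (1 / ((m : ℝ) + 1))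
    (by positivity)
  have hlim : Tendsto (fun m => testEmb g k Ω (F m)) atTop (𝓝 u) := by
    rw [tendsto_iff_dist_tendsto_zero]
    refine squeeze_zero (fun _ => dist_nonneg) (fun m => ?_) tendsto_one_div_add_atTop_nhds_zero_nat
    rw [dist_comm]
    exact (hF m).le
  have hLp : Tendsto (fun m => (testEmb g k Ω (F m) :
      Lp (EuclideanSpace ℝ (JetIdx n k)) 2 ((vol g).restrict Ω))) atTop (𝓝 (u : Lp _ 2 _)) :=
    (continuous_subtype_val.tendsto u).comp hlim
  obtain ⟨ns, hns, hae⟩ := (tendstoInMeasure_of_tendsto_Lp hLp).exists_seq_tendsto_ae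
  refine ⟨fun m => F (ns m), fun m => (F (ns m)).2, hlim.comp hns.tendsto_atTop, ?_⟩
  filter_upwards [hae, ae_all_iff.2 fun m => IsTest.val_cls g k (F (ns m)).2] with x hx hx'
  have h1 : Tendsto (fun m => Hk0.val (testEmb g k Ω (F (ns m))) x) atTop (𝓝 (Hk0.val u x)) :=
    (((PiLp.continuous_apply 2 (fun _ : JetIdx n k => ℝ) (⟨0, Fin.elim0⟩ : JetIdx n k)).tendsto _).comp hx)
  exact h1.congr hx'

/-- The uniform boundedness principle, applied to the images in the double dual; the embedding is
isometric. -/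
theorem exists_norm_le_of_weak {X : Type*} [NormedAddCommGroup X] [NormedSpace ℝ X] {u : ℕ → X}
    {u' : X} (hu : ∀ ℓ : X →L[ℝ] ℝ, Tendsto (fun i => ℓ (u i)) atTop (𝓝 (ℓ u'))) :
    ∃ M : ℝ, ∀ i, ‖u i‖ ≤ M := by
  obtain ⟨M, hM⟩ := banach_steinhaus (g := fun i => NormedSpace.inclusionInDoubleDual ℝ X (u i))
    fun ℓ => by
      obtain ⟨C, hC⟩ := (hu ℓ).norm.bddAbove_range
      exact ⟨C, fun i => hC ⟨i, rfl⟩⟩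
  refine ⟨M, fun i => ?_⟩
  rw [← (NormedSpace.inclusionInDoubleDualLi ℝ (E := X)).norm_map (u i)]
  exact hM i

variable {p : N} {L : Set (E n)}

theorem exists_sobSq_loc_le_norm (g : RMetric n N) (k : ℕ) (hLU : L ⊆ (extChartAt (𝓡 n) p).target)
    (hL : IsCompact L) {χ : E n → ℝ} (hχ : IsBumpOn L χ) :
    ∃ C : ℝ, 0 ≤ C ∧ ∀ (f : N → ℝ) (hf : IsTest n Ω f),
      sobSq (k + 1) (fun y => χ y * f ((extChartAt (𝓡 n) p).symm y)) ≤ C * ‖hf.cls g k‖ ^ 2 := by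
  obtain ⟨C, hC0, hC⟩ := exists_sobSq_loc_le g hLU hL hχ k
  refine ⟨C, hC0, fun f hf => ?_⟩
  rw [hf.norm_cls_sq]
  exact hC f ⟨hf.1, hf.2.1, subset_univ _⟩

/-- A bounded functional of the localised function is bounded on test functions for the Sobolev
norm, so by density it extends to the whole space. There f_i - h_i differs from u_i - u_∞, which is
weakly null, by a sequence that is null in norm. -/
theorem weaklyNull_loc (hLU : L ⊆ (extChartAt (𝓡 n) p).target) (hL : IsCompact L) {χ : E n → ℝ}
    (hχ : IsBumpOn L χ) {u : ℕ → Hk0 g k Ω} {u' : Hk0 g k Ω}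
    (hu : ∀ ℓ : Hk0 g k Ω →L[ℝ] ℝ, Tendsto (fun i => ℓ (u i)) atTop (𝓝 (ℓ u')))
    {f h : ℕ → N → ℝ} (hf : ∀ i, IsTest n Ω (f i)) (hh : ∀ i, IsTest n Ω (h i))
    (hfu : Tendsto (fun i => (hf i).cls g k - u i) atTop (𝓝 0))
    (hhu : Tendsto (fun i => (hh i).cls g k) atTop (𝓝 u')) :
    WeaklyNull L k (fun i y => χ y * (f i ((extChartAt (𝓡 n) p).symm y) -
      h i ((extChartAt (𝓡 n) p).symm y))) := by
  rintro ℓ hl ⟨C, hC⟩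
  obtain ⟨D, hD0, hD⟩ := exists_sobSq_loc_le_norm (Ω := Ω) g k hLU hL hχ
  have hb : ∀ f : testSpace n Ω, IsBumpOn L (fun y => χ y * f.1 ((extChartAt (𝓡 n) p).symm y)) :=
    fun f => (IsTest.smoothFn f.2).isBumpOn_mul hLU hχ
  have h0 : IsBumpOn L (fun _ => (0 : ℝ)) := by
    have := hb 0
    simpa using this
  have hl0 : ℓ (fun _ => 0) = 0 := by
    have := hl _ _ h0 h0 1
    simpa using this
  let Λ : testSpace n Ω →ₗ[ℝ] ℝ :=
    { toFun := fun f => ℓ (fun y => χ y * f.1 ((extChartAt (𝓡 n) p).symm y))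
      map_add' := fun f f' => by
        rw [← one_mul (ℓ fun y => χ y * f'.1 _), ← hl _ _ (hb f) (hb f')]
        congr 1
        funext y
        simp [mul_add]
      map_smul' := fun c f => by
        have := hl _ _ h0 (hb f) c
        rw [hl0, zero_add] at this
        rw [RingHom.id_apply, smul_eq_mul, ← this]
        congr 1
        funext y
        simp
        ring }
  have hΛ : ∃ B : ℝ, ∀ f, ‖Λ f‖ ≤ B * ‖testEmb g k Ω f‖ := by
    refine ⟨|C| * √D, fun f => (hC _ (hb f)).trans ?_⟩
    rw [mul_assoc]
    refine mul_le_mul (le_abs_self C) ?_ (Real.sqrt_nonneg _) (abs_nonneg _)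
    rw [← Real.sqrt_sq (norm_nonneg (testEmb g k Ω f)), ← Real.sqrt_mul hD0]
    exact Real.sqrt_le_sqrt (hD f.1 f.2)
  have key := LinearMap.extendOfNorm_eq (denseRange_testEmb g k Ω) hΛ
  set ℓ' := Λ.extendOfNorm (testEmb g k Ω)
  have e : ∀ i, ℓ (fun y => χ y * (f i ((extChartAt (𝓡 n) p).symm y) -
      h i ((extChartAt (𝓡 n) p).symm y))) =
      ℓ' ((hf i).cls g k - u i) + ℓ' (u i) - ℓ' ((hh i).cls g k) := fun i => by
    have h1 := key (⟨f i, hf i⟩ - ⟨h i, hh i⟩)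
    rw [map_sub, map_sub] at h1
    rw [map_sub, sub_add_cancel]
    exact h1.symm
  simp only [e]
  have h1 := ((ℓ'.continuous.tendsto _).comp hfu).add (hu ℓ')
  have h2 := h1.sub ((ℓ'.continuous.tendsto _).comp hhu)
  simpa using h2

end TestSpace
end SmallEnergy

namespace SmallEnergy

theorem two_lt_crit {n k : ℕ} (hk : 1 ≤ k) (hkn : 2 * k < n) : 2 < crit n k := by
  have h1 : (2 * k : ℝ) < n := by exact_mod_cast hkn
  have h2 : (1 : ℝ) ≤ k := by exact_mod_cast hk
  rw [crit, lt_div_iff₀ (by linarith)]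
  linarith

/-! ### The derivative of the critical power. -/

section Nonlinear

variable {n : ℕ} {L : Set (E n)} {p : ℝ}

/-- Differentiation under the integral. For |t| < 1 the derivative is dominated by its expression
with |f| + |φ| in place of |f + tφ|, which is continuous on the compact set. -/
theorem hasDerivAt_setIntegral_rpow (hp : 2 < p) (hL : IsCompact L) {f φ ρ : E n → ℝ}
    (hf : ContinuousOn f L) (hφ : ContinuousOn φ L) (hρ : ContinuousOn ρ L) (hρ0 : ∀ y ∈ L, 0 ≤ ρ y) :
    HasDerivAt (fun t : ℝ => ∫ y in L, |f y + t * φ y| ^ p * ρ y)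
      (p * ∫ y in L, |f y| ^ (p - 2) * f y * φ y * ρ y) 0 := by
  have hp0 : 0 ≤ p := by linarith
  have hp2 : 0 ≤ p - 2 := by linarith
  have hc : ∀ t : ℝ, ContinuousOn (fun y => f y + t * φ y) L := fun t =>
    hf.add (continuousOn_const.mul hφ)
  have hs := hf.abs.add hφ.abs
  have key := (hasDerivAt_integral_of_dominated_loc_of_deriv_le (μ := volume.restrict L)
    (F := fun t y => |f y + t * φ y| ^ p * ρ y) (x₀ := (0 : ℝ))
    (F' := fun t y => p * |f y + t * φ y| ^ (p - 2) * (f y + t * φ y) * φ y * ρ y)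
    (bound := fun y => p * (|f y| + |φ y|) ^ (p - 2) * (|f y| + |φ y|) * |φ y| * ρ y)
    (Metric.ball_mem_nhds 0 one_pos)
    (Eventually.of_forall fun t => (((hc t).abs.rpow_const fun _ _ => Or.inr hp0).mul hρ).aestronglyMeasurable
      hL.measurableSet)
    ((((hc 0).abs.rpow_const fun _ _ => Or.inr hp0).mul hρ).integrableOn_compact hL)
    ((((((continuousOn_const.mul ((hc 0).abs.rpow_const fun _ _ => Or.inr hp2)).mul (hc 0)).mul hφ).mul
      hρ)).aestronglyMeasurable hL.measurableSet)
    (ae_restrict_of_forall_mem hL.measurableSet fun y hy t ht => ?_)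
    ((((((continuousOn_const.mul (hs.rpow_const fun _ _ => Or.inr hp2)).mul hs).mul hφ.abs).mul
      hρ)).integrableOn_compact hL)
    (ae_of_all _ fun y t _ => ?_)).2
  · have e : p * ∫ y in L, |f y| ^ (p - 2) * f y * φ y * ρ y =
        ∫ y in L, p * |f y + 0 * φ y| ^ (p - 2) * (f y + 0 * φ y) * φ y * ρ y := by
      rw [← integral_const_mul]
      refine integral_congr_ae (ae_of_all _ fun y => ?_)
      simp only [zero_mul, add_zero]
      ring
    rw [e]
    exact key
  · have ht' : |t| ≤ 1 := by
      have := mem_ball_zero_iff.1 ht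
      rw [Real.norm_eq_abs] at this
      exact this.le
    have h1 : |f y + t * φ y| ≤ |f y| + |φ y| := by
      refine (abs_add_le _ _).trans (add_le_add le_rfl ?_)
      rw [abs_mul]
      exact mul_le_of_le_one_left (abs_nonneg _) ht'
    rw [Real.norm_eq_abs, abs_mul, abs_mul, abs_mul, abs_mul, abs_of_nonneg hp0, abs_of_nonneg (hρ0 y hy),
      abs_of_nonneg (Real.rpow_nonneg (abs_nonneg _) _)]
    have h2 : |f y + t * φ y| ^ (p - 2) ≤ (|f y| + |φ y|) ^ (p - 2) :=
      Real.rpow_le_rpow (abs_nonneg _) h1 hp2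
    have := hρ0 y hy
    gcongr
  · have h1 : HasDerivAt (fun t : ℝ => f y + t * φ y) (φ y) t := by
      simpa using ((hasDerivAt_id t).mul_const (φ y)).const_add (f y)
    exact ((hasDerivAt_abs_rpow _ (by linarith)).comp t h1).mul_const (ρ y)

end Nonlinear

/-! ### The derivative of the functional at a test function. -/

section Functional

variable {n : ℕ} {N : Type*} [TopologicalSpace N] [ChartedSpace (E n) N] [IsManifold (𝓡 n) ∞ N]
  [SecondCountableTopology N] [Nonempty N]

variable {Ω : Set N} {f φ : N → ℝ} {k : ℕ}

/-- Polarisation: in the symmetric difference the terms even in t cancel, and the symmetry of `A`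
merges the two mixed terms. -/
theorem tensorQuad_sub {l : ℕ} (h : RMetric n N) {A : TensorField n N l} (hA : A.IsSymm)
    (hf : SmoothFn (n := n) f) (hφ : SmoothFn (n := n) φ) (t : ℝ) (x : N) :
    tensorQuad h A (fun x => f x + t * φ x) x - tensorQuad h A (fun x => f x + (-t) * φ x) x =
      4 * t * tensorBil h A f φ x := by
  have hsymm : tensorBil h A φ f x = tensorBil h A f φ x := by
    simp only [tensorBil]
    rw [Finset.sum_comm]
    refine Finset.sum_congr rfl fun a _ => Finset.sum_congr rfl fun b _ => ?_
    rw [hA]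
    ring
  have e : tensorQuad h A (fun x => f x + t * φ x) x - tensorQuad h A (fun x => f x + (-t) * φ x) x =
      2 * t * (tensorBil h A f φ x + tensorBil h A φ f x) := by
    simp only [tensorQuad, tensorBil, cov_add_mul h hf hφ, Finset.mul_sum, ← Finset.sum_add_distrib,
      ← Finset.sum_sub_distrib]
    refine Finset.sum_congr rfl fun a _ => Finset.sum_congr rfl fun b _ => ?_
    ring
  rw [e, hsymm]
  ring

theorem bil_sub {m : ℕ} {U : Set (E n)} {c : Fin m → Fin m → E n → ℝ} {T : Fin m → (E n → ℝ) → E n → ℝ}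
    {y : E n} (hy : y ∈ U) (hc : ∀ a b, c a b y = c b a y) (hT : ∀ a, IsDiffOp U k (T a))
    {u v : E n → ℝ} (hu : ContDiffOn ℝ ∞ u U) (hv : ContDiffOn ℝ ∞ v U) (t : ℝ) :
    bil c T (fun z => u z + t * v z) (fun z => u z + t * v z) y -
      bil c T (fun z => u z + (-t) * v z) (fun z => u z + (-t) * v z) y = 4 * t * bil c T u v y := by
  have h1 := fun (t : ℝ) w => bil_add_mul_left (d := c) hT hu hv t w hy
  rw [h1, h1, bil_comm hc u, bil_comm hc u, bil_comm hc v, bil_comm hc v, h1, h1, h1, h1,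
    bil_comm hc v u]
  ring

theorem quadDensity_sub (h : RMetric n N) {A : (l : ℕ) → TensorField n N l} (hA : ∀ l < k, (A l).IsSymm)
    (hf : SmoothFn (n := n) f) (hφ : SmoothFn (n := n) φ) {p : N} {m : ℕ}
    {c : Fin m → Fin m → E n → ℝ} {T : Fin m → (E n → ℝ) → E n → ℝ}
    (hT : ∀ a, IsDiffOp (extChartAt (𝓡 n) p).target k (T a))
    (hq : ∀ v y, lapHalfE (gram h p) k v y = bil c T v v y) (t : ℝ) {y : E n}
    (hy : y ∈ (extChartAt (𝓡 n) p).target) (hc : ∀ a b, c a b y = c b a y) :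
    quadDensity h k A (fun x => f x + t * φ x) ((extChartAt (𝓡 n) p).symm y) -
      quadDensity h k A (fun x => f x + (-t) * φ x) ((extChartAt (𝓡 n) p).symm y) =
    4 * t * (bil c T (f ∘ (extChartAt (𝓡 n) p).symm) (φ ∘ (extChartAt (𝓡 n) p).symm) y +
      ∑ l ∈ Finset.range k, tensorBil h (A l) f φ ((extChartAt (𝓡 n) p).symm y)) := by
  have hx := (extChartAt (𝓡 n) p).map_target hy
  have h1 : ∀ s : ℝ, lapHalfSq h k (fun x => f x + s * φ x) ((extChartAt (𝓡 n) p).symm y) =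
      bil c T (fun z => (f ∘ (extChartAt (𝓡 n) p).symm) z + s * (φ ∘ (extChartAt (𝓡 n) p).symm) z)
        (fun z => (f ∘ (extChartAt (𝓡 n) p).symm) z + s * (φ ∘ (extChartAt (𝓡 n) p).symm) z) y := fun s => by
    rw [lapHalfSq_eq h (hf.add_mul hφ s) hx, (extChartAt (𝓡 n) p).right_inv hy, hq]
    rfl
  rw [quadDensity, quadDensity, h1, h1, add_sub_add_comm, bil_sub hy hc hT (hf p) (hφ p),
    ← Finset.sum_sub_distrib, mul_add, Finset.mul_sum]
  congr 1
  exact Finset.sum_congr rfl fun l hl => tensorQuad_sub h (hA l (Finset.mem_range.1 hl)) hf hφ t _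

variable [T2Space N] [MeasurableSpace N] [BorelSpace N] {g : RMetric n N}

/-- The representative chosen at `x` is arbitrary, but the density depends only on its k-jet at `x`,
which almost everywhere is that of `f`. -/
theorem IsTest.quadP_cls (hf : IsTest n Ω f) (g : RMetric n N) (k : ℕ) (h : RMetric n N)
    (A : (l : ℕ) → TensorField n N l) :
    ∀ᵐ x ∂(vol h).restrict Ω, quadP h A (hf.cls g k) x = quadDensity h k A f x := by
  filter_upwards [((absolutelyContinuous_vol h g).restrict Ω).ae_le (hf.jetAt_cls g k)] with x hx
  have hex : ∃ f' : N → ℝ, ContMDiff (𝓡 n) 𝓘(ℝ, ℝ) ∞ f' ∧ jet g k f' x = Hk0.jetAt (hf.cls g k) x :=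
    ⟨f, hf.1, hx.symm⟩
  have h1 := Classical.choose_spec hex
  rw [quadP, Hk0.rep, dif_pos hex]
  exact (sameJet_of_jet_eq g h1.1.smoothFn hf.smoothFn (h1.2.trans hx)).quadDensity_eq
    h1.1.smoothFn hf.smoothFn h A

theorem IsTest.val_cls' (hf : IsTest n Ω f) (g : RMetric n N) (k : ℕ) (h : RMetric n N) :
    ∀ᵐ x ∂(vol h).restrict Ω, Hk0.val (hf.cls g k) x = f x :=
  ((absolutelyContinuous_vol h g).restrict Ω).ae_le (hf.val_cls g k)

variable {h : RMetric n N} {A : (l : ℕ) → TensorField n N l}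

theorem IsC1Functional.integrable (hJ : IsC1Functional h A g k Ω) (hf : IsTest n Ω f) :
    IntegrableOn (quadDensity h k A f) Ω (vol h) ∧
      IntegrableOn (fun x => |f x| ^ crit n k) Ω (vol h) := by
  obtain ⟨h1, h2⟩ := hJ.1 (hf.cls g k)
  refine ⟨h1.congr (hf.quadP_cls g k h A), h2.congr ?_⟩
  filter_upwards [hf.val_cls' g k h] with x hx
  rw [hx]

theorem IsTest.J_cls (hf : IsTest n Ω f) (g : RMetric n N) (k : ℕ) (h : RMetric n N)
    (A : (l : ℕ) → TensorField n N l) : J h A (hf.cls g k) =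
      (1 / 2) * ∫ x in Ω, quadDensity h k A f x ∂(vol h) -
        (1 / crit n k) * ∫ x in Ω, |f x| ^ crit n k ∂(vol h) := by
  rw [J, integral_congr_ae (hf.quadP_cls g k h A)]
  congr 2
  refine integral_congr_ae ?_
  filter_upwards [hf.val_cls' g k h] with x hx
  rw [hx]

variable {p : N} {L : Set (E n)}

/-- Either integral over Ω may involve points outside the chart; only the difference of the
integrands is supported in `S`, hence in the chart. -/
theorem setIntegral_sub_eq_chart (hΩ : IsOpen Ω) {F F' : N → ℝ} (hF : IntegrableOn F Ω (vol h))
    (hF' : IntegrableOn F' Ω (vol h)) {S : Set N} (hSΩ : S ⊆ Ω)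
    (hLU : L ⊆ (extChartAt (𝓡 n) p).target) (hL : IsCompact L)
    (hS : S ⊆ (extChartAt (𝓡 n) p).symm '' L) (h0 : ∀ x ∉ S, F x - F' x = 0) :
    IntegrableOn (fun y => (F ((extChartAt (𝓡 n) p).symm y) - F' ((extChartAt (𝓡 n) p).symm y)) *
      dens (gram h p) y) L ∧
    (∫ x in Ω, F x ∂(vol h)) - ∫ x in Ω, F' x ∂(vol h) =
      ∫ y in L, (F ((extChartAt (𝓡 n) p).symm y) - F' ((extChartAt (𝓡 n) p).symm y)) *
        dens (gram h p) y := by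
  have hi := hF.sub hF'
  have hi' : Integrable (fun x => F x - F' x) (vol h) := by
    refine (integrableOn_iff_integrable_of_support_subset (s := Ω) fun x hx => ?_).1 hi
    by_contra hx'
    exact hx (h0 x fun h' => hx' (hSΩ h'))
  refine ⟨(hi'.integrableOn (s := (extChartAt (𝓡 n) p).source)).chart hLU hL, ?_⟩
  rw [← integral_sub hF hF', setIntegral_eq_integral_of_forall_compl_eq_zero fun x hx =>
    h0 x fun h' => hx (hSΩ h')]
  exact integral_eq_chart h hi'.aestronglyMeasurable hLU hL fun x hx => h0 x fun h' => hx (hS h')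

/-- Since J is differentiable, its derivative is half that of t ↦ J(f + tφ) - J(f - tφ) at 0. In
this difference the integrands agree off the support of φ, so the integrals reduce to `L`. The
quadratic part is exactly linear in t, so only the critical power has to be differentiated under the
integral. -/
theorem IsC1Functional.fderiv_cls (hJ : IsC1Functional h A g k Ω) (hk : 1 ≤ k) (hkn : 2 * k < n)
    (hΩ : IsOpen Ω) (hA : ∀ l < k, (A l).IsSymm) (hf : IsTest n Ω f) (hφ : IsTest n Ω φ)
    (hLU : L ⊆ (extChartAt (𝓡 n) p).target) (hL : IsCompact L)
    (hφL : tsupport φ ⊆ (extChartAt (𝓡 n) p).symm '' L) {m : ℕ}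
    {c : Fin m → Fin m → E n → ℝ} {T : Fin m → (E n → ℝ) → E n → ℝ}
    (hc : ∀ a b, ∀ y ∈ (extChartAt (𝓡 n) p).target, c a b y = c b a y)
    (hT : ∀ a, IsDiffOp (extChartAt (𝓡 n) p).target k (T a))
    (hq : ∀ v y, lapHalfE (gram h p) k v y = bil c T v v y) :
    IntegrableOn (fun y => (bil c T (f ∘ (extChartAt (𝓡 n) p).symm) (φ ∘ (extChartAt (𝓡 n) p).symm) y +
      ∑ l ∈ Finset.range k, tensorBil h (A l) f φ ((extChartAt (𝓡 n) p).symm y)) * dens (gram h p) y) L ∧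
    fderiv ℝ (fun v : Hk0 g k Ω => J h A v) (hf.cls g k) (hφ.cls g k) =
      (∫ y in L, (bil c T (f ∘ (extChartAt (𝓡 n) p).symm) (φ ∘ (extChartAt (𝓡 n) p).symm) y +
        ∑ l ∈ Finset.range k, tensorBil h (A l) f φ ((extChartAt (𝓡 n) p).symm y)) * dens (gram h p) y) -
      ∫ y in L, |f ((extChartAt (𝓡 n) p).symm y)| ^ (crit n k - 2) * f ((extChartAt (𝓡 n) p).symm y) *
        φ ((extChartAt (𝓡 n) p).symm y) * dens (gram h p) y := by
  have hp := two_lt_crit hk hkn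
  set q := crit n k with hq_def
  set ψ := (extChartAt (𝓡 n) p).symm with hψ
  set ρ := dens (gram h p) with hρ
  set β : E n → ℝ := fun y => bil c T (f ∘ ψ) (φ ∘ ψ) y +
    ∑ l ∈ Finset.range k, tensorBil h (A l) f φ (ψ y) with hβ
  have ht : ∀ t : ℝ, IsTest n Ω (fun x => f x + t * φ x) := fun t => hf.add_mul hφ t
  have hloc : ∀ (t : ℝ), ∀ x ∉ tsupport φ, (fun x => f x + t * φ x) =ᶠ[𝓝 x] fun x => f x + (-t) * φ x :=
    fun t x hx => by
      filter_upwards [notMem_tsupport_iff_eventuallyEq.1 hx] with z hz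
      simp [hz]
  -- the quadratic part
  have hquad : ∀ t : ℝ, IntegrableOn (fun y => 4 * t * β y * ρ y) L ∧
      (∫ x in Ω, quadDensity h k A (fun x => f x + t * φ x) x ∂(vol h)) -
        ∫ x in Ω, quadDensity h k A (fun x => f x + (-t) * φ x) x ∂(vol h) =
      4 * t * ∫ y in L, β y * ρ y := fun t => by
    obtain ⟨h1, h2⟩ := setIntegral_sub_eq_chart hΩ (hJ.integrable (ht t)).1 (hJ.integrable (ht (-t))).1
      hφ.2.2 hLU hL hφL fun x hx => by
        rw [(sameJet_of_eventuallyEq (hloc t x hx)).quadDensity_eq (ht t).smoothFn (ht (-t)).smoothFn h A,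
          sub_self]
    have e : ∀ y ∈ L, (quadDensity h k A (fun x => f x + t * φ x) (ψ y) -
        quadDensity h k A (fun x => f x + (-t) * φ x) (ψ y)) * ρ y = 4 * t * β y * ρ y := fun y hy => by
      rw [quadDensity_sub h hA hf.smoothFn hφ.smoothFn hT hq t (hLU hy) fun a b => hc a b y (hLU hy)]
    refine ⟨h1.congr_fun e hL.measurableSet, h2.trans ?_⟩
    rw [setIntegral_congr_fun hL.measurableSet e, ← integral_const_mul]
    simp only [mul_assoc]
  -- the nonlinear part
  set Ψ : ℝ → ℝ := fun t => ∫ y in L, |f (ψ y) + t * φ (ψ y)| ^ q * ρ y with hΨ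
  have hfc : ContinuousOn (f ∘ ψ) L := (hf.smoothFn p).continuousOn.mono hLU
  have hφc : ContinuousOn (φ ∘ ψ) L := (hφ.smoothFn p).continuousOn.mono hLU
  have hρc : ContinuousOn ρ L := (isMetric_gram h p).continuousOn_dens.mono hLU
  have hint : ∀ t : ℝ, IntegrableOn (fun y => |f (ψ y) + t * φ (ψ y)| ^ q * ρ y) L := fun t =>
    (((hfc.add (continuousOn_const.mul hφc)).abs.rpow_const fun _ _ => Or.inr (by linarith)).mul
      hρc).integrableOn_compact hL
  have hnl : ∀ t : ℝ, (∫ x in Ω, |f x + t * φ x| ^ q ∂(vol h)) - ∫ x in Ω, |f x + (-t) * φ x| ^ q ∂(vol h) =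
      Ψ t - Ψ (-t) := fun t => by
    obtain ⟨-, h2⟩ := setIntegral_sub_eq_chart hΩ (hJ.integrable (ht t)).2 (hJ.integrable (ht (-t))).2
      hφ.2.2 hLU hL hφL fun x hx => by simp only [image_eq_zero_of_notMem_tsupport hx, mul_zero, sub_self]
    rw [h2, hΨ, ← integral_sub (hint t) (hint (-t))]
    simp only [sub_mul, hψ, hρ, hq_def]
  have hΨd := hasDerivAt_setIntegral_rpow hp hL hfc hφc hρc fun y hy =>
    ((isMetric_gram h p).dens_pos (hLU hy)).le
  -- the derivative of the functional along the line
  have hdiff : HasFDerivAt (fun v : Hk0 g k Ω => J h A v)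
      (fderiv ℝ (fun v : Hk0 g k Ω => J h A v) (hf.cls g k)) (hf.cls g k) :=
    (hJ.2.differentiable (by simp) _).hasFDerivAt
  set d := fderiv ℝ (fun v : Hk0 g k Ω => J h A v) (hf.cls g k) (hφ.cls g k) with hd
  have hline : HasDerivAt (fun t : ℝ => J h A (hf.cls g k + t • hφ.cls g k)) d 0 := by
    have h1 : HasDerivAt (fun t : ℝ => hf.cls g k + t • hφ.cls g k) (hφ.cls g k) 0 := by
      simpa using ((hasDerivAt_id (0 : ℝ)).smul_const (hφ.cls g k)).const_add (hf.cls g k)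
    have h2 : HasFDerivAt (fun v : Hk0 g k Ω => J h A v)
        (fderiv ℝ (fun v : Hk0 g k Ω => J h A v) (hf.cls g k)) (hf.cls g k + (0 : ℝ) • hφ.cls g k) := by
      simpa using hdiff
    exact h2.comp_hasDerivAt (0 : ℝ) h1
  have hsym : ∀ {F : ℝ → ℝ} {F' : ℝ}, HasDerivAt F F' 0 → HasDerivAt (fun t => F t - F (-t)) (2 * F') 0 :=
    fun {F F'} hF => by
      have h1 : HasDerivAt (fun t : ℝ => F (-t)) (-F') 0 := by
        have := (show HasDerivAt F F' (-0) by simpa using hF).comp (0 : ℝ) (hasDerivAt_neg (0 : ℝ))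
        simpa [Function.comp_def] using this
      have := hF.sub h1
      rwa [sub_neg_eq_add, ← two_mul] at this
  have hJt : ∀ t : ℝ, J h A (hf.cls g k + t • hφ.cls g k) =
      (1 / 2) * ∫ x in Ω, quadDensity h k A (fun x => f x + t * φ x) x ∂(vol h) -
        (1 / q) * ∫ x in Ω, |f x + t * φ x| ^ q ∂(vol h) := fun t => by
    rw [← IsTest.cls_add_mul g k hf hφ t]
    exact (ht t).J_cls g k h A
  have hJd : (fun t : ℝ => J h A (hf.cls g k + t • hφ.cls g k) - J h A (hf.cls g k + (-t) • hφ.cls g k)) =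
      fun t => t * (2 * ∫ y in L, β y * ρ y) - (1 / q) * (Ψ t - Ψ (-t)) := by
    funext t
    rw [hJt, hJt, ← hnl]
    linear_combination (1 / 2) * (hquad t).2
  have h1 := hsym hline
  rw [hJd] at h1
  have h2 := ((hasDerivAt_id (0 : ℝ)).mul_const (2 * ∫ y in L, β y * ρ y)).sub
    ((hsym hΨd).const_mul (1 / q))
  have h3 := h1.unique h2
  have hq0 : q ≠ 0 := by linarith
  refine ⟨?_, ?_⟩
  -- With t = 1/4 the factor 4 t equals 1.
  · have := (hquad (1 / 4)).1
    refine this.congr_fun (fun y _ => ?_) hL.measurableSet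
    simp only [hβ]
    ring
  · have h4 : 1 / q * (2 * (q * ∫ y in L, |(f ∘ ψ) y| ^ (q - 2) * (f ∘ ψ) y * (φ ∘ ψ) y * ρ y)) =
        2 * ∫ y in L, |(f ∘ ψ) y| ^ (q - 2) * (f ∘ ψ) y * (φ ∘ ψ) y * ρ y := by
      field_simp
    rw [h4, one_mul] at h3
    have h5 : d = (∫ y in L, β y * ρ y) -
      ∫ y in L, |(f ∘ ψ) y| ^ (q - 2) * (f ∘ ψ) y * (φ ∘ ψ) y * ρ y := by linarith
    exact h5

end Functional
end SmallEnergy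

namespace SmallEnergy

/-! ### Uniform bounds for the terms of lower order. -/

section LowerOrder

variable {n : ℕ} {N : Type*} [TopologicalSpace N] [ChartedSpace (E n) N] [IsManifold (𝓡 n) ∞ N]
  [SecondCountableTopology N] [Nonempty N]

variable {p : N} {L : Set (E n)} {g : ℕ → RMetric n N} {g' : RMetric n N}

/-- Every ingredient is bounded uniformly for large indices: the frame by the trace of the inverse
metric, the tensor components by their convergence, the covariant derivatives by the jets. -/
theorem exists_abs_tensorBil_le (hg : MetricTendsto g g') {l : ℕ} {A : ℕ → TensorField n N l}
    {A' : TensorField n N l} (hA : ∀ i, (A i).IsSmooth) (hA' : A'.IsSmooth) (hAA : TensorTendsto A A')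
    (hLU : L ⊆ (extChartAt (𝓡 n) p).target) (hL : IsCompact L) :
    ∃ C : ℝ, 0 ≤ C ∧ ∀ᶠ i in atTop, ∀ f φ, SmoothFn (n := n) f → SmoothFn (n := n) φ → ∀ y ∈ L,
      |tensorBil (g i) (A i) f φ ((extChartAt (𝓡 n) p).symm y)| ≤
        C * (jetNorm (l + 1) (f ∘ (extChartAt (𝓡 n) p).symm) y *
          jetNorm (l + 1) (φ ∘ (extChartAt (𝓡 n) p).symm) y) := by
  have hU := isOpen_target (n := n) p
  obtain ⟨B, hB0, hB⟩ := (hg.metricConv p).exists_trace_inv_le hU hLU hL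
  obtain ⟨C, hC0, hC⟩ := hg.exists_abs_cov_le hLU hL l
  choose D hD0 hD using fun I J => (SmoothTendsto.of_tendstoSmoothLoc hU (fun i => hA i p I J)
    (hA' p I J) (hAA p I J)).exists_bound hU hLU hL
  set M : ℝ := ∑ I, ∑ J, (B ^ l * B ^ l) * D I J with hM
  have hM0 : 0 ≤ M := Finset.sum_nonneg fun I _ => Finset.sum_nonneg fun J _ =>
    mul_nonneg (by positivity) (hD0 I J)
  refine ⟨∑ _a : Fin l → Fin n, ∑ _b : Fin l → Fin n, M * (C * C), by positivity, ?_⟩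
  filter_upwards [hB, hC, eventually_all.2 fun I => eventually_all.2 (hD I)] with i hBi hCi hDi f φ hf hφ y hy
  have hx : (extChartAt (𝓡 n) p).symm y ∈ (extChartAt (𝓡 n) p).source :=
    (extChartAt (𝓡 n) p).map_target (hLU hy)
  have hfr := isFrame_frameIn (g i) hx
  rw [(extChartAt (𝓡 n) p).right_inv (hLU hy)] at hfr
  have hF : ∀ j a, |frameIn (g i) p ((extChartAt (𝓡 n) p).symm y) j a| ≤ B := fun j a =>
    (abs_le_one_add_of_sum_sq hfr.sum_sq j a).trans (hBi y hy)
  have hprod : ∀ I a : Fin l → Fin n,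
      |∏ s, frameIn (g i) p ((extChartAt (𝓡 n) p).symm y) (I s) (a s)| ≤ B ^ l := fun I a => by
    rw [Finset.abs_prod]
    refine (Finset.prod_le_prod (fun _ _ => abs_nonneg _) fun s _ => hF (I s) (a s)).trans ?_
    simp
  have hAe : ∀ a b : Fin l → Fin n, |A i ((extChartAt (𝓡 n) p).symm y)
      (Sum.elim (fun s => frame (g i) _ (a s)) (fun s => frame (g i) _ (b s)))| ≤ M := fun a b => by
    rw [tensor_frame_eq (g i) (A i) hx, (extChartAt (𝓡 n) p).right_inv (hLU hy)]
    refine (Finset.abs_sum_le_sum_abs _ _).trans (Finset.sum_le_sum fun I _ =>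
      (Finset.abs_sum_le_sum_abs _ _).trans (Finset.sum_le_sum fun J _ => ?_))
    rw [abs_mul, abs_mul]
    exact mul_le_mul (mul_le_mul (hprod I a) (hprod J b) (abs_nonneg _) (by positivity)) (hDi I J y hy)
      (abs_nonneg _) (by positivity)
  have hjf := jetNorm_nonneg (l + 1) (f ∘ (extChartAt (𝓡 n) p).symm) y
  have hjφ := jetNorm_nonneg (l + 1) (φ ∘ (extChartAt (𝓡 n) p).symm) y
  rw [tensorBil, Finset.sum_mul]
  refine (Finset.abs_sum_le_sum_abs _ _).trans (Finset.sum_le_sum fun a _ => ?_)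
  rw [Finset.sum_mul]
  refine (Finset.abs_sum_le_sum_abs _ _).trans (Finset.sum_le_sum fun b _ => ?_)
  rw [abs_mul, abs_mul, mul_assoc, mul_mul_mul_comm]
  exact mul_le_mul (hAe a b) (mul_le_mul (hCi f hf a y hy) (hCi φ hφ b y hy) (abs_nonneg _)
    (by positivity)) (by positivity) hM0

variable [T2Space N] [MeasurableSpace N] [BorelSpace N] {Ω : Set N}

/-- Bounds the model expression, without the tensors A_l and with the cut-off `F` in place of `f`,
by the true derivative plus a lower order error. The alternative for germs says that `f` and `F`
agree near every point where `v` is not locally zero; elsewhere all terms vanish, so the replacement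
is exact. -/
theorem exists_le_fderiv_cls {k : ℕ} (hk : 1 ≤ k) (hkn : 2 * k < n) (hg : MetricTendsto g g')
    {A : ℕ → (l : ℕ) → TensorField n N l} {A' : (l : ℕ) → TensorField n N l}
    (hA : ∀ i, ∀ l < k, (A i l).IsSmooth) (hAs : ∀ i, ∀ l < k, (A i l).IsSymm)
    (hA' : ∀ l < k, (A' l).IsSmooth) (hAA : ∀ l < k, TensorTendsto (fun i => A i l) (A' l))
    (hΩ : IsOpen Ω) (hJ : ∀ i, IsC1Functional (g i) (A i) g' k Ω)
    (hLU : L ⊆ (extChartAt (𝓡 n) p).target) (hL : IsCompact L) {m : ℕ}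
    {c : ℕ → Fin m → Fin m → E n → ℝ} {c' : Fin m → Fin m → E n → ℝ}
    {T : ℕ → Fin m → (E n → ℝ) → E n → ℝ} {T' : Fin m → (E n → ℝ) → E n → ℝ}
    (hbil : BilTendsto (extChartAt (𝓡 n) p).target k c c' T T')
    (hq : ∀ i v y, lapHalfE (gram (g i) p) k v y = bil (c i) (T i) v v y) :
    ∃ C : ℝ, 0 ≤ C ∧ ∀ᶠ i in atTop, ∀ (f : N → ℝ) (F v : E n → ℝ) (hf : IsTest n Ω f)
      (hφ : IsTest n Ω (lift p v)), IsBumpOn L F → IsBumpOn L v →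
      (∀ y ∈ L, f ∘ (extChartAt (𝓡 n) p).symm =ᶠ[𝓝 y] F ∨ v =ᶠ[𝓝 y] fun _ => 0) →
      (∫ y in L, bil (c i) (T i) F v y * dens (gram (g i) p) y) -
        (∫ y in L, |F y| ^ (crit n k - 2) * F y * v y * dens (gram (g i) p) y) ≤
      fderiv ℝ (fun w : Hk0 g' k Ω => J (g i) (A i) w) (hf.cls g' k) (hφ.cls g' k) +
        C * (√(sobSq k F) * √(sobSq k v)) := by
  have hU := isOpen_target (n := n) p
  have hG := hg.metricConv p
  choose D hD0 hD using fun l : Finset.range k => exists_abs_tensorBil_le hg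
    (fun i => hA i l (Finset.mem_range.1 l.2)) (hA' l (Finset.mem_range.1 l.2))
    (hAA l (Finset.mem_range.1 l.2)) hLU hL
  obtain ⟨r, R, hr, hR, hrR⟩ := exists_dens_bounds hG.lim hLU hL
  refine ⟨(∑ l, D l) * (2 * R), mul_nonneg (Finset.sum_nonneg fun l _ => hD0 l) (by positivity), ?_⟩
  filter_upwards [eventually_all.2 hD, hG.dens hU hLU hL one_pos] with i hDi hρi f F v hf hφ hF hv hfF
  have hp := two_lt_crit hk hkn
  set ψ := (extChartAt (𝓡 n) p).symm with hψ
  have hLφ : tsupport (lift p v) ⊆ ψ '' L := tsupport_lift_subset hLU hL hv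
  have hT := fun a => (hbil.op a).op i
  have hφv := lift_comp_symm_eqOn (p := p) v
  have hbilF : ∀ y ∈ L, bil (c i) (T i) (f ∘ ψ) (lift p v ∘ ψ) y = bil (c i) (T i) F v y := fun y hy => by
    have hcc := fun a b => hbil.symm i a b y (hLU hy)
    have h1 : bil (c i) (T i) (f ∘ ψ) (lift p v ∘ ψ) y = bil (c i) (T i) (f ∘ ψ) v y := by
      rw [bil_comm hcc, bil_congr_left hU hT (hφ.smoothFn p) hv.smooth.contDiffOn (hLU hy)
        (hφv.eventuallyEq_of_mem (hU.mem_nhds (hLU hy))), bil_comm hcc]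
    rw [h1]
    rcases hfF y hy with h | h
    · exact bil_congr_left hU hT (hf.smoothFn p) hF.smooth.contDiffOn (hLU hy) h v
    · have h0 : ∀ w, ContDiffOn ℝ ∞ w (extChartAt (𝓡 n) p).target → bil (c i) (T i) w v y = 0 :=
        fun w hw => by
          have e : ∀ a, T i a v y = 0 := fun a => by
            have h2 := (hT a).sub hv.smooth.contDiffOn hv.smooth.contDiffOn (hLU hy)
            rw [sub_self] at h2
            rw [← h2]
            refine (hT a).eq_of_jetNorm_sub_eq_zero hv.smooth.contDiffOn
              (hv.smooth.contDiffOn.sub hv.smooth.contDiffOn) (hLU hy) ?_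
            rw [jetNorm_congr (g := fun _ => (0 : ℝ)) (by filter_upwards [h] with z hz; simp [hz])]
            simp
          simp [bil, e]
      rw [h0 _ (hf.smoothFn p), h0 _ hF.smooth.contDiffOn]
  have hjet : ∀ y ∈ L, ∀ a, jetNorm a (f ∘ ψ) y * jetNorm a (lift p v ∘ ψ) y =
      jetNorm a F y * jetNorm a v y := fun y hy a => by
    rw [jetNorm_congr_on hU hφv (hLU hy)]
    rcases hfF y hy with h | h
    · rw [jetNorm_congr h]
    · rw [jetNorm_congr h]
      simp
  obtain ⟨hint, hder⟩ := (hJ i).fderiv_cls hk hkn hΩ (hAs i) hf hφ hLU hL hLφ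
    (fun a b y hy => hbil.symm i a b y hy) hT (hq i)
  rw [hder]
  have hib := hbil.integrableOn_seq hG hLU hL i hF hv
  set τ : E n → ℝ := fun y => ∑ l ∈ Finset.range k, tensorBil (g i) (A i l) f (lift p v) (ψ y) with hτ
  have e0 : ∀ y ∈ L, (bil (c i) (T i) (f ∘ ψ) (lift p v ∘ ψ) y + τ y) * dens (gram (g i) p) y =
      bil (c i) (T i) F v y * dens (gram (g i) p) y + τ y * dens (gram (g i) p) y := fun y hy => by
    rw [hbilF y hy, add_mul]
  -- Integrability of the lower order part is read off as a difference of two integrable functions.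
  have hiτ : IntegrableOn (fun y => τ y * dens (gram (g i) p) y) L := by
    refine (hint.sub hib).congr_fun (fun y hy => ?_) hL.measurableSet
    have := e0 y hy
    simp only [Pi.sub_apply]
    linear_combination this
  have e1 : ∫ y in L, (bil (c i) (T i) (f ∘ ψ) (lift p v ∘ ψ) y + τ y) * dens (gram (g i) p) y =
      (∫ y in L, bil (c i) (T i) F v y * dens (gram (g i) p) y) +
        ∫ y in L, τ y * dens (gram (g i) p) y := by
    rw [setIntegral_congr_fun hL.measurableSet e0]
    exact integral_add hib hiτ
  have e2 : ∫ y in L, |f (ψ y)| ^ (crit n k - 2) * f (ψ y) * lift p v (ψ y) * dens (gram (g i) p) y =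
      ∫ y in L, |F y| ^ (crit n k - 2) * F y * v y * dens (gram (g i) p) y := by
    refine setIntegral_congr_fun hL.measurableSet fun y hy => ?_
    beta_reduce
    rw [hψ, lift_symm v (hLU hy)]
    rcases hfF y hy with h | h
    · have : f (ψ y) = F y := h.self_of_nhds
      rw [← this]
    · rw [show v y = 0 from h.self_of_nhds]
      ring
  have e3 : |∫ y in L, τ y * dens (gram (g i) p) y| ≤
      (∑ l, D l) * (2 * R) * (√(sobSq k F) * √(sobSq k v)) := by
    refine (abs_setIntegral_le hL hiτ ((hF.integrableOn_jetNorm_mul hL hv k k).const_mul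
      ((∑ l, D l) * (2 * R))) fun y hy => ?_).trans ?_
    · have hj := mul_nonneg (jetNorm_nonneg k F y) (jetNorm_nonneg k v y)
      have hρ0 := ((hG.metric i).dens_pos (hLU hy)).le
      have h1 : |τ y| ≤ (∑ l, D l) * (jetNorm k F y * jetNorm k v y) := by
        rw [hτ, Finset.sum_mul]
        refine (Finset.abs_sum_le_sum_abs _ _).trans ?_
        rw [← Finset.sum_coe_sort]
        refine Finset.sum_le_sum fun l _ => (hDi l f _ hf.smoothFn hφ.smoothFn y hy).trans
          (mul_le_mul_of_nonneg_left ?_ (hD0 l))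
        have hl := Finset.mem_range.1 l.2
        rw [hjet y hy]
        exact mul_le_mul (jetNorm_mono hl _ _) (jetNorm_mono hl _ _) (jetNorm_nonneg _ _ _)
          (jetNorm_nonneg _ _ _)
      have h2 : dens (gram (g i) p) y ≤ 2 * R := by
        have := (abs_le.1 (hρi y hy)).2
        linarith [(hrR y hy).2]
      rw [abs_mul, abs_of_nonneg hρ0]
      calc _ ≤ (∑ l, D l) * (jetNorm k F y * jetNorm k v y) * (2 * R) :=
            mul_le_mul h1 h2 hρ0 ((abs_nonneg _).trans h1)
        _ = _ := by ring
    · rw [integral_const_mul]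
      exact mul_le_mul_of_nonneg_left (setIntegral_jetNorm_mul_le hL hF hv k k)
        (mul_nonneg (Finset.sum_nonneg fun l _ => hD0 l) (by positivity))
  rw [e1, e2]
  linarith [neg_abs_le (∫ y in L, τ y * dens (gram (g i) p) y)]

end LowerOrder

/-! ### Energy of the approximating test functions. -/

section Energy

variable {n : ℕ} {N : Type*} [TopologicalSpace N] [ChartedSpace (E n) N] [IsManifold (𝓡 n) ∞ N]
  [SecondCountableTopology N] [Nonempty N] [T2Space N] [MeasurableSpace N] [BorelSpace N]

variable {p : N} {L S : Set (E n)} {Ω : Set N} {g : RMetric n N} {k : ℕ} {f : N → ℝ}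

theorem IsTest.eLpNorm_chart (hf : IsTest n Ω f) (h : RMetric n N)
    (hSU : S ⊆ (extChartAt (𝓡 n) p).target) (hS : IsCompact S) {q : ℝ} (hq : 0 < q) :
    eLpNorm f (ENNReal.ofReal q) ((vol h).restrict ((extChartAt (𝓡 n) p).symm '' S)) =
      ENNReal.ofReal ((∫ y in S, |f ((extChartAt (𝓡 n) p).symm y)| ^ q * dens (gram h p) y) ^ q⁻¹) := by
  have hfin : IsFiniteMeasure ((vol h).restrict ((extChartAt (𝓡 n) p).symm '' S)) :=
    ⟨by simpa using vol_symm_image_lt_top h hSU hS⟩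
  obtain ⟨C, hC⟩ := hf.2.1.exists_bound_of_continuous hf.1.continuous
  have hm : MemLp f (ENNReal.ofReal q) ((vol h).restrict ((extChartAt (𝓡 n) p).symm '' S)) :=
    MemLp.of_bound hf.1.continuous.aestronglyMeasurable C (ae_of_all _ hC)
  rw [hm.eLpNorm_eq_integral_rpow_norm (by simpa using hq) (by simp), ENNReal.toReal_ofReal hq.le]
  simp only [Real.norm_eq_abs]
  rw [setIntegral_symm_image h (hf.1.continuous.measurable.abs.pow_const q).aestronglyMeasurable hSU hS]

/-- The Sobolev inequality of `g` bounds χ f in L^q, and χ = 1 on `S`. Comparing the densities on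
`L` with Lebesgue measure allows the integral to be taken for another metric `h`. -/
theorem SobolevIneq.exists_eLpNorm_le {K C : ℝ} (hk : 1 ≤ k) (hkn : 2 * k < n) (hK : 0 ≤ K) (hC : 0 ≤ C)
    (hSob : SobolevIneq g k K C) (hLU : L ⊆ (extChartAt (𝓡 n) p).target) (hL : IsCompact L)
    {χ : E n → ℝ} (hχ : IsBumpOn L χ) (hS : IsCompact S) (hSL : S ⊆ L) (hχS : ∀ y ∈ S, χ y = 1)
    (h : RMetric n N) : ∃ D : ℝ, 0 ≤ D ∧ ∀ (f : N → ℝ) (hf : IsTest n Ω f),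
      eLpNorm f (ENNReal.ofReal (crit n k)) ((vol h).restrict ((extChartAt (𝓡 n) p).symm '' S)) ≤
        ENNReal.ofReal (D * ‖hf.cls g k‖) := by
  have hp := two_lt_crit hk hkn
  set q := crit n k with hq
  have hq0 : 0 < q := by linarith
  have hU := isOpen_target (n := n) p
  have hH := isMetric_gram g p
  obtain ⟨C₀, hC₀, hC₀'⟩ := hSob.chart hkn hC hLU hL
  obtain ⟨m, c, c', T, T', hbil, -, hlap⟩ := exists_bil_lapHalfE hU (MetricConv.const hH) k
  obtain ⟨CB, hCB0, hCB⟩ := hbil.integral_bound hU hH hLU hL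
  obtain ⟨P, hP0, hP⟩ := exists_setIntegral_rpow_le (k := k) hH hLU hL hp (B := K * CB + C₀) (by positivity)
    fun v hv => by
      refine (hC₀' v hv).trans ?_
      have h1 := (le_abs_self _).trans (hCB v v hv hv)
      rw [Real.mul_self_sqrt (sobSq_nonneg _ _)] at h1
      simp only [hlap]
      have h2 := mul_le_mul_of_nonneg_left h1 hK
      have h3 := mul_le_mul_of_nonneg_left (sobSq_mono hL hv (Nat.le_succ k)) hC₀
      rw [Nat.succ_eq_add_one] at h3
      linarith
  obtain ⟨M, hM0, hM⟩ := exists_sobSq_loc_le_norm (Ω := Ω) g k hLU hL hχ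
  obtain ⟨r, R, hr, hR, hrR⟩ := exists_dens_bounds (isMetric_gram h p) hLU hL
  refine ⟨(R * (P * M ^ (q / 2))) ^ q⁻¹, by positivity, fun f hf => ?_⟩
  rw [hf.eLpNorm_chart h (hSL.trans hLU) hS hq0]
  refine ENNReal.ofReal_le_ofReal ?_
  have hb := hf.smoothFn.isBumpOn_mul hLU hχ
  have hc := Continuous.abs_rpow hb.smooth.continuous hq0.le
  have hfc : ContinuousOn (fun y => |f ((extChartAt (𝓡 n) p).symm y)| ^ q * dens (gram h p) y) S :=
    (((hf.smoothFn p).continuousOn.abs.rpow_const fun _ _ => Or.inr hq0.le).mul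
      (isMetric_gram h p).continuousOn_dens).mono (hSL.trans hLU)
  have hx : 0 ≤ ∫ y in S, |f ((extChartAt (𝓡 n) p).symm y)| ^ q * dens (gram h p) y :=
    setIntegral_nonneg hS.measurableSet fun y hy =>
      mul_nonneg (by positivity) ((isMetric_gram h p).dens_pos (hLU (hSL hy))).le
  have key : ∫ y in S, |f ((extChartAt (𝓡 n) p).symm y)| ^ q * dens (gram h p) y ≤
      (R * (P * M ^ (q / 2))) * ‖hf.cls g k‖ ^ q := by
    calc _ ≤ ∫ y in S, R * |χ y * f ((extChartAt (𝓡 n) p).symm y)| ^ q := by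
          refine setIntegral_mono_on (hfc.integrableOn_compact hS)
            ((hc.continuousOn.integrableOn_compact hS).const_mul R) hS.measurableSet fun y hy => ?_
          rw [hχS y hy, one_mul, mul_comm]
          exact mul_le_mul_of_nonneg_right (hrR y (hSL hy)).2 (by positivity)
      _ ≤ R * ∫ y in L, |χ y * f ((extChartAt (𝓡 n) p).symm y)| ^ q := by
          rw [integral_const_mul]
          exact mul_le_mul_of_nonneg_left (setIntegral_mono_set (hc.continuousOn.integrableOn_compact hL)
            (ae_of_all _ fun y => by positivity) hSL.eventuallyLE) hR.le
      _ ≤ R * (P * (M * ‖hf.cls g k‖ ^ 2) ^ (q / 2)) := by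
          refine mul_le_mul_of_nonneg_left ((hP _ hb).trans (mul_le_mul_of_nonneg_left ?_ hP0)) hR.le
          exact Real.rpow_le_rpow (sobSq_nonneg _ _) (hM f hf) (by positivity)
      _ = _ := by
          rw [Real.mul_rpow hM0 (by positivity), ← Real.rpow_natCast, ← Real.rpow_mul (norm_nonneg _)]
          push_cast
          rw [mul_div_cancel₀ q two_ne_zero]
          ring
  calc _ ≤ ((R * (P * M ^ (q / 2))) * ‖hf.cls g k‖ ^ q) ^ q⁻¹ := Real.rpow_le_rpow hx key (by positivity)
    _ = _ := by rw [Real.mul_rpow (by positivity) (by positivity), Real.rpow_rpow_inv (norm_nonneg _) hq0.ne']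

theorem Hk0.aestronglyMeasurable_val (u : Hk0 g k Ω) :
    AEStronglyMeasurable (Hk0.val u) ((vol g).restrict Ω) :=
  (PiLp.continuous_apply 2 (fun _ : JetIdx n k => ℝ) (⟨0, Fin.elim0⟩ : JetIdx n k)).comp_aestronglyMeasurable
    (Lp.aestronglyMeasurable _)

/-- By Minkowski's inequality the L^q norm of f_m on `S` exceeds that of `u` by at most the norm of
f_m - u, which the Sobolev inequality makes small. The strict increase of powers turns this into the
additive error ε. -/
theorem SobolevIneq.eventually_energy_le {K C : ℝ} (hk : 1 ≤ k) (hkn : 2 * k < n) (hK : 0 ≤ K) (hC : 0 ≤ C)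
    (hSob : SobolevIneq g k K C) (hLU : L ⊆ (extChartAt (𝓡 n) p).target) (hL : IsCompact L)
    {χ : E n → ℝ} (hχ : IsBumpOn L χ) (hS : IsCompact S) (hSL : S ⊆ L) (hχS : ∀ y ∈ S, χ y = 1)
    (hΩ : IsOpen Ω) (h : RMetric n N) {u : Hk0 g k Ω}
    (hu : IntegrableOn (fun x => |Hk0.val u x| ^ crit n k) Ω (vol h)) {B : Set N}
    (hSB : (extChartAt (𝓡 n) p).symm '' S ⊆ B) {κ ε : ℝ} (hκ : 0 ≤ κ) (hε : 0 < ε)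
    (hE : ∫ x in B ∩ Ω, |Hk0.val u x| ^ crit n k ∂(vol h) ≤ κ) {f : ℕ → N → ℝ}
    (hf : ∀ m, IsTest n Ω (f m)) (hfu : Tendsto (fun m => (hf m).cls g k) atTop (𝓝 u))
    (hae : ∀ᵐ x ∂(vol g).restrict Ω, Tendsto (fun m => f m x) atTop (𝓝 (Hk0.val u x))) :
    ∀ᶠ m in atTop, ∫ y in S, |f m ((extChartAt (𝓡 n) p).symm y)| ^ crit n k * dens (gram h p) y ≤
      κ + ε := by
  obtain ⟨D, hD0, hD⟩ := hSob.exists_eLpNorm_le (Ω := Ω) hk hkn hK hC hLU hL hχ hS hSL hχS h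
  have hp := two_lt_crit hk hkn
  set q := crit n k with hq
  have hq0 : 0 < q := by linarith
  set S' := (extChartAt (𝓡 n) p).symm '' S with hS'
  have hS'm : MeasurableSet S' := (isCompact_symm_image (hSL.trans hLU) hS).measurableSet
  set μ := ((vol h).restrict S').restrict Ω with hμ
  have hμΩ : μ ≤ (vol h).restrict Ω := Measure.restrict_mono le_rfl Measure.restrict_le_self
  have hac : μ ≪ (vol g).restrict Ω :=
    hμΩ.absolutelyContinuous.trans ((absolutelyContinuous_vol h g).restrict Ω)
  have hμB : μ ≤ (vol h).restrict (B ∩ Ω) := by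
    rw [hμ, Measure.restrict_restrict hΩ.measurableSet, inter_comm]
    exact Measure.restrict_mono (inter_subset_inter_left _ hSB) le_rfl
  have hval : AEStronglyMeasurable (Hk0.val u) μ := (Hk0.aestronglyMeasurable_val u).mono_ac hac
  have hqe : ENNReal.ofReal q ≠ 0 := by simpa using hq0
  have hmem : MemLp (Hk0.val u) (ENNReal.ofReal q) μ := by
    rw [← integrable_norm_rpow_iff hval hqe (by simp), ENNReal.toReal_ofReal hq0.le]
    exact Integrable.mono_measure hu hμΩ
  have hvalκ : eLpNorm (Hk0.val u) (ENNReal.ofReal q) μ ≤ ENNReal.ofReal (κ ^ q⁻¹) := by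
    rw [hmem.eLpNorm_eq_integral_rpow_norm hqe (by simp), ENNReal.toReal_ofReal hq0.le]
    refine ENNReal.ofReal_le_ofReal (Real.rpow_le_rpow (integral_nonneg fun x => by positivity) ?_
      (by positivity))
    exact (integral_mono_measure hμB (ae_of_all _ fun x => by positivity)
      (hu.mono_set inter_subset_right)).trans hE
  have hrestr : ∀ {F : N → ℝ}, IsTest n Ω F → eLpNorm F (ENNReal.ofReal q) ((vol h).restrict S') =
      eLpNorm F (ENNReal.ofReal q) μ := fun {F} hF => by
    rw [hμ, ← eLpNorm_indicator_eq_eLpNorm_restrict hΩ.measurableSet]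
    congr 1
    exact (indicator_eq_self.2 fun x hx => by_contra fun hx' => hx (hF.eq_zero hx')).symm
  -- The Sobolev bound is available only for test functions. It is applied to f_m - f_j and passed
  -- to the limit in j by Fatou's lemma, using the almost everywhere convergence.
  have hdiff : ∀ m, eLpNorm (fun x => f m x - Hk0.val u x) (ENNReal.ofReal q) μ ≤
      ENNReal.ofReal (D * ‖(hf m).cls g k - u‖) := fun m => by
    have hlim : Tendsto (fun j => ENNReal.ofReal (D * ‖(hf m).cls g k - (hf j).cls g k‖)) atTop
        (𝓝 (ENNReal.ofReal (D * ‖(hf m).cls g k - u‖))) :=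
      ENNReal.tendsto_ofReal ((hfu.const_sub _).norm.const_mul D)
    refine (Lp.eLpNorm_lim_le_liminf_eLpNorm (f := fun j x => f m x - f j x)
      (fun j => ((hf m).sub (hf j)).1.continuous.aestronglyMeasurable) _ ?_).trans ?_
    · filter_upwards [hac.ae_le hae] with x hx
      exact hx.const_sub _
    · rw [← hlim.liminf_eq]
      refine liminf_le_liminf (Eventually.of_forall fun j => ?_)
      rw [← IsTest.cls_sub, ← hrestr ((hf m).sub (hf j))]
      exact hD _ ((hf m).sub (hf j))
  have hbound : ∀ m, (∫ y in S, |f m ((extChartAt (𝓡 n) p).symm y)| ^ q * dens (gram h p) y) ^ q⁻¹ ≤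
      D * ‖(hf m).cls g k - u‖ + κ ^ q⁻¹ := fun m => by
    rw [← ENNReal.ofReal_le_ofReal_iff (by positivity), ← (hf m).eLpNorm_chart h (hSL.trans hLU) hS hq0,
      hrestr (hf m), ENNReal.ofReal_add (by positivity) (by positivity)]
    have e : f m = (fun x => f m x - Hk0.val u x) + Hk0.val u := by funext x; simp
    refine (congrArg (fun F => eLpNorm F (ENNReal.ofReal q) μ) e).le.trans ?_
    refine (eLpNorm_add_le ?_ hval ?_).trans (add_le_add (hdiff m) hvalκ)
    · exact (hf m).1.continuous.aestronglyMeasurable.sub hval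
    · rw [ENNReal.one_le_ofReal]
      linarith
  have h0 : Tendsto (fun m => D * ‖(hf m).cls g k - u‖ + κ ^ q⁻¹) atTop (𝓝 (κ ^ q⁻¹)) := by
    have := ((tendsto_iff_norm_sub_tendsto_zero.1 hfu).const_mul D).add_const (κ ^ q⁻¹)
    simpa using this
  have h1 : κ ^ q⁻¹ < (κ + ε) ^ q⁻¹ := Real.rpow_lt_rpow hκ (by linarith) (by positivity)
  filter_upwards [h0.eventually (gt_mem_nhds h1)] with m hm
  have h2 := (hbound m).trans hm.le
  have h3 : 0 ≤ ∫ y in S, |f m ((extChartAt (𝓡 n) p).symm y)| ^ q * dens (gram h p) y :=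
    setIntegral_nonneg hS.measurableSet fun y hy =>
      mul_nonneg (by positivity) ((isMetric_gram h p).dens_pos (hLU (hSL hy))).le
  exact (Real.rpow_le_rpow_iff h3 (by positivity) (by positivity)).1 h2

end Energy
end SmallEnergy

namespace SmallEnergy

/-! ### Balls of the Riemannian distance. -/

section Balls

variable {n : ℕ} {N : Type*} [TopologicalSpace N] [ChartedSpace (E n) N] [IsManifold (𝓡 n) ∞ N]

-- Points close in the topology of the manifold are at small Riemannian distance; the triangle
-- inequality does the rest.
open scoped Bundle in
theorem isOpen_gBall (g : RMetric n N) (x₀ : N) (r : ℝ) : IsOpen (gBall g x₀ r) := by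
  letI : Bundle.RiemannianBundle (fun x : N => TangentSpace (𝓡 n) x) := ⟨g.toRiemannianMetric⟩
  haveI : IsContinuousRiemannianBundle (E n) (fun x : N => TangentSpace (𝓡 n) x) :=
    ⟨g.toContinuousRiemannianMetric.inner, g.contMDiff.continuous, fun _ _ _ => rfl⟩
  haveI : IsManifold (𝓡 n) 1 N := IsManifold.of_le (n := ∞) (by simp)
  refine isOpen_iff_mem_nhds.2 fun x (hx : Manifold.riemannianEDist (𝓡 n) x₀ x < ENNReal.ofReal r) => ?_
  filter_upwards [eventually_riemannianEDist_lt (𝓡 n) x (tsub_pos_of_lt hx)] with y hy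
  calc Manifold.riemannianEDist (𝓡 n) x₀ y
      ≤ Manifold.riemannianEDist (𝓡 n) x₀ x + Manifold.riemannianEDist (𝓡 n) x y :=
        Manifold.riemannianEDist_triangle
    _ < Manifold.riemannianEDist (𝓡 n) x₀ x +
        (ENNReal.ofReal r - Manifold.riemannianEDist (𝓡 n) x₀ x) :=
        ENNReal.add_lt_add_left hx.ne_top hy
    _ = ENNReal.ofReal r := add_tsub_cancel_of_le hx.le

-- A point of the closure has a point of the ball within distance r, so its distance to the centre
-- is less than 2r.
open scoped Bundle in
theorem closure_gBall_subset (g : RMetric n N) (x₀ : N) {r : ℝ} (hr : 0 < r) :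
    closure (gBall g x₀ r) ⊆ gBall g x₀ (2 * r) := by
  letI : Bundle.RiemannianBundle (fun x : N => TangentSpace (𝓡 n) x) := ⟨g.toRiemannianMetric⟩
  haveI : IsContinuousRiemannianBundle (E n) (fun x : N => TangentSpace (𝓡 n) x) :=
    ⟨g.toContinuousRiemannianMetric.inner, g.contMDiff.continuous, fun _ _ _ => rfl⟩
  haveI : IsManifold (𝓡 n) 1 N := IsManifold.of_le (n := ∞) (by simp)
  intro x hx
  have h := eventually_riemannianEDist_lt (𝓡 n) x (c := ENNReal.ofReal r) (by simpa using hr)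
  obtain ⟨y, hy, hy'⟩ := mem_closure_iff_nhds.1 hx _ h
  change Manifold.riemannianEDist (𝓡 n) x₀ x < ENNReal.ofReal (2 * r)
  rw [two_mul, ENNReal.ofReal_add hr.le hr.le]
  refine (Manifold.riemannianEDist_triangle (y := y)).trans_lt (ENNReal.add_lt_add hy' ?_)
  rw [Manifold.riemannianEDist_comm]
  exact hy
end Balls

/-! ### Strong convergence near a point. -/

section Local

variable {n : ℕ} {N : Type*} [TopologicalSpace N] [ChartedSpace (E n) N] [IsManifold (𝓡 n) ∞ N]
  [SecondCountableTopology N] [Nonempty N] [T2Space N] [MeasurableSpace N] [BorelSpace N]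

theorem Hk0.edist_eq {g : RMetric n N} {k : ℕ} {Ω : Set N} (u v : Hk0 g k Ω) :
    eLpNorm (fun x => Hk0.jetAt u x - Hk0.jetAt v x) 2 ((vol g).restrict Ω) = edist u v := by
  have h : ∀ F G : Lp (EuclideanSpace ℝ (JetIdx n k)) 2 ((vol g).restrict Ω),
      eLpNorm (fun x => F x - G x) 2 ((vol g).restrict Ω) = edist F G := fun F G =>
    (Lp.edist_def F G).symm
  exact h u v

/-- On the open set `V` the functions f - h and φ have the same germs, hence the same jets, so the
local distance is bounded by the full norm of φ. -/
theorem IsTest.eLpNorm_jetAt_sub_le {g : RMetric n N} {k : ℕ} {Ω : Set N} {f h φ : N → ℝ}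
    (hf : IsTest n Ω f) (hh : IsTest n Ω h) (hφ : IsTest n Ω φ) (hΩ : IsOpen Ω) {V : Set N}
    (hV : IsOpen V) (he : ∀ x ∈ V, f x - h x = φ x) :
    eLpNorm (fun x => Hk0.jetAt (hf.cls g k) x - Hk0.jetAt (hh.cls g k) x) 2
      ((vol g).restrict (V ∩ Ω)) ≤ ENNReal.ofReal ‖hφ.cls g k‖ := by
  have hle : (vol g).restrict (V ∩ Ω) ≤ (vol g).restrict Ω :=
    Measure.restrict_mono inter_subset_right le_rfl
  have hae : (fun x => Hk0.jetAt (hf.cls g k) x - Hk0.jetAt (hh.cls g k) x)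
      =ᵐ[(vol g).restrict (V ∩ Ω)] jet g k φ := by
    filter_upwards [hle.absolutelyContinuous.ae_le (hf.jetAt_cls g k),
      hle.absolutelyContinuous.ae_le (hh.jetAt_cls g k),
      ae_restrict_mem (hV.inter hΩ).measurableSet] with x hx hx' hxV
    rw [hx, hx', ← jet_sub g k hf.smoothFn hh.smoothFn]
    refine (sameJet_of_eventuallyEq ?_).jet_eq (hf.sub hh).smoothFn hφ.smoothFn g
    filter_upwards [hV.mem_nhds hxV.1] with z hz using he z hz
  rw [hφ.enorm_cls, eLpNorm_congr_ae hae]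
  exact eLpNorm_mono_measure _ hle

set_option maxHeartbeats 1000000 in
/-- The strong convergence near a point of an open set on which the energy is small. -/
theorem exists_nhds_tendsto {k : ℕ} (hk : 1 ≤ k) (hkn : 2 * k < n)
    {gInf : RMetric n N} {g : ℕ → RMetric n N} (hg : MetricTendsto g gInf)
    {A : ℕ → (l : ℕ) → TensorField n N l} {AInf : (l : ℕ) → TensorField n N l}
    (hA_smooth : ∀ i, ∀ l < k, (A i l).IsSmooth) (hA_symm : ∀ i, ∀ l < k, (A i l).IsSymm)
    (hAInf_smooth : ∀ l < k, (AInf l).IsSmooth)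
    (hA : ∀ l < k, TensorTendsto (fun i => A i l) (AInf l))
    {Ω : Set N} (hΩ : IsOpen Ω) (hJ : ∀ i, IsC1Functional (g i) (A i) gInf k Ω)
    {u : ℕ → Hk0 gInf k Ω} {uInf : Hk0 gInf k Ω}
    (hu : ∀ ℓ : Hk0 gInf k Ω →L[ℝ] ℝ, Tendsto (fun i => ℓ (u i)) atTop (𝓝 (ℓ uInf)))
    {K : Set N} (hPS : ∀ ε : ℝ, 0 < ε → ∀ᶠ i in atTop, ∀ φ : Hk0 gInf k Ω, Hk0.SuppIn φ K →
      fderiv ℝ (fun v : Hk0 gInf k Ω => J (g i) (A i) v) (u i) φ ≤ ε * ‖φ‖)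
    {KInf C : ℝ} (hKInf : 0 < KInf) (hC : 0 ≤ C) (hSob : SobolevIneq gInf k KInf C)
    {B : Set N} (hB : IsOpen B) (hBK : B ⊆ K)
    (henergy : ∀ i, ∫ x in B ∩ Ω, |Hk0.val (u i) x| ^ crit n k ∂(vol (g i)) ≤
      (1 / (2 * KInf)) ^ (crit n k / (crit n k - 2))) {p : N} (hpB : p ∈ B) :
    ∃ V : Set N, IsOpen V ∧ p ∈ V ∧ Tendsto (fun i => eLpNorm
      (fun x => Hk0.jetAt (u i) x - Hk0.jetAt uInf x) 2 ((vol gInf).restrict (V ∩ Ω))) atTop (𝓝 0) := by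
  have hq := two_lt_crit hk hkn
  have hU := isOpen_target (n := n) p
  have hG := hg.metricConv p
  set ψ := (extChartAt (𝓡 n) p).symm with hψ
  set x₀ : E n := extChartAt (𝓡 n) p p with hx₀
  -- cut-off functions in the chart
  obtain ⟨r, hr, hball⟩ : ∃ r : ℝ, 0 < r ∧
      Metric.closedBall x₀ (3 * r) ⊆ (extChartAt (𝓡 n) p).target ∩ ψ ⁻¹' B := by
    have h1 : (extChartAt (𝓡 n) p).target ∩ ψ ⁻¹' B ∈ 𝓝 x₀ := by
      refine inter_mem (extChartAt_target_mem_nhds p) ((continuousAt_extChartAt_symm p) ?_)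
      rw [extChartAt_to_inv p]
      exact hB.mem_nhds hpB
    obtain ⟨s, hs, hsb⟩ := Metric.nhds_basis_closedBall.mem_iff.1 h1
    exact ⟨s / 3, by positivity, by rwa [mul_div_cancel₀ s three_ne_zero]⟩
  set L := Metric.closedBall x₀ (3 * r) with hL_def
  have hLU : L ⊆ (extChartAt (𝓡 n) p).target := fun y hy => (hball hy).1
  have hLB : ψ '' L ⊆ B := by rintro _ ⟨y, hy, rfl⟩; exact (hball hy).2
  have hL : IsCompact L := isCompact_closedBall _ _
  -- χ equals 1 on the ball of radius 2r while η is supported in radius r. Hence χ f and f have the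
  -- same germ at every point of the support of η, as the comparison of derivatives requires.
  let χ : ContDiffBump x₀ := ⟨2 * r, 3 * r, by linarith, by linarith⟩
  let η : ContDiffBump x₀ := ⟨r / 2, r, by linarith, by linarith⟩
  have hχ : IsBumpOn L χ := ⟨χ.contDiff, χ.tsupport_eq.subset⟩
  have hη : ContDiff ℝ ∞ η := η.contDiff
  have hηt : tsupport η = Metric.closedBall x₀ r := η.tsupport_eq
  have hηL : tsupport η ⊆ L := by
    rw [hηt]; exact Metric.closedBall_subset_closedBall (by linarith)
  have hηc : IsCompact (tsupport η) := by rw [hηt]; exact isCompact_closedBall _ _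
  have hχ1 : ∀ y ∈ Metric.closedBall x₀ (2 * r), χ y = 1 := fun y hy => χ.one_of_mem_closedBall hy
  have hχη : ∀ y ∈ tsupport η, χ y = 1 := fun y hy => by
    rw [hηt] at hy
    exact hχ1 y (Metric.closedBall_subset_closedBall (by linarith) hy)
  -- approximation by test functions
  obtain ⟨h, hh, hhu, -⟩ := exists_test_seq uInf
  set κ : ℝ := (1 / (2 * KInf)) ^ (crit n k / (crit n k - 2)) with hκ
  have hκ0 : 0 ≤ κ := by positivity
  -- Three simultaneous approximations of u_i by one test function: in norm, in the derivative of
  -- J_i (continuous since J_i is C¹), and in the energy near the support of η.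
  have hex : ∀ i : ℕ, ∃ (f : N → ℝ) (hf : IsTest n Ω f), ‖hf.cls gInf k - u i‖ ≤ 1 / ((i : ℝ) + 1) ∧
      ‖fderiv ℝ (fun v : Hk0 gInf k Ω => J (g i) (A i) v) (hf.cls gInf k) -
        fderiv ℝ (fun v : Hk0 gInf k Ω => J (g i) (A i) v) (u i)‖ ≤ 1 / ((i : ℝ) + 1) ∧
      ∫ y in tsupport η, |f (ψ y)| ^ crit n k * dens (gram (g i) p) y ≤ κ + 1 / ((i : ℝ) + 1) := fun i => by
    obtain ⟨F, hF, hFu, hae⟩ := exists_test_seq (u i)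
    have hi : 0 < 1 / ((i : ℝ) + 1) := by positivity
    have e1 := (tendsto_iff_norm_sub_tendsto_zero.1 hFu).eventually (ge_mem_nhds hi)
    have hFJ : Tendsto (fun m => fderiv ℝ (fun v : Hk0 gInf k Ω => J (g i) (A i) v) ((hF m).cls gInf k))
        atTop (𝓝 (fderiv ℝ (fun v : Hk0 gInf k Ω => J (g i) (A i) v) (u i))) :=
      (((hJ i).2.continuous_fderiv one_ne_zero).tendsto (u i)).comp hFu
    have e2 := (tendsto_iff_norm_sub_tendsto_zero (E := Hk0 gInf k Ω →L[ℝ] ℝ).1 hFJ).eventually (ge_mem_nhds hi)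
    have e3 := hSob.eventually_energy_le hk hkn hKInf.le hC hLU hL hχ hηc hηL hχη hΩ (g i)
      ((hJ i).1 (u i)).2 ((image_mono hηL).trans hLB) hκ0 hi (henergy i) hF hFu hae
    obtain ⟨m, h1, h2, h3⟩ := (e1.and (e2.and e3)).exists
    exact ⟨F m, hF m, h1, h2, h3⟩
  choose f hf hfu hfJ hfE using hex
  have hinv : Tendsto (fun i : ℕ => 1 / ((i : ℝ) + 1)) atTop (𝓝 0) := tendsto_one_div_add_atTop_nhds_zero_nat
  have hfu0 : Tendsto (fun i => (hf i).cls gInf k - u i) atTop (𝓝 0) :=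
    squeeze_zero_norm hfu hinv
  obtain ⟨M₀, hM₀⟩ := exists_norm_le_of_weak hu
  obtain ⟨M₁, hM₁⟩ := hhu.norm.bddAbove_range
  obtain ⟨D, hD0, hD⟩ := exists_sobSq_loc_le_norm (Ω := Ω) gInf k hLU hL hχ
  have hM₀' : ∀ i, ‖(hf i).cls gInf k‖ ≤ M₀ + 1 := fun i => by
    have h1 : ‖(hf i).cls gInf k‖ ≤ ‖(hf i).cls gInf k - u i‖ + ‖u i‖ := by
      simpa using norm_add_le ((hf i).cls gInf k - u i) (u i)
    have h2 : 1 / ((i : ℝ) + 1) ≤ 1 := by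
      rw [div_le_one (by positivity)]
      linarith [(Nat.cast_nonneg i : (0 : ℝ) ≤ i)]
    linarith [hM₀ i, hfu i]
  set M : ℝ := D * (M₀ + 1) ^ 2 + D * M₁ ^ 2 with hM
  set F : ℕ → E n → ℝ := fun i y => χ y * f i (ψ y) with hF
  set G : ℕ → E n → ℝ := fun i y => χ y * h i (ψ y) with hGd
  set W : ℕ → E n → ℝ := fun i y => χ y * (f i (ψ y) - h i (ψ y)) with hW
  have hFb : ∀ i, IsBumpOn L (F i) := fun i => (hf i).smoothFn.isBumpOn_mul hLU hχ
  have hGb : ∀ i, IsBumpOn L (G i) := fun i => (hh i).smoothFn.isBumpOn_mul hLU hχ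
  have hWb : ∀ i, IsBumpOn L (W i) := fun i => ((hf i).sub (hh i)).smoothFn.isBumpOn_mul hLU hχ
  have hFM : ∀ i, sobSq (k + 1) (F i) ≤ M := fun i => by
    have h1 := (hD _ (hf i)).trans (mul_le_mul_of_nonneg_left
      (pow_le_pow_left₀ (norm_nonneg _) (hM₀' i) 2) hD0)
    have h2 : 0 ≤ D * M₁ ^ 2 := by positivity
    exact h1.trans (by linarith)
  have hGM : ∀ i, sobSq (k + 1) (G i) ≤ M := fun i => by
    have h1 := (hD _ (hh i)).trans (mul_le_mul_of_nonneg_left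
      (pow_le_pow_left₀ (norm_nonneg _) (hM₁ ⟨i, rfl⟩) 2) hD0)
    have h2 : 0 ≤ D * (M₀ + 1) ^ 2 := by positivity
    exact h1.trans (by linarith)
  have hFGW : ∀ i y, W i y = F i y - G i y := fun i y => mul_sub _ _ _
  have hWM : ∀ i, sobSq (k + 1) (W i) ≤ 4 * M := fun i => by
    have h1 := sobSq_sub_le hL (hFb i) (hGb i) (k + 1)
    rw [show W i = fun y => F i y - G i y from funext (hFGW i)]
    linarith [hFM i, hGM i]
  have hCau : SobCauchy (k + 1) G := fun ε hε => by
    have h1 : Tendsto (fun a : ℕ × ℕ => D * ‖(hh a.1).cls gInf k - (hh a.2).cls gInf k‖ ^ 2)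
        (atTop ×ˢ atTop) (𝓝 0) := by
      have h2 := ((hhu.comp tendsto_fst).sub (hhu.comp (tendsto_snd (f := atTop (α := ℕ))))).norm
      simpa [Function.comp_def] using (h2.pow 2).const_mul D
    obtain ⟨j, hj⟩ := eventually_atTop_prod_self.1 (prod_atTop_atTop_eq (α := ℕ) (β := ℕ) ▸ h1.eventually (ge_mem_nhds hε))
    refine ⟨j, (eventually_ge_atTop j).mono fun i hi => ?_⟩
    have h2 := hD _ ((hh i).sub (hh j))
    rw [IsTest.cls_sub gInf k (hh i) (hh j)] at h2
    have e : (fun y => G i y - G j y) = fun y => χ y * (h i (ψ y) - h j (ψ y)) :=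
      funext fun y => (mul_sub _ _ _).symm
    rw [e]
    exact h2.trans (hj i j hi le_rfl)
  have hnull : WeaklyNull L k W := weaklyNull_loc hLU hL hχ hu hf hh hfu0 hhu
  obtain ⟨C₀, hC₀, hSobL⟩ := hSob.chart hkn hC hLU hL
  obtain ⟨m, c, c', T, T', hbil, hlapG, hlapH⟩ := exists_bil_lapHalfE hU hG k
  obtain ⟨Cₐ, hCₐ, hder⟩ := exists_le_fderiv_cls hk hkn hg hA_smooth hA_symm hAInf_smooth hA hΩ hJ
    hLU hL hbil hlapG
  obtain ⟨D₁, hD₁, hDη⟩ := exists_sobSq_mul_le hL hη (k + 1)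
  obtain ⟨D₂, hD₂, hDlift⟩ := exists_integral_jet_lift_le gInf hLU hL k
  have key := local_strong_convergence hU hG hLU hL hq hbil hk hlapH hη (fun y => ⟨η.nonneg, η.le_one⟩)
    hηL hFb hGb hFGW hFM hGM hCau hnull hKInf hC₀ hSobL (fun ε hε => by
      filter_upwards [hinv.eventually (ge_mem_nhds hε)] with i hi
      have e : ∫ y in tsupport η, |F i y| ^ crit n k * dens (gram (g i) p) y =
          ∫ y in tsupport η, |f i (ψ y)| ^ crit n k * dens (gram (g i) p) y :=
        setIntegral_congr_fun hηc.measurableSet fun y hy => by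
          simp only [hF, hχη y hy, one_mul]
      rw [e]
      exact (hfE i).trans (add_le_add le_rfl hi)) hCₐ (fun ε hε => by
      -- `R` bounds the norm of the direction η² W uniformly in the index; one factor D₁ for each η.
      -- Then ε is split between the Palais-Smale condition at u_i and the replacement of u_i by
      -- f_i.
      set R : ℝ := √(D₂ * (D₁ * (D₁ * (4 * M)))) with hR
      have hR0 : 0 ≤ R := Real.sqrt_nonneg _
      have hε' : 0 < ε / (2 * (R + 1)) := by positivity
      filter_upwards [hder, hPS _ hε', hinv.eventually (ge_mem_nhds hε')] with i hi hPSi hinvi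
      have hvb : IsBumpOn L (fun z => η z * (η z * W i z)) := IsBumpOn.mul hη (IsBumpOn.mul hη (hWb i))
      -- The direction is a cut-off times f_i - h_i, so its lift is a test function supported in Ω.
      have hφ : IsTest n Ω (lift p fun z => η z * (η z * W i z)) := by
        have h1 := ((hf i).sub (hh i)).lift_mul hLU hL (IsBumpOn.mul hη (IsBumpOn.mul hη hχ))
        have e : (fun z => η z * (η z * W i z)) =
            fun y => η y * (η y * χ y) * (f i (ψ y) - h i (ψ y)) := by
          funext z
          simp only [hW]
          ring
        rw [e]
        exact h1
      have h1 := hi (f i) (F i) _ (hf i) hφ (hFb i) hvb fun y _ => by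
        by_cases hy : y ∈ tsupport η
        · left
          rw [hηt] at hy
          have h2 : Metric.closedBall x₀ (2 * r) ∈ 𝓝 y :=
            Filter.mem_of_superset (Metric.isOpen_ball.mem_nhds
              (Metric.closedBall_subset_ball (by linarith : r < 2 * r) hy)) Metric.ball_subset_closedBall
          filter_upwards [h2] with z hz
          simp only [hF, hχ1 z hz, one_mul, hψ, Function.comp_apply]
        · right
          filter_upwards [notMem_tsupport_iff_eventuallyEq.1 hy] with z hz
          simp [hz]
      have hnorm : ‖hφ.cls gInf k‖ ≤ R := by
        refine Real.le_sqrt_of_sq_le ?_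
        rw [hφ.norm_cls_sq]
        refine (hDlift _ hvb).trans (mul_le_mul_of_nonneg_left ?_ hD₂)
        refine (hDη _ (IsBumpOn.mul hη (hWb i))).trans (mul_le_mul_of_nonneg_left ?_ hD₁)
        exact (hDη _ (hWb i)).trans (mul_le_mul_of_nonneg_left (hWM i) hD₁)
      have hsupp : Hk0.SuppIn (hφ.cls gInf k) K := by
        filter_upwards [hφ.val_cls gInf k] with x hx hxK
        rw [hx]
        exact lift_eq_zero hvb.eq_zero fun hx' => hxK (hBK (hLB hx'))
      have h2 := hPSi _ hsupp
      have h3 := (le_abs_self _).trans (((fderiv ℝ (fun v : Hk0 gInf k Ω => J (g i) (A i) v)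
        ((hf i).cls gInf k) - fderiv ℝ (fun v : Hk0 gInf k Ω => J (g i) (A i) v) (u i)).le_opNorm
          (hφ.cls gInf k)))
      rw [ContinuousLinearMap.sub_apply] at h3
      have h4 := mul_le_mul ((hfJ i).trans hinvi) hnorm (norm_nonneg _) hε'.le
      have h5 := mul_le_mul_of_nonneg_left hnorm hε'.le
      have h6 : ε / (2 * (R + 1)) * R + ε / (2 * (R + 1)) * R ≤ ε := by
        rw [← mul_add, div_mul_eq_mul_div, div_le_iff₀ (by positivity)]
        nlinarith
      linarith)
  -- conclusion near the point
  set V : Set N := (extChartAt (𝓡 n) p).source ∩ extChartAt (𝓡 n) p ⁻¹' Metric.ball x₀ (r / 2) with hV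
  have hVo : IsOpen V := isOpen_extChartAt_preimage' p Metric.isOpen_ball
  have hpV : p ∈ V := ⟨mem_extChartAt_source p, Metric.mem_ball_self (by positivity)⟩
  refine ⟨V, hVo, hpV, ?_⟩
  have hηχ : IsBumpOn L (fun y => η y * χ y) := IsBumpOn.mul hη hχ
  have hw : ∀ i, IsTest n Ω (lift p fun y => η y * W i y) := fun i => by
    have e : (fun y => η y * W i y) = fun y => η y * χ y * (f i (ψ y) - h i (ψ y)) := by
      funext z
      simp only [hW]
      ring
    rw [e]
    exact ((hf i).sub (hh i)).lift_mul hLU hL hηχ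
  have hw0 : Tendsto (fun i => ‖(hw i).cls gInf k‖) atTop (𝓝 0) := by
    have h1 : Tendsto (fun i => √(D₂ * sobSq (k + 1) fun y => η y * W i y)) atTop (𝓝 0) := by
      have := (Real.continuous_sqrt.tendsto _).comp (key.const_mul D₂)
      simpa [Function.comp_def] using this
    refine squeeze_zero (fun _ => norm_nonneg _) (fun i => Real.le_sqrt_of_sq_le ?_) h1
    rw [(hw i).norm_cls_sq]
    exact hDlift _ (IsBumpOn.mul hη (hWb i))
  have hle : (vol gInf).restrict (V ∩ Ω) ≤ (vol gInf).restrict Ω :=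
    Measure.restrict_mono inter_subset_right le_rfl
  have hmeas : ∀ v : Hk0 gInf k Ω, AEStronglyMeasurable (Hk0.jetAt v) ((vol gInf).restrict (V ∩ Ω)) :=
    fun v => (Lp.aestronglyMeasurable (p := 2) v.1).mono_measure hle
  -- Split u_i - u_∞ into (u_i - f_i) + (f_i - h_i) + (h_i - u_∞). On `V` both cut-offs are 1, so
  -- the middle difference is the lift of η W; the outer ones are small in the full norm.
  have hbound : ∀ i, eLpNorm (fun x => Hk0.jetAt (u i) x - Hk0.jetAt uInf x) 2
      ((vol gInf).restrict (V ∩ Ω)) ≤ edist (u i) ((hf i).cls gInf k) +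
        (ENNReal.ofReal ‖(hw i).cls gInf k‖ + edist ((hh i).cls gInf k) uInf) := fun i => by
    have e : (fun x => Hk0.jetAt (u i) x - Hk0.jetAt uInf x) =
        (fun x => Hk0.jetAt (u i) x - Hk0.jetAt ((hf i).cls gInf k) x) +
          ((fun x => Hk0.jetAt ((hf i).cls gInf k) x - Hk0.jetAt ((hh i).cls gInf k) x) +
            fun x => Hk0.jetAt ((hh i).cls gInf k) x - Hk0.jetAt uInf x) := by
      funext x
      simp
    rw [e]
    refine (eLpNorm_add_le ((hmeas _).sub (hmeas _)) (((hmeas _).sub (hmeas _)).add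
      ((hmeas _).sub (hmeas _))) one_le_two).trans (add_le_add ?_
        ((eLpNorm_add_le ((hmeas _).sub (hmeas _)) ((hmeas _).sub (hmeas _)) one_le_two).trans
          (add_le_add ?_ ?_)))
    · rw [← Hk0.edist_eq]
      exact eLpNorm_mono_measure _ hle
    · refine (hf i).eLpNorm_jetAt_sub_le (hh i) (hw i) hΩ hVo fun x hx => ?_
      have h1 : extChartAt (𝓡 n) p x ∈ Metric.closedBall x₀ (r / 2) := Metric.ball_subset_closedBall hx.2
      have h2 : η (extChartAt (𝓡 n) p x) = 1 := η.one_of_mem_closedBall h1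
      have h3 := hχ1 _ (Metric.closedBall_subset_closedBall (by linarith) h1)
      rw [lift, indicator_of_mem hx.1, Function.comp_apply, h2, one_mul]
      simp only [hW, h3, one_mul, hψ, (extChartAt (𝓡 n) p).left_inv hx.1]
    · rw [← Hk0.edist_eq]
      exact eLpNorm_mono_measure _ hle
  refine tendsto_of_tendsto_of_tendsto_of_le_of_le tendsto_const_nhds ?_ (fun _ => zero_le) hbound
  have t1 : Tendsto (fun i => edist (u i) ((hf i).cls gInf k)) atTop (𝓝 0) := by
    have h1 := ENNReal.tendsto_ofReal (tendsto_zero_iff_norm_tendsto_zero.1 hfu0)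
    rw [ENNReal.ofReal_zero] at h1
    refine h1.congr fun i => ?_
    rw [edist_comm, edist_dist, dist_eq_norm]
  have t2 : Tendsto (fun i => ENNReal.ofReal ‖(hw i).cls gInf k‖) atTop (𝓝 0) := by
    simpa using ENNReal.tendsto_ofReal hw0
  have t3 := tendsto_iff_edist_tendsto_0.1 hhu
  simpa using t1.add (t2.add t3)

end Local
end SmallEnergy

/-! ### From local to global strong convergence. -/

namespace SmallEnergy

theorem eLpNorm_two_restrict_union_le {X F : Type*} [MeasurableSpace X] [NormedAddCommGroup F]
    {μ : Measure X} (f : X → F) (S T : Set X) :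
    eLpNorm f 2 (μ.restrict (S ∪ T)) ≤ eLpNorm f 2 (μ.restrict S) + eLpNorm f 2 (μ.restrict T) := by
  have h : ∀ R : Set X, eLpNorm f 2 (μ.restrict R) = (∫⁻ x in R, ‖f x‖ₑ ^ (2 : ℝ) ∂μ) ^ (1 / 2 : ℝ) :=
    fun R => by rw [eLpNorm_eq_lintegral_rpow_enorm_toReal two_ne_zero ENNReal.ofNat_ne_top]; simp
  rw [h, h, h]
  exact (ENNReal.rpow_le_rpow (lintegral_union_le _ _ _) (by norm_num)).trans
    (ENNReal.rpow_add_le_add_rpow _ _ (by norm_num) (by norm_num))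

/-- Compactness induction: the convergence is inherited by subsets and, by subadditivity of the norm
in the set, by finite unions. -/
theorem tendsto_eLpNorm_of_local {X F : Type*} [TopologicalSpace X] [MeasurableSpace X]
    [NormedAddCommGroup F] {μ : Measure X} {f : ℕ → X → F} {S Q Ω : Set X} (hQ : IsCompact Q)
    (hloc : ∀ p ∈ Q, ∃ V : Set X, IsOpen V ∧ p ∈ V ∧
      Tendsto (fun i => eLpNorm (f i) 2 (μ.restrict (V ∩ Ω))) atTop (𝓝 0)) (hS : S ⊆ Q) :
    Tendsto (fun i => eLpNorm (f i) 2 (μ.restrict (S ∩ Ω))) atTop (𝓝 0) := by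
  have hmono : ∀ {R T : Set X}, R ⊆ T →
      Tendsto (fun i => eLpNorm (f i) 2 (μ.restrict (T ∩ Ω))) atTop (𝓝 0) →
      Tendsto (fun i => eLpNorm (f i) 2 (μ.restrict (R ∩ Ω))) atTop (𝓝 0) := fun hRT h =>
    tendsto_of_tendsto_of_tendsto_of_le_of_le tendsto_const_nhds h (fun _ => zero_le) fun i =>
      eLpNorm_mono_measure _ (Measure.restrict_mono (inter_subset_inter_left _ hRT) le_rfl)
  refine hmono hS (hQ.induction_on (p := fun R => Tendsto
    (fun i => eLpNorm (f i) 2 (μ.restrict (R ∩ Ω))) atTop (𝓝 0)) (by simp) (fun R T => hmono)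
    (fun R T hR hT => ?_) fun p hp => ?_)
  · refine tendsto_of_tendsto_of_tendsto_of_le_of_le tendsto_const_nhds
      (by simpa using hR.add hT) (fun _ => zero_le) fun i => ?_
    rw [union_inter_distrib_right]
    exact eLpNorm_two_restrict_union_le _ _ _
  · obtain ⟨V, hV, hpV, h⟩ := hloc p hp
    exact ⟨V, mem_nhdsWithin_of_mem_nhds (hV.mem_nhds hpV), h⟩

end SmallEnergy
open SmallEnergy in
theorem mainTheorem4 {n k : ℕ} (hk : 1 ≤ k) (hkn : 2 * k < n)
    {N : Type*} [TopologicalSpace N] [T2Space N] [SecondCountableTopology N] [Nonempty N]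
    [ChartedSpace (E n) N] [IsManifold (𝓡 n) ∞ N] [MeasurableSpace N] [BorelSpace N]
    (gInf : RMetric n N) (g : ℕ → RMetric n N) (hg : MetricTendsto g gInf)
    (A : ℕ → (l : ℕ) → TensorField n N l) (AInf : (l : ℕ) → TensorField n N l)
    (hA_smooth : ∀ i, ∀ l < k, (A i l).IsSmooth) (hA_symm : ∀ i, ∀ l < k, (A i l).IsSymm)
    (hAInf_smooth : ∀ l < k, (AInf l).IsSmooth) (hAInf_symm : ∀ l < k, (AInf l).IsSymm)
    (hA : ∀ l < k, TensorTendsto (fun i => A i l) (AInf l))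
    (Ω : Set N) (hΩ : IsOpen Ω)
    (hJ : ∀ i, IsC1Functional (g i) (A i) gInf k Ω)
    (u : ℕ → Hk0 gInf k Ω) (uInf : Hk0 gInf k Ω)
    (hu : ∀ ℓ : Hk0 gInf k Ω →L[ℝ] ℝ, Tendsto (fun i => ℓ (u i)) atTop (𝓝 (ℓ uInf)))
    (K : Set N) (hK : IsCompact K)
    (hPS : ∀ ε : ℝ, 0 < ε → ∀ᶠ i in atTop, ∀ φ : Hk0 gInf k Ω, Hk0.SuppIn φ K →
      fderiv ℝ (fun v : Hk0 gInf k Ω => J (g i) (A i) v) (u i) φ ≤ ε * ‖φ‖)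
    (KInf C : ℝ) (hKInf : 0 < KInf) (hC : 0 ≤ C) (hSob : SobolevIneq gInf k KInf C)
    (x₀ : N) (hx₀ : x₀ ∈ Ω) (δ : ℝ) (hδ : 0 < δ) (hball : gBall gInf x₀ (2 * δ) ⊆ K)
    (henergy : ∀ i, ∫ x in gBall gInf x₀ (2 * δ) ∩ Ω, |Hk0.val (u i) x| ^ crit n k ∂(vol (g i)) ≤
      (1 / (2 * KInf)) ^ (crit n k / (crit n k - 2))) :
    Tendsto (fun i => eLpNorm (fun x => Hk0.jetAt (u i) x - Hk0.jetAt uInf x) 2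
      ((vol gInf).restrict (gBall gInf x₀ δ ∩ Ω))) atTop (𝓝 0) := by
  -- Compactness of the closed ball comes from `K`, not from completeness of the metric.
  have hcpt : IsCompact (closure (gBall gInf x₀ δ)) :=
    hK.of_isClosed_subset isClosed_closure ((closure_gBall_subset gInf x₀ hδ).trans hball)
  have hloc : ∀ p ∈ closure (gBall gInf x₀ δ), ∃ V : Set N, IsOpen V ∧ p ∈ V ∧
      Tendsto (fun i => eLpNorm (fun x => Hk0.jetAt (u i) x - Hk0.jetAt uInf x) 2
        ((vol gInf).restrict (V ∩ Ω))) atTop (𝓝 0) := fun p hp =>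
    exists_nhds_tendsto hk hkn hg hA_smooth hA_symm hAInf_smooth hA hΩ hJ hu hPS hKInf hC hSob
      (isOpen_gBall gInf x₀ _) hball henergy (closure_gBall_subset gInf x₀ hδ hp)
  exact tendsto_eLpNorm_of_local hcpt hloc subset_closure
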